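/- **Notation.** Fix $E>0$, $p>1$ and a real-valued compactly supported $v\in L^p(\mathbb R^2)$; identify $x=(x_1,x_2)$ with $z=x_1+ix_2$. Put $\varphi_0(z,\lambda)=e^{i\frac{\sqrt E}{2}(\lambda\bar z+z/\lambda)}$, $k(\lambda)=\big((\lambda+\tfrac1\lambda)\tfrac{\sqrt E}{2},(\tfrac1\lambda-\lambda)\tfrac{i\sqrt E}{2}\big)$ and, for $\lambda\ne0$, $|\lambda|\neq 1$, $$g(x,k)=-\frac1{(2\pi)^2}\int_{\mathbb R^2}\frac{e^{i\xi\cdot x}}{|\xi|^2+2k\cdot\xi}\,d\xi ,\quad k=k(\lambda)$$ (limit of the integrals over $|\xi|<R$ as $R\to\infty$). A point $\lambda$ with $|\lambda|\ne0,1$ is *exceptional* if $\mu(z,\lambda)=1+\int g(z-z',k(\lambda))v(z')\mu(z',\lambda)\,dx_1'dx_2'$ is not uniquely solvable in $L^\infty$. Otherwise $\psi(z,\lambda)=\varphi_0(z,\lambda)\mu(z,\lambda)$ is the Faddeev solution, and $$h(\varsigma,\lambda)=\frac1{(2\pi)^2}\int_{\mathbb R^2}\varphi_0(z,-\varsigma)v(z)\psi(z,\lambda)\,dx_1dx_2,\qquad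 r(\lambda)=\frac{\operatorname{sgn}(|\lambda|^2-1)\,\pi}{\bar\lambda}\,h\big(-\tfrac1{\bar\lambda},\lambda\big).$$ For $\lambda\neq0$ let $\psi^+(\cdot,\lambda)$ be the classical scattering solution, i.e. the locally bounded solution of $\psi^+(z,\lambda)=\varphi_0(z,\lambda)+\int G^+(z-z')v(z')\psi^+(z',\lambda)\,dx_1'dx_2'$, $G^+(z)=-\frac i4H^{(1)}_0(\sqrt E|z|)$. For $A>1$ let $D=\{A^{-1}<|\lambda|<A\}$, with $\partial D$ oriented so that $D$ is on the left, and assume that $D$ contains all exceptional points. Let $r'=r$ outside $D\cup\{0\}$ and $r'=0$ in $D$; let $\psi'=\psi$ outside $D\cup\{0\}$ and $\psi'=\psi^+$ in $D$; let $\mu'(z,\lambda)=\psi'(z,\lambda)\varphi_0(z,-\lambda)$ and $e_0(z,\lambda)=\varphi_0(z,-\lambda)\varphi_0(z,-1/\bar\lambda)$. For $\lambda,\varsigma\in\partial D$ let, with $\theta$ the Heaviside function and principal logarithms, $$c(\lambda,\varsigma)=\frac{i}{2}\operatorname{sgn}(|\lambda|^2-1)\,\frac1\varsigma\left[\operatorname{Ln}\frac{\varsigma-\lambda}{\varsigma-\frac{\lambda}{|\lambda|}}-\operatorname{Ln}\frac{-\frac1\varsigma-\bar\lambda}{-\frac1\varsigma-\frac{\bar\lambda}{|\lambda|}}\right]+\int_{|\varsigma_1|=1}\frac{1}{2(\varsigma-\varsigma_1)}\,\theta\!\left[i\operatorname{sgn}(|\lambda|^2-1)\Big(\frac{|\lambda|\varsigma_1}{\lambda}-\frac{\lambda}{|\lambda|\varsigma_1}\Big)\right]|d\varsigma_1|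 .$$ Let $T_z=T_z^{(1)}+T_z^{(2)}$, where, with $\phi^-$ the trace of $\phi$ on $\partial D$ from the interior of $D$, $$T_z^{(1)}\phi(\lambda)=\frac1\pi\int_{\mathbb C}r'(\varsigma)e_0(z,\varsigma)\,\phi\big(-1/\bar\varsigma\big)\frac{d\varsigma_R\,d\varsigma_I}{\varsigma-\lambda},$$ $$T_z^{(2)}\phi(\lambda)=\frac1{2\pi i}\int_{\partial D}\frac{d\varsigma}{\varsigma-\lambda}\int_{\partial D}c(\varsigma,\varsigma')h(\varsigma',\varsigma)\varphi_0(z,-\varsigma)\varphi_0(z,\varsigma')\phi^-(\varsigma')\,d\varsigma'.$$ **Theorem.** A ring $D$ (with some $A>1$) containing all exceptional points exists, and $\psi^+(\cdot,\lambda)$ exists and is unique for every $\lambda\ne0$. For every such ring $D$ and every $z\in\mathbb C$, $$(I+T_z)(\mu'(z,\cdot)-1)=-T_z1,\qquad \lambda\in\mathbb C\setminus\{0\}.$$ Here for $\lambda\notin\partial D$ the relation holds pointwise, with all integrals in $T_z1$ and $T_z(\mu'-1)$ absolutely convergent and the traces existing; at the points of $\partial D$ it holds for the boundary values from $D$ and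 for those from the complement of $\overline D$, all of which exist, and the boundary value of $\mu'$ from outside is its value there. The same is true if $\phi(-1/\bar\varsigma)$ in $T_z^{(1)}$ is replaced by $\overline{\phi(\varsigma)}$. -/

import Mathlib

namespace Faddeev

noncomputable section

open MeasureTheory Filter
open scoped Topology ComplexConjugate Real

/-! Points `z = x₁ + i x₂` of the plane and spectral parameters `l` are complex numbers; `volume` on
`ℂ` is two-dimensional Lebesgue measure. `E > 0` is the energy, `v` the real potential. -/

/-- The plane wave `φ₀(z, l) = exp(i (√E / 2) (l z̄ + z / l))`. -/
def phi0 (E : ℝ) (z l : ℂ) : ℂ :=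
  Complex.exp (Complex.I * ((√E : ℝ) / 2 : ℂ) * (l * conj z + z / l))

/-- First component of the complex momentum, `k₁ = (l + 1/l) √E / 2`. -/
def k1 (E : ℝ) (l : ℂ) : ℂ := (l + 1 / l) * ((√E : ℝ) / 2 : ℂ)

/-- Second component of the complex momentum, `k₂ = (1/l - l) i √E / 2`. -/
def k2 (E : ℝ) (l : ℂ) : ℂ := (1 / l - l) * (Complex.I * (√E : ℝ) / 2)

/-- The function `g(x, k(l)) = -(2π)⁻² ∫_{ℝ²} exp(i ξ·x) / (|ξ|² + 2 k·ξ) dξ`, for `l ≠ 0`,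
`|l| ≠ 1`, `x ≠ 0`. The integrand is locally integrable but only of size `|ξ|⁻²` at infinity, so the
integral is the (convergent) improper one, the limit of the integrals over the discs `|ξ| < R`. -/
def g (E : ℝ) (x l : ℂ) : ℂ :=
  limUnder atTop fun R : ℝ =>
    -(1 / (2 * π : ℂ) ^ 2) * ∫ ξ in Metric.ball (0 : ℂ) R,
      Complex.exp (Complex.I * ((ξ.re * x.re + ξ.im * x.im : ℝ) : ℂ)) /
        (((‖ξ‖ ^ 2 : ℝ) : ℂ) + 2 * (k1 E l * (ξ.re : ℂ) + k2 E l * (ξ.im : ℂ)))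

/-- `m` is an `L^∞` solution of the Lippmann–Schwinger equation
`m(z) = 1 + ∫ g(z - z', k(l)) v(z') m(z') dz'`. The right-hand side depends only on the class of `m`
and makes sense at every `z`, so `m` is taken to be the representative that satisfies the equation
everywhere. -/
def IsFaddeevMu (E : ℝ) (v : ℂ → ℝ) (l : ℂ) (m : ℂ → ℂ) : Prop :=
  MemLp m ⊤ volume ∧ ∀ z, m z = 1 + ∫ z', g E (z - z') l * (v z' : ℂ) * m z'

/-- Exceptional points: those `l` with `l ≠ 0`, `|l| ≠ 1` for which the equation for `m` is not
uniquely solvable in `L^∞`. -/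
def IsExceptional (E : ℝ) (v : ℂ → ℝ) (l : ℂ) : Prop :=
  l ≠ 0 ∧ ‖l‖ ≠ 1 ∧ ¬ ∃! m : ℂ → ℂ, IsFaddeevMu E v l m

/-- The solution `μ(·, l)` (meaningful at non-exceptional points). -/
def mu (E : ℝ) (v : ℂ → ℝ) (z l : ℂ) : ℂ := Classical.epsilon (IsFaddeevMu E v l) z

/-- The Faddeev scattering solution `ψ(z, l) = φ₀(z, l) μ(z, l)`. -/
def psi (E : ℝ) (v : ℂ → ℝ) (z l : ℂ) : ℂ := phi0 E z l * mu E v z l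

/-- The Bessel function `J₀`. -/
def besselJ0 (x : ℝ) : ℝ := ∑' n : ℕ, (-1) ^ n * (x ^ 2 / 4) ^ n / (n.factorial : ℝ) ^ 2

/-- The Bessel function `Y₀` on `x > 0`, by its classical expansion
`Y₀(x) = (2/π)(ln(x/2) + γ) J₀(x) - (2/π) ∑ (-1)ⁿ Hₙ (x²/4)ⁿ / (n!)²` (`H₀ = 0`). -/
def besselY0 (x : ℝ) : ℝ :=
  2 / π * (Real.log (x / 2) + Real.eulerMascheroniConstant) * besselJ0 x -
    2 / π * ∑' n : ℕ, (-1) ^ n * ((harmonic n : ℚ) : ℝ) * (x ^ 2 / 4) ^ n / (n.factorial : ℝ) ^ 2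

/-- The outgoing Green function `G⁺(x) = -(i/4) H₀⁽¹⁾(√E |x|)`, with `H₀⁽¹⁾ = J₀ + i Y₀`. -/
def Gplus (E : ℝ) (x : ℂ) : ℂ :=
  -(Complex.I / 4) *
    ((besselJ0 (√E * ‖x‖) : ℂ) + Complex.I * (besselY0 (√E * ‖x‖) : ℂ))

/-- `f` is the classical scattering solution with incident wave `φ₀(·, l)`: a locally bounded
solution of `f(z) = φ₀(z, l) + ∫ G⁺(z - z') v(z') f(z') dz'`. -/
def IsScatteringSolution (E : ℝ) (v : ℂ → ℝ) (l : ℂ) (f : ℂ → ℂ) : Prop :=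
  (∀ R : ℝ, MemLp f ⊤ (volume.restrict (Metric.ball 0 R))) ∧
    ∀ z, f z = phi0 E z l + ∫ z', Gplus E (z - z') * (v z' : ℂ) * f z'

/-- The classical scattering solution `ψ⁺(z, l)`. -/
def psiPlus (E : ℝ) (v : ℂ → ℝ) (z l : ℂ) : ℂ :=
  Classical.epsilon (IsScatteringSolution E v l) z

/-- The scattering data
`h(s, l) = (2π)⁻² ∫ exp(-i (√E/2) (s z̄ + z/s)) v(z) ψ(z, l) dz`. -/
def h (E : ℝ) (v : ℂ → ℝ) (s l : ℂ) : ℂ :=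
  1 / (2 * π : ℂ) ^ 2 * ∫ z, phi0 E z (-s) * (v z : ℂ) * psi E v z l

/-- The scattering data `r(l) = sgn(|l|² - 1) π / l̄ · h(-1/l̄, l)`. -/
def r (E : ℝ) (v : ℂ → ℝ) (l : ℂ) : ℂ :=
  (Real.sign (‖l‖ ^ 2 - 1) : ℂ) * (π : ℂ) / conj l * h E v (-1 / conj l) l

/-- The ring `D = {1/A < |l| < A}`. -/
def ring (A : ℝ) : Set ℂ := {l | A⁻¹ < ‖l‖ ∧ ‖l‖ < A}

/-- The ring contains all exceptional points. -/
def IsAdmissible (E : ℝ) (v : ℂ → ℝ) (A : ℝ) : Prop :=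
  ∀ l, IsExceptional E v l → l ∈ ring A

open Classical in
/-- `r'` equals `r` outside `D` and `0` in `D` (and at the origin). -/
def rPrime (E : ℝ) (v : ℂ → ℝ) (A : ℝ) (l : ℂ) : ℂ :=
  if l ∈ ring A ∨ l = 0 then 0 else r E v l

open Classical in
/-- `ψ'` equals `ψ⁺` in `D` and `ψ` outside `D`. -/
def psiPrime (E : ℝ) (v : ℂ → ℝ) (A : ℝ) (z l : ℂ) : ℂ :=
  if l ∈ ring A then psiPlus E v z l else psi E v z l

/-- `μ'(z, l) = ψ'(z, l) φ₀(z, -l)`. -/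
def muPrime (E : ℝ) (v : ℂ → ℝ) (A : ℝ) (z l : ℂ) : ℂ := psiPrime E v A z l * phi0 E z (-l)

/-- `e₀(z, l) = φ₀(z, -l) φ₀(z, -1/l̄)`. -/
def e0 (E : ℝ) (z l : ℂ) : ℂ := phi0 E z (-l) * phi0 E z (-1 / conj l)

/-- The Heaviside function. -/
def heaviside (x : ℝ) : ℝ := if 0 < x then 1 else 0

/-- The kernel `c(l, s)`, `l, s ∈ ∂D`. The arguments of both logarithms avoid the negative half-line,
so the logarithms are principal; `|ds₁|` on the unit circle is `dt`, `s₁ = exp(it)`. -/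
def c (l s : ℂ) : ℂ :=
  Complex.I / 2 * (Real.sign (‖l‖ ^ 2 - 1) : ℂ) * (1 / s) *
      (Complex.log ((s - l) / (s - l / (‖l‖ : ℂ))) -
        Complex.log ((-1 / s - conj l) / (-1 / s - conj l / (‖l‖ : ℂ)))) +
    ∫ t in (0 : ℝ)..2 * π,
      1 / (2 * (s - Complex.exp (Complex.I * t))) *
        (heaviside
          (Complex.I * (Real.sign (‖l‖ ^ 2 - 1) : ℂ) *
            ((‖l‖ : ℂ) * Complex.exp (Complex.I * t) / l -
              l / ((‖l‖ : ℂ) * Complex.exp (Complex.I * t)))).re : ℂ)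

/-- The integral over `∂D`, with `D` on the left: the outer circle is traversed counterclockwise, the
inner one clockwise. -/
def boundaryIntegral (A : ℝ) (f : ℂ → ℂ) : ℂ :=
  (∮ s in C(0, A), f s) - ∮ s in C(0, A⁻¹), f s

/-- Absolute convergence of the integral over `∂D`. -/
def BoundaryIntegrable (A : ℝ) (f : ℂ → ℂ) : Prop :=
  CircleIntegrable f 0 A ∧ CircleIntegrable f 0 A⁻¹

/-- The trace `φ⁻(s)` at `s ∈ ∂D` of `φ`, taken from the interior of `D`. -/
def trace (A : ℝ) (φ : ℂ → ℂ) (s : ℂ) : ℂ := limUnder (𝓝[ring A] s) φ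

/-- The integrand of the area integral in `T_z⁽¹⁾`. -/
def areaIntegrand (E : ℝ) (v : ℂ → ℝ) (A : ℝ) (z : ℂ) (φ : ℂ → ℂ) (l s : ℂ) : ℂ :=
  rPrime E v A s * e0 E z s * φ (-1 / conj s) / (s - l)

/-- The integrand of the area integral in the simpler form of `T_z⁽¹⁾` for real potentials. -/
def areaIntegrandReal (E : ℝ) (v : ℂ → ℝ) (A : ℝ) (z : ℂ) (φ : ℂ → ℂ) (l s : ℂ) : ℂ :=
  rPrime E v A s * e0 E z s * conj (φ s) / (s - l)

/-- The integrand of the inner boundary integral in `T_z⁽²⁾`. -/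
def innerIntegrand (E : ℝ) (v : ℂ → ℝ) (A : ℝ) (z : ℂ) (φ : ℂ → ℂ) (s s' : ℂ) : ℂ :=
  c s s' * h E v s' s * phi0 E z (-s) * phi0 E z s' * trace A φ s'

/-- The integrand of the outer boundary integral in `T_z⁽²⁾`. -/
def outerIntegrand (E : ℝ) (v : ℂ → ℝ) (A : ℝ) (z : ℂ) (φ : ℂ → ℂ) (l s : ℂ) : ℂ :=
  boundaryIntegral A (innerIntegrand E v A z φ s) / (s - l)

/-- `T_z⁽²⁾ φ (l)`, for `l ∉ ∂D`. -/
def T2 (E : ℝ) (v : ℂ → ℝ) (A : ℝ) (z : ℂ) (φ : ℂ → ℂ) (l : ℂ) : ℂ :=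
  1 / (2 * π * Complex.I) * boundaryIntegral A (outerIntegrand E v A z φ l)

/-- The operator `T_z = T_z⁽¹⁾ + T_z⁽²⁾`. -/
def T (E : ℝ) (v : ℂ → ℝ) (A : ℝ) (z : ℂ) (φ : ℂ → ℂ) (l : ℂ) : ℂ :=
  1 / (π : ℂ) * (∫ s, areaIntegrand E v A z φ l s) + T2 E v A z φ l

/-- The operator `T_z` with the simpler form of `T_z⁽¹⁾` for real potentials. -/
def TReal (E : ℝ) (v : ℂ → ℝ) (A : ℝ) (z : ℂ) (φ : ℂ → ℂ) (l : ℂ) : ℂ :=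
  1 / (π : ℂ) * (∫ s, areaIntegrandReal E v A z φ l s) + T2 E v A z φ l

/-- All integrals that define `T_z φ (l)`, in either form, converge absolutely, and the trace of `φ`
on `∂D` from the interior of `D` exists. -/
def IntegralsConverge (E : ℝ) (v : ℂ → ℝ) (A : ℝ) (z : ℂ) (φ : ℂ → ℂ) (l : ℂ) : Prop :=
  (∀ s ∈ frontier (ring A), Tendsto φ (𝓝[ring A] s) (𝓝 (trace A φ s))) ∧
  Integrable (areaIntegrand E v A z φ l) volume ∧
  Integrable (areaIntegrandReal E v A z φ l) volume ∧
  (∀ s ∈ frontier (ring A), BoundaryIntegrable A (innerIntegrand E v A z φ s)) ∧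
  BoundaryIntegrable A (outerIntegrand E v A z φ l)

/-- The relation `(I + S)(m - 1) = -S 1` on `ℂ \ {0}`: pointwise off `∂D`; on `∂D`, where the Cauchy
integral in `S` jumps, for the boundary values from `D` (elements of the space `L^s ∩ C(D̄)` are
continuous up to `∂D` from inside), and also for the boundary values from outside `D̄`, for which the
boundary value of `m` is its actual value. All these boundary values exist. -/
def SatisfiesRelation (A : ℝ) (S : (ℂ → ℂ) → ℂ → ℂ) (m : ℂ → ℂ) : Prop :=
  (∀ l, l ≠ 0 → l ∉ frontier (ring A) →
    (m l - 1) + S (fun w => m w - 1) l = -S (fun _ => 1) l) ∧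
  (∀ l ∈ frontier (ring A), ∃ m₀ a b : ℂ,
    Tendsto m (𝓝[ring A] l) (𝓝 m₀) ∧
    Tendsto (S fun w => m w - 1) (𝓝[ring A] l) (𝓝 a) ∧
    Tendsto (S fun _ => 1) (𝓝[ring A] l) (𝓝 b) ∧
    (m₀ - 1) + a = -b) ∧
  (∀ l ∈ frontier (ring A), ∃ a b : ℂ,
    Tendsto m (𝓝[(closure (ring A))ᶜ] l) (𝓝 (m l)) ∧
    Tendsto (S fun w => m w - 1) (𝓝[(closure (ring A))ᶜ] l) (𝓝 a) ∧
    Tendsto (S fun _ => 1) (𝓝[(closure (ring A))ᶜ] l) (𝓝 b) ∧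
    (m l - 1) + a = -b)

end

end Faddeev

namespace Faddeev

open MeasureTheory Filter Set
open scoped Topology ComplexConjugate Real Complex
open Complex (I exp_add exp_log norm_real I_sq conj_ofReal exp_ne_zero normSq_eq_norm_sq norm_exp
  exp_neg conj_I mul_conj conj_conj ofReal_re ofReal_im ofReal_zero measurableEquivRealProd
  volume_preserving_equiv_real_prod exp_conj re_add_im normSq_apply norm_I log_re ofReal_pow
  neg_im exp_zero real_smul norm_exp_ofReal_mul_I hasDerivAt_exp exp_pi_mul_I ofReal_mul
  exp_two_pi_mul_I continuous_exp continuous_conj conjLIE conjCLE I_ne_zero abs_re_le_norm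
  abs_im_le_norm ofReal_sub ofReal_neg ofReal_exp)
open Real (sinh cosh sin cos log exp_pos pi_pos pi_ne_zero eulerMascheroniConstant norm_of_nonneg
  mul_rpow exp_le_exp sqrt_pos sinh_pos_iff sinh_nonneg_iff rpow_le_rpow_of_nonpos exp_le_one_iff
  norm_eq_abs rpow_neg rpow_mul rpow_add add_one_le_exp sq_sqrt exp_lt_exp sqrt_sq rpow_nonneg
  rpow_one one_le_exp log_pos log_exp cosh_pos continuous_sinh hasDerivAt_sinh cosh_sq)
open Metric (ball sphere ball_subset_closedBall isOpen_ball isBounded_ball)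
open intervalIntegral (integral_of_le integral_eq_sub_of_hasDerivAt
  integral_add_adjacent_intervals)
open Ring (inverse)

noncomputable section

/-! ### Bessel functions of order zero -/

/-- A power series with coefficients `O(2ⁿ / n!)` may be differentiated termwise. -/
lemma hasDerivAt_tsum_of_le_factorial {a : ℕ → ℝ} {C : ℝ}
    (ha : ∀ n, |a n| ≤ C * 2 ^ n / n.factorial) (t : ℝ) :
    HasDerivAt (fun t => ∑' n, a n * t ^ n) (∑' n : ℕ, ((n + 1 : ℕ) : ℝ) * a (n + 1) * t ^ n) t := by
  have hC : 0 ≤ C := by simpa using (abs_nonneg _).trans (ha 0)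
  set R : ℝ := |t| + 1
  have hR : 1 ≤ R := by simp [R]
  have hu : Summable fun n : ℕ => C * ((4 * R) ^ n / n.factorial) :=
    (Real.summable_pow_div_factorial (4 * R)).mul_left C
  have key n y (hy : |y| ≤ R) : |a n * (n * y ^ (n - 1))| ≤ C * ((4 * R) ^ n / n.factorial) := by
    have h2 : (n : ℝ) ≤ 2 ^ n := by exact_mod_cast Nat.lt_two_pow_self.le
    have h3 : |y| ^ (n - 1) ≤ R ^ n :=
      (pow_le_pow_left₀ (abs_nonneg y) hy _).trans (pow_le_pow_right₀ hR (Nat.sub_le _ _))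
    rw [abs_mul, abs_mul, abs_pow, Nat.abs_cast]
    calc |a n| * (n * |y| ^ (n - 1)) ≤ (C * 2 ^ n / n.factorial) * (2 ^ n * R ^ n) :=
          mul_le_mul (ha n) (mul_le_mul h2 h3 (by positivity) (by positivity)) (by positivity)
            (by positivity)
      _ = C * ((4 * R) ^ n / n.factorial) := by
          rw [show 4 * R = 2 * 2 * R by ring, mul_pow, mul_pow]; ring
  have hd := hasDerivAt_tsum_of_isPreconnected (y₀ := 0) (y := t) hu
    isOpen_ball (convex_ball _ _).isPreconnected
    (fun n y _ => (hasDerivAt_pow n y).const_mul (a n))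
    (fun n y hy => key n y (by simpa using (mem_ball_zero_iff.1 hy).le))
    (by simp; linarith)
    (summable_of_ne_finset_zero (s := {0}) (fun n hn => by
      have : n ≠ 0 := by simpa using hn
      simp [this])) (by simp [R])
  convert! hd using 1
  have hs : Summable fun n : ℕ => a n * (n * t ^ (n - 1)) :=
    Summable.of_norm_bounded hu fun n => key n t (by simp [R])
  rw [hs.tsum_eq_zero_add]
  simp only [CharP.cast_eq_zero, zero_mul, mul_zero, zero_add, Nat.add_sub_cancel]
  exact tsum_congr fun n => by ring

/-- Coefficients of `J₀` as a power series in `x² / 4`. -/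
def coeffJ (n : ℕ) : ℝ := (-1) ^ n / (n.factorial : ℝ) ^ 2

/-- Coefficients of the entire part of `Y₀` as a power series in `x² / 4`. -/
def coeffY (n : ℕ) : ℝ := (-1) ^ n * ((harmonic n : ℚ) : ℝ) / (n.factorial : ℝ) ^ 2

lemma harmonic_le_self (n : ℕ) : ((harmonic n : ℚ) : ℝ) ≤ n := by
  induction n with
  | zero => simp
  | succ n ih =>
    rw [harmonic_succ]
    push_cast
    have : ((n : ℝ) + 1)⁻¹ ≤ 1 := inv_le_one_of_one_le₀ (by linarith [n.cast_nonneg (α := ℝ)])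
    linarith

lemma harmonic_nonneg' (n : ℕ) : (0 : ℝ) ≤ ((harmonic n : ℚ) : ℝ) := by
  rw [harmonic]; push_cast; positivity

lemma abs_coeff_aux {n : ℕ} {x : ℝ} (h0 : |x| ≤ (n : ℝ) * n ∨ |x| ≤ 1 ∨ |x| ≤ n) :
    |x / (n.factorial : ℝ) ^ 2| ≤ 1 * 2 ^ n / n.factorial := by
  have hf : (n : ℝ) ≤ n.factorial := by exact_mod_cast n.self_le_factorial
  have h1 : (1 : ℝ) ≤ n.factorial := by exact_mod_cast n.factorial_pos
  have h2 : (n : ℝ) ≤ 2 ^ n := by exact_mod_cast Nat.lt_two_pow_self.le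
  have h3 : (1 : ℝ) ≤ 2 ^ n := one_le_pow₀ (by norm_num)
  have h4 : |x| ≤ 2 ^ n * n.factorial := by
    rcases h0 with h | h | h
    · exact h.trans (mul_le_mul h2 hf (by positivity) (by positivity))
    · exact h.trans (by nlinarith)
    · exact h.trans (by nlinarith)
  rw [abs_div, abs_of_nonneg (by positivity : (0 : ℝ) ≤ (n.factorial : ℝ) ^ 2),
    div_le_div_iff₀ (by positivity) (by positivity)]
  nlinarith

lemma abs_coeffJ_le (n : ℕ) : |coeffJ n| ≤ 1 * 2 ^ n / n.factorial :=
  abs_coeff_aux (Or.inr (Or.inl (by simp)))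

lemma abs_coeffY_le (n : ℕ) : |coeffY n| ≤ 1 * 2 ^ n / n.factorial :=
  abs_coeff_aux (Or.inr (Or.inr (by
    simpa [abs_of_nonneg (harmonic_nonneg' n)] using harmonic_le_self n)))

lemma abs_mul_coeffJ_le (n : ℕ) : |n * coeffJ n| ≤ 1 * 2 ^ n / n.factorial := by
  rw [coeffJ, ← mul_div_assoc]
  exact abs_coeff_aux (Or.inr (Or.inr (by simp [abs_mul])))

lemma abs_mul_coeffY_le (n : ℕ) : |n * coeffY n| ≤ 1 * 2 ^ n / n.factorial := by
  rw [coeffY, ← mul_div_assoc]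
  refine abs_coeff_aux (Or.inl ?_)
  simpa [abs_of_nonneg (harmonic_nonneg' n)] using
    mul_le_mul_of_nonneg_left (harmonic_le_self n) n.cast_nonneg

/-- `J₀` as a function of `x² / 4`. -/
def serJ (t : ℝ) : ℝ := ∑' n, coeffJ n * t ^ n
/-- `t` times the derivative of `serJ`. -/
def serJ' (t : ℝ) : ℝ := ∑' n : ℕ, (n * coeffJ n) * t ^ n
/-- The entire part of `Y₀` as a function of `x² / 4`. -/
def serY (t : ℝ) : ℝ := ∑' n, coeffY n * t ^ n
/-- `t` times the derivative of `serY`. -/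
def serY' (t : ℝ) : ℝ := ∑' n : ℕ, (n * coeffY n) * t ^ n

lemma summable_of_le_factorial {a : ℕ → ℝ} {C : ℝ}
    (ha : ∀ n, |a n| ≤ C * 2 ^ n / n.factorial) (t : ℝ) : Summable fun n => a n * t ^ n := by
  refine Summable.of_norm_bounded ((Real.summable_pow_div_factorial (2 * |t|)).mul_left C)
    fun n => ?_
  rw [norm_eq_abs, abs_mul, abs_pow]
  calc |a n| * |t| ^ n ≤ C * 2 ^ n / n.factorial * |t| ^ n := by gcongr; exact ha n
    _ = _ := by rw [mul_pow]; ring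

lemma mul_tsum_deriv {a : ℕ → ℝ} {C : ℝ} (ha : ∀ n, |n * a n| ≤ C * 2 ^ n / n.factorial) (t : ℝ) :
    ∑' n : ℕ, (n * a n) * t ^ n = t * ∑' n : ℕ, ((n + 1 : ℕ) : ℝ) * a (n + 1) * t ^ n := by
  rw [(summable_of_le_factorial ha t).tsum_eq_zero_add, ← tsum_mul_left]
  simp only [CharP.cast_eq_zero, zero_mul, zero_add]
  exact tsum_congr fun n => by ring

lemma hasDerivAt_serJ {t : ℝ} (ht : t ≠ 0) : HasDerivAt serJ (serJ' t / t) t := by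
  convert! hasDerivAt_tsum_of_le_factorial abs_coeffJ_le t using 1
  rw [serJ', mul_tsum_deriv abs_mul_coeffJ_le]; field_simp

lemma hasDerivAt_serY {t : ℝ} (ht : t ≠ 0) : HasDerivAt serY (serY' t / t) t := by
  convert! hasDerivAt_tsum_of_le_factorial abs_coeffY_le t using 1
  rw [serY', mul_tsum_deriv abs_mul_coeffY_le]; field_simp

lemma hasDerivAt_serJ' (t : ℝ) : HasDerivAt serJ' (-serJ t) t := by
  convert! hasDerivAt_tsum_of_le_factorial abs_mul_coeffJ_le t using 1
  rw [serJ, ← tsum_neg]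
  refine tsum_congr fun n => ?_
  rw [coeffJ, coeffJ, Nat.factorial_succ]
  push_cast
  field_simp
  ring

lemma hasDerivAt_serY' {t : ℝ} (ht : t ≠ 0) : HasDerivAt serY' (-serY t + serJ' t / t) t := by
  convert! hasDerivAt_tsum_of_le_factorial abs_mul_coeffY_le t using 1
  rw [serJ', mul_tsum_deriv abs_mul_coeffJ_le, mul_div_cancel_left₀ _ ht, serY, ← tsum_neg,
    ← Summable.tsum_add]
  · refine tsum_congr fun n => ?_
    rw [coeffJ, coeffY, coeffY, pow_succ, Nat.factorial_succ, harmonic_succ]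
    push_cast
    field_simp
    ring
  · exact (summable_of_le_factorial abs_coeffY_le t).neg
  · have := (summable_nat_add_iff 1).2 (summable_of_le_factorial abs_mul_coeffJ_le t)
    refine ((summable_mul_left_iff ht).1 (this.congr fun n => ?_))
    ring

lemma continuous_serJ : Continuous serJ :=
  continuous_iff_continuousAt.2 fun t =>
    (hasDerivAt_tsum_of_le_factorial abs_coeffJ_le t).continuousAt

lemma continuous_serY : Continuous serY :=
  continuous_iff_continuousAt.2 fun t =>
    (hasDerivAt_tsum_of_le_factorial abs_coeffY_le t).continuousAt

lemma besselJ0_eq (x : ℝ) : besselJ0 x = serJ (x ^ 2 / 4) := by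
  rw [besselJ0, serJ]; exact tsum_congr fun n => by rw [coeffJ]; ring

lemma besselY0_eq (x : ℝ) : besselY0 x =
    2 / π * ((log (x / 2) + eulerMascheroniConstant) * serJ (x ^ 2 / 4) - serY (x ^ 2 / 4)) := by
  rw [besselY0, besselJ0_eq, serY]
  have : (∑' n : ℕ, (-1) ^ n * ((harmonic n : ℚ)) * (x ^ 2 / 4) ^ n / n.factorial ^ 2) =
      ∑' n, coeffY n * (x ^ 2 / 4) ^ n := tsum_congr fun n => by rw [coeffY]; ring
  rw [this]; ring

/-- `f` solves Bessel's equation of order zero on `(0, ∞)`, and `F(r) = r f'(r)`. -/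
def IsBesselPair (f F : ℝ → ℂ) : Prop :=
  ∀ r : ℝ, 0 < r → HasDerivAt f (F r / r) r ∧ HasDerivAt F (-(r * f r)) r

/-- The function `r J₀'(r)`. -/
def besselJ0' (x : ℝ) : ℝ := 2 * serJ' (x ^ 2 / 4)
/-- The function `r Y₀'(r)`. -/
def besselY0' (x : ℝ) : ℝ :=
  2 / π * (serJ (x ^ 2 / 4) + (log (x / 2) + eulerMascheroniConstant) *
    (2 * serJ' (x ^ 2 / 4)) - 2 * serY' (x ^ 2 / 4))

lemma hasDerivAt_sq_div_four (x : ℝ) : HasDerivAt (fun x : ℝ => x ^ 2 / 4) (x / 2) x := by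
  convert! (hasDerivAt_pow 2 x).div_const 4 using 1; simp; ring

lemma isBesselPair_J : IsBesselPair (fun r => (besselJ0 r : ℂ)) (fun r => (besselJ0' r : ℂ)) := by
  intro r hr
  have ht : r ^ 2 / 4 ≠ 0 := by positivity
  have h1 := (hasDerivAt_serJ ht).comp r (hasDerivAt_sq_div_four r)
  have h2 := ((hasDerivAt_serJ' (r ^ 2 / 4)).comp r (hasDerivAt_sq_div_four r)).const_mul 2
  constructor
  · have : HasDerivAt besselJ0 (besselJ0' r / r) r := by
      convert! h1 using 1
      · funext x; exact besselJ0_eq x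
      · rw [besselJ0']; field_simp; ring
    simpa using this.ofReal_comp
  · have : HasDerivAt besselJ0' (-(r * besselJ0 r)) r := by
      convert! h2 using 1
      rw [besselJ0_eq]; ring
    simpa using this.ofReal_comp

lemma isBesselPair_Y : IsBesselPair (fun r => (besselY0 r : ℂ)) (fun r => (besselY0' r : ℂ)) := by
  intro r hr
  have ht : r ^ 2 / 4 ≠ 0 := by positivity
  have hq := hasDerivAt_sq_div_four r
  have hl : HasDerivAt (fun x : ℝ => log (x / 2) + eulerMascheroniConstant) (1 / r) r := by
    convert! (((hasDerivAt_id r).div_const 2).log (by simp; positivity)).add_const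
      eulerMascheroniConstant using 1
    simp; field_simp
  have hJ := (hasDerivAt_serJ ht).comp r hq
  have hJ' := (hasDerivAt_serJ' (r ^ 2 / 4)).comp r hq
  have hY := (hasDerivAt_serY ht).comp r hq
  have hY' := (hasDerivAt_serY' ht).comp r hq
  constructor
  · have : HasDerivAt besselY0 (besselY0' r / r) r := by
      convert! ((hl.mul hJ).sub hY).const_mul (2 / π) using 1
      · funext x; exact besselY0_eq x
      · rw [besselY0']; simp only [Function.comp]; field_simp; ring
    simpa using this.ofReal_comp
  · have : HasDerivAt besselY0' (-(r * besselY0 r)) r := by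
      convert! ((hJ.add (hl.mul (hJ'.const_mul 2))).sub (hY'.const_mul 2)).const_mul (2 / π) using 1
      rw [besselY0_eq]; simp only [Function.comp]; field_simp; ring
    simpa using this.ofReal_comp

/-! ### An integral representation of the Hankel function -/

lemma sinh_pow_mul_exp_le (k : ℕ) {c : ℝ} (hc : 0 < c) {t : ℝ} (ht : 0 ≤ t) :
    sinh t ^ k * rexp (-(c * sinh t)) ≤ (k.factorial * (2 / c) ^ k) * rexp (-(c / 2) * t) := by
  have h1 := Real.pow_div_factorial_le_exp (c / 2 * sinh t) (by positivity) k
  have h2 : t ≤ sinh t := Real.self_le_sinh_iff.2 ht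
  have h3 : sinh t ^ k ≤ (k.factorial * (2 / c) ^ k) * rexp (c / 2 * sinh t) := by
    rw [div_le_iff₀ (by positivity), mul_pow] at h1
    calc sinh t ^ k = (2 / c) ^ k * ((c / 2) ^ k * sinh t ^ k) := by
          rw [← mul_assoc, ← mul_pow]; field_simp; simp
      _ ≤ (2 / c) ^ k * (rexp (c / 2 * sinh t) * k.factorial) := by gcongr
      _ = _ := by ring
  calc sinh t ^ k * rexp (-(c * sinh t))
      ≤ (k.factorial * (2 / c) ^ k) * rexp (c / 2 * sinh t) * rexp (-(c * sinh t)) := by gcongr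
    _ = (k.factorial * (2 / c) ^ k) * rexp (-(c / 2) * sinh t) := by
        rw [mul_assoc, ← Real.exp_add]; ring_nf
    _ ≤ _ := by gcongr ?_ * ?_; simp_all

lemma integrableOn_sinh_pow_mul_exp (k : ℕ) {c : ℝ} (hc : 0 < c) :
    IntegrableOn (fun t => sinh t ^ k * rexp (-(c * sinh t))) (Ioi 0) := by
  refine Integrable.mono' ((exp_neg_integrableOn_Ioi 0 (half_pos hc)).const_mul
    (k.factorial * (2 / c) ^ k)) (by fun_prop) ?_
  filter_upwards [ae_restrict_mem measurableSet_Ioi] with t ht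
  have hs : 0 ≤ sinh t := sinh_nonneg_iff.2 (le_of_lt ht)
  rw [norm_of_nonneg (by positivity)]
  exact sinh_pow_mul_exp_le k hc (le_of_lt ht)

/-- The integrals `∫₀^∞ sinhᵏ t exp(-r sinh t) dt`. -/
def sinhMoment (k : ℕ) (r : ℝ) : ℝ :=
  ∫ t in Ioi (0 : ℝ), sinh t ^ k * rexp (-(r * sinh t))

lemma hasDerivAt_sinhMoment (k : ℕ) {r : ℝ} (hr : 0 < r) :
    HasDerivAt (sinhMoment k) (-sinhMoment (k + 1) r) r := by
  have h := hasDerivAt_integral_of_dominated_loc_of_deriv_le (μ := volume.restrict (Ioi 0))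
    (F := fun r t => sinh t ^ k * rexp (-(r * sinh t)))
    (F' := fun r t => -(sinh t ^ (k + 1) * rexp (-(r * sinh t))))
    (bound := fun t => sinh t ^ (k + 1) * rexp (-(r / 2 * sinh t)))
    (x₀ := r) (s := Ioi (r / 2)) (Ioi_mem_nhds (by linarith)) ?_ ?_ ?_ ?_ ?_ ?_
  · convert! h.2 using 1
    rw [sinhMoment, integral_neg]
  · exact .of_forall fun x => by fun_prop
  · exact integrableOn_sinh_pow_mul_exp k hr
  · fun_prop
  · filter_upwards [ae_restrict_mem measurableSet_Ioi] with t ht x hx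
    have hs : 0 ≤ sinh t := sinh_nonneg_iff.2 (le_of_lt ht)
    rw [norm_neg, norm_of_nonneg (by positivity)]
    gcongr
    exact (mem_Ioi.1 hx).le
  · exact integrableOn_sinh_pow_mul_exp (k + 1) (half_pos hr)
  · refine .of_forall fun t x _ => ?_
    convert! (((hasDerivAt_id x).mul_const (sinh t)).neg.exp).const_mul (sinh t ^ k) using 1
    simp; ring

lemma tendsto_exp_neg_sinh {r : ℝ} (hr : 0 < r) (k : ℕ) :
    Tendsto (fun t => sinh t ^ k * rexp (-(r * sinh t))) atTop (𝓝 0) := by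
  have h : Tendsto (fun t : ℝ => (k.factorial * (2 / r) ^ k) * rexp (-(r / 2) * t))
      atTop (𝓝 0) := by
    have : Tendsto (fun t : ℝ => rexp (-(r / 2) * t)) atTop (𝓝 0) :=
      Real.tendsto_exp_atBot.comp (tendsto_id.const_mul_atTop_of_neg (by linarith))
    simpa using this.const_mul (k.factorial * (2 / r) ^ k)
  refine squeeze_zero' ?_ ?_ h
  · filter_upwards [eventually_ge_atTop 0] with t ht
    positivity
  · filter_upwards [eventually_ge_atTop 0] with t ht
    exact sinh_pow_mul_exp_le k hr ht

lemma cosh_le_sinh_add_one {t : ℝ} (ht : 0 ≤ t) : cosh t ≤ sinh t + 1 := by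
  have := Real.cosh_sub_sinh t
  have : rexp (-t) ≤ 1 := exp_le_one_iff.2 (by linarith)
  linarith

lemma integrableOn_cosh_mul_exp {r : ℝ} (hr : 0 < r) :
    IntegrableOn (fun t => cosh t * rexp (-(r * sinh t))) (Ioi 0) := by
  refine Integrable.mono' ((integrableOn_sinh_pow_mul_exp 1 hr).add
    (integrableOn_sinh_pow_mul_exp 0 hr)) (by fun_prop) ?_
  filter_upwards [ae_restrict_mem measurableSet_Ioi] with t ht
  rw [norm_of_nonneg (by positivity)]
  simp only [Pi.add_apply, pow_one, pow_zero, ← add_mul]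
  gcongr
  exact cosh_le_sinh_add_one (le_of_lt ht)

lemma integral_cosh_mul_exp {r : ℝ} (hr : 0 < r) :
    ∫ t in Ioi (0 : ℝ), cosh t * rexp (-(r * sinh t)) = 1 / r := by
  have := integral_Ioi_of_hasDerivAt_of_tendsto
    (f := fun t => -(1 / r) * (sinh t ^ 0 * rexp (-(r * sinh t))))
    (by fun_prop) (fun x _ => ?_)
    (integrableOn_cosh_mul_exp hr) (by simpa using (tendsto_exp_neg_sinh hr 0).const_mul (-(1 / r)))
  · simpa using this
  · convert! ((((hasDerivAt_sinh x).const_mul r).neg.exp).const_mul (-(1 / r))) using 1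
    · simp
    · field_simp; rfl

lemma sinhMoment_relation {r : ℝ} (hr : 0 < r) :
    r * sinhMoment 0 r + r * sinhMoment 2 r - sinhMoment 1 r = 1 := by
  have h0 := integrableOn_sinh_pow_mul_exp 0 hr
  have h1 := integrableOn_sinh_pow_mul_exp 1 hr
  have h2 := integrableOn_sinh_pow_mul_exp 2 hr
  rw [sinhMoment, sinhMoment, sinhMoment, ← integral_const_mul, ← integral_const_mul,
    ← integral_add (h0.const_mul r) (h2.const_mul r)]
  have hi := integral_sub ((h0.const_mul r).add (h2.const_mul r)) h1
  have h3 := ((h0.const_mul r).add (h2.const_mul r)).sub h1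
  simp only [Pi.add_apply] at hi
  simp only [Pi.add_def, Pi.sub_def] at h3
  rw [← hi]
  have := integral_Ioi_of_hasDerivAt_of_tendsto (m := 0)
    (f := fun t => -(cosh t * rexp (-(r * sinh t))))
    (by fun_prop) (fun x _ => ?_)
    h3 ?_
  · rw [this]; simp
  · convert! ((Real.hasDerivAt_cosh x).mul
      ((hasDerivAt_sinh x).const_mul r).neg.exp).neg using 1
    have := cosh_sq x
    linear_combination (-r * rexp (-(r * sinh x))) * this
  · refine squeeze_zero_norm' ?_ (by
      simpa using (tendsto_exp_neg_sinh hr 1).add (tendsto_exp_neg_sinh hr 0))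
    filter_upwards [eventually_ge_atTop 0] with t ht
    rw [norm_neg, norm_of_nonneg (by positivity)]
    have := cosh_le_sinh_add_one ht
    nlinarith [exp_pos (-(r * sinh t))]

/-- The integrals `∫₀^{π/2} sinᵏ t exp(i r sin t) dt`. -/
def sinMoment (k : ℕ) (r : ℝ) : ℂ :=
  ∫ t in (0 : ℝ)..π / 2, (sin t : ℂ) ^ k * cexp (I * (r * sin t))

lemma norm_sin_pow_mul_exp_le (k : ℕ) (r t : ℝ) :
    ‖(sin t : ℂ) ^ k * cexp (I * (r * sin t))‖ ≤ 1 := by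
  have h : ‖cexp (I * (r * sin t))‖ = 1 := by
    rw [mul_comm]; exact_mod_cast norm_exp_ofReal_mul_I (r * sin t)
  rw [norm_mul, h, mul_one, norm_pow, norm_real]
  exact pow_le_one₀ (norm_nonneg _) (Real.abs_sin_le_one t)

lemma hasDerivAt_sinMoment (k : ℕ) (r : ℝ) :
    HasDerivAt (sinMoment k) (I * sinMoment (k + 1) r) r := by
  have h := intervalIntegral.hasDerivAt_integral_of_dominated_loc_of_deriv_le
    (μ := volume) (a := 0) (b := π / 2)
    (F := fun (r : ℝ) t => (sin t) ^ k * cexp (I * (r * sin t)))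
    (F' := fun r t => I * ((sin t) ^ (k + 1) * cexp (I * (r * sin t))))
    (bound := fun t => 1) (x₀ := r) univ_mem ?_ ?_ ?_ ?_ ?_ ?_
  · convert! h.2 using 1
    rw [sinMoment, intervalIntegral.integral_const_mul]
  · exact .of_forall fun x => by fun_prop
  · exact Continuous.intervalIntegrable (by fun_prop) _ _
  · fun_prop
  · refine .of_forall fun t _ x _ => ?_
    rw [norm_mul, norm_I, one_mul]
    exact norm_sin_pow_mul_exp_le _ _ _
  · simp
  · refine .of_forall fun t _ x _ => ?_
    have h1 : HasDerivAt (fun x : ℝ => I * (x * (sin t))) (I * sin t) x := by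
      simpa using (((hasDerivAt_id x).ofReal_comp).mul_const (sin t)).const_mul I
    convert! (h1.cexp).const_mul ((sin t : ℂ) ^ k) using 1
    ring

lemma sinMoment_relation (r : ℝ) :
    r * sinMoment 0 r - r * sinMoment 2 r + I * sinMoment 1 r = I := by
  have hi k : IntervalIntegrable (fun t : ℝ => (sin t) ^ k *
      cexp (I * (r * sin t))) volume 0 (π / 2) :=
    Continuous.intervalIntegrable (by fun_prop) _ _
  rw [sinMoment, sinMoment, sinMoment, ← intervalIntegral.integral_const_mul,
    ← intervalIntegral.integral_const_mul, ← intervalIntegral.integral_const_mul,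
    ← intervalIntegral.integral_sub ((hi 0).const_mul _) ((hi 2).const_mul _),
    ← intervalIntegral.integral_add (((hi 0).const_mul _).sub ((hi 2).const_mul _))
      ((hi 1).const_mul _)]
  rw [integral_eq_sub_of_hasDerivAt (f := fun t : ℝ => -I * cos t * cexp (I * (r * sin t)))]
  · simp
  · intro x _
    have h1 : HasDerivAt (fun t : ℝ => I * (r * (sin t))) (I * (r * cos x)) x := by
      have := ((Real.hasDerivAt_sin x).ofReal_comp).const_mul (r : ℂ)
      exact this.const_mul I
    have h2 : HasDerivAt (fun t : ℝ => -I * (cos t)) (-I * ((-sin x : ℝ))) x :=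
      ((Real.hasDerivAt_cos x).ofReal_comp).const_mul _
    convert! h2.mul h1.cexp using 1
    have h3 : (sin x) ^ 2 + (cos x : ℂ) ^ 2 = 1 := by
      exact_mod_cast congrArg ((↑) : ℝ → ℂ) (Real.sin_sq_add_cos_sq x)
    push_cast at h3 ⊢
    linear_combination (-r * cexp (I * (r * Complex.sin x))) * h3 +
      (r * Complex.cos x ^ 2 * cexp (I * (r * Complex.sin x))) * I_sq
  · exact Continuous.intervalIntegrable (by fun_prop) _ _

/-- The function `∫₀^∞ exp(-r sinh t) dt + i ∫₀^{π/2} exp(i r sin t) dt`, a multiple of the Hankel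
function `H₀⁽¹⁾`. -/
def hankelU (r : ℝ) : ℂ := sinhMoment 0 r + I * sinMoment 0 r

/-- The function `r hankelU'(r)`. -/
def hankelU' (r : ℝ) : ℂ := -(r * sinhMoment 1 r) - r * sinMoment 1 r

lemma isBesselPair_hankelU : IsBesselPair hankelU hankelU' := by
  intro r hr
  have hrC : (r : ℂ) ≠ 0 := by exact_mod_cast hr.ne'
  have hid : HasDerivAt (fun r : ℝ => (r : ℂ)) 1 r := by
    simpa using (hasDerivAt_id r).ofReal_comp
  constructor
  · convert! ((hasDerivAt_sinhMoment 0 hr).ofReal_comp).add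
      ((hasDerivAt_sinMoment 0 r).const_mul I) using 1
    rw [hankelU']
    field_simp
    push_cast
    linear_combination (-sinMoment 1 r) * I_sq
  · convert! ((hid.mul (hasDerivAt_sinhMoment 1 hr).ofReal_comp).neg).sub
      (hid.mul (hasDerivAt_sinMoment 1 r)) using 1
    have h1 : (r : ℂ) * sinhMoment 0 r + r * sinhMoment 2 r - sinhMoment 1 r = 1 := by
      exact_mod_cast congrArg ((↑) : ℝ → ℂ) (sinhMoment_relation hr)
    have h2 := sinMoment_relation r
    rw [hankelU]
    push_cast
    linear_combination (-1) * h1 - I * h2 + (sinMoment 1 r -1) * I_sq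

lemma IsBesselPair.wronskian_const {f F g G : ℝ → ℂ} (hf : IsBesselPair f F)
    (hg : IsBesselPair g G) : ∃ c, ∀ r : ℝ, 0 < r → f r * G r - F r * g r = c := by
  have hd r (hr : 0 < r) : HasDerivAt (fun r => f r * G r - F r * g r) 0 r := by
    have hrC : (r : ℂ) ≠ 0 := by exact_mod_cast hr.ne'
    convert! ((hf r hr).1.mul (hg r hr).2).sub ((hf r hr).2.mul (hg r hr).1) using 1
    field_simp
    ring
  refine ⟨f 1 * G 1 - F 1 * g 1, fun r hr => ?_⟩
  exact isOpen_Ioi.is_const_of_deriv_eq_zero isPreconnected_Ioi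
    (fun x hx => (hd x hx).differentiableAt.differentiableWithinAt)
    (fun x hx => (hd x hx).deriv) (mem_Ioi.2 hr) (mem_Ioi.2 one_pos)

lemma IsBesselPair.wronskian_eq_of_tendsto {f F g G : ℝ → ℂ} (hf : IsBesselPair f F)
    (hg : IsBesselPair g G) {c : ℂ}
    (hc : Tendsto (fun r => f r * G r - F r * g r) (𝓝[>] 0) (𝓝 c)) {r : ℝ} (hr : 0 < r) :
    f r * G r - F r * g r = c := by
  obtain ⟨c', h⟩ := hf.wronskian_const hg
  rw [h r hr]
  refine tendsto_nhds_unique (Tendsto.congr' ?_ tendsto_const_nhds) hc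
  filter_upwards [self_mem_nhdsWithin] with x hx using (h x hx).symm

lemma integral_log_mul_exp_neg :
    ∫ t in Ioi (0 : ℝ), log t * rexp (-t) = -eulerMascheroniConstant := by
  have h1 := Complex.hasDerivAt_GammaIntegral (s := 1) (by simp)
  have h2 : HasDerivAt Complex.GammaIntegral (-eulerMascheroniConstant) 1 := by
    refine Complex.hasDerivAt_Gamma_one.congr_of_eventuallyEq ?_
    have : IsOpen {s : ℂ | 0 < s.re} := Complex.continuous_re.isOpen_preimage _ isOpen_Ioi
    filter_upwards [this.mem_nhds (show 1 ∈ {s : ℂ | 0 < s.re} by simp)] with a ha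
    exact (Complex.Gamma_eq_integral ha).symm
  have h3 := h1.unique h2
  simp only [sub_self, Complex.cpow_zero, one_mul] at h3
  have h4 : ((∫ t in Ioi 0, log t * rexp (-t) : ℝ) : ℂ) = ((-eulerMascheroniConstant : ℝ)) := by
    rw [← integral_complex_ofReal]; push_cast; push_cast at h3; exact h3
  exact_mod_cast h4

lemma integrableOn_log_mul_exp_neg : IntegrableOn (fun t => log t * rexp (-t)) (Ioi 0) := by
  by_contra h
  have h1 := integral_undef h
  rw [integral_log_mul_exp_neg] at h1
  linarith [Real.one_half_lt_eulerMascheroniConstant]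

lemma tendsto_integral_log_mul_exp_neg :
    Tendsto (fun s : ℝ => ∫ t in Ioi s, log t * rexp (-t)) (𝓝[>] 0)
      (𝓝 (-eulerMascheroniConstant)) := by
  have h : Tendsto (fun s : ℝ => ∫ t in Ioi 0,
      (Ioi s).indicator (fun t => log t * rexp (-t)) t) (𝓝[>] 0)
      (𝓝 (∫ t in Ioi 0, log t * rexp (-t))) := by
    refine tendsto_integral_filter_of_dominated_convergence
      (fun t => ‖log t * rexp (-t)‖) ?_ ?_ integrableOn_log_mul_exp_neg.norm ?_
    · exact .of_forall fun s =>
        (integrableOn_log_mul_exp_neg.aestronglyMeasurable).indicator measurableSet_Ioi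
    · exact .of_forall fun s => .of_forall fun t => norm_indicator_le_norm_self _ _
    · filter_upwards [ae_restrict_mem measurableSet_Ioi] with t ht
      refine tendsto_const_nhds.congr' ?_
      filter_upwards [mem_nhdsWithin_of_mem_nhds (Iio_mem_nhds (mem_Ioi.1 ht))] with s hs
      simp_all
  rw [integral_log_mul_exp_neg] at h
  refine h.congr' ?_
  filter_upwards [self_mem_nhdsWithin] with s hs
  rw [setIntegral_indicator measurableSet_Ioi, inter_eq_self_of_subset_right]
  grind

lemma exp_neg_mul_exp_le {s : ℝ} (hs : 0 < s) (t : ℝ) :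
    rexp t * rexp (-(s * rexp t)) ≤ 6 / s ^ 3 * rexp (-(2 * t)) := by
  have h1 := Real.pow_div_factorial_le_exp (s * rexp t) (by positivity) 3
  have h2 : rexp t ^ 3 = rexp t * rexp (2 * t) := by
    rw [← Real.exp_nat_mul, ← Real.exp_add]; congr 1; push_cast; ring
  rw [div_le_iff₀ (by positivity), mul_pow, h2] at h1
  have h3 : (Nat.factorial 3 : ℝ) = 6 := by norm_num [Nat.factorial]
  rw [h3] at h1
  rw [Real.exp_neg, Real.exp_neg, ← div_eq_mul_inv, ← div_eq_mul_inv,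
    div_le_div_iff₀ (exp_pos _) (exp_pos _), div_mul_eq_mul_div,
    le_div_iff₀ (by positivity)]
  linarith

lemma integral_exp_neg_mul_exp {s : ℝ} (hs : 0 < s) :
    IntegrableOn (fun t => rexp (-(s * rexp t))) (Ioi 0) ∧
    ∫ t in Ioi (0 : ℝ), rexp (-(s * rexp t)) =
      (∫ u in Ioi s, log u * rexp (-u)) - log s * rexp (-s) := by
  have hI1 : IntegrableOn (fun t => rexp (-(s * rexp t))) (Ioi 0) := by
    refine Integrable.mono' (exp_neg_integrableOn_Ioi 0 hs) (by fun_prop) ?_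
    filter_upwards [ae_restrict_mem measurableSet_Ioi] with t ht
    rw [norm_of_nonneg (by positivity)]
    refine exp_le_exp.2 ?_
    have := add_one_le_exp t
    nlinarith
  have hI2 : IntegrableOn (fun t => t * (s * rexp t * rexp (-(s * rexp t)))) (Ici 0) := by
    rw [integrableOn_Ici_iff_integrableOn_Ioi]
    refine Integrable.mono' ((exp_neg_integrableOn_Ioi 0 one_pos).const_mul (6 / s ^ 2))
      (by fun_prop) ?_
    filter_upwards [ae_restrict_mem measurableSet_Ioi] with t ht
    have ht0 : 0 < t := ht
    rw [norm_of_nonneg (by positivity)]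
    have h1 : t * rexp (-(2 * t)) ≤ rexp (-1 * t) := by
      have h2 : t ≤ rexp t := by linarith [add_one_le_exp t]
      calc t * rexp (-(2 * t)) ≤ rexp t * rexp (-(2 * t)) := by gcongr
        _ = _ := by rw [← Real.exp_add]; ring_nf
    calc t * (s * rexp t * rexp (-(s * rexp t)))
        = t * s * (rexp t * rexp (-(s * rexp t))) := by ring
      _ ≤ t * s * (6 / s ^ 3 * rexp (-(2 * t))) := by
          exact mul_le_mul_of_nonneg_left (exp_neg_mul_exp_le hs t) (by positivity)
      _ = 6 / s ^ 2 * (t * rexp (-(2 * t))) := by field_simp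
      _ ≤ _ := by gcongr
  have hI2' := hI2.mono_set Ioi_subset_Ici_self
  have hE := exp_neg_integrableOn_Ioi s one_pos
  have himg : (fun t => s * rexp t) '' Ici 0 ⊆ Ici s := by
    rintro _ ⟨t, ht, rfl⟩
    have := one_le_exp (mem_Ici.1 ht)
    exact mem_Ici.2 (by nlinarith)
  have hg : IntegrableOn (fun u => (log u - log s) * rexp (-u)) (Ioi s) := by
    have := (integrableOn_log_mul_exp_neg.mono_set (Ioi_subset_Ioi hs.le)).sub
      (hE.const_mul (log s))
    refine this.congr (.of_forall fun u => ?_)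
    simp [sub_mul]
  have hsub := integral_comp_mul_deriv_Ioi (a := 0) (f := fun t => s * rexp t)
    (g := fun u => (log u - log s) * rexp (-u))
    (by fun_prop) (Real.tendsto_exp_atTop.const_mul_atTop hs)
    (fun x _ => ((Real.hasDerivAt_exp x).const_mul s).hasDerivWithinAt) ?_ ?_ ?_
  · have hlog t : log (s * rexp t) - log s = t := by
      rw [Real.log_mul hs.ne' (exp_pos t).ne', log_exp]; ring
    have hparts := integral_Ioi_of_hasDerivAt_of_tendsto (m := 0)
      (f := fun t => t * rexp (-(s * rexp t)))
      (f' := fun t => rexp (-(s * rexp t)) -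
        t * (s * rexp t * rexp (-(s * rexp t)))) (by fun_prop) (fun x _ => ?_)
      (hI1.sub hI2') ?_
    · rw [integral_sub hI1 hI2'] at hparts
      refine ⟨hI1, ?_⟩
      simp only [Function.comp, hlog, Real.exp_zero, mul_one] at hsub
      simp only [zero_mul, sub_zero] at hparts
      rw [sub_eq_zero.1 hparts]
      have e1 : ∫ t in Ioi 0, t * (s * rexp t * rexp (-(s * rexp t))) =
          ∫ t in Ioi 0, t * rexp (-(s * rexp t)) * (s * rexp t) := by
        congr 1; funext t; ring
      rw [e1, hsub]
      simp only [sub_mul]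
      rw [integral_sub (integrableOn_log_mul_exp_neg.mono_set (Ioi_subset_Ioi hs.le))
        (by simpa using hE.const_mul (log s)), integral_const_mul, integral_exp_neg_Ioi]
    · convert! (hasDerivAt_id x).mul (((Real.hasDerivAt_exp x).const_mul s).neg.exp) using 1
      simp only [id, Pi.neg_apply]; ring
    · have h1 : Tendsto (fun t : ℝ => 6 / s ^ 3 * rexp (-(2 * t))) atTop (𝓝 0) := by
        have : Tendsto (fun t : ℝ => rexp (-(2 * t))) atTop (𝓝 0) :=
          Real.tendsto_exp_neg_atTop_nhds_zero.comp (tendsto_id.const_mul_atTop two_pos)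
        simpa using this.const_mul (6 / s ^ 3)
      refine squeeze_zero' ?_ ?_ h1
      · filter_upwards [eventually_ge_atTop 0] with t ht using by positivity
      · filter_upwards [eventually_ge_atTop 0] with t ht
        refine le_trans ?_ (exp_neg_mul_exp_le hs t)
        gcongr
        linarith [add_one_le_exp t]
  · refine ContinuousOn.mul (ContinuousOn.sub (Real.continuousOn_log.mono ?_) continuousOn_const)
      (by fun_prop)
    simp [hs.ne']
  · rw [← integrableOn_Ici_iff_integrableOn_Ioi] at hg
    exact hg.mono_set himg
  · refine hI2.congr (.of_forall fun t => ?_)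
    simp only [Function.comp]
    rw [Real.log_mul hs.ne' (exp_pos t).ne', log_exp]; ring

lemma abs_sinhMoment_zero_sub_le {r : ℝ} (hr : 0 < r) :
    |sinhMoment 0 r - ∫ t in Ioi (0 : ℝ), rexp (-(r / 2 * rexp t))| ≤ r / 2 := by
  have hI0 := integrableOn_sinh_pow_mul_exp 0 hr
  have hI1 := (integral_exp_neg_mul_exp (half_pos hr)).1
  have hE := exp_neg_integrableOn_Ioi 0 one_pos
  rw [sinhMoment, ← integral_sub hI0 hI1, ← norm_eq_abs]
  refine (norm_integral_le_integral_norm _).trans ?_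
  calc _ ≤ ∫ t in Ioi 0, r / 2 * rexp (-1 * t) := by
        refine integral_mono_of_nonneg (.of_forall fun t => norm_nonneg _) (hE.const_mul _) ?_
        filter_upwards [ae_restrict_mem measurableSet_Ioi] with t ht
        have hs : 0 ≤ sinh t := sinh_nonneg_iff.2 (le_of_lt ht)
        have e1 : r / 2 * rexp t = r * sinh t + r / 2 * rexp (-t) := by
          rw [Real.sinh_eq]; ring
        have e2 : rexp (-(r / 2 * rexp t)) =
            rexp (-(r * sinh t)) * rexp (-(r / 2 * rexp (-t))) := by
          rw [← Real.exp_add, e1]; ring_nf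
        have h1 : 1 - rexp (-(r / 2 * rexp (-t))) ≤ r / 2 * rexp (-t) := by
          linarith [add_one_le_exp (-(r / 2 * rexp (-t)))]
        have h2 : rexp (-(r / 2 * rexp (-t))) ≤ 1 :=
          exp_le_one_iff.2 (by have := exp_pos (-t); nlinarith)
        have h3 : rexp (-(r * sinh t)) ≤ 1 := exp_le_one_iff.2 (by nlinarith)
        simp only [pow_zero, one_mul, e2, neg_mul]
        rw [norm_of_nonneg (by nlinarith [exp_pos (-(r * sinh t))])]
        nlinarith [exp_pos (-(r * sinh t))]
    _ = r / 2 := by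
        rw [integral_const_mul]
        simp only [neg_mul, one_mul]
        rw [integral_exp_neg_Ioi]; simp

lemma tendsto_log_mul_self : Tendsto (fun r : ℝ => r * log r) (𝓝[>] 0) (𝓝 0) := by
  have := tendsto_log_mul_rpow_nhdsGT_zero one_pos
  refine this.congr fun x => by rw [rpow_one, mul_comm]

lemma tendsto_half_nhdsGT : Tendsto (fun r : ℝ => r / 2) (𝓝[>] 0) (𝓝[>] 0) := by
  refine tendsto_nhdsWithin_iff.2 ⟨?_, ?_⟩
  · have : Tendsto (fun r : ℝ => r / 2) (𝓝 0) (𝓝 (0 / 2)) := by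
      exact (continuous_id.div_const 2).tendsto 0
    simpa using this.mono_left nhdsWithin_le_nhds
  · filter_upwards [self_mem_nhdsWithin] with r hr using half_pos (mem_Ioi.1 hr)

/-- The behaviour of the real part of `hankelU` at the origin. -/
lemma tendsto_sinhMoment_zero_add_log :
    Tendsto (fun r => sinhMoment 0 r + (log (r / 2) + eulerMascheroniConstant)) (𝓝[>] 0) (𝓝 0) := by
  have h1 : Tendsto (fun r : ℝ => (∫ u in Ioi (r / 2), log u * rexp (-u)) +
      eulerMascheroniConstant) (𝓝[>] 0) (𝓝 0) := by
    have := (tendsto_integral_log_mul_exp_neg.comp tendsto_half_nhdsGT).add_const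
      eulerMascheroniConstant
    simpa using this
  have h2 : Tendsto (fun r : ℝ => log (r / 2) * (1 - rexp (-(r / 2)))) (𝓝[>] 0) (𝓝 0) := by
    have h3 : Tendsto (fun s : ℝ => log s * (1 - rexp (-s))) (𝓝[>] 0) (𝓝 0) := by
      have h4 := tendsto_log_mul_self.norm
      rw [norm_zero] at h4
      refine squeeze_zero_norm' ?_ h4
      filter_upwards [self_mem_nhdsWithin] with s hs
      have hs0 : 0 < s := hs
      rw [norm_mul, norm_mul, mul_comm]
      gcongr
      have := add_one_le_exp (-s)
      have h5 : rexp (-s) ≤ 1 := exp_le_one_iff.2 (by linarith)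
      rw [norm_of_nonneg (by linarith), norm_of_nonneg hs0.le]
      linarith
    exact h3.comp tendsto_half_nhdsGT
  have h3 : Tendsto (fun r : ℝ => sinhMoment 0 r -
      ∫ t in Ioi 0, rexp (-(r / 2 * rexp t))) (𝓝[>] 0) (𝓝 0) := by
    refine squeeze_zero_norm' ?_ (tendsto_half_nhdsGT.mono_right nhdsWithin_le_nhds)
    filter_upwards [self_mem_nhdsWithin] with r hr
    exact abs_sinhMoment_zero_sub_le hr
  have := (h1.add h2).add h3
  simp only [add_zero] at this
  refine this.congr' ?_
  filter_upwards [self_mem_nhdsWithin] with r hr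
  rw [(integral_exp_neg_mul_exp (half_pos (mem_Ioi.1 hr))).2]
  ring

lemma serJ_zero : serJ 0 = 1 := by
  rw [serJ, tsum_eq_single 0 (fun n hn => by simp [hn])]; simp [coeffJ]

lemma serJ'_zero : serJ' 0 = 0 := by
  rw [serJ', tsum_eq_single 0 (fun n hn => by simp [hn])]; simp

lemma serY_zero : serY 0 = 0 := by
  rw [serY, tsum_eq_single 0 (fun n hn => by simp [hn])]; simp [coeffY]

lemma serY'_zero : serY' 0 = 0 := by
  rw [serY', tsum_eq_single 0 (fun n hn => by simp [hn])]; simp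

lemma IsBesselPair.add {f F g G : ℝ → ℂ} (hf : IsBesselPair f F) (hg : IsBesselPair g G) :
    IsBesselPair (fun r => f r + g r) (fun r => F r + G r) := fun r hr =>
  ⟨((hf r hr).1.add (hg r hr).1).congr_deriv (by ring),
    ((hf r hr).2.add (hg r hr).2).congr_deriv (by ring)⟩

lemma IsBesselPair.const_mul {f F : ℝ → ℂ} (c : ℂ) (hf : IsBesselPair f F) :
    IsBesselPair (fun r => c * f r) (fun r => c * F r) := fun r hr =>
  ⟨((hf r hr).1.const_mul c).congr_deriv (by ring), ((hf r hr).2.const_mul c).congr_deriv (by ring)⟩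

lemma isBigO_comp_sq {s : ℝ → ℝ} {d : ℝ} (h : HasDerivAt s d 0) :
    (fun r : ℝ => s (r ^ 2 / 4) - s 0) =O[𝓝[>] 0] fun r => r * r := by
  have h1 : (fun t => s t - s 0) =O[𝓝 0] fun t => t := by
    simpa using h.differentiableAt.isBigO_sub
  have h2 : Tendsto (fun r : ℝ => r ^ 2 / 4) (𝓝[>] 0) (𝓝 0) := by
    have : Tendsto (fun r : ℝ => r ^ 2 / 4) (𝓝 0) (𝓝 (0 ^ 2 / 4)) :=
      Continuous.tendsto (by fun_prop) 0
    simpa using this.mono_left nhdsWithin_le_nhds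
  refine (h1.comp_tendsto h2).trans ?_
  exact Asymptotics.IsBigO.of_bound (1 / 4) (.of_forall fun r => by
    simp [Function.comp]; nlinarith)

lemma tendsto_id_nhdsGT : Tendsto (fun r : ℝ => r) (𝓝[>] 0) (𝓝 0) :=
  tendsto_id.mono_left nhdsWithin_le_nhds

/-- The expression `log (r / 2) + γ`. -/
def logGamma (r : ℝ) : ℝ := log (r / 2) + eulerMascheroniConstant

lemma tendsto_mul_logGamma : Tendsto (fun r : ℝ => r * logGamma r) (𝓝[>] 0) (𝓝 0) := by
  have h := (tendsto_log_mul_self.comp tendsto_half_nhdsGT).const_mul 2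
  have h2 := (tendsto_id_nhdsGT.mul_const eulerMascheroniConstant).add h
  simp only [zero_mul, mul_zero, add_zero] at h2
  refine h2.congr fun r => ?_
  simp only [Function.comp, logGamma]; ring

lemma isBigO_mul_logGamma {u : ℝ → ℝ} (h : u =O[𝓝[>] 0] fun r => r * r) :
    (fun r => u r * logGamma r) =O[𝓝[>] 0] fun r => r := by
  have h1 : (fun r => u r * logGamma r) =O[𝓝[>] 0] fun r => r * (r * logGamma r) := by
    simpa [mul_assoc] using h.mul (Asymptotics.isBigO_refl logGamma (𝓝[>] 0))
  refine h1.trans ?_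
  simpa using (Asymptotics.isBigO_refl (fun r : ℝ => r) (𝓝[>] 0)).mul
    (tendsto_mul_logGamma.isBigO_one ℝ)

lemma isBigO_mul_self : (fun r : ℝ => r * r) =O[𝓝[>] 0] fun r => r := by
  simpa using (Asymptotics.isBigO_refl (fun r : ℝ => r) (𝓝[>] 0)).mul
    (tendsto_id_nhdsGT.isBigO_one ℝ)

lemma isBigO_mul_sinhMoment_one : (fun r : ℝ => r * sinhMoment 1 r - 1) =O[𝓝[>] 0] fun r => r := by
  refine Asymptotics.IsBigO.of_bound 1 ?_
  filter_upwards [self_mem_nhdsWithin] with r hr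
  have hr0 : 0 < r := hr
  have hI1 := integrableOn_sinh_pow_mul_exp 1 hr0
  have hI2 := integrableOn_cosh_mul_exp hr0
  have hE := exp_neg_integrableOn_Ioi 0 one_pos
  have e : r * sinhMoment 1 r - 1 = r * ∫ t in Ioi 0, (sinh t ^ 1 * rexp (-(r * sinh t)) -
        cosh t * rexp (-(r * sinh t))) := by
    rw [integral_sub hI1 hI2, integral_cosh_mul_exp hr0, sinhMoment]; field_simp
  rw [e, norm_mul, one_mul]
  refine mul_le_of_le_one_right (norm_nonneg _) ((norm_integral_le_integral_norm _).trans ?_)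
  calc _ ≤ ∫ t in Ioi 0, rexp (-1 * t) := by
        refine integral_mono_of_nonneg (.of_forall fun t => norm_nonneg _) hE ?_
        filter_upwards [ae_restrict_mem measurableSet_Ioi] with t ht
        have hs : 0 ≤ sinh t := sinh_nonneg_iff.2 (le_of_lt ht)
        simp only [pow_one, ← sub_mul, ← neg_sub (cosh t), Real.cosh_sub_sinh]
        have h3 : rexp (-(r * sinh t)) ≤ 1 := exp_le_one_iff.2 (by nlinarith)
        simpa using mul_le_of_le_one_right (exp_pos (-t)).le h3
    _ = 1 := by
        simp only [neg_mul, one_mul]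
        rw [integral_exp_neg_Ioi]; simp

lemma tendsto_comp_sq {s : ℝ → ℝ} (h : ContinuousAt s 0) :
    Tendsto (fun r : ℝ => s (r ^ 2 / 4)) (𝓝[>] 0) (𝓝 (s 0)) := by
  have h2 : Tendsto (fun r : ℝ => r ^ 2 / 4) (𝓝[>] 0) (𝓝 0) := by
    have : Tendsto (fun r : ℝ => r ^ 2 / 4) (𝓝 0) (𝓝 (0 ^ 2 / 4)) :=
      Continuous.tendsto (by fun_prop) 0
    simpa using this.mono_left nhdsWithin_le_nhds
  exact h.tendsto.comp h2

/-- The integral representation of `H₀⁽¹⁾ = J₀ + i Y₀`. -/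
lemma hankelU_eq {r : ℝ} (hr : 0 < r) :
    hankelU r = (π * I / 2) * ((besselJ0 r : ℂ) + I * (besselY0 r : ℂ)) := by
  have hπ : (π : ℂ) ≠ 0 := by exact_mod_cast pi_ne_zero
  have hJ0 := hasDerivAt_tsum_of_le_factorial abs_coeffJ_le 0
  have hJ0' := hasDerivAt_serJ' 0
  have hY0' := hasDerivAt_tsum_of_le_factorial abs_mul_coeffY_le 0
  have oJ := isBigO_comp_sq hJ0
  have oJ' := isBigO_comp_sq hJ0'
  have oY' := isBigO_comp_sq hY0'
  change (fun r : ℝ => serJ (r ^ 2 / 4) - serJ 0) =O[_] _ at oJ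
  change (fun r : ℝ => serY' (r ^ 2 / 4) - serY' 0) =O[_] _ at oY'
  simp only [serJ_zero, serJ'_zero, serY'_zero, sub_zero] at oJ oJ' oY'
  have tJ := tendsto_comp_sq continuous_serJ.continuousAt
  have tY := tendsto_comp_sq continuous_serY.continuousAt
  have tJ' := tendsto_comp_sq hJ0'.continuousAt
  have tY' : Tendsto (fun r : ℝ => serY' (r ^ 2 / 4)) (𝓝[>] 0) (𝓝 (serY' 0)) :=
    tendsto_comp_sq hY0'.continuousAt
  rw [serJ_zero] at tJ
  rw [serY_zero] at tY
  rw [serJ'_zero] at tJ'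
  rw [serY'_zero] at tY'
  set f : ℝ → ℂ := fun r => hankelU r + ((-(π * I / 2)) * (besselJ0 r) +
    (π / 2) * (besselY0 r)) with hf
  set F : ℝ → ℂ := fun r => hankelU' r + ((-(π * I / 2)) * (besselJ0' r) +
    (π / 2) * (besselY0' r)) with hF
  have hfF : IsBesselPair f F := isBesselPair_hankelU.add
    ((isBesselPair_J.const_mul _).add (isBesselPair_Y.const_mul _))
  have tL : Tendsto (fun r => (serJ (r ^ 2 / 4) - 1) * logGamma r) (𝓝[>] 0) (𝓝 0) :=
    (isBigO_mul_logGamma oJ).trans_tendsto tendsto_id_nhdsGT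
  have tL' : Tendsto (fun r => serJ' (r ^ 2 / 4) * logGamma r) (𝓝[>] 0) (𝓝 0) :=
    (isBigO_mul_logGamma oJ').trans_tendsto tendsto_id_nhdsGT
  have tM : Tendsto (sinMoment 0) (𝓝[>] 0) (𝓝 (π / 2)) := by
    have h1 := (hasDerivAt_sinMoment 0 0).continuousAt.tendsto
    have h2 : sinMoment 0 0 = π / 2 := by simp [sinMoment]
    rw [h2] at h1
    exact h1.mono_left nhdsWithin_le_nhds
  have fEq r : f r = ((sinhMoment 0 r + logGamma r : ℝ)) +
      I * (sinMoment 0 r - π / 2 * (serJ (r ^ 2 / 4))) +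
      (((serJ (r ^ 2 / 4) - 1) * logGamma r - serY (r ^ 2 / 4) : ℝ)) := by
    simp only [hf, hankelU, besselJ0_eq, besselY0_eq, logGamma]
    push_cast
    field_simp
    ring
  have FEq r : F r = -((r * sinhMoment 1 r - 1 : ℝ)) - r * sinMoment 1 r -
      π * I * (serJ' (r ^ 2 / 4)) + ((serJ (r ^ 2 / 4) - 1 : ℝ)) +
      ((2 * (serJ' (r ^ 2 / 4) * logGamma r) - 2 * serY' (r ^ 2 / 4) : ℝ) : ℂ) := by
    simp only [hF, hankelU', besselJ0', besselY0', logGamma]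
    push_cast
    field_simp
    ring
  have tf : Tendsto f (𝓝[>] 0) (𝓝 0) := by
    have h1 := ((tendsto_sinhMoment_zero_add_log.ofReal).add
      ((tM.sub ((tJ.ofReal).const_mul (π / 2 : ℂ))).const_mul I)).add
      ((tL.sub tY).ofReal)
    simp only [Complex.ofReal_one, mul_one, sub_self, mul_zero, ofReal_zero, add_zero] at h1
    exact h1.congr fun r => (fEq r).symm
  have castO {u : ℝ → ℝ} (h : u =O[𝓝[>] 0] fun r => r) :
      (fun r => ((u r) : ℂ)) =O[𝓝[>] 0] fun r => r := by
    refine (Asymptotics.isBigO_norm_left.1 ?_)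
    simpa using h.norm_left
  have oF : F =O[𝓝[>] 0] fun r => r := by
    have h2 : (fun r : ℝ => r * sinMoment 1 r) =O[𝓝[>] 0] fun r => r := by
      have h1 := ((hasDerivAt_sinMoment 1 0).continuousAt.tendsto.mono_left
        (nhdsWithin_le_nhds (s := Ioi 0))).isBigO_one ℝ
      simpa using (castO (Asymptotics.isBigO_refl (fun r : ℝ => r) _)).mul h1
    refine ((((castO isBigO_mul_sinhMoment_one).neg_left.sub h2).sub
      ((castO (oJ'.trans isBigO_mul_self)).const_mul_left (π * I))).add
      (castO (oJ.trans isBigO_mul_self))).add (castO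
      (((isBigO_mul_logGamma oJ').const_mul_left 2).sub
        ((oY'.trans isBigO_mul_self).const_mul_left 2))) |>.congr_left fun r => (FEq r).symm
  have tF : Tendsto F (𝓝[>] 0) (𝓝 0) := oF.trans_tendsto tendsto_id_nhdsGT
  have tFL : Tendsto (fun r => F r * (logGamma r)) (𝓝[>] 0) (𝓝 0) := by
    have : (fun r => F r * (logGamma r)) =O[𝓝[>] 0] fun r => r * logGamma r := by
      refine oF.mul (Asymptotics.IsBigO.of_bound 1 (.of_forall fun r => ?_))
      rw [norm_real, one_mul]
    exact this.trans_tendsto tendsto_mul_logGamma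
  have tY1 : Tendsto (fun r => besselY0' r) (𝓝[>] 0) (𝓝 (2 / π)) := by
    have h1 := ((tJ.add (tL'.const_mul 2)).sub (tY'.const_mul 2)).const_mul (2 / π)
    simp only [mul_zero, add_zero, sub_zero, mul_one] at h1
    refine h1.congr fun r => ?_
    simp only [besselY0', logGamma]; ring
  have tJ1 : Tendsto (fun r => besselJ0' r) (𝓝[>] 0) (𝓝 0) := by
    simpa [besselJ0'] using tJ'.const_mul 2
  have tJJ : Tendsto (fun r => besselJ0 r) (𝓝[>] 0) (𝓝 1) := by
    refine tJ.congr fun r => (besselJ0_eq r).symm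
  have C1 : f r * (besselJ0' r) - F r * (besselJ0 r) = 0 :=
    hfF.wronskian_eq_of_tendsto isBesselPair_J (by
      simpa using (tf.mul (tJ1.ofReal)).sub (tF.mul (tJJ.ofReal))) hr
  have C2 : f r * (besselY0' r) - F r * (besselY0 r) = 0 := by
    refine hfF.wronskian_eq_of_tendsto isBesselPair_Y ?_ hr
    have h1 := (tf.mul (tY1.ofReal)).sub (((tFL.mul (tJ.ofReal)).sub
      (tF.mul (tY.ofReal))).const_mul (2 / π : ℂ))
    simp only [zero_mul, sub_zero, mul_zero] at h1
    refine h1.congr fun r => ?_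
    simp only [besselY0_eq, logGamma]
    push_cast
    ring
  have W : (besselJ0 r) * (besselY0' r) - (besselJ0' r) * (besselY0 r : ℂ) = 2 / π := by
    refine isBesselPair_J.wronskian_eq_of_tendsto isBesselPair_Y ?_ hr
    have h1 := ((tJJ.mul tY1).sub ((tL'.mul tJ).sub (tJ'.mul tY) |>.const_mul (4 / π))).ofReal
    simp only [zero_mul, sub_zero, mul_zero, one_mul] at h1
    push_cast at h1
    refine h1.congr fun r => ?_
    simp only [besselY0_eq, besselJ0', logGamma]
    push_cast
    ring
  have hfr : f r * (2 / π) = 0 := by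
    rw [← W]
    linear_combination (besselJ0 r) * C2 - (besselY0 r) * C1
  have hfr0 : f r = 0 := by
    rcases mul_eq_zero.1 hfr with h | h
    · exact h
    · grind
  linear_combination hfr0 - (π / 2 * besselY0 r) * I_sq

/-! ### Weyl's integral -/

/-- The exponent in Weyl's integral representation. -/
def weylPhase (a b t : ℝ) : ℂ :=
  cexp (I * a * cosh t - b * sinh t)

lemma norm_weylPhase (a b t : ℝ) : ‖weylPhase a b t‖ = rexp (-(b * sinh t)) := by
  rw [weylPhase, norm_exp]
  congr 1
  rw [Complex.sub_re, show I * a * (cosh t) =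
    I * ((a * cosh t : ℝ)) by push_cast; ring, Complex.I_mul_re,
    show b * (sinh t) = ((b * sinh t : ℝ) : ℂ) by push_cast; ring]
  rw [ofReal_im, ofReal_re]; ring

lemma continuous_weylPhase (a b : ℝ) : Continuous (weylPhase a b) := by
  unfold weylPhase
  fun_prop

lemma integrableOn_weylPhase (a : ℝ) {b : ℝ} (hb : 0 < b) :
    IntegrableOn (weylPhase a b) (Ioi 0) := by
  refine (integrableOn_sinh_pow_mul_exp 0 hb).mono'
    (continuous_weylPhase a b).aestronglyMeasurable (.of_forall fun t => ?_)
  simp [norm_weylPhase]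

lemma hasDerivAt_weylPhase_snd (a b t : ℝ) : HasDerivAt (weylPhase a b)
    (weylPhase a b t * (I * a * sinh t - b * cosh t)) t :=
  ((((Real.hasDerivAt_cosh t).ofReal_comp).const_mul (I * a)).sub
    (((hasDerivAt_sinh t).ofReal_comp).const_mul (b : ℂ))).cexp

lemma hasDerivAt_weylPhase_angle (p t θ : ℝ) :
    HasDerivAt (fun θ => weylPhase (p * cos θ) (p * sin θ) t)
      (I * (weylPhase (p * cos θ) (p * sin θ) t *
        (I * (p * cos θ : ℝ) * sinh t - (p * sin θ : ℝ) * cosh t))) θ := by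
  have h1 := (((Real.hasDerivAt_cos θ).const_mul p).ofReal_comp.const_mul I).mul_const (cosh t)
  have h2 := (((Real.hasDerivAt_sin θ).const_mul p).ofReal_comp).mul_const (sinh t)
  convert! (h1.sub h2).cexp using 1
  simp only [weylPhase]
  push_cast
  linear_combination (cexp (I * (p * Complex.cos θ) * Complex.cosh t -
    p * Complex.sin θ * Complex.sinh t) * p * Complex.cos θ * Complex.sinh t) * I_sq

/-- Half of the evanescent part of Weyl's integral. -/
def weylQ (a b : ℝ) : ℂ := ∫ t in Ioi (0 : ℝ), weylPhase a b t

lemma norm_weylPhase_deriv_le {p θ c t : ℝ} (hp : 0 ≤ p) (ht : 0 ≤ t) (hc : c ≤ p * sin θ) :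
    ‖weylPhase (p * cos θ) (p * sin θ) t *
        (I * (p * cos θ : ℝ) * sinh t - (p * sin θ : ℝ) * cosh t)‖ ≤
      2 * p * (cosh t * rexp (-(c * sinh t))) := by
  have hs : 0 ≤ sinh t := sinh_nonneg_iff.2 ht
  have h1 : ‖I * ((p * cos θ : ℝ)) * sinh t - (p * sin θ : ℝ) * cosh t‖ ≤ 2 * p * cosh t := by
    refine (norm_sub_le _ _).trans ?_
    rw [norm_mul, norm_mul, norm_mul, norm_I, one_mul, norm_real, norm_real,
      norm_real, norm_real, norm_of_nonneg hs,
      norm_of_nonneg (cosh_pos t).le, norm_mul, norm_mul, norm_of_nonneg hp]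
    have h2 := Real.abs_cos_le_one θ
    have h3 := Real.abs_sin_le_one θ
    have h4 : sinh t ≤ cosh t := (Real.sinh_lt_cosh t).le
    have h5 : p * ‖cos θ‖ * sinh t ≤ p * 1 * cosh t := by gcongr; exact h2
    have h6 : p * ‖sin θ‖ * cosh t ≤ p * 1 * cosh t := by
      gcongr
      exact h3
    linarith
  rw [norm_mul, norm_weylPhase]
  calc _ ≤ rexp (-(c * sinh t)) * (2 * p * cosh t) := by gcongr
    _ = _ := by ring

lemma hasDerivAt_weylQ {p θ : ℝ} (hp : 0 < p) (hθ : 0 < sin θ) :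
    HasDerivAt (fun θ => weylQ (p * cos θ) (p * sin θ)) (-(I * cexp (I * (p * cos θ)))) θ := by
  have hb : 0 < p * sin θ := mul_pos hp hθ
  have h := hasDerivAt_integral_of_dominated_loc_of_deriv_le (μ := volume.restrict (Ioi 0))
    (F := fun θ t => weylPhase (p * cos θ) (p * sin θ) t)
    (F' := fun θ t => I * (weylPhase (p * cos θ) (p * sin θ) t *
        (I * (p * cos θ : ℝ) * sinh t - (p * sin θ : ℝ) * cosh t)))
    (bound := fun t => 2 * p * (cosh t * rexp (-(p * sin θ / 2 * sinh t))))
    (x₀ := θ) (s := {x | p * sin θ / 2 < p * sin x})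
    ((isOpen_lt (by fun_prop) (by fun_prop)).mem_nhds (by grind))
    ?_ ?_ ?_ ?_ ?_ ?_
  · refine h.2.congr_deriv ?_
    rw [integral_const_mul]
    have hi : IntegrableOn (fun t => weylPhase (p * cos θ) (p * sin θ) t *
        (I * (p * cos θ : ℝ) * sinh t - (p * sin θ : ℝ) * cosh t)) (Ioi 0) := by
      refine ((integrableOn_cosh_mul_exp hb).const_mul (2 * p)).mono' ?_ ?_
      · exact (((continuous_weylPhase _ _).mul (by fun_prop))).aestronglyMeasurable
      · filter_upwards [ae_restrict_mem measurableSet_Ioi] with t ht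
        exact norm_weylPhase_deriv_le hp.le (le_of_lt ht) le_rfl
    rw [integral_Ioi_of_hasDerivAt_of_tendsto (m := 0)
     
      (continuous_weylPhase _ _).continuousWithinAt
      (fun x _ => hasDerivAt_weylPhase_snd _ _ x) hi]
    · simp [weylPhase]
    · rw [tendsto_zero_iff_norm_tendsto_zero]
      simpa [norm_weylPhase] using tendsto_exp_neg_sinh hb 0
  · exact .of_forall fun x => (continuous_weylPhase _ _).aestronglyMeasurable
  · exact integrableOn_weylPhase _ hb
  · exact (continuous_const.mul ((continuous_weylPhase _ _).mul (by fun_prop))).aestronglyMeasurable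
  · filter_upwards [ae_restrict_mem measurableSet_Ioi] with t ht x hx
    rw [norm_mul, norm_I, one_mul]
    exact norm_weylPhase_deriv_le hp.le (le_of_lt ht) (le_of_lt hx)
  · exact (integrableOn_cosh_mul_exp (half_pos hb)).const_mul _
  · exact .of_forall fun t x _ => hasDerivAt_weylPhase_angle p t x

lemma hasDerivAt_integral_exp_cos_sub (p θ : ℝ) :
    HasDerivAt (fun θ => ∫ t in (0 : ℝ)..π, cexp (I * (p * cos (t - θ))))
      (cexp (I * (p * cos θ)) - cexp (-(I * (p * cos θ)))) θ := by
  have e θ : ∫ t in 0..π, cexp (I * (p * cos (t - θ))) =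
      (∫ t in 0..(π - θ), cexp (I * (p * cos t))) -
      ∫ t in 0..(0 - θ), cexp (I * (p * cos t)) := by
    have hc : Continuous fun t : ℝ => cexp (I * (p * cos t)) := by fun_prop
    rw [intervalIntegral.integral_interval_sub_left (hc.intervalIntegrable _ _)
      (hc.intervalIntegrable _ _)]
    exact intervalIntegral.integral_comp_sub_right (fun t => cexp (I * (p * cos t))) θ
  have hd c : HasDerivAt (fun θ : ℝ =>
      ∫ t in 0..(c - θ), cexp (I * (p * cos t)))
      (-cexp (I * (p * cos (c - θ)))) θ := by
    have hc : Continuous fun t : ℝ => cexp (I * (p * cos t)) := by fun_prop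
    have h1 := (hc.integral_hasStrictDerivAt 0 (c - θ)).hasDerivAt
    have := h1.scomp θ ((hasDerivAt_id θ).const_sub c)
    simpa [Function.comp_def] using this
  refine (((hd π).sub (hd 0)).congr_deriv ?_).congr_of_eventuallyEq (.of_forall fun θ => e θ)
  rw [Real.cos_pi_sub, zero_sub, Real.cos_neg]
  push_cast
  ring_nf

/-- **Weyl's integral** for the Hankel function. -/
lemma weylQ_add_weylQ (a : ℝ) {b : ℝ} (hb : 0 < b) :
    weylQ a b + weylQ (-a) b + I * ∫ t in (0 : ℝ)..π, cexp (I * (a * cos t + b * sin t)) =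
    2 * hankelU (√(a ^ 2 + b ^ 2)) := by
  set p := √(a ^ 2 + b ^ 2) with hp
  have hp0 : 0 < p := sqrt_pos.2 (by positivity)
  obtain ⟨θ, hθ, hcos, hsin⟩ : ∃ θ ∈ Ioo 0 π, p * cos θ = a ∧ p * sin θ = b := by
    have hn : ‖(⟨a, b⟩ : ℂ)‖ = p := by
      rw [Complex.norm_eq_sqrt_sq_add_sq]
    have h1 := Complex.norm_mul_cos_arg ⟨a, b⟩
    have h2 := Complex.norm_mul_sin_arg ⟨a, b⟩
    rw [hn] at h1 h2
    refine ⟨Complex.arg ⟨a, b⟩, ⟨?_, ?_⟩, h1, h2⟩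
    · refine lt_of_le_of_ne (Complex.arg_nonneg_iff.2 hb.le) fun h => ?_
      rw [← h, Real.sin_zero, mul_zero] at h2
      exact hb.ne h2
    · exact Complex.arg_lt_pi_iff.2 (Or.inr hb.ne')
  have hder x (hx : x ∈ Ioo 0 π) : HasDerivAt (fun θ =>
      weylQ (p * cos θ) (p * sin θ) + weylQ (p * cos (π - θ)) (p * sin (π - θ)) +
      I * ∫ t in 0..π, cexp (I * (p * cos (t - θ)))) 0 x := by
    have h1 := hasDerivAt_weylQ hp0 (Real.sin_pos_of_mem_Ioo hx)
    have h2 := (hasDerivAt_weylQ (θ := π - x) hp0 (by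
      rw [Real.sin_pi_sub]; exact Real.sin_pos_of_mem_Ioo hx)).scomp x
      ((hasDerivAt_id x).const_sub π)
    have h3 := (hasDerivAt_integral_exp_cos_sub p x).const_mul I
    refine ((h1.add h2).add h3).congr_deriv ?_
    rw [Real.cos_pi_sub]
    push_cast
    simp only [neg_smul, one_smul, mul_neg]
    ring
  have hconst := isOpen_Ioo.is_const_of_deriv_eq_zero isPreconnected_Ioo
    (fun x hx => (hder x hx).differentiableAt.differentiableWithinAt)
    (fun x hx => (hder x hx).deriv) hθ (y := π / 2) ⟨by positivity, by linarith [pi_pos]⟩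
  simp only [Real.cos_pi_sub, Real.sin_pi_sub, mul_neg, hcos, hsin, Real.cos_pi_div_two,
    Real.sin_pi_div_two, mul_zero, mul_one, neg_zero] at hconst
  have e1 : ∫ t in 0..π, cexp (I * (p * cos (t - θ))) =
      ∫ t in 0..π, cexp (I * (a * cos t + b * sin t)) := by
    congr 1; funext t
    rw [Real.cos_sub, ← hcos, ← hsin]; push_cast; ring_nf
  have e2 : weylQ 0 p = sinhMoment 0 p := by
    rw [weylQ, sinhMoment, ← integral_complex_ofReal]
    congr 1; funext t
    simp [weylPhase]
  have e3 : ∫ t in 0..π, cexp (I * (p * cos (t - π / 2))) = 2 * sinMoment 0 p := by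
    simp only [Real.cos_sub_pi_div_two]
    have hc : Continuous fun t : ℝ => cexp (I * (p * sin t)) := by fun_prop
    rw [← integral_add_adjacent_intervals (b := π / 2)
      (hc.intervalIntegrable _ _) (hc.intervalIntegrable _ _)]
    have : ∫ t in (π / 2)..π, cexp (I * (p * sin t)) =
        ∫ t in 0..(π / 2), cexp (I * (p * sin t)) := by
      have h1 := intervalIntegral.integral_comp_sub_left (a := 0) (b := π / 2)
        (fun t : ℝ => cexp (I * (p * sin t))) π
      simp only [Real.sin_pi_sub] at h1
      rw [h1]; congr 1 <;> ring
    rw [this, sinMoment]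
    simp only [pow_zero, one_mul]
    ring
  rw [e1, e2, e3] at hconst
  rw [hconst, hankelU]
  ring

lemma Gplus_eq {E : ℝ} (hE : 0 < E) {x : ℂ} (hx : x ≠ 0) :
    Gplus E x = -(1 / (2 * π)) * hankelU (√E * ‖x‖) := by
  have hr : 0 < √E * ‖x‖ := mul_pos (sqrt_pos.2 hE) (norm_pos_iff.2 hx)
  rw [hankelU_eq hr, Gplus]
  field_simp
  ring

/-! ### A one-dimensional Fourier integral -/

/-- The inverse Fourier transform of `2π / (b - p)`, for `p` off the real axis. -/
def halfExp (p : ℂ) (y : ℝ) : ℂ :=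
  if 0 < p.im then (Ioi (0 : ℝ)).indicator (fun y : ℝ => I * cexp (I * p * y)) y
  else (Iio (0 : ℝ)).indicator (fun y : ℝ => -(I * cexp (I * p * y))) y

lemma halfExp_fourier {p : ℂ} (hp : p.im ≠ 0) (b : ℝ) :
    Integrable (fun y : ℝ => cexp (-(I * b * y)) * halfExp p y) ∧
    ∫ y : ℝ, cexp (-(I * b * y)) * halfExp p y = 1 / (b - p) := by
  have hbp : b - p ≠ 0 := fun h => hp (by have := congrArg Complex.im h; simpa using this)
  rcases lt_or_gt_of_ne hp with h | h
  · have hre : 0 < (I * (p - b)).re := by simp [h]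
    have e : (fun y : ℝ => cexp (-(I * b * y)) * halfExp p y) =
        (Iio 0).indicator fun y : ℝ => -I * cexp (I * (p - b) * y) := by
      funext y
      simp only [halfExp, not_lt.2 h.le, if_false]
      by_cases hy : y ∈ Iio 0
      · rw [indicator_of_mem hy, indicator_of_mem hy, mul_neg, mul_left_comm, ← exp_add]
        ring_nf
      · simp_all
    rw [e, integrable_indicator_iff measurableSet_Iio, integral_indicator measurableSet_Iio,
      integral_const_mul, ← integral_Iic_eq_integral_Iio, integral_exp_mul_complex_Iic hre]
    refine ⟨((integrableOn_exp_mul_complex_Iic hre 0).mono_set Iio_subset_Iic_self).const_mul _, ?_⟩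
    have h1 : p - b ≠ 0 := sub_ne_zero.2 (sub_ne_zero.1 hbp).symm
    simp only [ofReal_zero, mul_zero, exp_zero]
    field_simp
    ring
  · have hre : (I * (p - b)).re < 0 := by simp [h]
    have e : (fun y : ℝ => cexp (-(I * b * y)) * halfExp p y) =
        (Ioi 0).indicator fun y : ℝ => I * cexp (I * (p - b) * y) := by
      funext y
      simp only [halfExp, h, if_true]
      by_cases hy : y ∈ Ioi 0
      · rw [indicator_of_mem hy, indicator_of_mem hy, mul_left_comm, ← exp_add]
        ring_nf
      · simp_all
    rw [e, integrable_indicator_iff measurableSet_Ioi, integral_indicator measurableSet_Ioi,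
      integral_const_mul, integral_exp_mul_complex_Ioi hre]
    refine ⟨(integrableOn_exp_mul_complex_Ioi hre 0).const_mul _, ?_⟩
    have h1 : p - b ≠ 0 := sub_ne_zero.2 (sub_ne_zero.1 hbp).symm
    simp only [ofReal_zero, mul_zero, exp_zero]
    field_simp
    ring

lemma continuousAt_halfExp (p : ℂ) {y : ℝ} (hy : y ≠ 0) : ContinuousAt (halfExp p) y := by
  have h1 : ContinuousAt (fun y : ℝ => I * cexp (I * p * y)) y := by fun_prop
  have h0 : ContinuousAt (fun _ : ℝ => (0 : ℂ)) y := continuousAt_const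
  unfold halfExp
  split_ifs
  · rcases lt_or_gt_of_ne hy with h | h
    · refine h0.congr ?_
      filter_upwards [Iio_mem_nhds h] with x hx
      rw [indicator_of_notMem (by simpa using le_of_lt hx)]
    · refine h1.congr ?_
      filter_upwards [Ioi_mem_nhds h] with x hx
      rw [indicator_of_mem hx]
  · rcases lt_or_gt_of_ne hy with h | h
    · refine h1.neg.congr ?_
      filter_upwards [Iio_mem_nhds h] with x hx
      simp_all
    · refine h0.congr ?_
      filter_upwards [Ioi_mem_nhds h] with x hx
      rw [indicator_of_notMem (by simpa using le_of_lt hx)]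

lemma integrable_inv_norm_sub_sq {p : ℂ} (hp : p.im ≠ 0) :
    Integrable fun b : ℝ => (‖(b : ℂ) - p‖ ^ 2)⁻¹ := by
  have hpos (b : ℝ) : 0 < ‖b - p‖ ^ 2 := by
    refine pow_pos (norm_pos_iff.2 fun h => hp ?_) 2
    simpa using congrArg Complex.im h
  set C := 2 + (2 * p.re ^ 2 + 1) / p.im ^ 2
  have hp2 : 0 < p.im ^ 2 := by positivity
  refine (integrable_inv_one_add_sq.const_mul C).mono' ?_ (.of_forall fun b => ?_)
  · fun_prop
  · rw [norm_of_nonneg (by positivity), ← div_eq_mul_inv, inv_eq_one_div,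
      div_le_div_iff₀ (hpos b) (by positivity), one_mul]
    have e : ‖b - p‖ ^ 2 = (b - p.re) ^ 2 + p.im ^ 2 := by
      rw [← normSq_eq_norm_sq, normSq_apply]; simp; ring
    rw [e]
    have h1 : (2 * p.re ^ 2 + 1) / p.im ^ 2 * p.im ^ 2 = 2 * p.re ^ 2 + 1 :=
      div_mul_cancel₀ _ hp2.ne'
    have h2 : 0 ≤ (2 * p.re ^ 2 + 1) / p.im ^ 2 := by positivity
    have h3 : C * ((b - p.re) ^ 2 + p.im ^ 2) = 2 * (b - p.re) ^ 2 + 2 * p.im ^ 2 +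
        (2 * p.re ^ 2 + 1) / p.im ^ 2 * (b - p.re) ^ 2 + (2 * p.re ^ 2 + 1) := by
      simp only [C]; linear_combination h1
    nlinarith [sq_nonneg (b - 2 * p.re)]

lemma integrable_inv_sub_mul_sub {p q : ℂ} (hp : p.im ≠ 0) (hq : q.im ≠ 0) :
    Integrable fun b : ℝ => 1 / (((b : ℂ) - p) * (b - q)) := by
  have hne {p : ℂ} (hp : p.im ≠ 0) (b : ℝ) : b - p ≠ 0 := fun h => hp (by
    simpa using congrArg Complex.im h)
  refine ((integrable_inv_norm_sub_sq hp).add (integrable_inv_norm_sub_sq hq)).mono' ?_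
    (.of_forall fun b => ?_)
  · exact (Continuous.div (by fun_prop) (by fun_prop) fun b =>
      mul_ne_zero (hne hp b) (hne hq b)).aestronglyMeasurable
  · rw [norm_div, norm_one, norm_mul, Pi.add_apply, one_div, mul_inv, ← inv_pow, ← inv_pow]
    nlinarith [sq_nonneg (‖b - p‖⁻¹ - ‖b - q‖⁻¹), sq_nonneg (‖b - p‖⁻¹), sq_nonneg (‖b - q‖⁻¹)]

lemma integral_exp_div_sub_mul_sub {p q : ℂ} (hp : p.im ≠ 0) (hq : q.im ≠ 0) (hpq : p ≠ q)
    {y : ℝ} (hy : y ≠ 0) :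
    ∫ b : ℝ, cexp (I * b * y) / ((b - p) * (b - q)) =
      2 * π * ((halfExp p y - halfExp q y) / (p - q)) := by
  set k : ℝ → ℂ := fun y => (halfExp p y - halfExp q y) / (p - q) with hk
  have hne {p : ℂ} (hp : p.im ≠ 0) (b : ℝ) : b - p ≠ 0 := fun h => hp (by
    simpa using congrArg Complex.im h)
  have hki : Integrable k := by
    have h1 := (halfExp_fourier hp 0).1
    have h2 := (halfExp_fourier hq 0).1
    simp only [ofReal_zero, mul_zero, zero_mul, neg_zero, exp_zero, one_mul] at h1 h2
    exact (h1.sub h2).div_const _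
  have hF w : FourierTransform.fourier k w =
      1 / ((((2 * π * w : ℝ)) - p) * (((2 * π * w : ℝ)) - q)) := by
    rw [Real.fourier_real_eq_integral_exp_smul]
    have h1 := halfExp_fourier hp (2 * π * w)
    have h2 := halfExp_fourier hq (2 * π * w)
    have e : ∀ v : ℝ, cexp (((-2 * π * v * w : ℝ)) * I) • k v =
        (cexp (-(I * ((2 * π * w : ℝ)) * v)) * halfExp p v -
        cexp (-(I * ((2 * π * w : ℝ)) * v)) * halfExp q v) / (p - q) := by
      intro v
      rw [hk, smul_eq_mul, ← mul_sub, mul_div_assoc]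
      congr 2
      push_cast; ring
    simp only [e]
    rw [integral_div, integral_sub h1.1 h2.1, h1.2, h2.2]
    have := hne hp (2 * π * w)
    have := hne hq (2 * π * w)
    field_simp
    ring
  have hFi : Integrable (FourierTransform.fourier k) := by
    have := (integrable_inv_sub_mul_sub hp hq).comp_mul_left' (R := 2 * π) (by positivity)
    refine this.congr (.of_forall fun w => ?_)
    rw [hF]
  have hinv := hki.fourierInv_fourier_eq hFi
    (((continuousAt_halfExp p hy).sub (continuousAt_halfExp q hy)).div_const _)
  rw [Real.fourierInv_eq_fourier_neg, Real.fourier_real_eq_integral_exp_smul] at hinv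
  have h1 := MeasureTheory.Measure.integral_comp_mul_left
    (fun b : ℝ => cexp (I * b * y) / ((b - p) * (b - q))) (2 * π)
  have h2 : ∫ x : ℝ, (fun b : ℝ => cexp (I * b * y) / ((b - p) * (b - q))) (2 * π * x) = k y := by
    rw [← hinv]
    congr 1; funext w
    rw [hF, smul_eq_mul, mul_one_div]
    push_cast; ring_nf
  rw [h2] at h1
  change _ = 2 * π * k y
  generalize (∫ b : ℝ, cexp (I * b * y) / ((b - p) * (b - q))) = J at h1 ⊢
  rw [h1, abs_of_nonneg (by positivity), real_smul, ← mul_assoc]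
  push_cast
  field_simp

lemma integral_exp_div_sq_add_sq {N : ℝ} (hN : 0 < N) {w : ℂ} (hw0 : w ≠ 0) (hw : 0 ≤ w.re)
    (hwN : w.re ≠ N) {y : ℝ} (hy : y ≠ 0) :
    Integrable (fun b : ℝ => 1 / (((b : ℂ) - I * N) ^ 2 + w ^ 2)) ∧
    ∫ b : ℝ, cexp (I * b * y) / ((b - I * N) ^ 2 + w ^ 2) =
      π / w * cexp (-(N * y)) * (cexp (-(w * |y|)) - if w.re < N then cexp (w * y) else 0) := by
  set p : ℂ := I * (N + w)
  set q : ℂ := I * (N - w)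
  have hpi : p.im = N + w.re := by simp [p]
  have hqi : q.im = N - w.re := by simp [q]
  have hp : p.im ≠ 0 := by rw [hpi]; linarith
  have hq : q.im ≠ 0 := by rw [hqi]; exact sub_ne_zero.2 hwN.symm
  have e b : (b - I * N) ^ 2 + w ^ 2 = (b - p) * (b - q) := by
    simp only [p, q]; linear_combination (w ^ 2) * I_sq
  have epq : p - q = 2 * I * w := by simp only [p, q]; ring
  have hpq : p ≠ q := by
    rw [← sub_ne_zero, epq]; simp [hw0]
  simp only [e]
  refine ⟨integrable_inv_sub_mul_sub hp hq, ?_⟩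
  rw [integral_exp_div_sub_mul_sub hp hq hpq hy, epq]
  have hp0 : 0 < p.im := by rw [hpi]; linarith
  have ep : I * p * y = -(N * y) + -(w * y) := by
    simp only [p]; linear_combination ((N + w) * y) * I_sq
  have eq : I * q * y = -(N * y) + w * y := by
    simp only [q]; linear_combination ((N - w) * y) * I_sq
  simp only [halfExp, hp0, if_true]
  rcases lt_or_gt_of_ne hwN with h | h
  · have hq0 : 0 < q.im := by rw [hqi]; linarith
    simp only [hq0, if_true, h]
    rcases lt_or_gt_of_ne hy with h' | h'
    · rw [indicator_of_notMem (by simpa using h'.le), indicator_of_notMem (by simpa using h'.le),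
        abs_of_neg h']
      simp
    · rw [indicator_of_mem (mem_Ioi.2 h'), indicator_of_mem (mem_Ioi.2 h'), abs_of_pos h', ep, eq,
        exp_add, exp_add]
      field_simp
  · have hq0 : ¬ 0 < q.im := by rw [hqi]; linarith
    simp only [hq0, if_false, not_lt.2 h.le]
    rcases lt_or_gt_of_ne hy with h' | h'
    · rw [indicator_of_notMem (by simpa using h'.le), indicator_of_mem (mem_Iio.2 h'),
        abs_of_neg h', eq, exp_add]
      push_cast
      grind
    · rw [indicator_of_mem (mem_Ioi.2 h'), indicator_of_notMem (by simpa using h'.le),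
        abs_of_pos h', ep, exp_add]
      field_simp
      ring

/-! ### Improper integrals over discs -/

/-- The symbol `|ξ|² + 2 k·ξ` for `k = (M, -i N)`. -/
def symbP (M N a b : ℝ) : ℂ := a ^ 2 + b ^ 2 + 2 * M * a - 2 * I * N * b

lemma continuous_symbP (M N : ℝ) : Continuous fun p : ℝ × ℝ => symbP M N p.1 p.2 := by
  unfold symbP; fun_prop

lemma hasDerivAt_symbP (M N a b : ℝ) : HasDerivAt (symbP M N a) (2 * b - 2 * I * N) b := by
  have h1 : HasDerivAt (fun b : ℝ => (b : ℂ)) 1 b := (hasDerivAt_id b).ofReal_comp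
  have := (((h1.pow 2).const_add ((a : ℂ) ^ 2)).add_const (2 * M * a : ℂ)).sub
    (h1.const_mul (2 * I * N))
  refine this.congr_deriv ?_
  simp

lemma symbP_lower {M N R a b : ℝ} (hR : 4 * (|M| + |N|) ≤ R) (hR0 : 0 < R)
    (hab : R ^ 2 ≤ a ^ 2 + b ^ 2) :
    (a ^ 2 + b ^ 2) / 2 ≤ ‖symbP M N a b‖ ∧ |b| + |N| ≤ 2 * (a ^ 2 + b ^ 2) / R := by
  set S := a ^ 2 + b ^ 2
  have hM := abs_nonneg M
  have hb : |b| ≤ S / R := by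
    rw [le_div_iff₀ hR0]
    nlinarith [sq_abs b, sq_nonneg a]
  have ha : |a| ≤ S / R := by
    rw [le_div_iff₀ hR0]
    nlinarith [sq_abs a, sq_nonneg b]
  have hNS : |N| ≤ S / R := by
    rw [le_div_iff₀ hR0]; nlinarith
  constructor
  · have e : symbP M N a b = (S : ℂ) - (-(2 * (M * a : ℝ)) + 2 * I * (N * b : ℝ)) := by
      simp only [symbP, S]; push_cast; ring
    have h1 : ‖(-(2 * ((M * a : ℝ))) + 2 * I * ((N * b : ℝ)))‖ ≤
        2 * (|M| * |a|) + 2 * (|N| * |b|) := by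
      refine (norm_add_le _ _).trans ?_
      simp
    have h2 : 2 * (|M| * |a|) + 2 * (|N| * |b|) ≤ S / 2 := by
      have h3 : |M| * |a| ≤ |M| * (S / R) := by gcongr
      have h4 : |N| * |b| ≤ |N| * (S / R) := by gcongr
      have h5 : 4 * (|M| + |N|) * (S / R) ≤ R * (S / R) := by gcongr
      rw [mul_div_cancel₀ _ hR0.ne'] at h5
      linarith
    have h6 := norm_sub_norm_le (S : ℂ) (-(2 * ((M * a : ℝ))) + 2 * I * ((N * b : ℝ)))
    have hS0 : 0 ≤ S := by positivity
    rw [norm_real, norm_of_nonneg hS0] at h6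
    rw [e]; linarith
  grind

lemma integrable_inv_sq_add_sq {R : ℝ} (hR : 0 < R) :
    Integrable (fun b : ℝ => (R ^ 2 + b ^ 2)⁻¹) ∧ ∫ b : ℝ, (R ^ 2 + b ^ 2)⁻¹ = π / R := by
  have e b : (R ^ 2 + b ^ 2)⁻¹ = (R ^ 2)⁻¹ * (1 + (b / R) ^ 2)⁻¹ := by
    rw [← mul_inv]; congr 1; field_simp
  simp only [e]
  refine ⟨(integrable_inv_one_add_sq.comp_div hR.ne').const_mul _, ?_⟩
  rw [integral_const_mul, Measure.integral_comp_div (fun b : ℝ => (1 + b ^ 2)⁻¹) R,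
    integral_univ_inv_one_add_sq, abs_of_pos hR, smul_eq_mul]
  field_simp

lemma tail_bound {M N R a h y : ℝ} (hy : y ≠ 0) (hR : 4 * (|M| + |N|) ≤ R) (hR0 : 0 < R)
    (h0 : 0 ≤ h) (hah : a ^ 2 + h ^ 2 = R ^ 2) :
    ‖∫ b in Ioi h, cexp (I * b * y) / symbP M N a b‖ ≤ (2 + 32 * π) / |y| / R ^ 2 := by
  have hS b (hb : h ≤ b) : R ^ 2 ≤ a ^ 2 + b ^ 2 := by nlinarith
  have hS' b (hb : h ≤ b) : (R ^ 2 + b ^ 2) / 2 ≤ a ^ 2 + b ^ 2 := by nlinarith [sq_nonneg a]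
  have hlow b (hb : h ≤ b) := symbP_lower hR hR0 (hS b hb)
  have hRR : 0 < R ^ 2 := by positivity
  have hnz b (hb : h ≤ b) : symbP M N a b ≠ 0 := by
    rw [← norm_pos_iff]; linarith [(hlow b hb).1, hS b hb]
  have hexp (b : ℝ) : ‖cexp (I * b * y)‖ = 1 := by
    rw [show I * b * y = ((b * y : ℝ)) * I by push_cast; ring]
    exact norm_exp_ofReal_mul_I _
  have hJ := integrable_inv_sq_add_sq hR0
  have hcP : Continuous (symbP M N a) :=
    continuous_iff_continuousAt.2 fun b => (hasDerivAt_symbP M N a b).continuousAt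
  have b1 b (hb : h ≤ b) : ‖cexp (I * b * y) / symbP M N a b‖ ≤ 4 * (R ^ 2 + b ^ 2)⁻¹ := by
    rw [norm_div, hexp, ← div_eq_mul_inv, div_le_div_iff₀ (norm_pos_iff.2 (hnz b hb)) (by positivity)]
    linarith [(hlow b hb).1, hS' b hb]
  have b2 b (hb : h ≤ b) : ‖cexp (I * b * y) *
      ((2 * b - 2 * I * N) / symbP M N a b ^ 2)‖ ≤ 32 / R * (R ^ 2 + b ^ 2)⁻¹ := by
    have hSp : 0 < a ^ 2 + b ^ 2 := hRR.trans_le (hS b hb)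
    have h1 : ‖(2 * b - 2 * I * N)‖ ≤ 2 * (|b| + |N|) := by
      refine (norm_sub_le _ _).trans ?_
      simp [mul_add]
    rw [norm_mul, hexp, one_mul, norm_div, norm_pow]
    calc _ ≤ (2 * (2 * (a ^ 2 + b ^ 2) / R)) / ((a ^ 2 + b ^ 2) / 2) ^ 2 := by
          gcongr
          · grind
          · exact (hlow b hb).1
      _ = 16 / R * (a ^ 2 + b ^ 2)⁻¹ := by field_simp; ring
      _ ≤ 16 / R * ((R ^ 2 + b ^ 2) / 2)⁻¹ := by gcongr; exact hS' b hb
      _ = _ := by rw [inv_div]; ring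
  have i1 : IntegrableOn (fun b : ℝ => cexp (I * b * y) / symbP M N a b) (Ioi h) := by
    refine (hJ.1.const_mul 4).integrableOn.mono' (ContinuousOn.aestronglyMeasurable
      (ContinuousOn.div (by fun_prop) hcP.continuousOn fun b hb => hnz b (le_of_lt hb))
      measurableSet_Ioi) ?_
    filter_upwards [ae_restrict_mem measurableSet_Ioi] with b hb using b1 b (le_of_lt hb)
  have i2 : IntegrableOn (fun b : ℝ => cexp (I * b * y) *
      ((2 * b - 2 * I * N) / symbP M N a b ^ 2)) (Ioi h) := by
    refine (hJ.1.const_mul (32 / R)).integrableOn.mono' (ContinuousOn.aestronglyMeasurable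
      (ContinuousOn.mul (by fun_prop) (ContinuousOn.div (by fun_prop) (hcP.pow 2).continuousOn
        fun b hb => pow_ne_zero 2 (hnz b (le_of_lt hb)))) measurableSet_Ioi) ?_
    filter_upwards [ae_restrict_mem measurableSet_Ioi] with b hb using b2 b (le_of_lt hb)
  have i3 := (i1.const_mul (I * y)).sub i2
  simp only [Pi.sub_def] at i3
  have hparts := integral_Ioi_of_hasDerivAt_of_tendsto (m := 0)
    (f := fun b : ℝ => cexp (I * b * y) / symbP M N a b)
   
    (ContinuousWithinAt.div (by fun_prop) hcP.continuousWithinAt (hnz h le_rfl))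
    (fun b hb => ?_) i3 ?_
  · rw [integral_sub (i1.const_mul _) i2, integral_const_mul] at hparts
    have hyC : ‖I * y‖ = |y| := by simp
    have e : I * y * (∫ b in Ioi h, cexp (I * b * y) / symbP M N a b) =
      (∫ b in Ioi h, cexp (I * b * y) * ((2 * b - 2 * I * N) / symbP M N a b ^ 2)) -
        cexp (I * h * y) / symbP M N a h := by linear_combination hparts
    have hn := congrArg norm e
    rw [norm_mul, hyC] at hn
    have h2 : ‖cexp (I * h * y) / symbP M N a h‖ ≤ 2 / R ^ 2 := by
      rw [norm_div, hexp, div_le_div_iff₀ (norm_pos_iff.2 (hnz h le_rfl)) hRR]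
      linarith [(hlow h le_rfl).1]
    have h3 : ‖∫ b in Ioi h, cexp (I * b * y) *
        ((2 * b - 2 * I * N) / symbP M N a b ^ 2)‖ ≤ 32 * π / R ^ 2 := by
      refine (norm_integral_le_integral_norm _).trans ?_
      calc _ ≤ ∫ b in Ioi h, 32 / R * (R ^ 2 + b ^ 2)⁻¹ := by
            refine setIntegral_mono_on i2.norm (hJ.1.const_mul _).integrableOn measurableSet_Ioi ?_
            grind
        _ ≤ ∫ b : ℝ, 32 / R * (R ^ 2 + b ^ 2)⁻¹ :=
            setIntegral_le_integral (hJ.1.const_mul _) (.of_forall fun b => by positivity)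
        _ = _ := by rw [integral_const_mul, hJ.2]; field_simp
    have h4 := norm_sub_le (∫ b in Ioi h, cexp (I * b * y) *
        ((2 * b - 2 * I * N) / symbP M N a b ^ 2))
        (cexp (I * h * y) / symbP M N a h)
    rw [div_div, le_div_iff₀ (by positivity)]
    have h5 : 32 * π / R ^ 2 + 2 / R ^ 2 = (2 + 32 * π) / R ^ 2 := by ring
    have h6 : |y| * ‖∫ b in Ioi h, cexp (I * b * y) / symbP M N a b‖ ≤
        (2 + 32 * π) / R ^ 2 := by linarith
    rw [le_div_iff₀ hRR] at h6
    linarith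
  · have h1 : HasDerivAt (fun b : ℝ => cexp (I * b * y)) (cexp (I * b * y) * (I * y)) b := by
      have h1 : HasDerivAt (fun b : ℝ => (b : ℂ)) 1 b := (hasDerivAt_id b).ofReal_comp
      simpa using ((h1.const_mul I).mul_const y).cexp
    refine (h1.div (hasDerivAt_symbP M N a b) (hnz b (le_of_lt hb))).congr_deriv ?_
    field_simp
  · refine squeeze_zero_norm' (a := fun b : ℝ => 4 * (R ^ 2 + b ^ 2)⁻¹) ?_ ?_
    · filter_upwards [eventually_ge_atTop h] with b hb using b1 b hb
    · have : Tendsto (fun b : ℝ => R ^ 2 + b ^ 2) atTop atTop :=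
        tendsto_atTop_add_const_left _ _ (tendsto_pow_atTop two_ne_zero)
      simpa using this.inv_tendsto_atTop.const_mul 4

/-- The function `|x|^(-1/2)` is integrable on bounded intervals. -/
lemma locallyIntegrable_abs_rpow {s : ℝ} (hs : s < 1) :
    LocallyIntegrable (fun x : ℝ => |x| ^ (-s)) := by
  refine locallyIntegrable_of_norm_le_rpow (C := 1) (by simp) (by simpa using hs)
    (.of_forall fun x => ?_)
    (continuous_abs.measurable.pow_const _).aestronglyMeasurable
  rw [one_mul, norm_of_nonneg (by positivity), norm_eq_abs]

lemma norm_inv_symbP_le {M N R a b : ℝ} (hM : 0 < M) (hN : N ≠ 0) (hb : |b| ≤ R) (hb0 : b ≠ 0)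
    (ha0 : a ≠ 0) (haM : a + 2 * M ≠ 0) :
    ‖(symbP M N a b)⁻¹‖ ≤ ((1 + R / (2 * |N|)) / (2 * |N|) / M) ^ (1 / 2 : ℝ) *
      (((|a| ^ (-(1 / 2) : ℝ)) + |a + 2 * M| ^ (-(1 / 2) : ℝ)) * |b| ^ (-(1 / 2) : ℝ)) := by
  set P := symbP M N a b
  have hbp : 0 < |b| := abs_pos.2 hb0
  have hap : 0 < |a| := abs_pos.2 ha0
  have haMp : 0 < |a + 2 * M| := abs_pos.2 haM
  have hR : 0 < R := hbp.trans_le hb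
  have hre : P.re = a * (a + 2 * M) + b ^ 2 := by simp [P, symbP, ← ofReal_pow]; ring
  have him : P.im = -(2 * N * b) := by simp [P, symbP, ← ofReal_pow]
  have h1 : 2 * |N| * |b| ≤ ‖P‖ := by
    have := abs_im_le_norm P
    rw [him, abs_neg, abs_mul, abs_mul, abs_two] at this
    exact this
  have hPp : 0 < ‖P‖ := lt_of_lt_of_le (by positivity) h1
  have h2 : |a| * |a + 2 * M| ≤ (1 + R / (2 * |N|)) * ‖P‖ := by
    have h3 := abs_re_le_norm P
    rw [hre] at h3
    have h4 : |a * (a + 2 * M)| ≤ |a * (a + 2 * M) + b ^ 2| + b ^ 2 := by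
      have := abs_sub (a * (a + 2 * M) + b ^ 2) (b ^ 2)
      rw [add_sub_cancel_right, abs_of_nonneg (sq_nonneg b)] at this
      exact this
    have h5 : b ^ 2 ≤ R / (2 * |N|) * ‖P‖ := by
      calc b ^ 2 = |b| * |b| := by rw [← sq, sq_abs]
        _ ≤ R * (‖P‖ / (2 * |N|)) := by
            gcongr
            rw [le_div_iff₀ (by positivity)]; linarith
        _ = _ := by ring
    rw [← abs_mul]; linarith
  have h3 : M ≤ max |a| |a + 2 * M| := by
    by_contra hc
    rw [not_le, max_lt_iff, abs_lt, abs_lt] at hc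
    linarith [hc.1.2]
  set K := (1 + R / (2 * |N|)) / (2 * |N|) with hK
  have h4 : |b| * (|a| * |a + 2 * M|) ≤ K * ‖P‖ ^ 2 := by
    calc |b| * (|a| * |a + 2 * M|) ≤ (‖P‖ / (2 * |N|)) * ((1 + R / (2 * |N|)) * ‖P‖) := by
          gcongr
          rw [le_div_iff₀ (by positivity)]; linarith
      _ = _ := by rw [hK]; ring
  have key m (hm0 : 0 < m) (hm : M * m ≤ |a| * |a + 2 * M|) :
      ‖P⁻¹‖ ≤ (K / M) ^ (1 / 2 : ℝ) * (m ^ (-(1 / 2) : ℝ) * |b| ^ (-(1 / 2) : ℝ)) := by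
    rw [← mul_rpow hm0.le hbp.le, rpow_neg (by positivity),
      ← Real.inv_rpow (by positivity), ← mul_rpow (by positivity) (by positivity), norm_inv,
      ← Real.sqrt_eq_rpow]
    apply Real.le_sqrt_of_sq_le
    rw [inv_pow, ← div_eq_mul_inv, div_div, inv_eq_one_div,
      div_le_div_iff₀ (by positivity) (by positivity), one_mul]
    calc M * (m * |b|) = |b| * (M * m) := by ring
      _ ≤ |b| * (|a| * |a + 2 * M|) := by gcongr
      _ ≤ _ := h4
  have hx1 : 0 ≤ |a| ^ (-(1 / 2) : ℝ) := by positivity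
  have hx2 : 0 ≤ |a + 2 * M| ^ (-(1 / 2) : ℝ) := by positivity
  rcases le_max_iff.1 h3 with h | h
  · refine (key _ haMp (by gcongr)).trans ?_
    gcongr; linarith
  · refine (key _ hap (by rw [mul_comm M]; gcongr)).trans ?_
    gcongr; linarith

lemma integrableOn_inv_symbP {M N : ℝ} (hM : 0 < M) (hN : N ≠ 0) (R : ℝ) :
    IntegrableOn (fun p : ℝ × ℝ => (symbP M N p.1 p.2)⁻¹) (Icc (-R) R ×ˢ Icc (-R) R) := by
  have hs : (1 / 2 : ℝ) < 1 := by norm_num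
  have hl := locallyIntegrable_abs_rpow hs
  have h1 : IntegrableOn (fun a : ℝ => |a| ^ (-(1 / 2) : ℝ)) (Icc (-R) R) :=
    hl.integrableOn_isCompact isCompact_Icc
  have h2 : IntegrableOn (fun a : ℝ => |a + 2 * M| ^ (-(1 / 2) : ℝ)) (Icc (-R) R) := by
    have h3 := hl.integrableOn_isCompact (isCompact_Icc (a := -R + 2 * M) (b := R + 2 * M))
    have h4 := (measurePreserving_add_right volume (2 * M)).integrableOn_comp_preimage
      (measurableEmbedding_addRight (2 * M)) (f := fun a : ℝ => |a| ^ (-(1 / 2) : ℝ))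
      (s := Icc (-R + 2 * M) (R + 2 * M))
    have h5 := h4.2 h3
    simpa [Function.comp_def] using h5
  have h3 := (h1.add h2).mul_prod h1
  rw [Measure.prod_restrict] at h3
  set K := ((1 + R / (2 * |N|)) / (2 * |N|) / M) ^ (1 / 2 : ℝ)
  refine Integrable.mono' (h3.const_mul K) ?_ ?_
  · exact ((continuous_symbP M N).measurable.inv).aestronglyMeasurable
  · have n1 : ∀ᵐ p : ℝ × ℝ, p.1 ≠ 0 ∧ p.1 + 2 * M ≠ 0 ∧ p.2 ≠ 0 := by
      have q1 : ∀ᵐ p : ℝ × ℝ, p.1 ≠ 0 :=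
        Measure.quasiMeasurePreserving_fst.ae (compl_mem_ae_iff.2 (measure_singleton (0 : ℝ)))
      have q2 : ∀ᵐ p : ℝ × ℝ, p.1 ≠ -(2 * M) :=
        Measure.quasiMeasurePreserving_fst.ae (compl_mem_ae_iff.2 (measure_singleton (-(2 * M) : ℝ)))
      have q3 : ∀ᵐ p : ℝ × ℝ, p.2 ≠ 0 :=
        Measure.quasiMeasurePreserving_snd.ae (compl_mem_ae_iff.2 (measure_singleton (0 : ℝ)))
      filter_upwards [q1, q2, q3] with p h1 h2 h3
      exact ⟨h1, fun h => h2 (by linarith), h3⟩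
    filter_upwards [ae_restrict_mem (measurableSet_Icc.prod measurableSet_Icc),
      ae_restrict_of_ae n1] with p hp hn
    exact norm_inv_symbP_le hM hN (abs_le.2 hp.2) hn.2.2 hn.1 hn.2.1

/-- Improper integrals over discs of `exp(i ξ·x) / P(ξ)` as iterated integrals. -/
lemma tendsto_integral_ball_symbP {M N x y : ℝ} (hM : 0 < M) (hN : N ≠ 0) (hy : y ≠ 0)
    {H : ℝ → ℂ} (hH : Integrable H)
    (hHa : ∀ᵐ a : ℝ, Integrable (fun b : ℝ => (symbP M N a b)⁻¹) ∧
      ∫ b : ℝ, cexp (I * b * y) / symbP M N a b = H a) :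
    Tendsto (fun R : ℝ => ∫ ξ in ball (0 : ℂ) R,
      cexp (I * ((ξ.re * x + ξ.im * y : ℝ) : ℂ)) / symbP M N ξ.re ξ.im) atTop
      (𝓝 (∫ a : ℝ, cexp (I * a * x) * H a)) := by
  set f : ℝ × ℝ → ℂ := fun p =>
    cexp (I * ((p.1 * x + p.2 * y : ℝ))) / symbP M N p.1 p.2 with hf
  have hexp (t : ℝ) : ‖cexp (I * t)‖ = 1 := by
    rw [mul_comm]; exact norm_exp_ofReal_mul_I t
  set S : ℝ → Set (ℝ × ℝ) := fun R => {p | p.1 ^ 2 + p.2 ^ 2 < R ^ 2} with hS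
  have hSm R : MeasurableSet (S R) :=
    (isOpen_lt (by fun_prop) (by fun_prop)).measurableSet
  have hSsub R (hR : 0 < R) : S R ⊆ Icc (-R) R ×ˢ Icc (-R) R := by
    intro p hp
    have hp' : p.1 ^ 2 + p.2 ^ 2 < R ^ 2 := hp
    exact ⟨abs_le.1 (abs_le_of_sq_le_sq (by nlinarith [sq_nonneg p.2]) hR.le),
      abs_le.1 (abs_le_of_sq_le_sq (by nlinarith [sq_nonneg p.1]) hR.le)⟩
  have hfm : Measurable f := by
    have := (continuous_symbP M N).measurable
    exact Measurable.div (Continuous.measurable (by fun_prop)) this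
  have hfi R (hR : 0 < R) : Integrable ((S R).indicator f) := by
    rw [integrable_indicator_iff (hSm R)]
    refine Integrable.mono ((integrableOn_inv_symbP hM hN R).mono_set (hSsub R hR))
      hfm.aestronglyMeasurable (.of_forall fun p => ?_)
    simp only [hf]
    rw [norm_div, hexp, norm_inv, one_div]
  have hball R (hR : 0 < R) : ∫ ξ in ball (0 : ℂ) R,
      cexp (I * ((ξ.re * x + ξ.im * y : ℝ))) / symbP M N ξ.re ξ.im =
      ∫ a : ℝ, ∫ b : ℝ, (S R).indicator f (a, b) := by
    rw [← integral_prod _ (hfi R hR), ← integral_indicator isOpen_ball.measurableSet,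
      ← volume_preserving_equiv_real_prod.symm.integral_comp', Measure.volume_eq_prod]
    congr 1; funext p
    have : (measurableEquivRealProd.symm p ∈ ball 0 R) ↔ p ∈ S R := by
      rw [mem_ball_zero_iff, ← sq_lt_sq₀ (norm_nonneg _) hR.le, ← normSq_eq_norm_sq,
        normSq_apply, Complex.measurableEquivRealProd_symm_apply]
      simp only [hS, mem_ofPred_eq]
      ring_nf
    by_cases hp : p ∈ S R
    · simp_all
    · simp_all
  set C := (2 + 32 * π) / |y|
  have hEH : Integrable fun a : ℝ => cexp (I * a * x) * H a := by
    refine hH.bdd_mul (c := 1) (by fun_prop) (.of_forall fun a => ?_)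
    rw [show I * a * x = I * ((a * x : ℝ)) by push_cast; ring, hexp]
  -- comparison of the inner integrals
  have hinner R (hR : 4 * (|M| + |N|) ≤ R) (hR0 : 0 < R) : ∀ᵐ a : ℝ,
      ‖(∫ b : ℝ, (S R).indicator f (a, b)) -
        (Ioo (-R) R).indicator (fun a : ℝ => cexp (I * a * x) * H a) a‖ ≤
      (Ioo (-R) R).indicator (fun _ => 2 * C / R ^ 2) a := by
    filter_upwards [hHa] with a ha
    by_cases haR : a ∈ Ioo (-R) R
    · have haR2 : a ^ 2 < R ^ 2 := sq_lt_sq' haR.1 haR.2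
      set h := √(R ^ 2 - a ^ 2)
      have hh : a ^ 2 + h ^ 2 = R ^ 2 := by
        rw [sq_sqrt (by linarith)]; ring
      have hh0 : 0 ≤ h := Real.sqrt_nonneg _
      have hmem b : (a, b) ∈ S R ↔ b ∉ Ici h ∧ b ∉ Iic (-h) := by
        simp only [hS, mem_ofPred_eq, mem_Ici, mem_Iic, not_le]
        rw [← hh]
        constructor
        · intro hb
          have := abs_lt_of_sq_lt_sq (show b ^ 2 < h ^ 2 by linarith) hh0
          exact ⟨(abs_lt.1 this).2, (abs_lt.1 this).1⟩
        · rintro ⟨h1, h2⟩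
          have := sq_lt_sq' h2 h1
          linarith
      set e : ℝ → ℂ := fun b => cexp (I * b * y) / symbP M N a b with he
      have hei : Integrable e := by
        refine ha.1.mono ?_ (.of_forall fun b => ?_)
        · have c2 : Continuous (symbP M N a) := continuous_iff_continuousAt.2 fun b =>
            (hasDerivAt_symbP M N a b).continuousAt
          exact Measurable.aestronglyMeasurable
            (Measurable.div (Continuous.measurable (by fun_prop)) c2.measurable)
        · simp only [he]
          rw [show I * b * y = I * ((b * y : ℝ)) by push_cast; ring, norm_div,
            hexp, norm_inv, one_div]
      have hne : ∀ᵐ b : ℝ, (S R).indicator f (a, b) = cexp (I * a * x) *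
          (e b - (Ioi h).indicator e b - (Iio (-h)).indicator e b) := by
        have q1 : ∀ᵐ b : ℝ, b ≠ h := compl_mem_ae_iff.2 (measure_singleton h)
        have q2 : ∀ᵐ b : ℝ, b ≠ -h := compl_mem_ae_iff.2 (measure_singleton (-h))
        filter_upwards [q1, q2] with b hb1 hb2
        have hfe : f (a, b) = cexp (I * a * x) * e b := by
          simp only [hf, he]
          rw [← mul_div_assoc, ← exp_add]
          congr 2; push_cast; ring
        by_cases h1 : b ∈ Ici h
        · have h1' : b ∈ Ioi h := lt_of_le_of_ne h1 hb1.symm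
          have h2 : b ∉ Iio (-h) := by
            have := mem_Ioi.1 h1'
            simp only [mem_Iio, not_lt]; linarith
          simp_all
        · have h1' : b ∉ Ioi h := fun q => h1 (mem_Ici.2 (le_of_lt q))
          by_cases h2 : b ∈ Iic (-h)
          · have h2' : b ∈ Iio (-h) := lt_of_le_of_ne h2 hb2
            simp_all
          · have h2' : b ∉ Iio (-h) := fun q => h2 (mem_Iic.2 (le_of_lt q))
            simp_all
      have hlow : ∫ b in Iio (-h), e b =
          ∫ b in Ioi h, cexp (I * b * (-y : ℝ)) / symbP M (-N) a b := by
        rw [← integral_Iic_eq_integral_Iio, ← integral_comp_neg_Ioi]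
        congr 1; funext b
        simp only [he, symbP]
        push_cast
        congr 1 <;> ring_nf
      have hei2 := hei.sub (hei.indicator (measurableSet_Ioi (a := h)))
      simp only [Pi.sub_def] at hei2
      rw [integral_congr_ae hne, integral_const_mul, integral_sub hei2 (hei.indicator measurableSet_Iio),
        integral_sub hei (hei.indicator measurableSet_Ioi), integral_indicator measurableSet_Ioi,
        integral_indicator measurableSet_Iio, indicator_of_mem haR, indicator_of_mem haR, ha.2,
        ← mul_sub, norm_mul, show I * a * x = I * ((a * x : ℝ)) by push_cast; ring,
        hexp, one_mul, hlow]
      have t1 := tail_bound hy hR hR0 hh0 hh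
      have t2 := tail_bound (N := -N) (neg_ne_zero.2 hy) (by simpa using hR) hR0 hh0 hh
      rw [abs_neg] at t2
      calc _ = ‖(∫ b in Ioi h, e b) + ∫ b in Ioi h,
            cexp (I * b * (-y : ℝ)) / symbP M (-N) a b‖ := by
            rw [← norm_neg]; congr 1; ring
        _ ≤ C / R ^ 2 + C / R ^ 2 := (norm_add_le _ _).trans (add_le_add t1 t2)
        _ = _ := by ring
    · rw [indicator_of_notMem haR, indicator_of_notMem haR, sub_zero]
      have : ∀ b, (S R).indicator f (a, b) = 0 := fun b => by
        refine indicator_of_notMem (fun h => haR ?_) _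
        have h' : a ^ 2 + b ^ 2 < R ^ 2 := h
        exact abs_lt.1 (abs_lt_of_sq_lt_sq (by nlinarith [sq_nonneg b]) hR0.le)
      simp [this]
  have hlim1 : Tendsto (fun R : ℝ => ∫ a : ℝ,
      (Ioo (-R) R).indicator (fun a : ℝ => cexp (I * a * x) * H a) a) atTop
      (𝓝 (∫ a : ℝ, cexp (I * a * x) * H a)) := by
    refine tendsto_integral_filter_of_dominated_convergence
      (fun a => ‖cexp (I * a * x) * H a‖) ?_ ?_ hEH.norm ?_
    · exact .of_forall fun R => hEH.aestronglyMeasurable.indicator measurableSet_Ioo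
    · exact .of_forall fun R => .of_forall fun a => norm_indicator_le_norm_self _ _
    · refine .of_forall fun a => tendsto_const_nhds.congr' ?_
      filter_upwards [eventually_gt_atTop |a|] with R hR
      rw [indicator_of_mem (show a ∈ Ioo (-R) R from abs_lt.1 hR)]
  have hdiff : Tendsto (fun R : ℝ => (∫ ξ in ball (0 : ℂ) R,
      cexp (I * ((ξ.re * x + ξ.im * y : ℝ))) / symbP M N ξ.re ξ.im) -
      ∫ a : ℝ, (Ioo (-R) R).indicator (fun a : ℝ => cexp (I * a * x) * H a) a)
      atTop (𝓝 0) := by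
    refine squeeze_zero_norm' (a := fun R : ℝ => 4 * C / R) ?_ (tendsto_const_nhds.div_atTop tendsto_id)
    filter_upwards [eventually_ge_atTop (4 * (|M| + |N|)), eventually_gt_atTop 0] with R hR hR0
    have hi := (hfi R hR0).integral_prod_left
    rw [hball R hR0, ← integral_sub hi (hEH.indicator measurableSet_Ioo)]
    refine (norm_integral_le_of_norm_le ?_ (hinner R hR hR0)).trans (le_of_eq ?_)
    · exact (integrable_indicator_iff measurableSet_Ioo).2 (by simp)
    · rw [integral_indicator measurableSet_Ioo, setIntegral_const, Real.volume_real_Ioo_of_le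
        (by linarith), smul_eq_mul]
      field_simp
      ring
  simpa using hdiff.add hlim1

/-- A square root of `α² - e²` with non-negative real part. -/
def symbRoot (e α : ℝ) : ℂ :=
  if e < |α| then ((√(α ^ 2 - e ^ 2) : ℝ) : ℂ) else -I * ((√(e ^ 2 - α ^ 2) : ℝ) : ℂ)

/-- The partial Fourier transform of the inverse symbol, without the exponential prefactor. -/
def symbKer (e N y α : ℝ) : ℂ :=
  π / symbRoot e α * (cexp (-(symbRoot e α * |y|)) -
    if (symbRoot e α).re < N then cexp (symbRoot e α * y) else 0)

lemma symbRoot_neg (e α : ℝ) : symbRoot e (-α) = symbRoot e α := by simp [symbRoot]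

lemma symbKer_neg (e N y α : ℝ) : symbKer e N y (-α) = symbKer e N y α := by
  simp [symbKer, symbRoot_neg]

lemma symbRoot_mul_cosh {e τ : ℝ} (he : 0 < e) (hτ : 0 < τ) :
    symbRoot e (e * cosh τ) = ((e * sinh τ : ℝ) : ℂ) := by
  have h1 : 1 < cosh τ := Real.one_lt_cosh.2 hτ.ne'
  have h3 : (e * cosh τ) ^ 2 - e ^ 2 = (e * sinh τ) ^ 2 := by
    rw [mul_pow, cosh_sq]; ring
  rw [symbRoot, if_pos, h3, sqrt_sq (by positivity)]
  rw [abs_of_pos (by positivity)]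
  nlinarith

lemma symbRoot_mul_cos {e t : ℝ} (he : 0 < e) (ht : t ∈ Ioo 0 π) :
    symbRoot e (e * cos t) = -I * ((e * sin t : ℝ) : ℂ) := by
  have h2 : 0 < sin t := Real.sin_pos_of_mem_Ioo ht
  have h3 : e ^ 2 - (e * cos t) ^ 2 = (e * sin t) ^ 2 := by
    rw [mul_pow, mul_pow, Real.sin_sq]; ring
  rw [symbRoot, if_neg, h3, sqrt_sq (by positivity)]
  rw [abs_mul, abs_of_pos he, not_lt]
  nlinarith [Real.abs_cos_le_one t]

lemma symbRoot_sq {e : ℝ} (he : 0 < e) (α : ℝ) : symbRoot e α ^ 2 = (α : ℂ) ^ 2 - e ^ 2 := by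
  rw [symbRoot]
  split_ifs with h
  · have : 0 ≤ α ^ 2 - e ^ 2 := by
      have := sq_lt_sq' (by linarith) h
      rw [sq_abs] at this; linarith
    rw [← ofReal_pow, sq_sqrt this]; push_cast; rfl
  · have : 0 ≤ e ^ 2 - α ^ 2 := by
      have := pow_le_pow_left₀ (abs_nonneg α) (not_lt.1 h) 2
      rw [sq_abs] at this; linarith
    rw [mul_pow, ← ofReal_pow, sq_sqrt this, neg_sq, I_sq]; push_cast; ring

lemma symbRoot_re_nonneg (e α : ℝ) : 0 ≤ (symbRoot e α).re := by
  rw [symbRoot]; split_ifs <;> simp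

lemma image_mul_cosh {e : ℝ} (he : 0 < e) : (fun τ => e * cosh τ) '' Ioi 0 = Ioi e := by
  ext α
  constructor
  · rintro ⟨τ, hτ, rfl⟩
    have : 1 < cosh τ := Real.one_lt_cosh.2 (ne_of_gt hτ)
    simp_all
  · intro hα
    have h1 : 1 < α / e := by rw [one_lt_div he]; exact hα
    exact ⟨Real.arcosh (α / e), Real.arcosh_pos h1, by
      simp only [Real.cosh_arcosh h1.le]; field_simp⟩

lemma injOn_mul_cosh {e : ℝ} (he : 0 < e) : InjOn (fun τ => e * cosh τ) (Ioi 0) := by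
  intro a ha b hb h
  have h' : cosh a = cosh b := by
    simpa [he.ne'] using h
  rw [← Real.arcosh_cosh (le_of_lt ha), h', Real.arcosh_cosh (le_of_lt hb)]

lemma image_mul_cos {e : ℝ} (he : 0 < e) : (fun t => e * cos t) '' Ioo 0 π = Ioo (-e) e := by
  ext α
  constructor
  · rintro ⟨t, ht, rfl⟩
    have h1 : cos t < 1 := by
      rw [← Real.cos_zero]; exact Real.cos_lt_cos_of_nonneg_of_le_pi le_rfl ht.2.le ht.1
    have h2 : -1 < cos t := by
      rw [← Real.cos_pi]; exact Real.cos_lt_cos_of_nonneg_of_le_pi ht.1.le le_rfl ht.2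
    constructor <;> simp only <;> nlinarith
  · intro hα
    have h1 : α / e < 1 := by rw [div_lt_one he]; exact hα.2
    have h2 : -1 < α / e := by rw [lt_div_iff₀ he]; linarith [hα.1]
    refine ⟨Real.arccos (α / e), ⟨Real.arccos_pos.2 h1, ?_⟩, ?_⟩
    · rw [← Real.arccos_neg_one]
      exact Real.arccos_lt_arccos le_rfl h2 h1.le
    · simp only [Real.cos_arccos h2.le h1.le]; field_simp

lemma injOn_mul_cos {e : ℝ} (he : 0 < e) : InjOn (fun t => e * cos t) (Ioo 0 π) := by
  intro a ha b hb h
  have h' : cos a = cos b := by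
    simpa [he.ne'] using h
  exact Real.injOn_cos ⟨ha.1.le, ha.2.le⟩ ⟨hb.1.le, hb.2.le⟩ h'

lemma symbKer_integral_Ioi {e β y : ℝ} (he : 0 < e) (hβ : 0 < β) (hy : y ≠ 0) (x : ℝ) :
    IntegrableOn (fun α : ℝ => cexp (I * α * x) * symbKer e (e * sinh β) y α) (Ioi e) ∧
    ∫ α in Ioi e, cexp (I * α * x) * symbKer e (e * sinh β) y α =
      π * (weylQ (e * x) (e * |y|) - ∫ τ in (0 : ℝ)..β,
        cexp (I * (e * x) * cosh τ + e * y * sinh τ)) := by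
  have hd : ∀ τ ∈ Ioi 0, HasDerivWithinAt (fun τ => e * cosh τ) (e * sinh τ) (Ioi 0) τ := fun τ _ =>
    ((Real.hasDerivAt_cosh τ).const_mul e).hasDerivWithinAt
  rw [← image_mul_cosh he, integrableOn_image_iff_integrableOn_abs_deriv_smul measurableSet_Ioi hd
    (injOn_mul_cosh he), integral_image_eq_integral_abs_deriv_smul measurableSet_Ioi hd
    (injOn_mul_cosh he)]
  have hpt : EqOn (fun τ => |e * sinh τ| • (cexp (I * (e * cosh τ : ℝ) * x) *
      symbKer e (e * sinh β) y (e * cosh τ))) (fun τ => π * (weylPhase (e * x) (e * |y|) τ -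
        (Iio β).indicator (fun τ : ℝ =>
          cexp (I * (e * x) * cosh τ + e * y * sinh τ)) τ)) (Ioi 0) := by
    intro τ hτ
    have h2 : 0 < sinh τ := sinh_pos_iff.2 hτ
    have h3 : ((e * sinh τ : ℝ) : ℂ) ≠ 0 := by exact_mod_cast (mul_pos he h2).ne'
    have h4 : (e * sinh τ < e * sinh β) ↔ τ ∈ Iio β := by
      rw [mul_lt_mul_iff_right₀ he, Real.sinh_lt_sinh, mem_Iio]
    simp only [symbKer, symbRoot_mul_cosh he hτ, ofReal_re, h4]
    rw [abs_of_pos (mul_pos he h2), real_smul, weylPhase]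
    have key (A B) : ((e * sinh τ : ℝ)) * (A * (π / ((e * sinh τ : ℝ) : ℂ) * B)) =
        π * (A * B) := by field_simp
    rw [key]
    congr 1
    by_cases hm : τ ∈ Iio β
    · rw [if_pos hm, indicator_of_mem hm, mul_sub, ← exp_add, ← exp_add]
      congr 2 <;> (push_cast; ring)
    · rw [if_neg hm, indicator_of_notMem hm, sub_zero, sub_zero, ← exp_add]
      congr 1; push_cast; ring
  have hc : Continuous fun τ : ℝ =>
      cexp (I * (e * x) * cosh τ + e * y * sinh τ) := by
    have := Complex.continuous_ofReal.comp Real.continuous_cosh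
    have := Complex.continuous_ofReal.comp continuous_sinh
    simp only [Function.comp_def] at *
    fun_prop
  have hi1 : IntegrableOn (weylPhase (e * x) (e * |y|)) (Ioi 0) :=
    integrableOn_weylPhase _ (mul_pos he (abs_pos.2 hy))
  have hi2 : IntegrableOn ((Iio β).indicator (fun τ : ℝ =>
      cexp (I * (e * x) * cosh τ + e * y * sinh τ))) (Ioi 0) := by
    rw [IntegrableOn, integrable_indicator_iff measurableSet_Iio, IntegrableOn,
      Measure.restrict_restrict measurableSet_Iio, inter_comm, Ioi_inter_Iio]
    exact (hc.integrableOn_Icc).mono_set Ioo_subset_Icc_self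
  have hi3 := (Integrable.sub hi1 hi2).const_mul π
  refine ⟨(integrableOn_congr_fun hpt measurableSet_Ioi).2 hi3, ?_⟩
  rw [setIntegral_congr_fun measurableSet_Ioi hpt, integral_const_mul, integral_sub hi1 hi2, weylQ,
    integral_of_le hβ.le, setIntegral_indicator measurableSet_Iio, Ioi_inter_Iio,
    integral_Ioc_eq_integral_Ioo]

lemma symbKer_integral_Ioo {e N y : ℝ} (he : 0 < e) (hN : 0 < N) (x : ℝ) :
    IntegrableOn (fun α : ℝ => cexp (I * α * x) * symbKer e N y α) (Ioo (-e) e) ∧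
    ∫ α in Ioo (-e) e, cexp (I * α * x) * symbKer e N y α = π * (I * (∫ t in (0 : ℝ)..π,
        cexp (I * ((e * x : ℝ) * cos t + (e * |y| : ℝ) * sin t))) -
      I * ∫ t in (0 : ℝ)..π, cexp (I * (e * (x * cos t - y * sin t)))) := by
  have hd : ∀ t ∈ Ioo 0 π, HasDerivWithinAt (fun t => e * cos t)
      (e * -sin t) (Ioo 0 π) t := fun t _ =>
    ((Real.hasDerivAt_cos t).const_mul e).hasDerivWithinAt
  rw [← image_mul_cos he, integrableOn_image_iff_integrableOn_abs_deriv_smul measurableSet_Ioo hd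
    (injOn_mul_cos he), integral_image_eq_integral_abs_deriv_smul measurableSet_Ioo hd
    (injOn_mul_cos he)]
  have hpt : EqOn (fun t => |e * -sin t| • (cexp (I * (e * cos t : ℝ) * x) *
      symbKer e N y (e * cos t))) (fun t => π * (I * cexp (I *
        ((e * x : ℝ) * cos t + (e * |y| : ℝ) * sin t)) -
        I * cexp (I * (e * (x * cos t - y * sin t))))) (Ioo 0 π) := by
    intro t ht
    have h2 : 0 < sin t := Real.sin_pos_of_mem_Ioo ht
    have h3 : ((e * sin t : ℝ) : ℂ) ≠ 0 := by exact_mod_cast (mul_pos he h2).ne'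
    have h4 : (-I * ((e * sin t : ℝ))).re < N := by simpa using hN
    simp only [symbKer, symbRoot_mul_cos he ht, if_pos h4]
    rw [mul_neg, abs_neg, abs_of_pos (mul_pos he h2), real_smul]
    have key (A B) : ((e * sin t : ℝ)) * (A * (π / (-I * ((e * sin t : ℝ))) * B)) =
        π * (I * (A * B)) := by
      field_simp
      linear_combination (-(A * B)) * I_sq
    rw [key, ← mul_sub, mul_sub (cexp _), ← exp_add, ← exp_add]
    congr 4 <;> (push_cast; ring)
  have hc1 : Continuous fun t : ℝ => I * cexp (I *
        ((e * x : ℝ) * cos t + (e * |y| : ℝ) * sin t)) := by fun_prop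
  have hc2 : Continuous fun t : ℝ => I * cexp (I * (e * (x * cos t - y * sin t))) := by fun_prop
  have hi := ((hc1.sub hc2).const_smul (π : ℂ)).integrableOn_Icc (a := 0) (b := π) (μ := volume)
  refine ⟨(integrableOn_congr_fun hpt measurableSet_Ioo).2 (hi.mono_set Ioo_subset_Icc_self), ?_⟩
  rw [setIntegral_congr_fun measurableSet_Ioo hpt, ← integral_Ioc_eq_integral_Ioo,
    ← integral_of_le pi_pos.le, intervalIntegral.integral_const_mul,
    intervalIntegral.integral_sub (hc1.intervalIntegrable _ _) (hc2.intervalIntegrable _ _),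
    intervalIntegral.integral_const_mul, intervalIntegral.integral_const_mul]

lemma symbKer_integral {e β y : ℝ} (he : 0 < e) (hβ : 0 < β) (hy : y ≠ 0) (x : ℝ) :
    Integrable (fun α : ℝ => cexp (I * α * x) * symbKer e (e * sinh β) y α) ∧
    ∫ α : ℝ, cexp (I * α * x) * symbKer e (e * sinh β) y α =
      π * (2 * hankelU (e * √(x ^ 2 + y ^ 2)) - ((∫ τ in (0 : ℝ)..β,
        cexp (I * (e * x) * cosh τ + e * y * sinh τ)) +
        (∫ τ in (0 : ℝ)..β,
        cexp (-(I * (e * x) * cosh τ) + e * y * sinh τ)) +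
        I * ∫ t in (0 : ℝ)..π,
        cexp (I * (e * (x * cos t - y * sin t))))) := by
  set N := e * sinh β with hNd
  have hN : 0 < N := mul_pos he (sinh_pos_iff.2 hβ)
  obtain ⟨p1, p2⟩ := symbKer_integral_Ioi he hβ hy x
  obtain ⟨m1, m2⟩ := symbKer_integral_Ioi he hβ hy (-x)
  obtain ⟨c1, c2⟩ := symbKer_integral_Ioo (y := y) he hN x
  set F : ℝ → ℂ := fun α : ℝ => cexp (I * α * x) * symbKer e N y α with hF
  have hFn : (fun α : ℝ => cexp (I * α * (-x : ℝ)) * symbKer e N y α) = fun α => F (-α) := by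
    funext α; simp only [hF, symbKer_neg]; push_cast; ring_nf
  rw [hFn] at m1 m2
  have m1' : IntegrableOn F (Iic (-e)) := by
    have h4 := (Measure.measurePreserving_neg (volume : Measure ℝ)).integrableOn_comp_preimage
      (MeasurableEquiv.neg ℝ).measurableEmbedding (f := F) (s := Iio (-e))
    have h5 : (Neg.neg ⁻¹' Iio (-e) : Set ℝ) = Ioi e := by ext; simp
    rw [h5] at h4
    exact (integrableOn_Iic_iff_integrableOn_Iio (by simp)).2 (h4.1 m1)
  have m2' : ∫ α in Iic (-e), F α = ∫ α in Ioi e, F (-α) := (integral_comp_neg_Ioi _ _).symm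
  have c1' : IntegrableOn F (Ioc (-e) e) := (integrableOn_Ioc_iff_integrableOn_Ioo (by simp)).2 c1
  have u1 : Ioc (-e) e ∪ Ioi e = Ioi (-e) := Ioc_union_Ioi_eq_Ioi (by linarith)
  have i1 : IntegrableOn F (Ioi (-e)) := u1 ▸ c1'.union p1
  have i2 : Integrable F := by
    rw [← integrableOn_univ, ← Iic_union_Ioi (a := -e)]; exact m1'.union i1
  refine ⟨i2, ?_⟩
  have hw := weylQ_add_weylQ (e * x) (mul_pos he (abs_pos.2 hy))
  have hsq : √((e * x) ^ 2 + (e * |y|) ^ 2) = e * √(x ^ 2 + y ^ 2) := by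
    rw [show (e * x) ^ 2 + (e * |y|) ^ 2 = e ^ 2 * (x ^ 2 + y ^ 2) by grind,
      Real.sqrt_mul (by positivity), sqrt_sq he.le]
  rw [hsq] at hw
  rw [← intervalIntegral.integral_Iic_add_Ioi m1' i1, m2', m2, ← u1,
    setIntegral_union (by simp) measurableSet_Ioi
      c1' p1, p2, integral_Ioc_eq_integral_Ioo, c2, ← hw]
  simp only [mul_neg, neg_mul, ofReal_neg]
  ring

/-- The integral over the disc of radius `R` whose limit defines `g`. -/
def gDisc (E : ℝ) (x l : ℂ) (R : ℝ) : ℂ :=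
  -(1 / (2 * π : ℂ) ^ 2) * ∫ ξ in ball (0 : ℂ) R, cexp (I * ((ξ.re * x.re + ξ.im * x.im : ℝ) : ℂ)) /
        (((‖ξ‖ ^ 2 : ℝ) : ℂ) + (√E : ℝ) * (l * conj ξ + ξ / l))

lemma two_mul_momentum (E : ℝ) (l ξ : ℂ) :
    2 * (k1 E l * (ξ.re : ℂ) + k2 E l * (ξ.im : ℂ)) = (√E : ℝ) * (l * conj ξ + ξ / l) := by
  have h1 : conj ξ = ξ.re - ξ.im * I := by
    apply Complex.ext <;> simp
  have h2 : ξ / l = (ξ.re + ξ.im * I) / l := by rw [re_add_im]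
  rw [h1, h2, k1, k2]
  ring

lemma g_eq_limUnder (E : ℝ) (x l : ℂ) : g E x l = limUnder atTop (gDisc E x l) := by
  unfold g
  congr 1
  funext R
  simp only [gDisc, two_mul_momentum]

lemma gDisc_mul_rotation (E : ℝ) (x l u : ℂ) (hu : ‖u‖ = 1) (R : ℝ) :
    gDisc E (u * x) (u * l) R = gDisc E x l R := by
  have hu0 : u ≠ 0 := by rintro rfl; simp at hu
  let Φ := rotation (⟨u, mem_sphere_zero_iff_norm.2 hu⟩ : Circle)
  have hΦ ξ : Φ ξ = u * ξ := rotation_apply _ _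
  have hmp : MeasurePreserving Φ volume volume := Φ.measurePreserving
  have hpre : Φ ⁻¹' ball 0 R = ball 0 R := by
    ext ξ; simp
  have := hmp.setIntegral_preimage_emb Φ.toHomeomorph.measurableEmbedding (fun ξ : ℂ =>
    cexp (I * ((ξ.re * (u * x).re + ξ.im * (u * x).im : ℝ))) /
        (((‖ξ‖ ^ 2 : ℝ)) + √E * (u * l * conj ξ + ξ / (u * l)))) (ball 0 R)
  rw [hpre] at this
  rw [gDisc, gDisc, ← this]
  congr 2
  funext ξ
  have hinner : (u * ξ).re * (u * x).re + (u * ξ).im * (u * x).im = ξ.re * x.re + ξ.im * x.im := by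
    have h1 : u.re * u.re + u.im * u.im = 1 := by
      rw [← normSq_apply, normSq_eq_norm_sq, hu]; norm_num
    simp only [Complex.mul_re, Complex.mul_im]
    linear_combination (ξ.re * x.re + ξ.im * x.im) * h1
  have hcu : u * conj u = 1 := by
    rw [mul_conj, normSq_eq_norm_sq, hu]; norm_num
  rw [hΦ, hinner, norm_mul, hu, one_mul, map_mul, mul_div_mul_left _ _ hu0]
  grind

lemma gDisc_conj_arg (E : ℝ) (x l : ℂ) (R : ℝ) : gDisc E (conj x) l R = gDisc E x l⁻¹ R := by
  have hmp : MeasurePreserving conjLIE volume volume := conjLIE.measurePreserving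
  have hpre : conjLIE ⁻¹' ball 0 R = ball 0 R := by
    ext ξ; simp
  have := hmp.setIntegral_preimage_emb conjLIE.toHomeomorph.measurableEmbedding (fun ξ : ℂ =>
    cexp (I * ((ξ.re * (conj x).re + ξ.im * (conj x).im : ℝ))) /
        (((‖ξ‖ ^ 2 : ℝ)) + √E * (l * conj ξ + ξ / l))) (ball 0 R)
  rw [hpre] at this
  rw [gDisc, gDisc, ← this]
  congr 2
  funext ξ
  simp only [Complex.conjLIE_apply, Complex.conj_re, Complex.conj_im, RCLike.norm_conj,
    conj_conj, neg_mul_neg, div_inv_eq_mul]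
  grind

lemma gDisc_antipode (E : ℝ) (x l : ℂ) (R : ℝ) :
    gDisc E x (-1 / conj l) R = conj (gDisc E x l R) := by
  have hmp : MeasurePreserving (Neg.neg : ℂ → ℂ) volume volume := Measure.measurePreserving_neg _
  have hpre : Neg.neg ⁻¹' ball (0 : ℂ) R = ball 0 R := by
    ext ξ; simp
  have := hmp.setIntegral_preimage_emb (MeasurableEquiv.neg ℂ).measurableEmbedding (fun ξ : ℂ =>
    cexp (I * ((ξ.re * x.re + ξ.im * x.im : ℝ) : ℂ)) /
        (((‖ξ‖ ^ 2 : ℝ) : ℂ) + (√E : ℝ) * (l * conj ξ + ξ / l))) (ball 0 R)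
  rw [hpre] at this
  rw [gDisc, gDisc, ← this, map_mul, ← integral_conj]
  congr 2
  · simp [map_ofNat]
  · funext ξ
    simp only [map_div₀, ← exp_conj, map_add, map_mul, conj_I, conj_ofReal,
      norm_neg, map_neg, conj_conj, Complex.neg_re, neg_im]
    congr 1
    · congr 1; push_cast; ring
    grind

lemma phi0_mul_rotation (E : ℝ) (x l u : ℂ) (hu : ‖u‖ = 1) :
    phi0 E (u * x) (u * l) = phi0 E x l := by
  have hu0 : u ≠ 0 := by rintro rfl; simp at hu
  have hcu : u * conj u = 1 := by
    rw [mul_conj, normSq_eq_norm_sq, hu]; norm_num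
  rw [phi0, phi0, map_mul, mul_div_mul_left _ _ hu0,
    show u * l * (conj u * conj x) = (u * conj u) * (l * conj x) by ring, hcu, one_mul]

lemma phi0_conj_arg (E : ℝ) (x l : ℂ) : phi0 E (conj x) l = phi0 E x l⁻¹ := by
  rw [phi0, phi0, conj_conj, div_inv_eq_mul, div_eq_mul_inv]
  congr 2; ring

lemma phi0_add (E : ℝ) (x y l : ℂ) : phi0 E (x + y) l = phi0 E x l * phi0 E y l := by
  rw [phi0, phi0, phi0, ← exp_add, map_add]; congr 1; ring

lemma phi0_neg_arg (E : ℝ) (x l : ℂ) : phi0 E (-x) l = phi0 E x (-l) := by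
  rw [phi0, phi0, map_neg, div_neg, neg_div]; congr 1; ring

lemma phi0_mul_neg (E : ℝ) (x l : ℂ) : phi0 E x l * phi0 E x (-l) = 1 := by
  rw [← phi0_neg_arg, ← phi0_add, add_neg_cancel, phi0]; simp

lemma phi0_ne_zero (E : ℝ) (x l : ℂ) : phi0 E x l ≠ 0 := exp_ne_zero _

lemma phi0_sub (E : ℝ) (x y l : ℂ) : phi0 E (x - y) l = phi0 E x l * phi0 E y (-l) := by
  rw [sub_eq_add_neg, phi0_add, phi0_neg_arg]

lemma phi0_antipode (E : ℝ) (x l : ℂ) : phi0 E x (-1 / conj l) = conj (phi0 E x l) := by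
  rw [phi0, phi0, ← exp_conj]
  simp only [map_mul, conj_I, map_div₀, conj_ofReal, map_ofNat, map_add, conj_conj]
  grind

lemma phi0_exp (E : ℝ) (x w : ℂ) : phi0 E x (cexp w) =
    cexp (I * ((√E : ℝ) * (Complex.cosh w * x.re - I * Complex.sinh w * x.im))) := by
  have h1 : conj x = x.re - x.im * I := by
    apply Complex.ext <;> simp
  have h2 : x / cexp w = (x.re + x.im * I) * (Complex.cosh w - Complex.sinh w) := by
    rw [re_add_im, Complex.cosh_sub_sinh, exp_neg, div_eq_mul_inv]
  rw [phi0, h1, h2, ← Complex.cosh_add_sinh w]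
  congr 1
  ring

lemma Gplus_conj (E : ℝ) (x : ℂ) : Gplus E (conj x) = Gplus E x := by
  simp [Gplus]

lemma Gplus_mul_rotation (E : ℝ) (x u : ℂ) (hu : ‖u‖ = 1) : Gplus E (u * x) = Gplus E x := by
  simp [Gplus, hu]

lemma tendsto_integral_ball_exp {E β : ℝ} (hE : 0 < E) (hβ : 0 < β) {x y : ℝ} (hy : y ≠ 0) :
    Tendsto (fun R : ℝ => ∫ ξ in ball (0 : ℂ) R, cexp (I * ((ξ.re * x + ξ.im * y : ℝ) : ℂ)) /
        symbP (√E * cosh β) (√E * sinh β) ξ.re ξ.im) atTop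
      (𝓝 (cexp (-(I * (√E * cosh β) * x)) * cexp (-(√E * sinh β * y)) *
        ∫ α : ℝ, cexp (I * α * x) * symbKer (√E) (√E * sinh β) y α)) := by
  set e := √E with hed
  have he : 0 < e := sqrt_pos.2 hE
  set M := e * cosh β with hM
  set N := e * sinh β with hN
  have hM0 : 0 < M := mul_pos he (cosh_pos β)
  have hN0 : 0 < N := mul_pos he (sinh_pos_iff.2 hβ)
  have hMN : M ^ 2 = e ^ 2 + N ^ 2 := by rw [hN, mul_pow, mul_pow, cosh_sq]; ring
  obtain ⟨hi0, -⟩ := symbKer_integral he hβ hy 0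
  simp only [ofReal_zero, mul_zero, exp_zero, one_mul] at hi0
  have hH : Integrable fun a : ℝ => cexp (-(N * y)) * symbKer e N y (a + M) :=
    (hi0.comp_add_right M).const_mul _
  have hHa : ∀ᵐ a : ℝ, Integrable (fun b : ℝ => (symbP M N a b)⁻¹) ∧
      ∫ b : ℝ, cexp (I * b * y) / symbP M N a b = cexp (-(N * y)) * symbKer e N y (a + M) := by
    have q c : ∀ᵐ a : ℝ, a ≠ c := compl_mem_ae_iff.2 (measure_singleton c)
    filter_upwards [q (e - M), q (-e - M), q 0, q (-2 * M)] with a h1 h2 h3 h4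
    have hα1 : (a + M) ^ 2 ≠ e ^ 2 := by
      rw [Ne, sq_eq_sq_iff_eq_or_eq_neg]
      rintro (h | h)
      · exact h1 (by linarith)
      · exact h2 (by linarith)
    have hα2 : (a + M) ^ 2 ≠ M ^ 2 := by
      rw [Ne, sq_eq_sq_iff_eq_or_eq_neg]
      rintro (h | h)
      · exact h3 (by linarith)
      · exact h4 (by linarith)
    have hsq := symbRoot_sq he (a + M)
    have hw0 : symbRoot e (a + M) ≠ 0 := by
      intro h
      rw [h] at hsq
      apply hα1
      have : ((a + M : ℝ)) ^ 2 = (e : ℂ) ^ 2 := by linear_combination -hsq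
      exact_mod_cast this
    have hwN : (symbRoot e (a + M)).re ≠ N := by
      rw [symbRoot]
      split_ifs with h
      · rw [ofReal_re]
        intro h5
        apply hα2
        have : 0 < (a + M) ^ 2 - e ^ 2 := by
          have := sq_lt_sq' (by linarith) h
          rw [sq_abs] at this; linarith
        grind
      · simpa using hN0.ne
    have hP b : symbP M N a b = (b - I * N) ^ 2 + symbRoot e (a + M) ^ 2 := by
      have hMN' : (M : ℂ) ^ 2 = e ^ 2 + N ^ 2 := by exact_mod_cast hMN
      rw [hsq, symbP]; push_cast
      linear_combination (-1) * hMN' - N ^ 2 * I_sq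
    obtain ⟨k1, k2⟩ := integral_exp_div_sq_add_sq hN0 hw0 (symbRoot_re_nonneg _ _) hwN hy
    simp only [hP]
    refine ⟨by grind, k2.trans ?_⟩
    rw [symbKer]; ring
  have := tendsto_integral_ball_symbP (x := x) hM0 hN0.ne' hy hH hHa
  convert this using 2
  rw [← integral_add_right_eq_self (fun a : ℝ => cexp (I * a * x) * symbKer e N y a) M,
    ← integral_const_mul]
  congr 1; funext a
  have : cexp (I * ((a + M : ℝ)) * x) = cexp (I * a * x) * cexp (I * M * x) := by
    rw [← exp_add]; congr 1; push_cast; ring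
  have h2 : cexp (-(I * (e * cosh β) * x)) * cexp (I * M * x) = 1 := by
    rw [← exp_add, hM]; push_cast; rw [neg_add_cancel, exp_zero]
  rw [this]
  rw [show (e * (sinh β)) = (N : ℂ) by rw [hN]; push_cast; rfl]
  grind

lemma symbP_eq (E β : ℝ) (ξ : ℂ) : symbP (√E * cosh β) (√E * sinh β) ξ.re ξ.im =
      ((‖ξ‖ ^ 2 : ℝ) : ℂ) + (√E : ℝ) * (cexp β * conj ξ + ξ / cexp β) := by
  have h1 : conj ξ = ξ.re - ξ.im * I := by
    apply Complex.ext <;> simp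
  have h2 : ξ / cexp β = (ξ.re + ξ.im * I) * (Complex.cosh β - Complex.sinh β) := by
    rw [re_add_im, Complex.cosh_sub_sinh, exp_neg, div_eq_mul_inv]
  rw [h1, h2, ← Complex.cosh_add_sinh β, symbP, ← normSq_eq_norm_sq, normSq_apply]
  push_cast
  ring

lemma tendsto_gDisc_of_one_lt {E β : ℝ} (hE : 0 < E) (hβ : 0 < β) {x : ℂ} (hx : x.im ≠ 0)
    {P : ℂ → ℂ} (hP : ∀ w, HasDerivAt P (phi0 E x (cexp w)) w) :
    Tendsto (gDisc E x (cexp β)) atTop (𝓝 (phi0 E x (-cexp β) *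
      (Gplus E x + 1 / (4 * π) * (P β - P (-β - π * I))))) := by
  have he : 0 < √E := sqrt_pos.2 hE
  have hx0 : x ≠ 0 := by rintro rfl; simp at hx
  have i1 : ∫ τ in 0..β, cexp (I * (√E * x.re) * cosh τ + √E * x.im * sinh τ) = P β - P 0 := by
    rw [integral_eq_sub_of_hasDerivAt (f := fun τ : ℝ => P τ) (fun τ _ => ?_)]
    · simp
    · refine Continuous.intervalIntegrable ?_ _ _
      fun_prop
    · refine (hP τ).comp_ofReal.congr_deriv ?_
      rw [phi0_exp]; congr 1; push_cast
      linear_combination (-√E * Complex.sinh τ * x.im) * I_sq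
  have i2 : ∫ τ in 0..β, cexp (-(I * (√E * x.re) * cosh τ) +
      √E * x.im * sinh τ) = P (-(π * I)) - P (-β - π * I) := by
    rw [integral_eq_sub_of_hasDerivAt (f := fun τ : ℝ => -P (-τ - π * I)) (fun τ _ => ?_)]
    · simp only [ofReal_zero, neg_zero, zero_sub]; ring
    · refine Continuous.intervalIntegrable ?_ _ _
      fun_prop
    · have h1 : HasDerivAt (fun w : ℂ => -w - π * I) (-1) τ :=
        (hasDerivAt_id (τ : ℂ)).neg.sub_const _
      have h2 := (((hP (-τ - π * I)).comp (τ : ℂ) h1).neg).comp_ofReal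
      refine h2.congr_deriv ?_
      rw [phi0_exp, Complex.cosh_sub, Complex.sinh_sub, Complex.cosh_mul_I, Complex.sinh_mul_I,
        Complex.cos_pi, Complex.sin_pi, Complex.cosh_neg, Complex.sinh_neg]
      simp only [mul_neg, mul_one, neg_neg, zero_mul, mul_zero, sub_zero]
      congr 1; push_cast
      linear_combination (-√E * Complex.sinh τ * x.im) * I_sq
  have i3 : ∫ t in 0..π, cexp (I * (√E * (x.re * cos t -
      x.im * sin t))) = I * P (-(π * I)) - I * P 0 := by
    rw [integral_eq_sub_of_hasDerivAt (f := fun t : ℝ => I * P (-(t * I))) (fun t _ => ?_)]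
    · simp
    · refine Continuous.intervalIntegrable ?_ _ _
      fun_prop
    · have h1 : HasDerivAt (fun w : ℂ => -(w * I)) (-(1 * I)) t :=
        ((hasDerivAt_id (t : ℂ)).mul_const _).neg
      have h2 := (((hP (-(t * I))).comp (t : ℂ) h1).const_mul I).comp_ofReal
      refine h2.congr_deriv ?_
      rw [phi0_exp, Complex.cosh_neg, Complex.sinh_neg, Complex.cosh_mul_I, Complex.sinh_mul_I]
      rw [show I * (cexp (I * (√E * (Complex.cos t * x.re -
        I * -(Complex.sin t * I) * x.im))) * -(1 * I)) =
        -(I ^ 2) * cexp (I * (√E * (Complex.cos t * x.re +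
        I ^ 2 * Complex.sin t * x.im))) by ring_nf, I_sq]
      push_cast; ring_nf
  obtain ⟨-, hval⟩ := symbKer_integral he hβ hx x.re
  have hlim := (tendsto_integral_ball_exp hE hβ (x := x.re) hx).const_mul (-(1 / (2 * π : ℂ) ^ 2))
  rw [hval, i1, i2, i3] at hlim
  have hR : √(x.re ^ 2 + x.im ^ 2) = ‖x‖ := by
    rw [Complex.norm_def, normSq_apply]; congr 1; ring
  have hφ : phi0 E x (-cexp β) = cexp (-(I * (√E * cosh β) * x.re)) *
      cexp (-(√E * sinh β * x.im)) := by
    have h1 : conj (-x) = -x.re + x.im * I := by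
      apply Complex.ext <;> simp
    rw [← phi0_neg_arg, phi0_exp, ← exp_add]
    congr 1
    simp only [Complex.neg_re, neg_im]
    push_cast
    linear_combination (√E * Complex.sinh β * x.im) * I_sq
  rw [hR] at hlim
  simp only [symbP_eq] at hlim
  suffices hval : phi0 E x (-cexp β) *
      (Gplus E x + 1 / (4 * π) * (P β - P (-β - π * I))) = -(1 / (2 * π) ^ 2) *
      (cexp (-(I * (√E * cosh β) * x.re)) *
        cexp (-(√E * sinh β * x.im)) * (π * (2 * hankelU (√E * ‖x‖) -
          (P β - P 0 + (P (-(π * I)) - P (-β - π * I)) + I * (I * P (-(π * I)) - I * P 0))))) by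
    rw [hval]; exact hlim
  rw [hφ, Gplus_eq hE hx0, mul_comm (π : ℂ) I]
  field_simp
  linear_combination (4 * (P 0 - P (-(I * π)))) * I_sq


/-- The sign of `|l|² - 1`. -/
def sgn (l : ℂ) : ℝ := Real.sign (‖l‖ ^ 2 - 1)

lemma sgn_of_one_lt {l : ℂ} (h : 1 < ‖l‖) : sgn l = 1 :=
  Real.sign_of_pos (by nlinarith)

lemma sgn_of_lt_one {l : ℂ} (h : ‖l‖ < 1) : sgn l = -1 :=
  Real.sign_of_neg (by nlinarith [norm_nonneg l])

/-- `φ₀ g` in terms of the outgoing Green function and a primitive of `w ↦ φ₀(x, exp w)`. -/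
lemma tendsto_gDisc {E : ℝ} (hE : 0 < E) {l ω x : ℂ} (hω : cexp ω = l) (hl : ‖l‖ ≠ 1)
    (hx : (x * conj l).im ≠ 0) {P : ℂ → ℂ} (hP : ∀ w, HasDerivAt P (phi0 E x (cexp w)) w) :
    Tendsto (gDisc E x l) atTop (𝓝 (phi0 E x (-l) *
      (Gplus E x + sgn l / (4 * π) * (P ω - P (-conj ω - sgn l * π * I))))) := by
  set u := cexp (ω.im * I) with hu
  have hu1 : ‖u‖ = 1 := norm_exp_ofReal_mul_I _
  have hcu : u * conj u = 1 := by
    rw [mul_conj, normSq_eq_norm_sq, hu1]; norm_num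
  have hlu : l = u * cexp ω.re := by
    rw [← exp_add, ← hω]; congr 1
    rw [add_comm]; exact (re_add_im ω).symm
  set x' := conj u * x with hx'
  have hxu : x = u * x' := by rw [← mul_assoc, hcu, one_mul]
  have hx'0 : x'.im ≠ 0 := by
    intro h
    apply hx
    have : x * conj l = x' * (rexp ω.re) := by
      rw [hlu, hx', map_mul, ← ofReal_exp, conj_ofReal]; ring
    rw [this, Complex.im_mul_ofReal, h, zero_mul]
  have hnorm : ‖l‖ = rexp ω.re := by rw [← hω, norm_exp]
  have hcω : conj ω = ω.re - ω.im * I := by apply Complex.ext <;> simp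
  have hωe : ω = ω.re + ω.im * I := (re_add_im ω).symm
  have hexpu (w : ℂ) : cexp (w + ω.im * I) = u * cexp w := by
    rw [exp_add, mul_comm]
  have hfun : gDisc E x l = gDisc E x' (cexp ω.re) := by
    funext R; rw [hxu, hlu, gDisc_mul_rotation _ _ _ _ hu1]
  have hG : Gplus E x = Gplus E x' := by rw [hxu, Gplus_mul_rotation _ _ _ hu1]
  have hφ : phi0 E x (-l) = phi0 E x' (-cexp ω.re) := by
    rw [hxu, hlu, ← mul_neg, phi0_mul_rotation _ _ _ _ hu1]
  rcases lt_or_gt_of_ne hl with h1 | h1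
  · have hβ : 0 < -ω.re := by
      rw [hnorm] at h1
      have := Real.exp_lt_one_iff.1 h1
      linarith
    have hP' w : HasDerivAt (fun w => -P (-w + ω.im * I)) (phi0 E (conj x') (cexp w)) w := by
      have h2 : HasDerivAt (fun w : ℂ => -w + ω.im * I) (-1) w :=
        (hasDerivAt_id w).neg.add_const _
      refine (((hP _).comp w h2).neg).congr_deriv ?_
      rw [phi0_conj_arg, hexpu, ← exp_neg]
      nth_rewrite 1 [hxu]
      rw [phi0_mul_rotation _ _ _ _ hu1]; ring
    have := tendsto_gDisc_of_one_lt hE hβ (by simpa using hx'0) hP'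
    have hfun2 : gDisc E (conj x') (cexp ((-ω.re : ℝ))) = gDisc E x l := by
      funext R
      rw [hfun, gDisc_conj_arg, ← exp_neg]; push_cast; rw [neg_neg]
    rw [hfun2, Gplus_conj, phi0_conj_arg, inv_neg, ← exp_neg, ← hG] at this
    push_cast at this
    rw [neg_neg, ← hφ] at this
    rw [sgn_of_lt_one h1]
    convert this using 4
    push_cast
    grind
  · have hβ : 0 < ω.re := by
      rw [hnorm] at h1; exact Real.one_lt_exp_iff.1 h1
    have hP' w : HasDerivAt (fun w => P (w + ω.im * I)) (phi0 E x' (cexp w)) w := by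
      refine ((hP _).comp_add_const w _).congr_deriv ?_
      rw [hexpu]
      nth_rewrite 1 [hxu]
      rw [phi0_mul_rotation _ _ _ _ hu1]
    have := tendsto_gDisc_of_one_lt hE hβ hx'0 hP'
    rw [sgn_of_one_lt h1]
    convert this using 4
    rw [← hωe, hcω]
    push_cast
    ring_nf

lemma phi0_mul_g {E : ℝ} (hE : 0 < E) {l ω x : ℂ} (hω : cexp ω = l) (hl : ‖l‖ ≠ 1)
    (hx : (x * conj l).im ≠ 0) {P : ℂ → ℂ} (hP : ∀ w, HasDerivAt P (phi0 E x (cexp w)) w) :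
    phi0 E x l * g E x l = Gplus E x + sgn l / (4 * π) * (P ω - P (-conj ω - sgn l * π * I)) := by
  rw [g_eq_limUnder, (tendsto_gDisc hE hω hl hx hP).limUnder_eq, ← mul_assoc, phi0_mul_neg, one_mul]

lemma differentiable_phi0_exp (E : ℝ) (x : ℂ) : Differentiable ℂ fun w => phi0 E x (cexp w) := by
  simp only [phi0_exp]; fun_prop

lemma exists_primitive_phi0_exp (E : ℝ) (x : ℂ) :
    ∃ P : ℂ → ℂ, ∀ w, HasDerivAt P (phi0 E x (cexp w)) w := by
  obtain ⟨P, hP⟩ := (differentiable_phi0_exp E x).isExactOn_univ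
  exact ⟨P, fun w => hP w (mem_univ w)⟩

lemma g_antipode {E : ℝ} (hE : 0 < E) {l x : ℂ} (hl0 : l ≠ 0) (hl : ‖l‖ ≠ 1)
    (hx : (x * conj l).im ≠ 0) : g E x (-1 / conj l) = conj (g E x l) := by
  obtain ⟨P, hP⟩ := exists_primitive_phi0_exp E x
  have h1 := tendsto_gDisc hE (exp_log hl0) hl hx hP
  have h2 := (continuous_conj.tendsto _).comp h1
  have h3 : (fun z => conj z) ∘ gDisc E x l = gDisc E x (-1 / conj l) := by
    funext R; rw [gDisc_antipode]; rfl
  rw [g_eq_limUnder, g_eq_limUnder, h1.limUnder_eq, ← h3]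
  exact h2.limUnder_eq

lemma exp_neg_le_rpow {u δ : ℝ} (hu : 0 < u) (h0 : 0 ≤ δ) (h1 : δ ≤ 1) : rexp (-u) ≤ u ^ (-δ) := by
  rw [Real.exp_neg, rpow_neg hu.le]
  refine inv_anti₀ (by positivity) ?_
  rcases le_total u 1 with h | h
  · exact (Real.rpow_le_one hu.le h h0).trans (one_le_exp hu.le)
  · calc u ^ δ ≤ u ^ (1 : ℝ) := Real.rpow_le_rpow_of_exponent_le h h1
      _ = u := rpow_one u
      _ ≤ rexp u := by linarith [add_one_le_exp u]

lemma integrableOn_sinh_rpow {δ : ℝ} (h0 : 0 < δ) (h1 : δ < 1) :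
    IntegrableOn (fun t => sinh t ^ (-δ)) (Ioi 0) := by
  have hm (s : Set ℝ) : AEStronglyMeasurable (fun t => sinh t ^ (-δ)) (volume.restrict s) :=
    (continuous_sinh.measurable.pow_const _).aestronglyMeasurable
  rw [← Ioc_union_Ioi_eq_Ioi zero_le_one]
  refine IntegrableOn.union ?_ ?_
  · have h2 : IntegrableOn (fun t : ℝ => t ^ (-δ)) (Ioc 0 1) :=
      (intervalIntegrable_iff_integrableOn_Ioc_of_le zero_le_one).1
        (intervalIntegral.intervalIntegrable_rpow' (by linarith))
    refine h2.mono' (hm _) ?_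
    filter_upwards [ae_restrict_mem measurableSet_Ioc] with t ht
    have hs : t ≤ sinh t := Real.self_le_sinh_iff.2 ht.1.le
    rw [norm_of_nonneg (rpow_nonneg (ht.1.le.trans hs) _)]
    exact rpow_le_rpow_of_nonpos ht.1 hs (by linarith)
  · have h2 : IntegrableOn (fun t : ℝ => (1 / 4) ^ (-δ) * rexp (-δ * t)) (Ioi 1) :=
      (exp_neg_integrableOn_Ioi 1 h0).const_mul _
    refine h2.mono' (hm _) ?_
    filter_upwards [ae_restrict_mem measurableSet_Ioi] with t ht
    have ht : 1 < t := ht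
    have hs : 1 / 4 * rexp t ≤ sinh t := by
      rw [Real.sinh_eq]
      have h3 : 1 + t ≤ rexp t := by linarith [add_one_le_exp t]
      have h4 : rexp (-t) ≤ 1 := exp_le_one_iff.2 (by linarith)
      linarith
    rw [norm_of_nonneg (rpow_nonneg ((by positivity : (0:ℝ) ≤ _).trans hs) _)]
    refine (rpow_le_rpow_of_nonpos (by positivity) hs (by linarith)).trans (le_of_eq ?_)
    rw [mul_rpow (by norm_num) (exp_pos _).le, ← Real.exp_mul]
    ring_nf

/-- `∫₀^∞ sinh(t)^(-δ) dt`. -/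
def sinhInt (δ : ℝ) : ℝ := ∫ t in Ioi (0 : ℝ), sinh t ^ (-δ)

lemma sinhInt_nonneg (δ : ℝ) : 0 ≤ sinhInt δ :=
  setIntegral_nonneg measurableSet_Ioi fun _ ht =>
    rpow_nonneg (sinh_nonneg_iff.2 (le_of_lt ht)) _

lemma sinhMoment_zero_le {δ r : ℝ} (h0 : 0 < δ) (h1 : δ < 1) (hr : 0 < r) :
    sinhMoment 0 r ≤ r ^ (-δ) * sinhInt δ := by
  rw [sinhMoment, sinhInt, ← integral_const_mul]
  refine setIntegral_mono_on (integrableOn_sinh_pow_mul_exp 0 hr)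
    ((integrableOn_sinh_rpow h0 h1).const_mul _) measurableSet_Ioi fun t ht => ?_
  have hs : 0 < sinh t := sinh_pos_iff.2 ht
  rw [pow_zero, one_mul, ← mul_rpow hr.le hs.le]
  exact exp_neg_le_rpow (mul_pos hr hs) h0.le h1.le

lemma norm_hankelU_le {δ r : ℝ} (h0 : 0 < δ) (h1 : δ < 1) (hr : 0 < r) :
    ‖hankelU r‖ ≤ r ^ (-δ) * sinhInt δ + π / 2 := by
  refine (norm_add_le _ _).trans (add_le_add ?_ ?_)
  · rw [norm_real, norm_of_nonneg]
    · exact sinhMoment_zero_le h0 h1 hr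
    · exact setIntegral_nonneg measurableSet_Ioi fun t _ => by simp; positivity
  · rw [norm_mul, norm_I, one_mul, sinMoment]
    refine (intervalIntegral.norm_integral_le_of_norm_le_const
      (fun t _ => norm_sin_pow_mul_exp_le 0 r t)).trans ?_
    rw [sub_zero, abs_of_pos (by positivity)]; simp

lemma norm_weylQ_le {δ b : ℝ} (h0 : 0 < δ) (h1 : δ < 1) (a : ℝ) (hb : 0 < b) :
    ‖weylQ a b‖ ≤ b ^ (-δ) * sinhInt δ := by
  refine (norm_integral_le_integral_norm _).trans (le_trans (le_of_eq ?_) (sinhMoment_zero_le h0 h1 hb))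
  congr 1; funext t
  rw [norm_weylPhase, pow_zero, one_mul]

lemma exp_mul_norm_integral_Ioi_le {δ b β : ℝ} (h0 : 0 < δ) (h1 : δ < 1) (a : ℝ) (hb : 0 < b)
    (hβ : 0 < β) : rexp (b * sinh β) * ‖∫ t in Ioi β, weylPhase a b t‖ ≤
      (b * cosh β) ^ (-δ) * sinhInt δ := by
  have hc : 0 < cosh β := cosh_pos β
  have hi : IntegrableOn (fun t => rexp (-(b * sinh t))) (Ioi β) := by
    have := (integrableOn_sinh_pow_mul_exp 0 hb).mono_set (Ioi_subset_Ioi hβ.le)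
    simpa using this
  have hi2 : IntegrableOn (fun s => rexp (-(b * sinh (s + β)))) (Ioi 0) := by
    have h4 := (measurePreserving_add_right volume β).integrableOn_comp_preimage
      (measurableEmbedding_addRight β) (f := fun t => rexp (-(b * sinh t))) (s := Ioi β)
    simpa [Function.comp_def] using h4.2 hi
  have h2 : ‖∫ t in Ioi β, weylPhase a b t‖ ≤ ∫ s in Ioi 0, rexp (-(b * sinh (s + β))) := by
    refine (norm_integral_le_integral_norm _).trans (le_of_eq ?_)
    simp only [norm_weylPhase]
    have h5 := (measurePreserving_add_right volume β).setIntegral_preimage_emb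
      (measurableEmbedding_addRight β) (fun t => rexp (-(b * sinh t))) (Ioi β)
    simpa using h5.symm
  refine (mul_le_mul_of_nonneg_left h2 (exp_pos _).le).trans ?_
  refine le_trans ?_ (sinhMoment_zero_le h0 h1 (mul_pos hb hc))
  rw [← integral_const_mul, sinhMoment]
  refine setIntegral_mono_on (hi2.const_mul _) (integrableOn_sinh_pow_mul_exp 0 (mul_pos hb hc))
    measurableSet_Ioi fun s hs => ?_
  have hsβ : 0 < sinh β := sinh_pos_iff.2 hβ
  rw [← Real.exp_add, pow_zero, one_mul, exp_le_exp, Real.sinh_add]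
  nlinarith [mul_nonneg (mul_nonneg hb.le hsβ.le) (sub_nonneg.2 (Real.one_le_cosh s))]

lemma integral_exp_sinh_le {δ b β : ℝ} (h0 : 0 < δ) (h1 : δ < 1) (hb : 0 < b) (hβ : 0 < β) :
    rexp (-(b * sinh β)) * ∫ t in (0 : ℝ)..β, rexp (b * sinh t) ≤
      2 * ((b * cosh (β / 2)) ^ (-δ) * sinhInt δ) := by
  have hc : 0 < cosh (β / 2) := cosh_pos _
  have e1 : ∫ t in 0..β, rexp (b * sinh t) = 2 * ∫ s in 0..β / 2, rexp (b * sinh (β - 2 * s)) := by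
    rw [intervalIntegral.integral_comp_sub_mul (fun t => rexp (b * sinh t)) two_ne_zero]
    simp only [smul_eq_mul]
    rw [mul_div_cancel₀ _ (two_ne_zero' ℝ)]
    simp
  rw [e1, mul_left_comm]
  refine mul_le_mul_of_nonneg_left ?_ zero_le_two
  refine le_trans ?_ (sinhMoment_zero_le h0 h1 (mul_pos hb hc))
  have hi := integrableOn_sinh_pow_mul_exp 0 (mul_pos hb hc)
  rw [← intervalIntegral.integral_const_mul, integral_of_le (by positivity), sinhMoment]
  refine le_trans (setIntegral_mono_on ?_ (hi.mono_set Ioc_subset_Ioi_self) measurableSet_Ioc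
    fun s hs => ?_) (setIntegral_mono_set hi ?_ Ioc_subset_Ioi_self.eventuallyLE)
  · exact (Continuous.integrableOn_Icc (by fun_prop)).mono_set Ioc_subset_Icc_self
  · have hs' : 0 < sinh s := sinh_pos_iff.2 hs.1
    rw [← Real.exp_add, pow_zero, one_mul, exp_le_exp]
    have hf : sinh β - sinh (β - 2 * s) = 2 * (cosh (β - s) * sinh s) := by
      have q1 := Real.sinh_add (β - s) s
      have q2 := Real.sinh_sub (β - s) s
      rw [sub_add_cancel] at q1
      rw [show β - s - s = β - 2 * s by ring] at q2
      linarith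
    have hcc : cosh (β / 2) ≤ cosh (β - s) := by
      rw [Real.cosh_le_cosh, abs_of_pos (by positivity), abs_of_nonneg (by linarith [hs.2])]
      linarith [hs.2]
    have : cosh (β / 2) * sinh s ≤ cosh (β - s) * sinh s := by gcongr
    have h3 : 0 ≤ cosh (β - s) * sinh s := by positivity
    nlinarith
  · filter_upwards with s
    simp; positivity


lemma weylQ_sub_integral (a : ℝ) {b β : ℝ} (hb : 0 < b) (hβ : 0 < β) :
    weylQ a b - ∫ t in (0 : ℝ)..β, weylPhase a b t = ∫ t in Ioi β, weylPhase a b t := by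
  have hi := integrableOn_weylPhase a hb
  rw [weylQ, integral_of_le hβ.le, ← Ioc_union_Ioi_eq_Ioi hβ.le,
    setIntegral_union (by simp) measurableSet_Ioi
      (hi.mono_set Ioc_subset_Ioi_self) (hi.mono_set (Ioi_subset_Ioi hβ.le))]
  ring

lemma norm_g_exp_le {E δ β : ℝ} (hE : 0 < E) (h0 : 0 < δ) (h1 : δ < 1) (hβ : 0 < β) {x : ℂ}
    (hx : x.im ≠ 0) {c0 : ℝ} (hc0 : 0 < c0) (hc1 : c0 ≤ 1) (hs : c0 * rexp β ≤ sinh β)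
    (hc : c0 * rexp (β / 2) ≤ cosh (β / 2)) :
    ‖g E x (cexp β)‖ ≤ (2 * sinhInt (δ / 2) + 6 * sinhInt δ + 2 * π) *
      (√E * c0 * (|x.im| * rexp (β / 2))) ^ (-δ) := by
  have he : 0 < √E := sqrt_pos.2 hE
  set e := √E with hed
  set y := x.im with hy
  have hy0 : 0 < |y| := abs_pos.2 hx
  set b := e * |y| with hb
  have hb0 : 0 < b := mul_pos he hy0
  have hsβ : 0 < sinh β := sinh_pos_iff.2 hβ
  set X := √E * c0 * (|y| * rexp (β / 2)) with hX
  have hX0 : 0 < X := by positivity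
  have hS := sinhInt_nonneg δ
  have hS2 := sinhInt_nonneg (δ / 2)
  have hlim := (tendsto_integral_ball_exp hE hβ (x := x.re) hx).const_mul (-(1 / (2 * π : ℂ) ^ 2))
  simp only [symbP_eq] at hlim
  have hg := (show Tendsto (gDisc E x (cexp β)) atTop _ from hlim).limUnder_eq
  rw [← g_eq_limUnder] at hg
  obtain ⟨-, hval⟩ := symbKer_integral he hβ hx x.re
  have hw := weylQ_add_weylQ (e * x.re) hb0
  have hsq : √((e * x.re) ^ 2 + b ^ 2) = e * √(x.re ^ 2 + y ^ 2) := by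
    rw [show (e * x.re) ^ 2 + b ^ 2 = e ^ 2 * (x.re ^ 2 + y ^ 2) by
      grind, Real.sqrt_mul (by positivity), sqrt_sq he.le]
  rw [hsq] at hw
  rw [hval, ← hw] at hg
  set I1 := ∫ τ in 0..β, cexp (I * (e * x.re) * cosh τ + e * y * sinh τ) with hI1
  set I2 := ∫ τ in 0..β, cexp (-(I * (e * x.re) * cosh τ) + e * y * sinh τ) with hI2
  set I3 := ∫ t in 0..π, cexp (I * (e * (x.re * cos t - y * sin t))) with hI3
  set J := ∫ t in 0..π, cexp (I * ((e * x.re : ℝ) * cos t + b * sin t)) with hJ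
  set D := (weylQ (e * x.re) b - I1) + (weylQ (-(e * x.re)) b - I2) + I * (J - I3) with hD
  have hnorm : ‖g E x (cexp β)‖ ≤ rexp (-(e * y * sinh β)) * ‖D‖ := by
    have hexp : ‖cexp (-(I * (e * cosh β) * x.re)) *
        cexp (-(e * sinh β * y))‖ = rexp (-(e * y * sinh β)) := by
      rw [← exp_add, norm_exp]
      congr 1
      have : -(I * (e * cosh β) * x.re) + -(e * sinh β * y) =
          ((-(e * y * sinh β) : ℝ)) + ((-(e * cosh β * x.re) : ℝ)) * I := by
        push_cast; ring
      rw [this, Complex.add_re, ofReal_re, Complex.re_ofReal_mul, Complex.I_re, mul_zero, add_zero]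
    have e1 : g E x (cexp β) = -(1 / (4 * π)) * ((cexp (-(I * (e * cosh β) * x.re)) *
        cexp (-(e * sinh β * y))) * D) := by
      have hπ : (π : ℂ) ≠ 0 := by exact_mod_cast pi_ne_zero
      rw [hg, hD, ← hed]
      field_simp
      ring
    have hπ : ‖(-(1 / (4 * π)) : ℂ)‖ ≤ 1 := by
      rw [norm_neg, norm_div, norm_one, norm_mul, norm_real, norm_of_nonneg pi_pos.le,
        Complex.norm_ofNat, div_le_one (by positivity)]
      linarith [Real.pi_gt_three]
    rw [e1, norm_mul, norm_mul, hexp]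
    exact mul_le_of_le_one_left (by positivity) hπ
  refine hnorm.trans ?_
  have hexpβ : rexp β = rexp (β / 2) * rexp (β / 2) := by
    rw [← Real.exp_add]; ring_nf
  have hle1 : X ≤ b * cosh (β / 2) := by
    calc X = b * (c0 * rexp (β / 2)) := by ring
      _ ≤ _ := by gcongr
  have hle2 : X ≤ b * sinh β := by
    calc X = b * (c0 * rexp (β / 2)) := by ring
      _ ≤ b * (c0 * rexp β) := by gcongr; linarith
      _ ≤ _ := by gcongr
  have hle3 : X ≤ b * cosh β := hle2.trans (by gcongr; exact (Real.sinh_lt_cosh β).le)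
  have mono {u : ℝ} (hu : X ≤ u) : u ^ (-δ) ≤ X ^ (-δ) :=
    rpow_le_rpow_of_nonpos hX0 hu (by linarith)
  have hne (p q) (t : ℝ) r (h : p = ((r : ℝ)) + q * I) (hq : q.im = 0) : ‖cexp p‖ = rexp r := by
    rw [norm_exp, h, Complex.add_re, ofReal_re, Complex.mul_I_re, hq, neg_zero, add_zero]
  rcases lt_or_gt_of_ne hx with hneg | hpos
  · have hyb : e * y = -b := by rw [hb, abs_of_neg hneg]; ring
    have hyb' : e * y = -(b : ℂ) := by exact_mod_cast hyb
    have k1 : I1 = ∫ t in 0..β, weylPhase (e * x.re) b t := by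
      rw [hI1]; congr 1; funext t; rw [weylPhase, hyb']; congr 1; push_cast; ring
    have k2 : I2 = ∫ t in 0..β, weylPhase (-(e * x.re)) b t := by
      rw [hI2]; congr 1; funext t; rw [weylPhase, hyb']; congr 1; push_cast; ring
    have k3 : I3 = J := by
      rw [hI3, hJ]; congr 1; funext t; congr 2
      push_cast
      linear_combination (-(Complex.sin t)) * hyb'
    rw [hD, k3, sub_self, mul_zero, add_zero, k1, k2, weylQ_sub_integral _ hb0 hβ,
      weylQ_sub_integral _ hb0 hβ, hyb, neg_mul, neg_neg]
    have t1 := exp_mul_norm_integral_Ioi_le h0 h1 (e * x.re) hb0 hβ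
    have t2 := exp_mul_norm_integral_Ioi_le h0 h1 (-(e * x.re)) hb0 hβ
    have t3 := mul_le_mul_of_nonneg_right (mono hle3) hS
    have t4 := mul_le_mul_of_nonneg_left (norm_add_le (∫ t in Ioi β, weylPhase (e * x.re) b t)
      (∫ t in Ioi β, weylPhase (-(e * x.re)) b t)) (exp_pos (b * sinh β)).le
    have t5 : 0 ≤ (2 * sinhInt (δ / 2) + 4 * sinhInt δ + 2 * π) * X ^ (-δ) := by positivity
    linarith
  · have hyb : e * y = b := by rw [hb, abs_of_pos hpos]
    have hyb' : e * y = (b : ℂ) := by exact_mod_cast hyb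
    have b1 : ‖I1‖ ≤ ∫ t in 0..β, rexp (b * sinh t) := by
      refine intervalIntegral.norm_integral_le_of_norm_le hβ.le (.of_forall fun t _ => ?_)
        (Continuous.intervalIntegrable (by fun_prop) _ _)
      refine (hne _ ((e * x.re * cosh t : ℝ)) t _ ?_ (ofReal_im _)).le
      rw [hyb']; push_cast; ring
    have b2 : ‖I2‖ ≤ ∫ t in 0..β, rexp (b * sinh t) := by
      refine intervalIntegral.norm_integral_le_of_norm_le hβ.le (.of_forall fun t _ => ?_)
        (Continuous.intervalIntegrable (by fun_prop) _ _)
      refine (hne _ ((-(e * x.re * cosh t) : ℝ)) t _ ?_ (ofReal_im _)).le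
      rw [hyb']; push_cast; ring
    have b3 : ‖I3‖ ≤ π := by
      refine (intervalIntegral.norm_integral_le_of_norm_le_const (C := 1) fun t _ => ?_).trans ?_
      · refine (hne _ ((e * (x.re * cos t - y * sin t) : ℝ)) t 0 ?_
          (ofReal_im _)).le.trans (by simp)
        push_cast; ring
      · rw [sub_zero, abs_of_pos pi_pos, one_mul]
    have b4 : ‖J‖ ≤ π := by
      refine (intervalIntegral.norm_integral_le_of_norm_le_const (C := 1) fun t _ => ?_).trans ?_
      · refine (hne _ ((e * x.re * cos t + b * sin t : ℝ)) t 0 ?_ (ofReal_im _)).le.trans (by simp)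
        push_cast; ring
      · rw [sub_zero, abs_of_pos pi_pos, one_mul]
    have b5 := norm_weylQ_le (half_pos h0) (by linarith) (e * x.re) hb0
    have b6 := norm_weylQ_le (half_pos h0) (by linarith) (-(e * x.re)) hb0
    have hDn : ‖D‖ ≤ 2 * (b ^ (-(δ / 2)) * sinhInt (δ / 2)) +
        2 * (∫ t in 0..β, rexp (b * sinh t)) + 2 * π := by
      have n1 := norm_add_le (weylQ (e * x.re) b - I1 + (weylQ (-(e * x.re)) b - I2)) (I * (J - I3))
      have n2 := norm_add_le (weylQ (e * x.re) b - I1) (weylQ (-(e * x.re)) b - I2)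
      have n3 := norm_sub_le (weylQ (e * x.re) b) I1
      have n4 := norm_sub_le (weylQ (-(e * x.re)) b) I2
      have n5 := norm_sub_le J I3
      rw [norm_mul, norm_I, one_mul] at n1
      linarith
    rw [hyb]
    have hE0 : 0 < rexp (-(b * sinh β)) := exp_pos _
    have m1 : rexp (-(b * sinh β)) ≤ X ^ (-δ) :=
      (exp_neg_le_rpow (by positivity) h0.le h1.le).trans (mono hle2)
    have m2 := integral_exp_sinh_le h0 h1 hb0 hβ
    have m3 := mul_le_mul_of_nonneg_right (mono hle1) hS
    have m4 : rexp (-(b * sinh β)) * b ^ (-(δ / 2)) ≤ X ^ (-δ) := by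
      have q1 : rexp (-(b * sinh β)) ≤ (b * sinh β) ^ (-(δ / 2)) :=
        exp_neg_le_rpow (by positivity) (by linarith) (by linarith)
      refine (mul_le_mul_of_nonneg_right q1 (rpow_nonneg hb0.le _)).trans ?_
      rw [← mul_rpow (by positivity) hb0.le]
      have q2 : X ^ 2 ≤ b * sinh β * b := by
        calc X ^ 2 = b * b * (c0 * (c0 * (rexp (β / 2) * rexp (β / 2)))) := by
              ring
          _ ≤ b * b * (1 * sinh β) := by
              rw [← hexpβ]; gcongr
          _ = _ := by ring
      refine (rpow_le_rpow_of_nonpos (by positivity) q2 (by linarith)).trans (le_of_eq ?_)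
      rw [← Real.rpow_natCast, ← rpow_mul hX0.le]
      congr 1; push_cast; ring
    have m6 := mul_le_mul_of_nonneg_right m1 pi_pos.le
    nlinarith

lemma norm_g_le_of_one_lt {E δ ρ₀ : ℝ} (hE : 0 < E) (h0 : 0 < δ) (h1 : δ < 1) (hρ : 1 < ρ₀) :
    ∃ C : ℝ, 0 ≤ C ∧ ∀ l x : ℂ, ρ₀ ≤ ‖l‖ → (x * conj l).im ≠ 0 →
      ‖g E x l‖ ≤ C * (√‖l‖ * |(x * conj (l / ‖l‖)).im|) ^ (-δ) := by
  have hρ2 : 1 < ρ₀ ^ 2 := by nlinarith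
  set c0 := (1 - (ρ₀ ^ 2)⁻¹) / 2 with hc0d
  have hinv : (ρ₀ ^ 2)⁻¹ < 1 := inv_lt_one_of_one_lt₀ hρ2
  have hinv0 : 0 < (ρ₀ ^ 2)⁻¹ := by positivity
  have hc0 : 0 < c0 := by rw [hc0d]; linarith
  refine ⟨(2 * sinhInt (δ / 2) + 6 * sinhInt δ + 2 * π) * (√E * c0) ^ (-δ), ?_, ?_⟩
  · have := sinhInt_nonneg δ
    have := sinhInt_nonneg (δ / 2)
    positivity
  intro l x hl hx
  have hl1 : 1 < ‖l‖ := hρ.trans_le hl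
  have hl0 : 0 < ‖l‖ := by linarith
  set β := log ‖l‖ with hβ
  have hβ0 : 0 < β := log_pos hl1
  have heβ : rexp β = ‖l‖ := Real.exp_log hl0
  set u : ℂ := l / ‖l‖ with hu
  have hn0 : (‖l‖ : ℂ) ≠ 0 := by exact_mod_cast hl0.ne'
  have hu1 : ‖u‖ = 1 := by rw [norm_div, norm_real, norm_norm, div_self hl0.ne']
  have hcu : u * conj u = 1 := by
    rw [mul_conj, normSq_eq_norm_sq, hu1]; norm_num
  have hlu : l = u * cexp β := by
    rw [← ofReal_exp, heβ, div_mul_cancel₀ _ hn0]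
  have hgg : g E x l = g E (x * conj u) (cexp β) := by
    rw [g_eq_limUnder, g_eq_limUnder]
    congr 1; funext R
    rw [← gDisc_mul_rotation E (x * conj u) (cexp β) u hu1, ← hlu,
      show u * (x * conj u) = (u * conj u) * x by ring, hcu, one_mul]
  have hx' : (x * conj u).im ≠ 0 := by
    intro h
    apply hx
    rw [hlu, map_mul, ← mul_assoc, ← ofReal_exp, conj_ofReal, Complex.im_mul_ofReal,
      h, zero_mul]
  have hsinh : c0 * rexp β ≤ sinh β := by
    have e1 : rexp (-β) = (rexp β)⁻¹ := Real.exp_neg β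
    have e2 : (rexp β)⁻¹ ≤ (ρ₀ ^ 2)⁻¹ * rexp β := by
      rw [heβ, inv_mul_eq_div, le_div_iff₀ (by positivity), inv_mul_le_iff₀ hl0]
      nlinarith
    rw [Real.sinh_eq, e1, hc0d]
    linarith
  have hcosh : c0 * rexp (β / 2) ≤ cosh (β / 2) := by
    rw [Real.cosh_eq]
    have := exp_pos (-(β / 2))
    have := exp_pos (β / 2)
    nlinarith
  have hsq : rexp (β / 2) = √‖l‖ := by rw [← heβ, Real.exp_half]
  have := norm_g_exp_le hE h0 h1 hβ0 hx' hc0 (by linarith) hsinh hcosh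
  rw [hgg]
  refine this.trans (le_of_eq ?_)
  rw [hsq, mul_rpow (by positivity) (by positivity), mul_assoc, mul_comm √‖l‖]

/-- `max |l| (1/|l|)`. -/
def specSize (l : ℂ) : ℝ := max ‖l‖ ‖l‖⁻¹

lemma norm_antipode (l : ℂ) : ‖-1 / conj l‖ = ‖l‖⁻¹ := by simp

lemma one_le_specSize {l : ℂ} (hl : l ≠ 0) : 1 ≤ specSize l := by
  have h0 : 0 < ‖l‖ := norm_pos_iff.2 hl
  rcases le_total 1 ‖l‖ with h | h
  · exact h.trans (le_max_left _ _)
  · exact ((one_le_inv₀ h0).2 h).trans (le_max_right _ _)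

lemma one_lt_specSize {l : ℂ} (hl : l ≠ 0) (h1 : ‖l‖ ≠ 1) : 1 < specSize l := by
  have h0 : 0 < ‖l‖ := norm_pos_iff.2 hl
  rcases lt_or_gt_of_ne h1 with h | h
  · exact ((one_lt_inv₀ h0).2 h).trans_le (le_max_right _ _)
  · exact h.trans_le (le_max_left _ _)

lemma norm_g_le {E δ ρ₀ : ℝ} (hE : 0 < E) (h0 : 0 < δ) (h1 : δ < 1) (hρ : 1 < ρ₀) :
    ∃ C : ℝ, 0 ≤ C ∧ ∀ l x : ℂ, l ≠ 0 → ρ₀ ≤ specSize l → (x * conj l).im ≠ 0 →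
      ‖g E x l‖ ≤ C * (√(specSize l) * |(x * conj (l / ‖l‖)).im|) ^ (-δ) := by
  obtain ⟨C, hC, h⟩ := norm_g_le_of_one_lt hE h0 h1 hρ
  refine ⟨C, hC, fun l x hl hs hx => ?_⟩
  have hl0 : 0 < ‖l‖ := norm_pos_iff.2 hl
  rcases le_total 1 ‖l‖ with h2 | h2
  · have e : specSize l = ‖l‖ := max_eq_left ((inv_le_one_of_one_le₀ h2).trans h2)
    grind
  · have e : specSize l = ‖l‖⁻¹ := max_eq_right (h2.trans ((one_le_inv₀ hl0).2 h2))
    have hne : ‖l‖ ≠ 1 := by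
      intro h3
      rw [e, h3, inv_one] at hs
      linarith
    have hcl : conj l ≠ 0 := by simpa using hl
    have hn0 : (‖l‖ : ℂ) ≠ 0 := by exact_mod_cast hl0.ne'
    have hll : l * conj l = ‖l‖ ^ 2 := by
      rw [mul_conj, normSq_eq_norm_sq]; push_cast; rfl
    have ean : -1 / conj l = -(l * ((‖l‖ ^ 2)⁻¹)) := by
      push_cast
      rw [div_eq_iff hcl]
      field_simp
      linear_combination hll
    have hx' : (x * conj (-1 / conj l)).im ≠ 0 := by
      rw [ean, map_neg, map_mul, conj_ofReal, mul_neg, neg_im, ← mul_assoc,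
        Complex.im_mul_ofReal]
      exact neg_ne_zero.2 (mul_ne_zero hx (by positivity))
    have h4 := h (-1 / conj l) x (by rw [norm_antipode, ← e]; exact hs) hx'
    rw [g_antipode hE hl hne hx, RCLike.norm_conj, norm_antipode, ← e] at h4
    convert h4 using 4
    rw [e, ean]
    have : -(l * (((‖l‖ ^ 2)⁻¹ : ℝ))) / ((‖l‖⁻¹ : ℝ)) = -(l / ‖l‖) := by
      push_cast; field_simp
    rw [this, map_neg, mul_neg, neg_im, abs_neg]

/-- A potential of class `L^q`, `1 < q ≤ 2`, supported in the disc of radius `R`. -/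
structure Setup where
  E : ℝ
  v : ℂ → ℝ
  R : ℝ
  q : ℝ
  hE : 0 < E
  hR : 0 < R
  hq1 : 1 < q
  hq2 : q ≤ 2
  hv : MemLp v (ENNReal.ofReal q)
  hsupp : ∀ z, R ≤ ‖z‖ → v z = 0

lemma exists_setup {E : ℝ} (hE : 0 < E) {p : ENNReal} (hp : 1 < p) {v : ℂ → ℝ}
    (hv : MemLp v p) (hcomp : HasCompactSupport v) (r : ℝ) :
    ∃ S : Setup, S.E = E ∧ S.v = v ∧ r ≤ S.R := by
  obtain ⟨R, hR⟩ := hcomp.isCompact.isBounded.subset_ball 0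
  set p' := min p 2 with hp'
  have hp2 : p' ≤ 2 := min_le_right _ _
  have hpt : p' ≠ ⊤ := ne_top_of_le_ne_top (by simp) hp2
  have h1 : 1 < p' := lt_min hp (by norm_num)
  have hv' : MemLp v p' := hv.mono_exponent_of_measure_support_ne_top
    (fun z hz => image_eq_zero_of_notMem_tsupport fun h => hz (hR h)) measure_ball_lt_top.ne (min_le_left _ _)
  refine ⟨⟨E, v, max (max R 1) r, p'.toReal, hE, by positivity, ?_, ?_, ?_, ?_⟩, rfl, rfl, ?_⟩
  · exact (ENNReal.toReal_lt_toReal (by simp) hpt).2 h1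
  · exact (ENNReal.toReal_le_toReal hpt (by simp)).2 hp2
  · simp_all
  · intro z hz
    refine image_eq_zero_of_notMem_tsupport fun h => ?_
    have := mem_ball_zero_iff.1 (hR h)
    grind
  · exact le_max_right _ _

namespace Setup

variable (S : Setup)

/-- Half of the reciprocal of the conjugate exponent. -/
def δ : ℝ := (1 - 1 / S.q) / 2

lemma δ_pos : 0 < S.δ := by
  have := (div_lt_one (by linarith [S.hq1])).2 S.hq1
  rw [δ]; linarith

lemma δ_lt : S.δ < 1 := by
  have : 0 < 1 / S.q := by have := S.hq1; positivity
  rw [δ]; linarith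

lemma integrable_v : Integrable S.v := by
  rw [← memLp_one_iff_integrable]
  refine S.hv.mono_exponent_of_measure_support_ne_top (s := ball 0 S.R) (fun z hz => ?_)
    measure_ball_lt_top.ne ?_
  · exact S.hsupp z (by simpa using hz)
  · rw [← ENNReal.ofReal_one]; exact ENNReal.ofReal_le_ofReal S.hq1.le

lemma integrable_abs_rpow_v : Integrable fun z => |S.v z| ^ S.q := by
  have := S.hv.integrable_norm_rpow (by simp; linarith [S.hq1]) (by simp)
  rw [ENNReal.toReal_ofReal (by linarith [S.hq1])] at this
  simpa using this

end Setup

lemma exists_integral_abs_sub_im_rpow_le (R : ℝ) : ∃ C : ℝ, ∀ c : ℝ,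
    IntegrableOn (fun w : ℂ => |c - w.im| ^ (-(1 / 2) : ℝ)) (ball 0 R) ∧
    ∫ w in ball (0 : ℂ) R, |c - w.im| ^ (-(1 / 2) : ℝ) ≤ C := by
  set k : ℝ → ℝ := (Icc (-1) 1).indicator fun t => |t| ^ (-(1 / 2) : ℝ) with hk
  have hki : Integrable k := by
    rw [integrable_indicator_iff measurableSet_Icc]
    exact (locallyIntegrable_abs_rpow (by norm_num)).integrableOn_isCompact isCompact_Icc
  have hk0 t : 0 ≤ k t := indicator_nonneg (fun t _ => by positivity) t
  set one : ℝ → ℝ := (Icc (-R) R).indicator fun _ => 1 with hone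
  have honei : Integrable one := by
    rw [integrable_indicator_iff measurableSet_Icc]; simp
  have hone0 t : 0 ≤ one t := indicator_nonneg (fun t _ => zero_le_one) t
  refine ⟨(∫ t, one t) * ((∫ t, k t) + ∫ t, one t), fun c => ?_⟩
  have hb : Integrable fun b : ℝ => k (c - b) + one b := (hki.comp_sub_left c).add honei
  have hprod := honei.mul_prod hb
  have hcomp := (volume_preserving_equiv_real_prod.integrable_comp_emb
    measurableEquivRealProd.measurableEmbedding).2 (by exact hprod)
  have hle w (hw : w ∈ ball 0 R) : |c - w.im| ^ (-(1 / 2) : ℝ) ≤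
      ((fun p : ℝ × ℝ => one p.1 * (k (c - p.2) + one p.2)) ∘ measurableEquivRealProd) w := by
    have hw' := mem_ball_zero_iff.1 hw
    have h1 : w.re ∈ Icc (-R) R := abs_le.1 ((abs_re_le_norm w).trans hw'.le)
    have h2 : w.im ∈ Icc (-R) R := abs_le.1 ((abs_im_le_norm w).trans hw'.le)
    simp only [Function.comp_apply, Complex.measurableEquivRealProd_apply]
    rw [hone, indicator_of_mem h1, indicator_of_mem h2, one_mul]
    by_cases h3 : c - w.im ∈ Icc (-1) 1
    · rw [hk, indicator_of_mem h3]; linarith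
    · have h4 : 1 ≤ |c - w.im| := by
        by_contra h5
        exact h3 (abs_le.1 (not_le.1 h5).le)
      have := Real.rpow_le_one_of_one_le_of_nonpos h4 (show (-(1 / 2)) ≤ 0 by norm_num)
      linarith [hk0 (c - w.im)]
  have hmeas : AEStronglyMeasurable (fun w : ℂ => |c - w.im| ^ (-(1 / 2) : ℝ))
      (volume.restrict (ball 0 R)) := by
    refine Measurable.aestronglyMeasurable (Measurable.pow_const ?_ _)
    exact Continuous.measurable (by fun_prop)
  have hint : IntegrableOn (fun w : ℂ => |c - w.im| ^ (-(1 / 2) : ℝ)) (ball 0 R) := by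
    refine Integrable.mono' hcomp.integrableOn hmeas ?_
    filter_upwards [ae_restrict_mem isOpen_ball.measurableSet] with w hw
    rw [norm_of_nonneg (by positivity)]
    exact hle w hw
  refine ⟨hint, ?_⟩
  calc _ ≤ ∫ w in ball 0 R, ((fun p : ℝ × ℝ => one p.1 * (k (c - p.2) + one p.2)) ∘
        measurableEquivRealProd) w :=
        setIntegral_mono_on hint hcomp.integrableOn isOpen_ball.measurableSet hle
    _ ≤ ∫ w : ℂ, ((fun p : ℝ × ℝ => one p.1 * (k (c - p.2) + one p.2)) ∘
        measurableEquivRealProd) w := by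
        refine setIntegral_le_integral hcomp (.of_forall fun w => ?_)
        exact mul_nonneg (hone0 _) (add_nonneg (hk0 _) (hone0 _))
    _ = ∫ p : ℝ × ℝ, one p.1 * (k (c - p.2) + one p.2) :=
        volume_preserving_equiv_real_prod.integral_comp'
          (g := fun p : ℝ × ℝ => one p.1 * (k (c - p.2) + one p.2))
    _ = (∫ t, one t) * ((∫ t, k t) + ∫ t, one t) := by
        rw [Measure.volume_eq_prod, integral_prod_mul (g := fun b => k (c - b) + one b),
          integral_add (hki.comp_sub_left c) honei, integral_sub_left_eq_self]
    _ ≤ _ := le_rfl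

namespace Setup

variable (S : Setup)

lemma exists_weight_bound : ∃ C : ℝ, 0 ≤ C ∧ ∀ z u : ℂ, ‖u‖ = 1 →
    Integrable (fun w => |((z - w) * conj u).im| ^ (-S.δ) * |S.v w|) ∧
    ∫ w, |((z - w) * conj u).im| ^ (-S.δ) * |S.v w| ≤ C := by
  obtain ⟨C, hC⟩ := exists_integral_abs_sub_im_rpow_le S.R
  have hvq := S.integrable_abs_rpow_v
  have hq := S.hq1
  refine ⟨max C 0 + ∫ w, |S.v w| ^ S.q, add_nonneg (le_max_right _ _)
    (integral_nonneg fun w => by positivity), fun z u hu => ?_⟩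
  set B := ball (0 : ℂ) S.R with hB
  obtain ⟨i1, i2⟩ := hC (z * conj u).im
  let Φ := rotation (⟨conj u, mem_sphere_zero_iff_norm.2 ((RCLike.norm_conj u).trans hu)⟩ : Circle)
  have hΦ ξ : Φ ξ = conj u * ξ := rotation_apply _ _
  have hmp : MeasurePreserving Φ volume volume := Φ.measurePreserving
  have hpre : Φ ⁻¹' B = B := by
    ext ξ
    rw [mem_preimage, mem_ball_zero_iff, mem_ball_zero_iff, LinearIsometryEquiv.norm_map]
  have hfun w : ((z - w) * conj u).im = (z * conj u).im - (Φ w).im := by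
    rw [hΦ, sub_mul, Complex.sub_im, mul_comm w]
  have j1 : IntegrableOn (fun w => |((z - w) * conj u).im| ^ (-(1 / 2) : ℝ)) B := by
    have := (hmp.integrableOn_comp_preimage Φ.toHomeomorph.measurableEmbedding).2 i1
    rw [hpre] at this
    simpa only [hfun, Function.comp_def] using this
  have j2 : ∫ w in B, |((z - w) * conj u).im| ^ (-(1 / 2) : ℝ) ≤ C := by
    have := hmp.setIntegral_preimage_emb Φ.toHomeomorph.measurableEmbedding
      (fun w : ℂ => |(z * conj u).im - w.im| ^ (-(1 / 2) : ℝ)) B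
    rw [hpre] at this
    simp only [hfun]
    rw [this]; exact i2
  have hle w : |((z - w) * conj u).im| ^ (-S.δ) * |S.v w| ≤
      B.indicator (fun w => |((z - w) * conj u).im| ^ (-(1 / 2) : ℝ)) w + |S.v w| ^ S.q := by
    by_cases hw : w ∈ B
    · rw [indicator_of_mem hw]
      have hconj : (S.q / (S.q - 1)).HolderConjugate S.q :=
        (Real.HolderConjugate.conjExponent hq).symm
      have hy := Real.young_inequality_of_nonneg (a := |((z - w) * conj u).im| ^ (-S.δ))
        (b := |S.v w|) (by positivity) (abs_nonneg _) hconj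
      have e1 : (|((z - w) * conj u).im| ^ (-S.δ)) ^ (S.q / (S.q - 1)) =
          |((z - w) * conj u).im| ^ (-(1 / 2) : ℝ) := by
        rw [← rpow_mul (abs_nonneg _)]
        congr 1
        have : S.q - 1 ≠ 0 := by linarith
        rw [δ]; field_simp
      rw [e1] at hy
      have h1 : 1 ≤ S.q / (S.q - 1) := hconj.lt.le
      have h2 : (0:ℝ) ≤ |((z - w) * conj u).im| ^ (-(1 / 2) : ℝ) := by positivity
      have h3 : (0:ℝ) ≤ |S.v w| ^ S.q := by positivity
      exact hy.trans (add_le_add (div_le_self h2 h1) (div_le_self h3 hq.le))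
    · have : S.v w = 0 := S.hsupp w (by simpa [hB] using hw)
      rw [indicator_of_notMem hw, this, abs_zero, mul_zero, Real.zero_rpow (by linarith), add_zero]
  have hI := (j1.integrable_indicator isOpen_ball.measurableSet).add hvq
  simp only [Pi.add_def] at hI
  have hmeas : AEStronglyMeasurable (fun w => |((z - w) * conj u).im| ^ (-S.δ) * |S.v w|) := by
    refine AEStronglyMeasurable.mul (Measurable.aestronglyMeasurable (Measurable.pow_const ?_ _))
      S.integrable_v.abs.aestronglyMeasurable
    exact Continuous.measurable (by fun_prop)
  have hint : Integrable (fun w => |((z - w) * conj u).im| ^ (-S.δ) * |S.v w|) := by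
    refine hI.mono' hmeas (.of_forall fun w => ?_)
    rw [norm_of_nonneg (by positivity)]; exact hle w
  refine ⟨hint, (integral_mono hint hI hle).trans ?_⟩
  rw [integral_add (j1.integrable_indicator isOpen_ball.measurableSet) hvq,
    integral_indicator isOpen_ball.measurableSet]
  grind

end Setup

lemma isCompactOperator_of_equicontinuous {X K : Type*} [NormedAddCommGroup X] [NormedSpace ℂ X]
    [TopologicalSpace K] [CompactSpace K] (T : X →L[ℂ] C(K, ℂ))
    (h : ∀ z₀ : K, ∀ ε > 0, ∀ᶠ z in 𝓝 z₀, ∀ f : X, ‖f‖ ≤ 1 → ‖T f z - T f z₀‖ ≤ ε) :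
    IsCompactOperator T := by
  let e := ContinuousMap.isometryEquivBoundedOfCompact K ℂ
  set A : Set (BoundedContinuousFunction K ℂ) := (fun f => e (T f)) '' Metric.closedBall 0 1
  have hA : IsCompact (closure A) := by
    refine BoundedContinuousFunction.arzela_ascoli (Metric.closedBall 0 ‖T‖)
      (isCompact_closedBall _ _) A ?_ ?_
    · rintro _ x ⟨f, hf, rfl⟩
      rw [mem_closedBall_zero_iff] at hf ⊢
      calc ‖T f x‖ ≤ ‖T f‖ := ContinuousMap.norm_coe_le_norm _ _
        _ ≤ ‖T‖ * ‖f‖ := T.le_opNorm f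
        _ ≤ ‖T‖ := mul_le_of_le_one_right (norm_nonneg _) hf
    · intro z₀
      rw [Metric.equicontinuousAt_iff_right]
      intro ε hε
      filter_upwards [h z₀ (ε / 2) (half_pos hε)] with z hz
      rintro ⟨_, f, hf, rfl⟩
      rw [dist_comm, dist_eq_norm]
      exact (hz f (mem_closedBall_zero_iff.1 hf)).trans_lt (half_lt_self hε)
  refine ⟨e.symm '' closure A, hA.image e.symm.continuous, ?_⟩
  filter_upwards [Metric.closedBall_mem_nhds (0 : X) one_pos] with f hf
  exact ⟨e (T f), subset_closure ⟨f, hf, rfl⟩, e.symm_apply_apply _⟩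

namespace Setup

variable (S : Setup)

/-- The closed disc of radius `R`. -/
abbrev K : Set ℂ := Metric.closedBall (0 : ℂ) S.R

/-- Continuous functions on the disc. -/
abbrev X : Type := C(S.K, ℂ)

/-- A continuous retraction of the plane to the disc. -/
def ret : C(ℂ, S.K) where
  toFun z := ⟨((S.R / max S.R ‖z‖ : ℝ) : ℂ) * z, by
    have hR := S.hR
    have h1 : 0 < max S.R ‖z‖ := lt_max_of_lt_left hR
    rw [mem_closedBall_zero_iff, norm_mul, norm_real, norm_of_nonneg (by positivity),
      div_mul_eq_mul_div, div_le_iff₀ h1]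
    simp_all⟩
  continuous_toFun := by
    have hR := S.hR
    refine Continuous.subtype_mk (Continuous.mul (Complex.continuous_ofReal.comp
      (Continuous.div (by fun_prop) (by fun_prop) fun z => ?_)) continuous_id) _
    positivity

lemma ret_of_mem {z : ℂ} (hz : z ∈ S.K) : S.ret z = ⟨z, hz⟩ := by
  have h1 : max S.R ‖z‖ = S.R := max_eq_left (mem_closedBall_zero_iff.1 hz)
  apply Subtype.ext
  change ((S.R / max S.R ‖z‖ : ℝ)) * z = z
  rw [h1, div_self S.hR.ne']; simp

/-- Extension of a function on the disc to the plane. -/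
def ext (f : S.X) (z : ℂ) : ℂ := f (S.ret z)

lemma continuous_ext (f : S.X) : Continuous (S.ext f) :=
  f.continuous.comp S.ret.continuous

lemma ext_of_mem (f : S.X) {z : ℂ} (hz : z ∈ S.K) : S.ext f z = f ⟨z, hz⟩ := by
  rw [ext, ret_of_mem S hz]

lemma norm_ext_le (f : S.X) (z : ℂ) : ‖S.ext f z‖ ≤ ‖f‖ :=
  ContinuousMap.norm_coe_le_norm _ _

lemma v_eq_zero {w : ℂ} (hw : w ∉ ball (0 : ℂ) S.R) : S.v w = 0 :=
  S.hsupp w (by simpa using hw)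

/-- Restriction of a continuous function to the disc. -/
def res (f : C(ℂ, ℂ)) : S.X := f.restrict S.K

/-- Kernels for which `w ↦ k(z - w) v(w)` is an integrable function depending continuously on `z`
in `L¹`. -/
structure Good (S : Setup) (k : ℂ → ℂ) : Prop where
  integrable : ∀ z, Integrable fun w => k (z - w) * (S.v w : ℂ)
  tendsto : ∀ z₀, Tendsto (fun z => ∫ w, ‖k (z - w) * (S.v w : ℂ) - k (z₀ - w) * (S.v w : ℂ)‖)
    (𝓝 z₀) (𝓝 0)

lemma Good.add {S : Setup} {k₁ k₂ : ℂ → ℂ} (h₁ : S.Good k₁) (h₂ : S.Good k₂) :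
    S.Good fun x => k₁ x + k₂ x where
  integrable z := by
    have := (h₁.integrable z).add (h₂.integrable z)
    simpa only [Pi.add_def, ← add_mul] using this
  tendsto z₀ := by
    have h := (h₁.tendsto z₀).add (h₂.tendsto z₀)
    rw [add_zero] at h
    refine squeeze_zero (fun z => integral_nonneg fun w => norm_nonneg _) (fun z => ?_) h
    have i1 := ((h₁.integrable z).sub (h₁.integrable z₀)).norm
    have i2 := ((h₂.integrable z).sub (h₂.integrable z₀)).norm
    simp only [Pi.sub_apply] at i1 i2
    rw [← integral_add i1 i2]
    refine integral_mono_of_nonneg (.of_forall fun w => norm_nonneg _) (i1.add i2)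
      (.of_forall fun w => ?_)
    refine le_trans (le_of_eq ?_) (norm_add_le _ _)
    ring_nf

lemma integrable_vC : Integrable fun w => (S.v w : ℂ) := S.integrable_v.ofReal

lemma integrable_mul_v {F : ℂ → ℂ} (hF : Continuous F) : Integrable fun w => F w * (S.v w : ℂ) := by
  obtain ⟨C, hC⟩ := (isCompact_closedBall 0 S.R).exists_bound_of_continuousOn hF.continuousOn
  refine (S.integrable_v.norm.const_mul C).mono' (hF.aestronglyMeasurable.mul
    S.integrable_vC.aestronglyMeasurable) (.of_forall fun w => ?_)
  rw [norm_mul, norm_real]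
  by_cases hw : w ∈ ball 0 S.R
  · gcongr
    exact hC w (ball_subset_closedBall hw)
  · simp [S.v_eq_zero hw]

lemma good_of_continuous {k : ℂ → ℂ} (hk : Continuous k) : S.Good k where
  integrable z := S.integrable_mul_v (F := fun w => k (z - w)) (by fun_prop)
  tendsto z₀ := by
    obtain ⟨C, hC⟩ := (isCompact_closedBall 0 (‖z₀‖ + 1 + S.R)).exists_bound_of_continuousOn
      hk.continuousOn
    have hC' z (hz : z ∈ ball z₀ 1) w (hw : w ∈ ball 0 S.R) : ‖k (z - w)‖ ≤ C := by
      refine hC _ (mem_closedBall_zero_iff.2 ?_)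
      have h1 : ‖z‖ ≤ ‖z₀‖ + 1 := by
        have := norm_le_norm_add_norm_sub z₀ z
        have h2 := mem_ball_iff_norm'.1 hz
        linarith
      have h2 := mem_ball_zero_iff.1 hw
      have := norm_sub_le z w
      linarith
    have := tendsto_integral_filter_of_dominated_convergence (l := 𝓝 z₀)
      (F := fun z w => ‖k (z - w) * (S.v w) - k (z₀ - w) * (S.v w)‖) (f := fun _ => 0)
      (fun w => 2 * C * ‖S.v w‖) (.of_forall fun z => ?_) ?_
      (S.integrable_v.norm.const_mul _) (.of_forall fun w => ?_)
    · simpa using this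
    · have hz z : AEStronglyMeasurable fun w => k (z - w) * (S.v w) :=
        (S.integrable_mul_v (by fun_prop)).aestronglyMeasurable
      fun_prop
    · filter_upwards [Metric.ball_mem_nhds z₀ one_pos] with z hz
      refine .of_forall fun w => ?_
      rw [norm_norm, ← sub_mul, norm_mul, norm_real]
      by_cases hw : w ∈ ball 0 S.R
      · have h1 := hC' z hz w hw
        have h2 := hC' z₀ (Metric.mem_ball_self one_pos) w hw
        have h3 := norm_sub_le (k (z - w)) (k (z₀ - w))
        gcongr
        linarith
      · simp [S.v_eq_zero hw]
    · have : Continuous fun z => ‖k (z - w) * (S.v w) - k (z₀ - w) * (S.v w)‖ := by fun_prop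
      simpa using this.tendsto z₀

lemma good_of_approx {k : ℂ → ℂ}
    (h : ∀ ε > 0, ∃ k' : ℂ → ℂ, Continuous k' ∧ ∀ z,
      Integrable (fun w => (k (z - w) - k' (z - w)) * (S.v w : ℂ)) ∧
      ∫ w, ‖(k (z - w) - k' (z - w)) * (S.v w : ℂ)‖ ≤ ε) : S.Good k where
  integrable z := by
    obtain ⟨k', hk', h1⟩ := h 1 one_pos
    have := (h1 z).1.add ((S.good_of_continuous hk').integrable z)
    simpa only [Pi.add_def, ← add_mul, sub_add_cancel] using this
  tendsto z₀ := by
    rw [Metric.tendsto_nhds]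
    intro ε hε
    obtain ⟨k', hk', h1⟩ := h (ε / 3) (by positivity)
    have hg := S.good_of_continuous hk'
    filter_upwards [Metric.tendsto_nhds.1 (hg.tendsto z₀) (ε / 3) (by positivity)] with z hz
    rw [dist_zero_right, norm_of_nonneg (integral_nonneg fun w => norm_nonneg _)] at hz ⊢
    have i0 := ((hg.integrable z).sub (hg.integrable z₀)).norm
    simp only [Pi.sub_apply] at i0
    have i1 := (h1 z).1.norm
    have i2 := (h1 z₀).1.norm
    have i3 := (i1.add i2).add i0
    calc _ ≤ ∫ w, (‖(k (z - w) - k' (z - w)) * (S.v w)‖ +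
          ‖(k (z₀ - w) - k' (z₀ - w)) * (S.v w)‖ +
          ‖k' (z - w) * (S.v w) - k' (z₀ - w) * (S.v w)‖) := by
          refine integral_mono_of_nonneg (.of_forall fun w => norm_nonneg _) i3
            (.of_forall fun w => ?_)
          refine le_trans (le_of_eq ?_) ((norm_add_le _ _).trans
            (add_le_add (norm_sub_le ((k (z - w) - k' (z - w)) * (S.v w))
              ((k (z₀ - w) - k' (z₀ - w)) * (S.v w))) le_rfl))
          ring_nf
      _ < ε := by
          have i12 := i1.add i2
          simp only [Pi.add_def] at i12
          rw [integral_add i12 i0, integral_add i1 i2]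
          linarith [(h1 z).2, (h1 z₀).2]

lemma Good.integrable_mul {S : Setup} {k : ℂ → ℂ} (hk : S.Good k) {F : ℂ → ℂ} {M : ℝ}
    (hF : AEStronglyMeasurable F) (hM : ∀ᵐ w, ‖F w‖ ≤ M) (z : ℂ) :
    Integrable fun w => k (z - w) * (S.v w : ℂ) * F w := by
  have := (hk.integrable z).bdd_mul hF hM
  grind

lemma Good.continuous_integral {S : Setup} {k : ℂ → ℂ} (hk : S.Good k) {F : ℂ → ℂ} {M : ℝ}
    (hF : AEStronglyMeasurable F) (hM : ∀ᵐ w, ‖F w‖ ≤ M) :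
    Continuous fun z => ∫ w, k (z - w) * (S.v w : ℂ) * F w := by
  refine continuous_iff_continuousAt.2 fun z₀ => ?_
  rw [ContinuousAt, tendsto_iff_norm_sub_tendsto_zero]
  have h := (hk.tendsto z₀).const_mul M
  rw [mul_zero] at h
  refine squeeze_zero (fun z => norm_nonneg _) (fun z => ?_) h
  have i0 := ((hk.integrable z).sub (hk.integrable z₀)).norm
  rw [← integral_sub (hk.integrable_mul hF hM z) (hk.integrable_mul hF hM z₀), ← integral_const_mul]
  refine norm_integral_le_of_norm_le (i0.const_mul M) ?_
  filter_upwards [hM] with w hw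
  rw [← sub_mul, norm_mul, mul_comm]
  gcongr

lemma Good.exists_bound {S : Setup} {k : ℂ → ℂ} (hk : S.Good k) : ∃ C : ℝ, 0 ≤ C ∧
    ∀ z ∈ S.K, ∫ w, ‖k (z - w) * (S.v w : ℂ)‖ ≤ C := by
  have hc : Continuous fun z => ∫ w, ‖k (z - w) * (S.v w)‖ := by
    refine continuous_iff_continuousAt.2 fun z₀ => ?_
    rw [ContinuousAt, tendsto_iff_norm_sub_tendsto_zero]
    refine squeeze_zero (fun z => norm_nonneg _) (fun z => ?_) (hk.tendsto z₀)
    have i0 := ((hk.integrable z).sub (hk.integrable z₀)).norm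
    simp only [Pi.sub_apply] at i0
    rw [← integral_sub (hk.integrable z).norm (hk.integrable z₀).norm]
    refine norm_integral_le_of_norm_le i0 (.of_forall fun w => ?_)
    exact abs_norm_sub_norm_le _ _
  obtain ⟨C, hC⟩ := (isCompact_closedBall 0 S.R).exists_bound_of_continuousOn hc.continuousOn
  exact ⟨max C 0, le_max_right _ _, fun z hz =>
    (le_abs_self _).trans ((hC z hz).trans (le_max_left _ _))⟩

/-- The integral operator with kernel `k(z - w) v(w)` on continuous functions on the disc. -/
def kop {k : ℂ → ℂ} (hk : S.Good k) : S.X →L[ℂ] S.X :=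
  LinearMap.mkContinuousOfExistsBound
    { toFun := fun f => S.res ⟨fun z => ∫ w, k (z - w) * (S.v w : ℂ) * S.ext f w,
        hk.continuous_integral (S.continuous_ext f).aestronglyMeasurable
          (.of_forall (S.norm_ext_le f))⟩
      map_add' := fun f g => by
        ext z
        change ∫ w, k (z - w) * (S.v w) * S.ext (f + g) w =
          (∫ w, k (z - w) * (S.v w) * S.ext f w) + ∫ w, k (z - w) * (S.v w) * S.ext g w
        rw [← integral_add (hk.integrable_mul (S.continuous_ext f).aestronglyMeasurable
          (.of_forall (S.norm_ext_le f)) _)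
          (hk.integrable_mul (S.continuous_ext g).aestronglyMeasurable
          (.of_forall (S.norm_ext_le g)) _)]
        congr 1; simp only [ext, ContinuousMap.add_apply]; ring_nf
      map_smul' := fun c f => by
        ext z
        change ∫ w, k (z - w) * (S.v w) * S.ext (c • f) w = c * ∫ w, k (z - w) * (S.v w) * S.ext f w
        rw [← integral_const_mul]
        congr 1; funext w
        simp only [ext, ContinuousMap.smul_apply, smul_eq_mul]; ring } (by
    obtain ⟨C, hC, h⟩ := hk.exists_bound
    refine ⟨C, fun f => (ContinuousMap.norm_le _ (by positivity)).2 fun z => ?_⟩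
    refine (norm_integral_le_of_norm_le ((hk.integrable z).norm.mul_const ‖f‖)
      (.of_forall fun w => ?_)).trans ?_
    · rw [norm_mul]; gcongr; exact S.norm_ext_le f w
    · rw [integral_mul_const]
      gcongr
      exact h z z.2)

lemma kop_apply {k : ℂ → ℂ} (hk : S.Good k) (f : S.X) (z : S.K) :
    S.kop hk f z = ∫ w, k (z - w) * (S.v w : ℂ) * S.ext f w := rfl

lemma isCompactOperator_kop {k : ℂ → ℂ} (hk : S.Good k) : IsCompactOperator (S.kop hk) := by
  refine isCompactOperator_of_equicontinuous _ fun z₀ ε hε => ?_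
  have h := (hk.tendsto z₀).comp (continuous_subtype_val.tendsto z₀)
  filter_upwards [(tendsto_order.1 h).2 ε hε] with z hz f hf
  rw [kop_apply, kop_apply, ← integral_sub
    (hk.integrable_mul (S.continuous_ext f).aestronglyMeasurable (.of_forall (S.norm_ext_le f)) _)
    (hk.integrable_mul (S.continuous_ext f).aestronglyMeasurable (.of_forall (S.norm_ext_le f)) _)]
  have i0 := ((hk.integrable z).sub (hk.integrable z₀)).norm
  refine (norm_integral_le_of_norm_le i0 (.of_forall fun w => ?_)).trans hz.le
  rw [← sub_mul, norm_mul]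
  exact mul_le_of_le_one_right (norm_nonneg _) ((S.norm_ext_le f w).trans hf)

end Setup

lemma ae_im_mul_conj_ne_zero (z : ℂ) {u : ℂ} (hu : u ≠ 0) :
    ∀ᵐ w : ℂ, ((z - w) * conj u).im ≠ 0 := by
  have h1 : ∀ᵐ w : ℂ, w.im ≠ 0 := by
    have q : ∀ᵐ p : ℝ × ℝ, p.2 ≠ 0 :=
      Measure.quasiMeasurePreserving_snd.ae (compl_mem_ae_iff.2 (measure_singleton 0))
    exact volume_preserving_equiv_real_prod.quasiMeasurePreserving.ae q
  have hu0 : ‖u‖ ≠ 0 := norm_ne_zero_iff.2 hu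
  have h2 : ‖conj u / ‖u‖‖ = 1 := by
    rw [norm_div, RCLike.norm_conj, norm_real, norm_norm, div_self hu0]
  let Φ := rotation (⟨conj u / ‖u‖, mem_sphere_zero_iff_norm.2 h2⟩ : Circle)
  have hΦ ξ : Φ ξ = conj u / ‖u‖ * ξ := rotation_apply _ _
  have h3 := Φ.measurePreserving.quasiMeasurePreserving.ae h1
  have h4 := (Measure.measurePreserving_sub_left (volume : Measure ℂ) z).quasiMeasurePreserving.ae h3
  filter_upwards [h4] with w hw h5
  apply hw
  rw [hΦ]
  have : conj u / ‖u‖ * (z - w) = ((‖u‖⁻¹ : ℝ)) * ((z - w) * conj u) := by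
    push_cast; field_simp
  simp_all

lemma continuousOn_hankelU : ContinuousOn hankelU (Ioi 0) := fun r hr =>
  (isBesselPair_hankelU r hr).1.continuousAt.continuousWithinAt

lemma continuousOn_Gplus {E : ℝ} (hE : 0 < E) : ContinuousOn (Gplus E) {0}ᶜ := by
  have he : 0 < √E := sqrt_pos.2 hE
  refine ContinuousOn.congr ?_ fun x hx => Gplus_eq hE hx
  refine continuousOn_const.mul (continuousOn_hankelU.comp (by fun_prop) fun x hx => ?_)
  simp_all

lemma measurable_Gplus {E : ℝ} (hE : 0 < E) : Measurable (Gplus E) :=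
  measurable_of_continuousOn_compl_singleton 0 (continuousOn_Gplus hE)

/-- The outgoing Green function with its singularity truncated. -/
def GplusTrunc (E η : ℝ) (x : ℂ) : ℂ :=
  -(1 / (2 * π)) * hankelU (√E * max η ‖x‖)

lemma continuous_GplusTrunc {E η : ℝ} (hE : 0 < E) (hη : 0 < η) : Continuous (GplusTrunc E η) := by
  have he : 0 < √E := sqrt_pos.2 hE
  refine continuous_const.mul (continuousOn_hankelU.comp_continuous (by fun_prop) fun x => ?_)
  simp_all

lemma exists_norm_Gplus_sub_le {E δ : ℝ} (hE : 0 < E) (h0 : 0 < δ) (h1 : δ < 1) :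
    ∃ C : ℝ, 0 ≤ C ∧ ∀ η : ℝ, 0 < η → η ≤ 1 → ∀ x : ℂ, x.im ≠ 0 →
      ‖Gplus E x - GplusTrunc E η x‖ ≤ C * η ^ (δ / 2) * |x.im| ^ (-δ) := by
  have he : 0 < √E := sqrt_pos.2 hE
  have hS := sinhInt_nonneg (δ / 2)
  refine ⟨2 * ((√E) ^ (-(δ / 2)) * sinhInt (δ / 2)) + π, by positivity, fun η hη hη1 x hx => ?_⟩
  have hx0 : x ≠ 0 := by rintro rfl; simp at hx
  have hr : 0 < ‖x‖ := norm_pos_iff.2 hx0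
  have hxi : 0 < |x.im| := abs_pos.2 hx
  rcases le_or_gt η ‖x‖ with h | h
  · rw [Gplus_eq hE hx0, GplusTrunc, max_eq_right h, sub_self, norm_zero]; positivity
  · rw [Gplus_eq hE hx0, GplusTrunc, max_eq_left h.le, ← mul_sub, norm_mul]
    have hπ : ‖(-(1 / (2 * π)) : ℂ)‖ ≤ 1 := by
      rw [norm_neg, norm_div, norm_one, norm_mul, norm_real, norm_of_nonneg pi_pos.le,
        Complex.norm_ofNat, div_le_one (by positivity)]
      linarith [Real.pi_gt_three]
    have n1 := norm_hankelU_le (half_pos h0) (by linarith) (mul_pos he hr)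
    have n2 := norm_hankelU_le (half_pos h0) (by linarith) (mul_pos he hη)
    rw [mul_rpow he.le hr.le] at n1
    rw [mul_rpow he.le hη.le] at n2
    have m1 : η ^ (-(δ / 2)) ≤ ‖x‖ ^ (-(δ / 2)) :=
      rpow_le_rpow_of_nonpos hr h.le (by linarith)
    have m2 : 1 ≤ ‖x‖ ^ (-(δ / 2)) :=
      Real.one_le_rpow_of_pos_of_le_one_of_nonpos hr (h.le.trans hη1) (by linarith)
    have m3 : ‖x‖ ^ (-(δ / 2)) ≤ η ^ (δ / 2) * |x.im| ^ (-δ) := by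
      have e1 : ‖x‖ ^ (-(δ / 2)) = ‖x‖ ^ (δ / 2) * ‖x‖ ^ (-δ) := by
        rw [← rpow_add hr]; ring_nf
      rw [e1]
      exact mul_le_mul (Real.rpow_le_rpow hr.le h.le (by linarith))
        (rpow_le_rpow_of_nonpos hxi (abs_im_le_norm x) (by linarith))
        (by positivity) (by positivity)
    set A := (√E) ^ (-(δ / 2)) * sinhInt (δ / 2) with hA
    have hA0 : 0 ≤ A := by positivity
    set r := ‖x‖ ^ (-(δ / 2)) with hrd
    have hfin : ‖hankelU (√E * ‖x‖) - hankelU (√E * η)‖ ≤ (2 * A + π) * r := by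
      have n3 := norm_sub_le (hankelU (√E * ‖x‖)) (hankelU (√E * η))
      have e1 : √E ^ (-(δ / 2)) * r * sinhInt (δ / 2) = A * r := by rw [hA]; ring
      have e2 : √E ^ (-(δ / 2)) * η ^ (-(δ / 2)) * sinhInt (δ / 2) = A * η ^ (-(δ / 2)) := by
        rw [hA]; ring
      rw [e1] at n1
      rw [e2] at n2
      have m4 := mul_le_mul_of_nonneg_left m1 hA0
      have m5 := mul_le_mul_of_nonneg_left m2 pi_pos.le
      linarith
    calc _ ≤ 1 * ((2 * A + π) * r) := mul_le_mul hπ hfin (norm_nonneg _) zero_le_one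
      _ ≤ (2 * A + π) * (η ^ (δ / 2) * |x.im| ^ (-δ)) := by
          rw [one_mul]; gcongr
      _ = _ := by ring

lemma differentiable_smulRight_mul {X : Type*} [NormedCommRing X] [NormedAlgebra ℂ X]
    (ℓ : X →L[ℂ] ℂ) {a b : ℂ → X} (ha : Differentiable ℂ a) (hb : Differentiable ℂ b) :
    Differentiable ℂ fun w => (ℓ ∘L ContinuousLinearMap.mul ℂ X (a w)).smulRight (b w) := by
  fun_prop

namespace Setup

variable (S : Setup)

lemma good_Gplus : S.Good (Gplus S.E) := by
  obtain ⟨C, hC, h⟩ := exists_norm_Gplus_sub_le S.hE S.δ_pos S.δ_lt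
  obtain ⟨W, hW, hw⟩ := S.exists_weight_bound
  have hδ := S.δ_pos
  refine S.good_of_approx fun ε hε => ?_
  have hlim : Tendsto (fun η : ℝ => C * η ^ (S.δ / 2) * W) (𝓝[>] 0) (𝓝 0) := by
    have h1 : Tendsto (fun η : ℝ => η ^ (S.δ / 2)) (𝓝[>] 0) (𝓝 0) := by
      have := (Real.continuousAt_rpow_const 0 (S.δ / 2) (Or.inr (by linarith))).tendsto
      rw [Real.zero_rpow (by linarith)] at this
      exact this.mono_left nhdsWithin_le_nhds
    simpa using (h1.const_mul C).mul_const W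
  obtain ⟨η, hη1, hη2, hη3⟩ := ((tendsto_order.1 hlim).2 ε hε |>.and
    (Ioc_mem_nhdsGT (zero_lt_one' ℝ))).exists
  refine ⟨GplusTrunc S.E η, continuous_GplusTrunc S.hE hη2, fun z => ?_⟩
  obtain ⟨i1, i2⟩ := hw z 1 (by simp)
  have hle : ∀ᵐ w, ‖(Gplus S.E (z - w) - GplusTrunc S.E η (z - w)) * (S.v w)‖ ≤
      C * η ^ (S.δ / 2) * (|((z - w) * conj 1).im| ^ (-S.δ) * |S.v w|) := by
    filter_upwards [ae_im_mul_conj_ne_zero z one_ne_zero] with w hne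
    rw [map_one, mul_one] at hne ⊢
    rw [norm_mul, norm_real, norm_eq_abs, ← mul_assoc]
    gcongr
    exact h η hη2 hη3 _ hne
  have hm : AEStronglyMeasurable
      fun w => (Gplus S.E (z - w) - GplusTrunc S.E η (z - w)) * (S.v w) := by
    refine AEStronglyMeasurable.mul (Measurable.aestronglyMeasurable ?_)
      S.integrable_vC.aestronglyMeasurable
    have := measurable_Gplus S.hE
    have := (continuous_GplusTrunc S.hE hη2).measurable
    fun_prop
  have hi := (i1.const_mul (C * η ^ (S.δ / 2))).mono' hm hle
  refine ⟨hi, ?_⟩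
  refine (integral_mono_ae hi.norm (i1.const_mul _) hle).trans ?_
  rw [integral_const_mul]
  refine (mul_le_mul_of_nonneg_left i2 (by positivity)).trans hη1.le

/-- The plane wave on the disc. -/
def Phi (s : ℂ) : S.X :=
  S.res ⟨fun z => phi0 S.E z s, by unfold phi0; fun_prop⟩

lemma Phi_apply (s : ℂ) (z : S.K) : S.Phi s z = phi0 S.E z s := rfl

/-- Integration against the potential. -/
def ell : S.X →L[ℂ] ℂ :=
  LinearMap.mkContinuous
    { toFun := fun f => ∫ w, S.ext f w * (S.v w : ℂ)
      map_add' := fun f g => by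
        rw [← integral_add (S.integrable_mul_v (S.continuous_ext f))
          (S.integrable_mul_v (S.continuous_ext g))]
        congr 1; funext w
        simp only [ext, ContinuousMap.add_apply]; ring
      map_smul' := fun c f => by
        rw [RingHom.id_apply, smul_eq_mul, ← integral_const_mul]
        congr 1; funext w
        simp only [ext, ContinuousMap.smul_apply, smul_eq_mul]; ring } (∫ w, ‖S.v w‖) (fun f => by
    refine (norm_integral_le_of_norm_le (S.integrable_v.norm.mul_const ‖f‖)
      (.of_forall fun w => ?_)).trans (le_of_eq (integral_mul_const _ _))
    rw [norm_mul, norm_real, mul_comm]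
    gcongr
    exact S.norm_ext_le f w)

lemma ell_apply (f : S.X) : S.ell f = ∫ w, S.ext f w * (S.v w : ℂ) := rfl

/-- The rank one operator with kernel `φ₀(z - w, s) v(w)`. -/
def Theta (s : ℂ) : S.X →L[ℂ] S.X :=
  (S.ell ∘L ContinuousLinearMap.mul ℂ S.X (S.Phi (-s))).smulRight (S.Phi s)

lemma Theta_apply (s : ℂ) (f : S.X) : S.Theta s f = S.ell (S.Phi (-s) * f) • S.Phi s := rfl

lemma Theta_apply_apply (s : ℂ) (f : S.X) (z : S.K) :
    S.Theta s f z = ∫ w, phi0 S.E (z - w) s * (S.v w : ℂ) * S.ext f w := by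
  rw [Theta_apply, ContinuousMap.smul_apply, ell_apply, smul_eq_mul, Phi_apply, mul_comm,
    ← integral_const_mul]
  congr 1; funext w
  by_cases hw : w ∈ ball 0 S.R
  · rw [S.ext_of_mem _ (ball_subset_closedBall hw),
      S.ext_of_mem _ (ball_subset_closedBall hw), phi0_sub, ContinuousMap.mul_apply, Phi_apply]
    ring
  · simp [S.v_eq_zero hw]

lemma differentiable_Phi_exp : Differentiable ℂ fun w => S.Phi (cexp w) := by
  set a : S.X := S.res ⟨fun z => conj z, by fun_prop⟩ with ha
  set b : S.X := S.res ⟨fun z => z, by fun_prop⟩ with hb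
  have h : (fun w => S.Phi (cexp w)) = fun w => NormedSpace.exp
      ((I * (√S.E / 2 : ℂ) * cexp w) • a + (I * (√S.E / 2 : ℂ) * cexp (-w)) • b) := by
    funext w
    ext z
    have := NormedSpace.map_exp (ContinuousMap.evalAlgHom ℂ ℂ z) (continuous_eval_const z)
      ((I * (√S.E / 2 : ℂ) * cexp w) • a + (I * (√S.E / 2 : ℂ) * cexp (-w)) • b)
    refine Eq.trans ?_ this.symm
    rw [← Complex.exp_eq_exp_ℂ, Phi_apply, phi0]
    congr 1
    change _ = (I * (√S.E / 2 : ℂ) * cexp w) * conj (z : ℂ) + (I * (√S.E / 2 : ℂ) * cexp (-w)) * z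
    rw [exp_neg]; ring
  rw [h]
  have hexp : Differentiable ℂ (NormedSpace.exp : S.X → S.X) := fun x =>
    (NormedSpace.exp_analytic x).differentiableAt
  fun_prop

lemma differentiable_Phi_neg_exp : Differentiable ℂ fun w => S.Phi (-cexp w) := by
  have h := S.differentiable_Phi_exp.comp (differentiable_id.add_const (π * I))
  have e : (fun w => S.Phi (-cexp w)) = (fun w => S.Phi (cexp w)) ∘ fun w => id w + (π * I) := by
    funext w
    simp only [Function.comp_apply, id]
    rw [exp_add, exp_pi_mul_I, mul_neg_one]
  rw [e]; exact h

lemma differentiable_Theta_exp : Differentiable ℂ fun w => S.Theta (cexp w) :=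
  differentiable_smulRight_mul S.ell S.differentiable_Phi_neg_exp S.differentiable_Phi_exp

end Setup

lemma sub_eq_integral_of_primitive {X : Type*} [NormedAddCommGroup X] [NormedSpace ℂ X]
    [CompleteSpace X] {P F : ℂ → X} (hP : ∀ w, HasDerivAt P (F w) w) (hF : Continuous F) (a b : ℂ) :
    P b - P a = (b - a) • ∫ s in (0 : ℝ)..1, F (a + s * (b - a)) := by
  have hd (s : ℝ) : HasDerivAt (fun s : ℝ => P (a + s * (b - a))) ((b - a) • F (a + s * (b - a))) s := by
    have h1 : HasDerivAt (fun w : ℂ => a + w * (b - a)) (b - a) s := by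
      simpa using ((hasDerivAt_id (s : ℂ)).mul_const (b - a)).const_add a
    exact (hP _).scomp s h1.comp_ofReal
  have := integral_eq_sub_of_hasDerivAt (a := 0) (b := 1) (fun s _ => hd s)
    (Continuous.intervalIntegrable (by fun_prop) _ _)
  simp_all

lemma hasDerivAt_clm_comp {X Y : Type*} [NormedAddCommGroup X] [NormedSpace ℂ X]
    [NormedAddCommGroup Y] [NormedSpace ℂ Y] (L : X →L[ℂ] Y) {P : ℂ → X} {P' : X} {w : ℂ}
    (h : HasDerivAt P P' w) : HasDerivAt (fun w => L (P w)) (L P') w :=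
  L.hasFDerivAt.comp_hasDerivAt w h

/-- The increment between `a` and `b` of a primitive of `w ↦ φ₀(x, exp w)`. -/
def segInt (E : ℝ) (a b x : ℂ) : ℂ :=
  (b - a) * ∫ s in (0 : ℝ)..1, phi0 E x (cexp (a + s * (b - a)))

lemma continuous_phi0_exp (E : ℝ) : Continuous fun p : ℂ × ℂ => phi0 E p.1 (cexp p.2) := by
  simp only [phi0_exp]; fun_prop

lemma segInt_eq {E : ℝ} {x : ℂ} {P : ℂ → ℂ} (hP : ∀ w, HasDerivAt P (phi0 E x (cexp w)) w)
    (a b : ℂ) : segInt E a b x = P b - P a := by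
  rw [sub_eq_integral_of_primitive hP (differentiable_phi0_exp E x).continuous, segInt, smul_eq_mul]

lemma continuous_segInt (E : ℝ) (a b : ℂ) : Continuous (segInt E a b) := by
  refine continuous_const.mul ?_
  refine intervalIntegral.continuous_parametric_intervalIntegral_of_continuous' ?_ 0 1
  exact (continuous_phi0_exp E).comp (f := fun p : ℂ × ℝ => (p.1, a + p.2 * (b - a))) (by fun_prop)

/-- The logarithm of `-1/l̄` corresponding to the logarithm `ω` of `l`. -/
def antiLog (σ : ℝ) (ω : ℂ) : ℂ := -conj ω - σ * π * I

namespace Setup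

variable (S : Setup)

/-- A primitive of `w ↦ Θ(exp w)`. -/
def Psi : ℂ → S.X →L[ℂ] S.X :=
  Classical.choose S.differentiable_Theta_exp.isExactOn_univ

lemma hasDerivAt_Psi (w : ℂ) : HasDerivAt S.Psi (S.Theta (cexp w)) w :=
  Classical.choose_spec S.differentiable_Theta_exp.isExactOn_univ w (mem_univ w)

lemma Psi_sub_apply (a b : ℂ) (f : S.X) (z : S.K) :
    (S.Psi b - S.Psi a) f z = ∫ w, segInt S.E a b (z - w) * (S.v w : ℂ) * S.ext f w := by
  let ev : (S.X →L[ℂ] S.X) →L[ℂ] ℂ :=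
    (ContinuousMap.evalCLM ℂ z).comp (ContinuousLinearMap.apply ℂ S.X f)
  have hd w : HasDerivAt (fun w => S.Psi w f z) (S.Theta (cexp w) f z) w :=
    hasDerivAt_clm_comp (X := S.X →L[ℂ] S.X) ev (S.hasDerivAt_Psi w)
  have hc : Continuous fun w => S.Theta (cexp w) f z :=
    ev.continuous.comp S.differentiable_Theta_exp.continuous
  have h1 := sub_eq_integral_of_primitive hd hc a b
  change S.Psi b f z - S.Psi a f z = _
  rw [h1]
  simp only [Theta_apply_apply, smul_eq_mul, segInt]
  rw [integral_of_le zero_le_one, integral_integral_swap, ← integral_const_mul]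
  · congr 1; funext w
    rw [integral_of_le zero_le_one, mul_assoc, mul_assoc, ← integral_mul_const]
    simp only [mul_assoc]
  · have hcont : Continuous fun p : ℝ × ℂ =>
        phi0 S.E (z - p.2) (cexp (a + p.1 * (b - a))) * S.ext f p.2 :=
      ((continuous_phi0_exp S.E).comp (f := fun p : ℝ × ℂ => (z - p.2, a + p.1 * (b - a)))
        (by fun_prop)).mul ((S.continuous_ext f).comp continuous_snd)
    obtain ⟨C, hC⟩ := (isCompact_Icc (a := 0) (b := 1)).prod
      (isCompact_closedBall 0 S.R) |>.exists_bound_of_continuousOn hcont.continuousOn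
    have hone : Integrable (fun _ : ℝ => C) (volume.restrict (Ioc 0 1)) := by simp
    have hi := hone.mul_prod S.integrable_v.norm
    refine hi.mono' ?_ ?_
    · have hv : AEStronglyMeasurable (fun p : ℝ × ℂ => (S.v p.2 : ℂ))
          ((volume.restrict (Ioc 0 1)).prod volume) :=
        S.integrable_vC.aestronglyMeasurable.comp_snd
      refine (hcont.aestronglyMeasurable.mul hv).congr (.of_forall fun p => ?_)
      simp only [Pi.mul_apply, Function.uncurry]; ring
    · have : (volume.restrict (Ioc 0 1)).prod (volume : Measure ℂ) =
          (volume.prod volume).restrict (Ioc (0 : ℝ) 1 ×ˢ univ) := by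
        rw [← Measure.prod_restrict, Measure.restrict_univ]
      rw [this]
      filter_upwards [ae_restrict_mem (measurableSet_Ioc.prod MeasurableSet.univ)] with p hp
      simp only [Function.uncurry]
      by_cases hw : p.2 ∈ ball 0 S.R
      · have := hC p ⟨Ioc_subset_Icc_self hp.1, ball_subset_closedBall hw⟩
        rw [norm_mul] at this
        rw [norm_mul, norm_mul, norm_real, mul_right_comm]
        gcongr
      · simp [S.v_eq_zero hw]

/-- The operator with kernel `G⁺(z - w) v(w)`. -/
def Tplus : S.X →L[ℂ] S.X := S.kop S.good_Gplus

/-- The operator with kernel `φ₀(z - w, l) g(z - w, l) v(w)`, `ω` a logarithm of `l`, `σ` the sign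
of `|l| - 1`. -/
def TOp (σ : ℝ) (ω : ℂ) : S.X →L[ℂ] S.X :=
  S.Tplus + (σ / (4 * π) : ℂ) • (S.Psi ω - S.Psi (antiLog σ ω))

/-- The function `φ₀ g`, up to a null set. -/
def kT (σ : ℝ) (ω x : ℂ) : ℂ :=
  Gplus S.E x + σ / (4 * π) * segInt S.E (antiLog σ ω) ω x

lemma good_kT (σ : ℝ) (ω : ℂ) : S.Good (S.kT σ ω) :=
  S.good_Gplus.add (S.good_of_continuous (continuous_const.mul (continuous_segInt S.E _ _)))

lemma TOp_eq_kop (σ : ℝ) (ω : ℂ) : S.TOp σ ω = S.kop (S.good_kT σ ω) := by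
  ext f z
  have e1 : S.TOp σ ω f z = S.Tplus f z + (σ / (4 * π)) * (S.Psi ω - S.Psi (antiLog σ ω)) f z := rfl
  have i1 := S.good_Gplus.integrable_mul (S.continuous_ext f).aestronglyMeasurable
    (.of_forall (S.norm_ext_le f)) z
  have i2 := (S.good_of_continuous (continuous_segInt S.E (antiLog σ ω) ω)).integrable_mul
    (S.continuous_ext f).aestronglyMeasurable (.of_forall (S.norm_ext_le f)) z
  rw [e1, Psi_sub_apply, Tplus, kop_apply, kop_apply, ← integral_const_mul,
    ← integral_add i1 (i2.const_mul _)]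
  congr 1; funext w
  rw [kT]; ring

lemma isCompactOperator_TOp (σ : ℝ) (ω : ℂ) : IsCompactOperator (S.TOp σ ω) := by
  rw [TOp_eq_kop]; exact S.isCompactOperator_kop _

lemma isCompactOperator_Tplus : IsCompactOperator S.Tplus :=
  S.isCompactOperator_kop _

end Setup

lemma isUnit_one_sub_of_isCompactOperator {X : Type*} [NormedAddCommGroup X] [NormedSpace ℂ X]
    [CompleteSpace X] {T : X →L[ℂ] X} (hT : IsCompactOperator T) (h : ∀ f, T f = f → f = 0) :
    IsUnit (1 - T) := by
  rcases hT.hasEigenvalue_or_mem_resolventSet (one_ne_zero) with h1 | h1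
  · obtain ⟨f, hf⟩ := h1.exists_hasEigenvector
    have := hf.apply_eq_smul
    rw [one_smul] at this
    exact absurd (h f this) hf.2
  · have := spectrum.mem_resolventSet_iff.1 h1
    simpa using this

lemma inverse_one_sub_apply {X : Type*} [NormedAddCommGroup X] [NormedSpace ℂ X]
    {T : X →L[ℂ] X} (hT : IsUnit (1 - T)) {f g : X} :
    inverse (1 - T) g = f ↔ f = g + T f := by
  have h1 : inverse (1 - T) * (1 - T) = 1 := Ring.inverse_mul_cancel _ hT
  have h2 : (1 - T) * inverse (1 - T) = 1 := Ring.mul_inverse_cancel _ hT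
  constructor
  · rintro rfl
    have := DFunLike.congr_fun h2 g
    grind
  · intro h
    have h3 : g = (1 - T) f := by
      change g = f - T f
      exact (sub_eq_iff_eq_add.2 h).symm
    grind

lemma continuous_phi0 (E : ℝ) (l : ℂ) : Continuous fun z => phi0 E z l := by
  unfold phi0; fun_prop

lemma sgn_ne {l : ℂ} (hl : ‖l‖ ≠ 1) : sgn l = 1 ∧ 1 < ‖l‖ ∨ sgn l = -1 ∧ ‖l‖ < 1 := by
  rcases lt_or_gt_of_ne hl with h | h
  · exact Or.inr ⟨sgn_of_lt_one h, h⟩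
  · exact Or.inl ⟨sgn_of_one_lt h, h⟩

namespace Setup

variable (S : Setup)

/-- Locally bounded solutions of `F = φ₀(·, l) + ∫ k(· - w) v(w) F(w) dw`. -/
def IsSol (k : ℂ → ℂ) (l : ℂ) (F : ℂ → ℂ) : Prop :=
  MemLp F ⊤ (volume.restrict (ball 0 S.R)) ∧
    ∀ z, F z = phi0 S.E z l + ∫ w, k (z - w) * (S.v w : ℂ) * F w

/-- The solution on the plane determined by its restriction to the disc. -/
def glob (k : ℂ → ℂ) (l : ℂ) (f : S.X) (z : ℂ) : ℂ :=
  phi0 S.E z l + ∫ w, k (z - w) * (S.v w : ℂ) * S.ext f w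

lemma Good.continuous_glob {S : Setup} {k : ℂ → ℂ} (hk : S.Good k) (l : ℂ) (f : S.X) :
    Continuous (S.glob k l f) :=
  (continuous_phi0 _ _).add (hk.continuous_integral (S.continuous_ext f).aestronglyMeasurable
    (.of_forall (S.norm_ext_le f)))

lemma glob_apply {k : ℂ → ℂ} (hk : S.Good k) {l : ℂ} {f : S.X}
    (hf : f = S.Phi l + S.kop hk f) (z : S.K) : S.glob k l f z = f z := by
  conv_rhs => rw [hf]
  rfl

lemma integral_congr_ball {a F G : ℂ → ℂ} (h : ∀ w ∈ ball (0 : ℂ) S.R, F w = G w) :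
    ∫ w, a w * (S.v w : ℂ) * F w = ∫ w, a w * (S.v w : ℂ) * G w := by
  congr 1; funext w
  by_cases hw : w ∈ ball 0 S.R
  · rw [h w hw]
  · simp [S.v_eq_zero hw]

lemma isSol_iff {k : ℂ → ℂ} (hk : S.Good k) {l : ℂ} {F : ℂ → ℂ} :
    S.IsSol k l F ↔ ∃ f : S.X, f = S.Phi l + S.kop hk f ∧ F = S.glob k l f := by
  constructor
  · rintro ⟨h1, h2⟩
    set F1 := (ball 0 S.R).indicator F with hF1
    have hm : AEStronglyMeasurable F1 :=
      (aestronglyMeasurable_indicator_iff isOpen_ball.measurableSet).2 h1.aestronglyMeasurable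
    obtain ⟨M, hM⟩ : ∃ M : ℝ, ∀ᵐ w, ‖F1 w‖ ≤ M := by
      have hb := ae_le_eLpNormEssSup (f := F) (μ := volume.restrict (ball 0 S.R))
      have htop : eLpNormEssSup F (volume.restrict (ball 0 S.R)) ≠ ⊤ := by
        have := h1.2.ne
        rwa [eLpNorm_exponent_top] at this
      refine ⟨(eLpNormEssSup F (volume.restrict (ball 0 S.R))).toReal, ?_⟩
      filter_upwards [(ae_restrict_iff' isOpen_ball.measurableSet).1 hb] with w hw
      by_cases hwb : w ∈ ball 0 S.R
      · rw [hF1, indicator_of_mem hwb, ← toReal_enorm]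
        exact ENNReal.toReal_mono htop (hw hwb)
      · rw [hF1, indicator_of_notMem hwb, norm_zero]; exact ENNReal.toReal_nonneg
    have h3 z : F z = phi0 S.E z l + ∫ w, k (z - w) * (S.v w) * F1 w := by
      rw [h2 z, S.integral_congr_ball fun w hw => (indicator_of_mem hw F).symm]
    have hc : Continuous F := by
      rw [show F = _ from funext h3]
      exact (continuous_phi0 _ _).add (hk.continuous_integral hm hM)
    refine ⟨S.res ⟨F, hc⟩, ?_, ?_⟩
    · ext z
      change F z = phi0 S.E z l + ∫ w, k (z - w) * (S.v w) * S.ext (S.res ⟨F, hc⟩) w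
      rw [h2 z]
      congr 1
      exact S.integral_congr_ball fun w hw =>
        (S.ext_of_mem (S.res ⟨F, hc⟩) (ball_subset_closedBall hw)).symm
    · funext z
      rw [h2 z, glob]
      congr 1
      exact S.integral_congr_ball fun w hw =>
        (S.ext_of_mem (S.res ⟨F, hc⟩) (ball_subset_closedBall hw)).symm
  · rintro ⟨f, hf, rfl⟩
    refine ⟨?_, fun z => ?_⟩
    · have hc := hk.continuous_glob l f
      obtain ⟨C, hC⟩ := (isCompact_closedBall 0 S.R).exists_bound_of_continuousOn hc.continuousOn
      refine memLp_top_of_bound hc.aestronglyMeasurable C ?_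
      filter_upwards [ae_restrict_mem isOpen_ball.measurableSet] with w hw
      exact hC w (ball_subset_closedBall hw)
    · conv_lhs => rw [glob]
      congr 1
      refine S.integral_congr_ball fun w hw => ?_
      rw [S.ext_of_mem _ (ball_subset_closedBall hw),
        S.glob_apply hk hf ⟨w, ball_subset_closedBall hw⟩]

lemma isSol_iff_of_isUnit {k : ℂ → ℂ} (hk : S.Good k) (hU : IsUnit (1 - S.kop hk))
    {l : ℂ} {F : ℂ → ℂ} :
    S.IsSol k l F ↔ F = S.glob k l (inverse (1 - S.kop hk) (S.Phi l)) := by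
  rw [S.isSol_iff hk]
  constructor
  · rintro ⟨f, hf, rfl⟩
    rw [(inverse_one_sub_apply hU).2 hf]
  · intro h
    exact ⟨_, (inverse_one_sub_apply hU).1 rfl, h⟩

lemma isUnit_of_existsUnique {k : ℂ → ℂ} (hk : S.Good k) {l : ℂ}
    (h : ∃! F, S.IsSol k l F) : IsUnit (1 - S.kop hk) := by
  refine isUnit_one_sub_of_isCompactOperator (S.isCompactOperator_kop hk) fun f hf => ?_
  obtain ⟨F, hF, huniq⟩ := h
  obtain ⟨f₀, hf₀, rfl⟩ := (S.isSol_iff hk).1 hF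
  have h1 : f₀ + f = S.Phi l + S.kop hk (f₀ + f) := by
    rw [map_add, hf, ← add_assoc, ← hf₀]
  have h2 := huniq _ ((S.isSol_iff hk).2 ⟨f₀ + f, h1, rfl⟩)
  ext z
  have h3 := congrFun h2 z
  rw [S.glob_apply hk h1, S.glob_apply hk hf₀] at h3
  simpa using h3

lemma isScatteringSolution_iff {l : ℂ} {F : ℂ → ℂ} :
    IsScatteringSolution S.E S.v l F ↔ S.IsSol (Gplus S.E) l F := by
  constructor
  · rintro ⟨h1, h2⟩
    exact ⟨h1 S.R, h2⟩
  · intro h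
    refine ⟨fun R => ?_, h.2⟩
    obtain ⟨f, -, rfl⟩ := (S.isSol_iff S.good_Gplus).1 h
    have hc := S.good_Gplus.continuous_glob l f
    obtain ⟨C, hC⟩ := (isCompact_closedBall 0 R).exists_bound_of_continuousOn hc.continuousOn
    refine memLp_top_of_bound hc.aestronglyMeasurable C ?_
    filter_upwards [ae_restrict_mem isOpen_ball.measurableSet] with w hw
    exact hC w (ball_subset_closedBall hw)

lemma phi0_mul_g_ae {l ω : ℂ} (hω : cexp ω = l) (hl : ‖l‖ ≠ 1) (z : ℂ) :
    ∀ᵐ w, phi0 S.E (z - w) l * g S.E (z - w) l = S.kT (sgn l) ω (z - w) := by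
  have hl0 : l ≠ 0 := by rw [← hω]; exact exp_ne_zero _
  filter_upwards [ae_im_mul_conj_ne_zero z hl0] with w hw
  obtain ⟨P, hP⟩ := exists_primitive_phi0_exp S.E (z - w)
  rw [phi0_mul_g S.hE hω hl hw hP, kT, segInt_eq hP, antiLog]

lemma g_ae_eq {l ω : ℂ} (hω : cexp ω = l) (hl : ‖l‖ ≠ 1) (z : ℂ) :
    ∀ᵐ w, g S.E (z - w) l = phi0 S.E (z - w) (-l) * S.kT (sgn l) ω (z - w) := by
  filter_upwards [S.phi0_mul_g_ae hω hl z] with w hw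
  rw [← hw, ← mul_assoc, mul_comm (phi0 _ _ (-l)), phi0_mul_neg, one_mul]

lemma aestronglyMeasurable_g {l : ℂ} (hl0 : l ≠ 0) (hl : ‖l‖ ≠ 1) (z : ℂ) :
    AEStronglyMeasurable fun w => g S.E (z - w) l := by
  have h := S.g_ae_eq (exp_log hl0) hl z
  refine AEStronglyMeasurable.congr (Measurable.aestronglyMeasurable ?_) (h.mono fun w hw => hw.symm)
  have h1 := (continuous_phi0 S.E (-l)).measurable
  have h2 : Measurable (S.kT (sgn l) (Complex.log l)) :=
    (measurable_Gplus S.hE).add (((continuous_segInt S.E _ _).measurable).const_mul _)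
  fun_prop

lemma exists_integral_g_le {ρ₀ : ℝ} (hρ : 1 < ρ₀) : ∃ C : ℝ, 0 ≤ C ∧
    ∀ l : ℂ, l ≠ 0 → ρ₀ ≤ specSize l → ‖l‖ ≠ 1 → ∀ z : ℂ,
      Integrable (fun w => g S.E (z - w) l * (S.v w : ℂ)) ∧
      ∫ w, ‖g S.E (z - w) l * (S.v w : ℂ)‖ ≤ C * √(specSize l) ^ (-S.δ) := by
  obtain ⟨C, hC, h⟩ := norm_g_le S.hE S.δ_pos S.δ_lt hρ
  obtain ⟨W, hW, hw⟩ := S.exists_weight_bound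
  refine ⟨C * W, by positivity, fun l hl hs hl1 z => ?_⟩
  have hl0 : ‖l‖ ≠ 0 := norm_ne_zero_iff.2 hl
  have hu : ‖l / ‖l‖‖ = 1 := by rw [norm_div, norm_real, norm_norm, div_self hl0]
  obtain ⟨i1, i2⟩ := hw z (l / ‖l‖) hu
  have hle : ∀ᵐ w, ‖g S.E (z - w) l * (S.v w)‖ ≤ C * √(specSize l) ^ (-S.δ) *
      (|((z - w) * conj (l / ‖l‖)).im| ^ (-S.δ) * |S.v w|) := by
    filter_upwards [ae_im_mul_conj_ne_zero z hl] with w hne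
    rw [norm_mul, norm_real, norm_eq_abs, ← mul_assoc]
    refine mul_le_mul_of_nonneg_right ((h l (z - w) hl hs hne).trans (le_of_eq ?_)) (abs_nonneg _)
    rw [mul_rpow (Real.sqrt_nonneg _) (abs_nonneg _), mul_assoc]
  have hi := (i1.const_mul (C * √(specSize l) ^ (-S.δ))).mono'
    ((S.aestronglyMeasurable_g hl hl1 z).mul S.integrable_vC.aestronglyMeasurable) hle
  refine ⟨hi, ?_⟩
  refine (integral_mono_ae hi.norm (i1.const_mul _) hle).trans ?_
  rw [integral_const_mul]
  calc _ ≤ C * √(specSize l) ^ (-S.δ) * W := mul_le_mul_of_nonneg_left i2 (by positivity)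
    _ = _ := by ring

lemma phi0_mul_integral_g {l ω : ℂ} (hω : cexp ω = l) (hl : ‖l‖ ≠ 1) (m : ℂ → ℂ) (z : ℂ) :
    phi0 S.E z l * ∫ w, g S.E (z - w) l * (S.v w : ℂ) * m w =
      ∫ w, S.kT (sgn l) ω (z - w) * (S.v w : ℂ) * (phi0 S.E w l * m w) := by
  rw [← integral_const_mul]
  refine integral_congr_ae ?_
  filter_upwards [S.phi0_mul_g_ae hω hl z] with w hw
  rw [← hw]
  nth_rewrite 1 [show z = (z - w) + w by ring]
  rw [phi0_add]; ring

lemma isFaddeevMu_iff {l ω : ℂ} (hω : cexp ω = l) (hl : ‖l‖ ≠ 1)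
    {m : ℂ → ℂ} : IsFaddeevMu S.E S.v l m ↔ S.IsSol (S.kT (sgn l) ω) l fun z => phi0 S.E z l * m z := by
  have hl0 : l ≠ 0 := by rw [← hω]; exact exp_ne_zero _
  constructor
  · rintro ⟨h1, h2⟩
    refine ⟨?_, fun z => ?_⟩
    · obtain ⟨C, hC⟩ := (isCompact_closedBall 0 S.R).exists_bound_of_continuousOn
        (continuous_phi0 S.E l).continuousOn
      have h3 : MemLp (fun z => phi0 S.E z l) ⊤ (volume.restrict (ball 0 S.R)) := by
        refine memLp_top_of_bound (continuous_phi0 S.E l).aestronglyMeasurable C ?_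
        filter_upwards [ae_restrict_mem isOpen_ball.measurableSet] with w hw
        exact hC w (ball_subset_closedBall hw)
      exact (h1.restrict _).mul h3
    · change phi0 S.E z l * m z = _
      rw [← S.phi0_mul_integral_g hω hl, h2 z]; ring
  · intro h
    have h2 z : m z = 1 + ∫ w, g S.E (z - w) l * (S.v w) * m w := by
      have := h.2 z
      simp only at this
      rw [← S.phi0_mul_integral_g hω hl] at this
      have h3 := phi0_ne_zero S.E z l
      apply mul_left_cancel₀ h3
      rw [this]; ring
    refine ⟨?_, h2⟩
    obtain ⟨f, -, hf⟩ := (S.isSol_iff (S.good_kT (sgn l) ω)).1 h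
    have hc : Continuous m := by
      have h4 : m = fun z => phi0 S.E z (-l) * S.glob (S.kT (sgn l) ω) l f z := by
        funext z
        rw [← hf, ← mul_assoc, mul_comm (phi0 _ _ (-l)), phi0_mul_neg, one_mul]
      rw [h4]
      exact (continuous_phi0 _ _).mul ((S.good_kT (sgn l) ω).continuous_glob l f)
    obtain ⟨M, hM⟩ := (isCompact_closedBall 0 S.R).exists_bound_of_continuousOn hc.continuousOn
    obtain ⟨C, -, hC⟩ := S.exists_integral_g_le (one_lt_specSize hl0 hl)
    refine memLp_top_of_bound hc.aestronglyMeasurable (1 + C * √(specSize l) ^ (-S.δ) * M)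
      (.of_forall fun z => ?_)
    obtain ⟨i1, i2⟩ := hC l hl0 le_rfl hl z
    have hM0 : 0 ≤ M := (norm_nonneg _).trans (hM 0 (Metric.mem_closedBall_self S.hR.le))
    rw [h2 z]
    refine (norm_add_le _ _).trans ?_
    rw [norm_one]
    refine add_le_add le_rfl ?_
    refine (norm_integral_le_of_norm_le (i1.norm.mul_const M) (.of_forall fun w => ?_)).trans ?_
    · by_cases hw : w ∈ ball 0 S.R
      · rw [norm_mul]
        gcongr
        exact hM w (ball_subset_closedBall hw)
      · simp [S.v_eq_zero hw]
    · rw [integral_mul_const]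
      gcongr

lemma existsUnique_isFaddeevMu_iff {l ω : ℂ} (hω : cexp ω = l) (hl : ‖l‖ ≠ 1) :
    (∃! m, IsFaddeevMu S.E S.v l m) ↔ IsUnit (1 - S.TOp (sgn l) ω) := by
  rw [TOp_eq_kop]
  have hinv z a : phi0 S.E z l * (phi0 S.E z (-l) * a) = a := by
    rw [← mul_assoc, phi0_mul_neg, one_mul]
  have hinv' z a : phi0 S.E z (-l) * (phi0 S.E z l * a) = a := by
    rw [mul_left_comm]; exact hinv z a
  constructor
  · rintro ⟨m, hm, huniq⟩
    refine S.isUnit_of_existsUnique (S.good_kT (sgn l) ω)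
      ⟨_, (S.isFaddeevMu_iff hω hl).1 hm, fun F hF => ?_⟩
    have : IsFaddeevMu S.E S.v l fun z => phi0 S.E z (-l) * F z := by
      rw [S.isFaddeevMu_iff hω hl]
      simpa only [hinv] using hF
    grind
  · intro hU
    refine ⟨fun z => phi0 S.E z (-l) *
      S.glob (S.kT (sgn l) ω) l (inverse (1 - S.kop (S.good_kT (sgn l) ω)) (S.Phi l)) z, ?_, ?_⟩
    · simp only [S.isFaddeevMu_iff hω hl, hinv]
      exact (S.isSol_iff_of_isUnit _ hU).2 rfl
    · intro m hm
      have := (S.isSol_iff_of_isUnit _ hU).1 ((S.isFaddeevMu_iff hω hl).1 hm)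
      funext z
      rw [← this, hinv']

lemma isFaddeevMu_mu {l : ℂ} (h : ∃! m, IsFaddeevMu S.E S.v l m) :
    IsFaddeevMu S.E S.v l fun z => mu S.E S.v z l :=
  Classical.epsilon_spec h.exists

/-- The Faddeev solution on the disc, by the resolvent. -/
def psiX (σ : ℝ) (ω : ℂ) : S.X :=
  inverse (1 - S.TOp σ ω) (S.Phi (cexp ω))

lemma psi_eq {l ω : ℂ} (hω : cexp ω = l) (hl : ‖l‖ ≠ 1)
    (hU : IsUnit (1 - S.TOp (sgn l) ω)) (z : S.K) : psi S.E S.v z l = S.psiX (sgn l) ω z := by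
  have h1 := (S.isFaddeevMu_iff hω hl).1
    (S.isFaddeevMu_mu ((S.existsUnique_isFaddeevMu_iff hω hl).2 hU))
  rw [TOp_eq_kop] at hU
  have h2 := (S.isSol_iff_of_isUnit _ hU).1 h1
  have h3 := congrFun h2 z
  rw [S.glob_apply _ ((inverse_one_sub_apply hU).1 rfl)] at h3
  rw [psiX, TOp_eq_kop, hω]
  exact h3

end Setup

lemma antiLog_antiLog (σ : ℝ) (ω : ℂ) : antiLog (-σ) (antiLog σ ω) = ω := by
  simp only [antiLog, map_sub, map_neg, map_mul, conj_conj, conj_ofReal, conj_I]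
  push_cast; ring

lemma exp_antiLog {σ : ℝ} (hσ : σ = 1 ∨ σ = -1) (ω : ℂ) :
    cexp (antiLog σ ω) = -1 / conj (cexp ω) := by
  rw [antiLog, Complex.exp_sub, exp_neg, ← exp_conj]
  rcases hσ with rfl | rfl
  · push_cast; rw [one_mul, exp_pi_mul_I]; field_simp
  · push_cast; rw [neg_one_mul, neg_mul, exp_neg, exp_pi_mul_I]; field_simp

lemma sgn_eq {l : ℂ} (hl : ‖l‖ ≠ 1) : sgn l = 1 ∨ sgn l = -1 := by
  rcases sgn_ne hl with h | h
  · exact Or.inl h.1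
  · exact Or.inr h.1

lemma sgn_antipode {l : ℂ} (hl0 : l ≠ 0) (hl : ‖l‖ ≠ 1) : sgn (-1 / conj l) = -sgn l := by
  have h0 : 0 < ‖l‖ := norm_pos_iff.2 hl0
  rcases sgn_ne hl with h | h
  · rw [h.1, sgn_of_lt_one]; rw [norm_antipode]; exact inv_lt_one_of_one_lt₀ h.2
  · rw [h.1, sgn_of_one_lt, neg_neg]; rw [norm_antipode]; exact (one_lt_inv₀ h0).2 h.2

lemma antipode_antipode (l : ℂ) : -1 / conj (-1 / conj l) = l := by
  simp

lemma antipode_ne_zero {l : ℂ} (hl0 : l ≠ 0) : -1 / conj l ≠ 0 := by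
  simp_all

lemma norm_antipode_ne_one {l : ℂ} (hl : ‖l‖ ≠ 1) : ‖-1 / conj l‖ ≠ 1 := by
  simp_all

lemma add_period_sub_const {X : Type*} [NormedAddCommGroup X] [NormedSpace ℂ X] {G P : ℂ → X}
    (h : ∀ w, HasDerivAt P (G (cexp w)) w) {c : ℂ} (hc : cexp c = 1) (a b : ℂ) :
    P (a + c) - P a = P (b + c) - P b := by
  have hd w : HasDerivAt (fun w => P (w + c) - P w) 0 w := by
    have h := ((h (w + c)).comp_add_const w c).sub (h w)
    rw [exp_add, hc, mul_one, sub_self] at h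
    exact h
  exact is_const_of_deriv_eq_zero (fun w => (hd w).differentiableAt) (fun w => (hd w).deriv) a b

namespace Setup

variable (S : Setup)

lemma TOp_antiLog (σ : ℝ) (ω : ℂ) : S.TOp (-σ) (antiLog σ ω) = S.TOp σ ω := by
  rw [TOp, TOp, antiLog_antiLog]
  congr 1
  rw [← neg_sub, smul_neg, ← neg_smul]
  congr 1; push_cast; ring

lemma Psi_add_sub {c : ℂ} (hc : cexp c = 1) (a b : ℂ) :
    S.Psi (a + c) - S.Psi a = S.Psi (b + c) - S.Psi b :=
  add_period_sub_const (X := S.X →L[ℂ] S.X) (G := S.Theta) (fun w => S.hasDerivAt_Psi w) hc a b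

lemma TOp_congr (σ : ℝ) {ω ω' : ℂ} (h : cexp ω = cexp ω') : S.TOp σ ω = S.TOp σ ω' := by
  obtain ⟨n, hn⟩ := Complex.exp_eq_exp_iff_exists_int.1 h
  set c : ℂ := n * (2 * π * I) with hc
  have hec : cexp c = 1 := Complex.exp_int_mul_two_pi_mul_I n
  have ha : antiLog σ ω = antiLog σ ω' + c := by
    rw [antiLog, antiLog, hn, hc]
    simp only [map_add, map_mul, conj_I, map_intCast, map_ofNat, conj_ofReal]
    ring
  rw [TOp, TOp, ha, hn]
  congr 2
  have := S.Psi_add_sub hec ω' (antiLog σ ω')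
  grind

/-- Solutions of the equation for `μ` at large or small `l` are close to the inhomogeneity. -/
lemma exists_norm_sub_le : ∃ A C : ℝ, 1 < A ∧ 0 ≤ C ∧ ∀ l : ℂ, l ≠ 0 →
    A ≤ specSize l → ‖l‖ ≠ 1 → ∀ (a : ℂ) (m : ℂ → ℂ), ContinuousOn m S.K →
    (∀ z ∈ S.K, m z = a + ∫ w, g S.E (z - w) l * (S.v w : ℂ) * m w) →
    ∀ z ∈ S.K, ‖m z - a‖ ≤ C * √(specSize l) ^ (-S.δ) * ‖a‖ := by
  obtain ⟨C, hC, h⟩ := S.exists_integral_g_le (one_lt_two)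
  have hδ := S.δ_pos
  have hlim : Tendsto (fun s : ℝ => C * √s ^ (-S.δ)) atTop (𝓝 0) := by
    have := ((tendsto_rpow_neg_atTop hδ).comp Real.tendsto_sqrt_atTop).const_mul C
    simpa using this
  obtain ⟨A, hA⟩ := ((tendsto_order.1 hlim).2 (1 / 2) (by norm_num)).exists_forall_of_atTop
  refine ⟨max A 2, 2 * C, lt_max_of_lt_right one_lt_two, by positivity, ?_⟩
  intro l hl hs hl1 a m hm heq z hz
  have hc := hA _ ((le_max_left A 2).trans hs)
  set c := C * √(specSize l) ^ (-S.δ) with hcd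
  obtain ⟨z₀, hz₀, hmax⟩ := (isCompact_closedBall 0 S.R).exists_isMaxOn
    ⟨0, Metric.mem_closedBall_self S.hR.le⟩ hm.norm
  have hb z (hz : z ∈ S.K) : ‖m z - a‖ ≤ c * ‖m z₀‖ := by
    obtain ⟨i1, i2⟩ := h l hl ((le_max_right A 2).trans hs) hl1 z
    rw [heq z hz, add_sub_cancel_left]
    refine (norm_integral_le_of_norm_le (i1.norm.mul_const ‖m z₀‖)
      (.of_forall fun w => ?_)).trans ?_
    · by_cases hw : w ∈ ball 0 S.R
      · rw [norm_mul]
        gcongr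
        exact hmax (ball_subset_closedBall hw)
      · simp [S.v_eq_zero hw]
    · rw [integral_mul_const]
      gcongr
  have h1 : ‖m z₀‖ ≤ 2 * ‖a‖ := by
    have h2 := hb z₀ hz₀
    have h3 : ‖m z₀‖ ≤ ‖a‖ + ‖m z₀ - a‖ := by
      have := norm_add_le a (m z₀ - a)
      rwa [add_sub_cancel] at this
    nlinarith [norm_nonneg (m z₀)]
  calc ‖m z - a‖ ≤ c * ‖m z₀‖ := hb z hz
    _ ≤ c * (2 * ‖a‖) := by gcongr
    _ = 2 * C * √(specSize l) ^ (-S.δ) * ‖a‖ := by rw [hcd]; ring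

lemma exists_TOp_fixed_eq_zero : ∃ A : ℝ, 1 < A ∧ ∀ l ω : ℂ, cexp ω = l →
    A ≤ specSize l → ‖l‖ ≠ 1 → ∀ f, S.TOp (sgn l) ω f = f → f = 0 := by
  obtain ⟨A, C, hA, -, h⟩ := S.exists_norm_sub_le
  refine ⟨A, hA, fun l ω hω hs hl f hf => ?_⟩
  have hl0 : l ≠ 0 := by rw [← hω]; exact exp_ne_zero _
  have h1 := h l hl0 hs hl 0 (fun w => phi0 S.E w (-l) * S.ext f w)
    ((continuous_phi0 _ _).mul (S.continuous_ext f)).continuousOn (fun z hz => ?_)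
  · ext z
    have h2 := h1 z z.2
    rw [norm_zero, mul_zero, sub_zero] at h2
    have h3 := norm_le_zero_iff.1 h2
    rw [S.ext_of_mem f z.2] at h3
    exact (mul_eq_zero.1 h3).resolve_left (phi0_ne_zero _ _ _)
  · have h4 := S.phi0_mul_integral_g hω hl (fun w => phi0 S.E w (-l) * S.ext f w) z
    have h5 w : phi0 S.E w l * (phi0 S.E w (-l) * S.ext f w) = S.ext f w := by
      rw [← mul_assoc, phi0_mul_neg, one_mul]
    simp only [h5] at h4
    have h6 : S.TOp (sgn l) ω f ⟨z, hz⟩ = ∫ w, S.kT (sgn l) ω (z - w) * (S.v w) * S.ext f w := by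
      rw [TOp_eq_kop, kop_apply]
    rw [hf] at h6
    rw [zero_add, S.ext_of_mem f hz, h6, ← h4, ← mul_assoc, mul_comm (phi0 _ _ (-l)), phi0_mul_neg,
      one_mul]

/-- Uniqueness and asymptotics of the Faddeev solutions for large and small `l`. -/
lemma exists_mu_sub_one_le : ∃ A C : ℝ, 1 < A ∧ 0 ≤ C ∧ ∀ l : ℂ, l ≠ 0 →
    A ≤ specSize l → ‖l‖ ≠ 1 → (∃! m, IsFaddeevMu S.E S.v l m) ∧
      ∀ z ∈ S.K, ‖mu S.E S.v z l - 1‖ ≤ C * √(specSize l) ^ (-S.δ) := by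
  obtain ⟨A, C, hA, hC, h⟩ := S.exists_norm_sub_le
  obtain ⟨A', hA', h'⟩ := S.exists_TOp_fixed_eq_zero
  refine ⟨max A A', C, lt_max_of_lt_left hA, hC, fun l hl hs hl1 => ?_⟩
  have hω := exp_log hl
  have hU : IsUnit (1 - S.TOp (sgn l) (Complex.log l)) :=
    isUnit_one_sub_of_isCompactOperator (S.isCompactOperator_TOp _ _)
      (h' l _ hω ((le_max_right A A').trans hs) hl1)
  have hE := (S.existsUnique_isFaddeevMu_iff hω hl1).2 hU
  refine ⟨hE, fun z hz => ?_⟩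
  have hmu := S.isFaddeevMu_mu hE
  obtain ⟨f, -, hf⟩ := (S.isSol_iff (S.good_kT (sgn l) (Complex.log l))).1
    ((S.isFaddeevMu_iff hω hl1).1 hmu)
  have hc : Continuous fun z => mu S.E S.v z l := by
    have h4 : (fun z => mu S.E S.v z l) =
        fun z => phi0 S.E z (-l) * S.glob (S.kT (sgn l) (Complex.log l)) l f z := by
      funext z
      rw [← hf, ← mul_assoc, mul_comm (phi0 _ _ (-l)), phi0_mul_neg, one_mul]
    rw [h4]
    exact (continuous_phi0 _ _).mul ((S.good_kT _ _).continuous_glob l f)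
  have := h l hl ((le_max_left A A').trans hs) hl1 1 _ hc.continuousOn (fun z _ => hmu.2 z) z hz
  rwa [norm_one, mul_one] at this

end Setup

lemma isFaddeevMu_conj {S : Setup} {l : ℂ} (hl0 : l ≠ 0) (hl : ‖l‖ ≠ 1) {m : ℂ → ℂ}
    (h : IsFaddeevMu S.E S.v l m) : IsFaddeevMu S.E S.v (-1 / conj l) fun z => conj (m z) := by
  refine ⟨h.1.star, fun z => ?_⟩
  change conj (m z) = _
  rw [h.2 z, map_add, map_one, ← integral_conj]
  congr 1
  refine integral_congr_ae ?_
  filter_upwards [ae_im_mul_conj_ne_zero z hl0] with w hw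
  rw [map_mul, map_mul, g_antipode S.hE hl0 hl hw, conj_ofReal]

lemma existsUnique_antipode {S : Setup} {l : ℂ} (hl0 : l ≠ 0) (hl : ‖l‖ ≠ 1)
    (h : ∃! m, IsFaddeevMu S.E S.v l m) : ∃! m, IsFaddeevMu S.E S.v (-1 / conj l) m := by
  obtain ⟨m, hm, hu⟩ := h
  refine ⟨_, isFaddeevMu_conj hl0 hl hm, fun m' hm' => ?_⟩
  have h1 := isFaddeevMu_conj (antipode_ne_zero hl0) (norm_antipode_ne_one hl) hm'
  rw [antipode_antipode] at h1
  funext z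
  have h2 := congrFun (hu _ h1) z
  rw [← h2]; simp

lemma mu_antipode {S : Setup} {l : ℂ} (hl0 : l ≠ 0) (hl : ‖l‖ ≠ 1)
    (h : ∃! m, IsFaddeevMu S.E S.v l m) (z : ℂ) :
    mu S.E S.v z (-1 / conj l) = conj (mu S.E S.v z l) := by
  have h1 := S.isFaddeevMu_mu (existsUnique_antipode hl0 hl h)
  have h2 := isFaddeevMu_conj hl0 hl (S.isFaddeevMu_mu h)
  exact congrFun ((existsUnique_antipode hl0 hl h).unique h1 h2) z

lemma conj_weylQ (a b : ℝ) : conj (weylQ a b) = weylQ (-a) b := by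
  rw [weylQ, weylQ, ← integral_conj]
  congr 1; funext t
  rw [weylPhase, weylPhase, ← exp_conj]
  simp [← Complex.cosh_conj, ← Complex.sinh_conj]

lemma phi0_exp_mul_I (E : ℝ) (x : ℂ) (t : ℝ) : phi0 E x (cexp (t * I)) =
    cexp (I * ((√E * x.re : ℝ) * cos t + (√E * x.im : ℝ) * sin t)) := by
  rw [phi0_exp, Complex.cosh_mul_I, Complex.sinh_mul_I]
  push_cast
  congr 2
  linear_combination (-√E * Complex.sin t * x.im) * I_sq

lemma segInt_circle (E : ℝ) (x : ℂ) : segInt E 0 (2 * π * I) x =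
    I * ((∫ t in (0 : ℝ)..π, phi0 E x (cexp (t * I))) +
      conj (∫ t in (0 : ℝ)..π, phi0 E x (cexp (t * I)))) := by
  obtain ⟨P, hP⟩ := exists_primitive_phi0_exp E x
  have hc : Continuous fun t : ℝ => phi0 E x (cexp (t * I)) :=
    (differentiable_phi0_exp E x).continuous.comp (by fun_prop)
  have hd (t : ℝ) : HasDerivAt (fun t : ℝ => P (t * I)) (I • phi0 E x (cexp (t * I))) t := by
    have h1 : HasDerivAt (fun w : ℂ => w * I) I t := by
      simpa using (hasDerivAt_id (t : ℂ)).mul_const I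
    exact (hP _).scomp t h1.comp_ofReal
  have h1 := integral_eq_sub_of_hasDerivAt (a := 0) (b := 2 * π) (fun s _ => hd s)
    (Continuous.intervalIntegrable (hc.fun_const_smul I) _ _)
  rw [segInt_eq hP]
  have e0 : P (2 * π * I) - P 0 = P (((2 * π : ℝ)) * I) - P (((0 : ℝ)) * I) := by simp
  rw [e0, ← h1, intervalIntegral.integral_smul, smul_eq_mul,
    ← integral_add_adjacent_intervals (hc.intervalIntegrable 0 π)
      (hc.intervalIntegrable π (2 * π))]
  congr 2
  rw [integral_of_le pi_pos.le, ← integral_conj, ← integral_of_le pi_pos.le]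
  have h2 := intervalIntegral.integral_comp_add_right
    (fun t : ℝ => phi0 E x (cexp (t * I))) π (a := 0) (b := π)
  rw [zero_add, ← two_mul] at h2
  rw [← h2]
  congr 1; funext t
  rw [phi0_exp_mul_I, phi0_exp_mul_I, ← exp_conj, Real.cos_add_pi, Real.sin_add_pi]
  congr 1
  simp only [map_mul, map_add, conj_I, conj_ofReal]
  push_cast; ring

lemma segInt_circle_neg (E : ℝ) (x : ℂ) :
    segInt E 0 (2 * π * I) (-x) = segInt E 0 (2 * π * I) x := by
  have e : (∫ t in 0..π, phi0 E (-x) (cexp (t * I))) =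
      conj (∫ t in 0..π, phi0 E x (cexp (t * I))) := by
    rw [integral_of_le pi_pos.le, integral_of_le pi_pos.le, ← integral_conj]
    congr 1; funext t
    rw [phi0_exp_mul_I, phi0_exp_mul_I, ← exp_conj]
    congr 1
    simp only [map_mul, map_add, conj_I, conj_ofReal, Complex.neg_re, neg_im]
    push_cast; ring
  rw [segInt_circle, segInt_circle, e, conj_conj, add_comm (conj _)]

lemma Gplus_neg (E : ℝ) (x : ℂ) : Gplus E (-x) = Gplus E x := by
  simp [Gplus]

/-- The jump between the outgoing and the incoming Green functions. -/
lemma Gplus_sub_conj {E : ℝ} (hE : 0 < E) {x : ℂ} (hx : x.im ≠ 0) :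
    Gplus E x - conj (Gplus E x) = -(1 / (4 * π)) * segInt E 0 (2 * π * I) x := by
  wlog h : 0 < x.im generalizing x
  · have := this (x := -x) (by simpa using hx) (by
      rw [neg_im]; grind)
    rwa [Gplus_neg, segInt_circle_neg] at this
  have he : 0 < √E := sqrt_pos.2 hE
  have hx0 : x ≠ 0 := by rintro rfl; simp at hx
  have h1 := weylQ_add_weylQ (√E * x.re) (mul_pos he h)
  have e1 : √((√E * x.re) ^ 2 + (√E * x.im) ^ 2) = √E * ‖x‖ := by
    have : (√E * x.re) ^ 2 + (√E * x.im) ^ 2 = (√E * ‖x‖) ^ 2 := by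
      rw [mul_pow √E ‖x‖, Complex.sq_norm, normSq_apply]; ring
    rw [this, sqrt_sq (by positivity)]
  simp only [← phi0_exp_mul_I] at h1
  rw [e1] at h1
  have h2 := congrArg conj h1
  simp only [map_add, map_mul, conj_weylQ, neg_neg, conj_I, map_ofNat] at h2
  have e2 : conj (Gplus E x) = -(1 / (2 * π)) * conj (hankelU (√E * ‖x‖)) := by
    rw [Gplus_eq hE hx0]
    simp only [map_mul, map_neg, map_div₀, map_one, map_ofNat, conj_ofReal]
  rw [e2, Gplus_eq hE hx0, segInt_circle]
  grind

namespace Setup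

variable (S : Setup)

lemma Good.conj {S : Setup} {k : ℂ → ℂ} (hk : S.Good k) : S.Good fun x => conj (k x) where
  integrable z := by
    have := (conjCLE : ℂ →L[ℝ] ℂ).integrable_comp (hk.integrable z)
    simp_all
  tendsto z₀ := by
    refine (hk.tendsto z₀).congr fun z => ?_
    congr 1; funext w
    rw [← Complex.norm_conj]; simp

lemma kop_conj {S : Setup} {k : ℂ → ℂ} (hk : S.Good k) (f : S.X) :
    S.kop hk.conj (star f) = star (S.kop hk f) := by
  ext z
  change _ = (starRingEnd ℂ) (S.kop hk f z)
  rw [kop_apply, kop_apply, ← integral_conj]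
  congr 1; funext w
  rw [map_mul, map_mul, conj_ofReal]; rfl

lemma ell_star (f : S.X) : S.ell (star f) = (starRingEnd ℂ) (S.ell f) := by
  rw [ell_apply, ell_apply, ← integral_conj]
  congr 1; funext w
  rw [map_mul, conj_ofReal]; rfl

lemma ell_mul_kop {k : ℂ → ℂ} (hk : S.Good k) (f g : S.X) : S.ell (f * S.kop hk g) =
    ∫ z, ∫ w, k (z - w) * ((S.v w : ℂ) * S.ext g w) * ((S.v z : ℂ) * S.ext f z) := by
  rw [ell_apply]
  congr 1; funext z
  rw [integral_mul_const]
  by_cases hz : z ∈ ball 0 S.R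
  · rw [S.ext_of_mem _ (ball_subset_closedBall hz),
      S.ext_of_mem _ (ball_subset_closedBall hz), ContinuousMap.mul_apply, kop_apply]
    ring_nf
  · simp [S.v_eq_zero hz]

lemma integrable_kernel {k : ℂ → ℂ} (hk : S.Good k) (hm : Measurable k) (f g : S.X) :
    Integrable (fun p : ℂ × ℂ => k (p.1 - p.2) * ((S.v p.2 : ℂ) * S.ext g p.2) *
      ((S.v p.1 : ℂ) * S.ext f p.1)) (volume.prod volume) := by
  have hvm := S.integrable_vC.aestronglyMeasurable
  have m1 : AEStronglyMeasurable (fun p : ℂ × ℂ => k (p.1 - p.2)) (volume.prod volume) :=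
    (hm.comp (measurable_fst.sub measurable_snd)).aestronglyMeasurable
  have m2 : AEStronglyMeasurable (fun p : ℂ × ℂ => (S.v p.2) * S.ext g p.2)
      (volume.prod volume) := (hvm.mul (S.continuous_ext g).aestronglyMeasurable).comp_snd
  have m3 : AEStronglyMeasurable (fun p : ℂ × ℂ => (S.v p.1) * S.ext f p.1)
      (volume.prod volume) := (hvm.mul (S.continuous_ext f).aestronglyMeasurable).comp_fst
  have hm3 := (m1.mul m2).mul m3
  obtain ⟨C, hC, hb⟩ := hk.exists_bound
  have i1 z : Integrable fun w => k (z - w) * ((S.v w) * S.ext g w) := by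
    have := hk.integrable_mul (S.continuous_ext g).aestronglyMeasurable
      (.of_forall (S.norm_ext_le g)) z
    simpa only [mul_assoc] using this
  refine (integrable_prod_iff hm3).2 ⟨.of_forall fun z => (i1 z).mul_const
    ((S.v z) * S.ext f z), ?_⟩
  refine Integrable.mono' (g := fun z => C * ‖g‖ * (‖S.v z‖ * ‖f‖))
    ((S.integrable_v.norm.mul_const _).const_mul _) hm3.norm.integral_prod_right'
    (.of_forall fun z => ?_)
  simp only [Pi.mul_apply]
  by_cases hz : z ∈ ball 0 S.R
  · rw [norm_of_nonneg (integral_nonneg fun w => norm_nonneg _)]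
    simp only [norm_mul _ ((S.v z) * S.ext f z)]
    rw [integral_mul_const]
    have h1 : ∫ w, ‖k (z - w) * ((S.v w) * S.ext g w)‖ ≤ C * ‖g‖ := by
      refine (integral_mono (i1 z).norm ((hk.integrable z).norm.mul_const ‖g‖) fun w => ?_).trans ?_
      · rw [← mul_assoc, norm_mul _ (S.ext g w)]
        gcongr
        exact S.norm_ext_le g w
      · rw [integral_mul_const]
        gcongr
        exact hb z (ball_subset_closedBall hz)
    have h2 : ‖(S.v z) * S.ext f z‖ ≤ ‖S.v z‖ * ‖f‖ := by
      rw [norm_mul, norm_real]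
      gcongr
      exact S.norm_ext_le f z
    exact mul_le_mul h1 h2 (norm_nonneg _) (by positivity)
  · simp [S.v_eq_zero hz]

lemma ell_kop_symm {k : ℂ → ℂ} (hk : S.Good k) (hm : Measurable k)
    (hs : ∀ x, k (-x) = k x) (f g : S.X) : S.ell (f * S.kop hk g) = S.ell (S.kop hk f * g) := by
  rw [mul_comm (S.kop hk f), ell_mul_kop, ell_mul_kop, integral_integral_swap (S.integrable_kernel hk hm f g)]
  congr 1; funext z
  congr 1; funext w
  rw [← hs, neg_sub]; ring

lemma conj_Phi_neg {s : ℂ} (hs : ‖s‖ = 1) : star (S.Phi (-s)) = S.Phi s := by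
  ext z
  change (starRingEnd ℂ) (phi0 S.E z (-s)) = phi0 S.E z s
  rw [← phi0_antipode]
  congr 1
  have : s ≠ 0 := by rintro rfl; simp at hs
  rw [map_neg, div_neg, neg_div, neg_neg, div_eq_iff (by simpa using this), mul_conj,
    normSq_eq_norm_sq, hs]
  simp

lemma ell_Psi_circle (f : S.X) : S.ell (star f * (S.Psi (2 * π * I) - S.Psi 0) f) = 2 * π * I *
      (∫ s in (0 : ℝ)..1, ‖S.ell (S.Phi (-cexp (s * (2 * π * I))) * f)‖ ^ 2 : ℝ) := by
  let L : (S.X →L[ℂ] S.X) →L[ℂ] ℂ :=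
    (S.ell ∘L ContinuousLinearMap.mul ℂ S.X (star f)) ∘L (ContinuousLinearMap.apply ℂ S.X f)
  have hd w : HasDerivAt (fun w => L (S.Psi w)) (L (S.Theta (cexp w))) w :=
    hasDerivAt_clm_comp (X := S.X →L[ℂ] S.X) L (S.hasDerivAt_Psi w)
  have hc : Continuous fun w => L (S.Theta (cexp w)) :=
    L.continuous.comp S.differentiable_Theta_exp.continuous
  have h1 := sub_eq_integral_of_primitive hd hc 0 (2 * π * I)
  have e1 : S.ell (star f * (S.Psi (2 * π * I) - S.Psi 0) f) =
      L (S.Psi (2 * π * I)) - L (S.Psi 0) := (map_sub L _ _)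
  rw [e1, h1, sub_zero, smul_eq_mul, ← intervalIntegral.integral_ofReal]
  congr 2; funext s
  rw [zero_add]
  set u := cexp (s * (2 * π * I)) with hu
  have hn : ‖u‖ = 1 := by
    rw [hu, ← mul_assoc, norm_exp]; simp
  have e2 : L (S.Theta u) = S.ell (star f * (S.ell (S.Phi (-u) * f) • S.Phi u)) := rfl
  have e3 : star f * S.Phi u = star (S.Phi (-u) * f) := by
    rw [star_mul, S.conj_Phi_neg hn]
  rw [e2, mul_smul_comm, map_smul, e3, ell_star, smul_eq_mul, mul_conj, normSq_eq_norm_sq]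

lemma eq_zero_of_Tplus_eq_self {f : S.X} (hf : S.Tplus f = f) : f = 0 := by
  set H : ℂ → ℂ := fun w => S.ell (S.Phi (-cexp w) * f) with hH
  have hHd : Differentiable ℂ H := by
    have h1 : Differentiable ℂ fun w => ContinuousLinearMap.mul ℂ S.X (S.Phi (-cexp w)) :=
      (ContinuousLinearMap.mul ℂ S.X).differentiable.comp S.differentiable_Phi_neg_exp
    exact S.ell.differentiable.comp (h1.clm_apply (differentiable_const f))
  have hm := measurable_Gplus S.hE
  have key : S.ell (star f * (S.Psi (2 * π * I) - S.Psi 0) f) = 0 := by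
    have h1 : S.ell (star f * S.kop S.good_Gplus.conj f) = S.ell (star f * f) := by
      rw [S.ell_kop_symm S.good_Gplus.conj (continuous_conj.measurable.comp hm)
        (fun x => by rw [Gplus_neg]), kop_conj S.good_Gplus]
      have : S.kop S.good_Gplus f = f := hf
      rw [this]
    have h2 : (S.Psi (2 * π * I) - S.Psi 0) f =
        (-(4 * π) : ℂ) • (f - S.kop S.good_Gplus.conj f) := by
      ext z
      have i1 := S.good_Gplus.integrable_mul (S.continuous_ext f).aestronglyMeasurable
        (.of_forall (S.norm_ext_le f)) z
      have i2 := S.good_Gplus.conj.integrable_mul (S.continuous_ext f).aestronglyMeasurable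
        (.of_forall (S.norm_ext_le f)) z
      have e1 : f z = ∫ w, Gplus S.E (z - w) * (S.v w) * S.ext f w := by
        conv_lhs => rw [← hf]
        rw [Tplus, kop_apply]
      rw [Psi_sub_apply, ContinuousMap.smul_apply, ContinuousMap.sub_apply, e1, kop_apply,
        ← integral_sub i1 i2, smul_eq_mul, ← integral_const_mul]
      refine integral_congr_ae ?_
      filter_upwards [ae_im_mul_conj_ne_zero z one_ne_zero] with w hw
      rw [map_one, mul_one] at hw
      have := Gplus_sub_conj S.hE hw
      have hπ : (π : ℂ) ≠ 0 := by exact_mod_cast pi_ne_zero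
      have e2 : segInt S.E 0 (2 * π * I) (z - w) =
          -(4 * π) * (Gplus S.E (z - w) - (starRingEnd ℂ) (Gplus S.E (z - w))) := by
        rw [this]; field_simp
      rw [e2]; ring
    rw [h2, mul_smul_comm, map_smul, mul_sub, map_sub, h1, sub_self, smul_zero]
  rw [ell_Psi_circle] at key
  have hint : ∫ s in 0..1, ‖H (s * (2 * π * I))‖ ^ 2 = 0 := by
    have hne : (2 * π * I) ≠ 0 := Complex.two_pi_I_ne_zero
    exact_mod_cast (mul_eq_zero.1 key).resolve_left hne
  have hz s (hs : s ∈ Icc (0 : ℝ) 1) : H (s * (2 * π * I)) = 0 := by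
    by_contra hne
    have := intervalIntegral.integral_pos (f := fun s : ℝ => ‖H (s * (2 * π * I))‖ ^ 2)
      zero_lt_one ((hHd.continuous.comp (by fun_prop)).norm.pow 2).continuousOn
      (fun _ _ => by positivity) ⟨s, hs, by positivity⟩
    exact this.ne' hint
  have hH0 : H = 0 := by
    refine AnalyticOnNhd.eq_of_frequently_eq (z₀ := 0) (hHd.differentiableOn.analyticOnNhd isOpen_univ)
      (fun _ _ => analyticAt_const) ?_
    have ht : Tendsto (fun n : ℕ => ((1 / (n + 1) : ℝ) : ℂ) * (2 * π * I)) atTop (𝓝[≠] 0) := by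
      refine tendsto_nhdsWithin_iff.2 ⟨?_, .of_forall fun n => ?_⟩
      · have := (tendsto_one_div_add_atTop_nhds_zero_nat).ofReal.mul_const (2 * π * I)
        simpa using this
      · refine mul_ne_zero ?_ Complex.two_pi_I_ne_zero
        have : 0 < 1 / ((n : ℝ) + 1) := by positivity
        exact_mod_cast this.ne'
    refine ht.frequently (Frequently.of_forall fun n => hz _ ⟨by positivity, ?_⟩)
    rw [div_le_one (by positivity)]; linarith [n.cast_nonneg (α := ℝ)]
  have hconst (a b) : S.Psi a f = S.Psi b f := by
    have hd w : HasDerivAt (fun w => S.Psi w f) 0 w := by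
      have h1 := hasDerivAt_clm_comp (ContinuousLinearMap.apply ℂ S.X f) (S.hasDerivAt_Psi w)
      refine h1.congr_deriv ?_
      have : S.Theta (cexp w) f = H w • S.Phi (cexp w) := rfl
      rw [ContinuousLinearMap.apply_apply, this, hH0]
      exact zero_smul _ _
    exact is_const_of_deriv_eq_zero (fun w => (hd w).differentiableAt) (fun w => (hd w).deriv) a b
  obtain ⟨A, hA, h⟩ := S.exists_TOp_fixed_eq_zero
  have hA0 : 0 < A := by linarith
  have hA' : (A : ℂ) ≠ 0 := by exact_mod_cast hA0.ne'
  have hAn : ‖(A : ℂ)‖ = A := by rw [norm_real, norm_of_nonneg hA0.le]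
  refine h A (Complex.log A) (exp_log hA') ?_ (by rw [hAn]; exact hA.ne') f ?_
  · rw [specSize, hAn]; exact le_max_left _ _
  · change S.Tplus f + (_ : ℂ) • (S.Psi _ f - S.Psi _ f) = f
    rw [hf, hconst _ 0, hconst (antiLog _ _) 0, sub_self, smul_zero, add_zero]

lemma isUnit_one_sub_Tplus : IsUnit (1 - S.Tplus) :=
  isUnit_one_sub_of_isCompactOperator S.isCompactOperator_Tplus fun _ => S.eq_zero_of_Tplus_eq_self

lemma existsUnique_isScatteringSolution (l : ℂ) : ∃! f, IsScatteringSolution S.E S.v l f := by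
  simp only [isScatteringSolution_iff, S.isSol_iff_of_isUnit S.good_Gplus S.isUnit_one_sub_Tplus]
  exact existsUnique_eq

/-- The scattering solution on the disc. -/
def psiP (l : ℂ) : S.X := inverse (1 - S.Tplus) (S.Phi l)

lemma psiPlus_eq (l : ℂ) (z : S.K) : psiPlus S.E S.v z l = S.psiP l z := by
  have h1 : IsScatteringSolution S.E S.v l (Classical.epsilon (IsScatteringSolution S.E S.v l)) :=
    Classical.epsilon_spec (S.existsUnique_isScatteringSolution l).exists
  have h2 := (S.isSol_iff_of_isUnit S.good_Gplus S.isUnit_one_sub_Tplus).1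
    (S.isScatteringSolution_iff.1 h1)
  have h3 : S.psiP l = S.Phi l + S.Tplus (S.psiP l) :=
    (inverse_one_sub_apply S.isUnit_one_sub_Tplus).1 rfl
  rw [psiPlus, h2]
  exact S.glob_apply S.good_Gplus h3 z

end Setup

lemma ring_lt {A : ℝ} (hA : 1 < A) : 0 < A⁻¹ ∧ A⁻¹ < 1 ∧ A⁻¹ < A := by
  have h : A⁻¹ < 1 := inv_lt_one_of_one_lt₀ hA
  exact ⟨by positivity, h, h.trans hA⟩

lemma ne_zero_of_mem_sphere {R : ℝ} (hR : 0 < R) {s : ℂ} (hs : s ∈ sphere (0 : ℂ) R) : s ≠ 0 := by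
  rintro rfl; simp at hs; exact hR.ne hs

/-- Cauchy's theorem on a ring. -/
lemma boundaryIntegral_eq_zero {A : ℝ} (hA : 1 < A) {f : ℂ → ℂ}
    (hf : ∀ s, A⁻¹ ≤ ‖s‖ → ‖s‖ ≤ A → DifferentiableAt ℂ f s) : boundaryIntegral A f = 0 := by
  obtain ⟨h0, -, hle⟩ := ring_lt hA
  rw [boundaryIntegral, sub_eq_zero]
  refine Complex.circleIntegral_eq_of_differentiable_on_annulus_off_countable h0 hle.le
    countable_empty (fun s hs => ?_) fun s hs => ?_
  · rw [Set.mem_sdiff, mem_closedBall_zero_iff, mem_ball_zero_iff, not_lt] at hs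
    exact (hf s hs.2 hs.1).continuousAt.continuousWithinAt
  · rw [sdiff_empty, Set.mem_sdiff, mem_closedBall_zero_iff, mem_ball_zero_iff, not_le] at hs
    exact hf s hs.2.le hs.1.le

lemma circleIntegral_inv_of_lt {R : ℝ} (hR : 0 < R) {w : ℂ} (hw : R < ‖w‖) :
    (∮ s in C(0, R), (s - w)⁻¹) = 0 := by
  have hne s (hs : s ∈ Metric.closedBall 0 R) : s - w ≠ 0 := by
    rw [sub_ne_zero]; rintro rfl
    exact absurd (mem_closedBall_zero_iff.1 hs) (not_le.2 hw)
  refine Complex.circleIntegral_eq_zero_of_differentiable_on_off_countable hR.le countable_empty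
    (fun s hs => ?_) fun s hs => ?_
  · exact (((continuous_id.sub continuous_const).continuousAt).inv₀ (hne s hs)).continuousWithinAt
  · exact (differentiableAt_id.sub_const w).inv (hne s (ball_subset_closedBall hs.1))

/-- Cauchy's formula on a ring. -/
lemma boundaryIntegral_cauchy {A : ℝ} (hA : 1 < A) {f : ℂ → ℂ}
    (hf : DifferentiableOn ℂ f {0}ᶜ) {w : ℂ} (hw : w ∈ ring A) :
    boundaryIntegral A (fun s => f s / (s - w)) = 2 * π * I * f w := by
  obtain ⟨h0, -, hle⟩ := ring_lt hA
  have hA0 : 0 < A := by linarith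
  have hw0 : w ≠ 0 := norm_pos_iff.1 (h0.trans hw.1)
  have hd : DifferentiableOn ℂ (dslope f w) {0}ᶜ :=
    (Complex.differentiableOn_dslope (isOpen_compl_singleton.mem_nhds hw0)).2 hf
  have key R (hR : 0 < R) (hRw : ‖w‖ ≠ R) : (∮ s in C(0, R), f s / (s - w)) =
      (∮ s in C(0, R), dslope f w s) + f w * ∮ s in C(0, R), (s - w)⁻¹ := by
    have hne s (hs : s ∈ sphere 0 R) : s ≠ w := by
      rintro rfl; exact hRw (mem_sphere_zero_iff_norm.1 hs)
    rw [← circleIntegral.integral_const_mul, ← circleIntegral.integral_add]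
    · refine circleIntegral.integral_congr hR.le fun s hs => ?_
      simp only [dslope_of_ne _ (hne s hs), slope, vsub_eq_sub, smul_eq_mul]
      ring
    · refine ContinuousOn.circleIntegrable hR.le (hd.continuousOn.mono fun s hs => ?_)
      exact ne_zero_of_mem_sphere hR hs
    · refine ContinuousOn.circleIntegrable hR.le (continuousOn_const.mul
        ((continuousOn_id.sub continuousOn_const).inv₀ fun s hs => ?_))
      exact sub_ne_zero.2 (hne s hs)
  have h1 := boundaryIntegral_eq_zero hA fun s hs _ =>
    (hd s (norm_pos_iff.1 (h0.trans_le hs))).differentiableAt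
      (isOpen_compl_singleton.mem_nhds (norm_pos_iff.1 (h0.trans_le hs)))
  rw [boundaryIntegral] at h1 ⊢
  rw [key A hA0 hw.2.ne, key _ h0 hw.1.ne', circleIntegral_inv_of_lt h0 hw.1,
    circleIntegral.integral_sub_inv_of_mem_ball (mem_ball_zero_iff.2 hw.2)]
  linear_combination h1

lemma circleIntegral_swap {R : ℝ} (hR : 0 < R) {γ ρ : ℝ → ℂ} (hγ : Continuous γ)
    (hρ : Measurable ρ) {M a b : ℝ} (hM : ∀ τ ∈ uIcc a b, ‖ρ τ‖ ≤ M)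
    (h : ∀ τ ∈ uIcc a b, ‖γ τ‖ ≠ R) {f : ℂ → ℂ} (hf : ContinuousOn f (sphere 0 R)) :
    IntervalIntegrable (fun τ => ρ τ * ∮ s in C(0, R), f s / (s - γ τ)) volume a b ∧
    CircleIntegrable (fun s => (∫ τ in a..b, ρ τ / (s - γ τ)) * f s) 0 R ∧
    (∮ s in C(0, R), (∫ τ in a..b, ρ τ / (s - γ τ)) * f s) =
      ∫ τ in a..b, ρ τ * ∮ s in C(0, R), f s / (s - γ τ) := by
  have hfc : Continuous fun θ => f (circleMap 0 R θ) :=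
    hf.comp_continuous (continuous_circleMap _ _) fun θ => circleMap_mem_sphere _ hR.le _
  have hdc : Continuous fun θ => deriv (circleMap 0 R) θ := by
    simp only [deriv_circleMap]; fun_prop
  set G : ℝ → ℝ → ℂ := fun τ θ =>
    ρ τ * (deriv (circleMap 0 R) θ * (f (circleMap 0 R θ) / (circleMap 0 R θ - γ τ))) with hG
  have hGm : Measurable (Function.uncurry G) := by
    have h1 := hfc.measurable
    have h2 := hdc.measurable
    have h3 := hγ.measurable
    have h4 := (continuous_circleMap 0 R).measurable
    simp only [hG, Function.uncurry_def]
    exact (hρ.comp measurable_fst).mul ((h2.comp measurable_snd).mul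
      ((h1.comp measurable_snd).div ((h4.comp measurable_snd).sub (h3.comp measurable_fst))))
  obtain ⟨τ₀, hτ₀, hmin⟩ := (isCompact_uIcc (a := a) (b := b)).exists_isMinOn nonempty_uIcc
    (f := fun τ => |R - ‖γ τ‖|) (by fun_prop)
  have hd : 0 < |R - ‖γ τ₀‖| := abs_pos.2 (sub_ne_zero.2 (h τ₀ hτ₀).symm)
  set d := |R - ‖γ τ₀‖| with hdd
  obtain ⟨B, hB⟩ := (isCompact_sphere 0 R).exists_bound_of_continuousOn hf
  have hGi : IntegrableOn (Function.uncurry G) (uIoc a b ×ˢ uIoc 0 (2 * π)) := by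
    refine Measure.integrableOn_of_bounded (M := M * (R * (B / d))) ?_ hGm.aestronglyMeasurable ?_
    · rw [Measure.volume_eq_prod, Measure.prod_prod]
      exact ENNReal.mul_ne_top (by simp [uIoc]) (by simp [uIoc])
    · filter_upwards [ae_restrict_mem (measurableSet_uIoc.prod measurableSet_uIoc)] with p hp
      have hτ := uIoc_subset_uIcc hp.1
      have h5 := circleMap_mem_sphere 0 hR.le p.2
      have h6 : d ≤ ‖circleMap 0 R p.2 - γ p.1‖ := by
        refine (hmin hτ).trans ?_
        have := abs_norm_sub_norm_le (circleMap 0 R p.2) (γ p.1)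
        rwa [mem_sphere_zero_iff_norm.1 h5] at this
      have h7 : ‖deriv (circleMap 0 R) p.2‖ = R := by
        simp [abs_of_pos hR]
      have h8 := hB _ h5
      simp only [hG, Function.uncurry_def]
      rw [norm_mul, norm_mul, norm_div, h7]
      have h9 := (norm_nonneg (ρ p.1)).trans (hM _ hτ)
      have h10 := (norm_nonneg _).trans h8
      gcongr
      exact hM _ hτ
  have e1 τ : (∫ θ in 0..2 * π, G τ θ) = ρ τ * ∮ s in C(0, R), f s / (s - γ τ) := by
    simp only [hG, intervalIntegral.integral_const_mul, circleIntegral, smul_eq_mul]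
  have e2 θ : (∫ τ in a..b, G τ θ) = deriv (circleMap 0 R) θ •
      ((∫ τ in a..b, ρ τ / (circleMap 0 R θ - γ τ)) * f (circleMap 0 R θ)) := by
    rw [← intervalIntegral.integral_mul_const, smul_eq_mul, ← intervalIntegral.integral_const_mul]
    congr 1; funext τ
    simp only [hG]; ring
  have hGi' : Integrable (Function.uncurry G)
      ((volume.restrict (uIoc a b)).prod (volume.restrict (uIoc 0 (2 * π)))) := by
    rwa [IntegrableOn, Measure.volume_eq_prod, ← Measure.prod_restrict] at hGi
  refine ⟨?_, ?_, ?_⟩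
  · rw [intervalIntegrable_iff]
    have := hGi'.integral_prod_left
    refine this.congr (.of_forall fun τ => ?_)
    change (∫ θ in uIoc 0 (2 * π), G τ θ) = ρ τ * _
    rw [← e1, integral_of_le (by positivity), uIoc_of_le (by positivity)]
  · rw [circleIntegrable_iff, intervalIntegrable_iff]
    have := hGi'.integral_prod_right
    rcases le_total a b with hab | hab
    · refine this.congr (.of_forall fun θ => ?_)
      beta_reduce
      rw [← e2, integral_of_le hab, uIoc_of_le hab]
      rfl
    · refine this.neg.congr (.of_forall fun θ => ?_)
      beta_reduce
      rw [← e2, intervalIntegral.integral_of_ge hab, uIoc_of_ge hab]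
      rfl
  · simp only [← e1]
    rw [intervalIntegral_intervalIntegral_swap hGi, circleIntegral]
    grind

/-- Superpositions of Cauchy kernels with poles in the ring. -/
lemma boundaryIntegral_superposition {A : ℝ} (hA : 1 < A) {γ ρ : ℝ → ℂ} (hγ : Continuous γ)
    (hρ : Measurable ρ) {M a b : ℝ} (hM : ∀ τ ∈ uIcc a b, ‖ρ τ‖ ≤ M)
    (h : ∀ τ ∈ uIcc a b, γ τ ∈ ring A) {f : ℂ → ℂ} (hf : DifferentiableOn ℂ f {0}ᶜ) :
    boundaryIntegral A (fun s => (∫ τ in a..b, ρ τ / (s - γ τ)) * f s) =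
      2 * π * I * ∫ τ in a..b, ρ τ * f (γ τ) := by
  obtain ⟨h0, -, hle⟩ := ring_lt hA
  have hfc R (hR : 0 < R) : ContinuousOn f (sphere 0 R) :=
    hf.continuousOn.mono fun s hs => ne_zero_of_mem_sphere hR hs
  obtain ⟨i1, -, e1⟩ := circleIntegral_swap (by linarith : 0 < A) hγ hρ hM (fun τ hτ => (h τ hτ).2.ne)
    (hfc A (by linarith))
  obtain ⟨i2, -, e2⟩ := circleIntegral_swap h0 hγ hρ hM (fun τ hτ => (h τ hτ).1.ne') (hfc _ h0)
  rw [boundaryIntegral, e1, e2, ← intervalIntegral.integral_sub i1 i2,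
    ← intervalIntegral.integral_const_mul]
  refine intervalIntegral.integral_congr fun τ hτ => ?_
  have := boundaryIntegral_cauchy hA hf (h τ hτ)
  rw [boundaryIntegral] at this
  grind

/-- The logarithm in the kernel `c`, with poles on the ray through the unimodular number `u`. -/
def rayLog (u : ℂ) (x : ℝ) (s : ℂ) : ℂ :=
  Complex.log ((s - u * rexp x) / (s - u))

lemma rayLog_mem_slitPlane {R x : ℝ} (h : (1 < R ∧ rexp x ≤ R) ∨
    (R < 1 ∧ R ≤ rexp x)) {u s : ℂ} (hu : ‖u‖ = 1) (hs : ‖s‖ = R) (hne : s ≠ u * rexp x) :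
    s - u ≠ 0 ∧ (s - u * rexp x) / (s - u) ∈ Complex.slitPlane := by
  have hR1 : R ≠ 1 := by rcases h with h | h <;> [exact h.1.ne'; exact h.1.ne]
  have h0 : s - u ≠ 0 := by
    rw [sub_ne_zero]; rintro rfl; exact hR1 (hs.symm.trans hu)
  refine ⟨h0, ?_⟩
  by_contra hq
  rw [Complex.mem_slitPlane_iff_not_le_zero, not_not, Complex.le_def] at hq
  set q := (s - u * rexp x) / (s - u) with hqd
  have hqr : q = (q.re : ℂ) := by
    apply Complex.ext
    · simp
    · simpa using hq.2
  set k := -q.re with hk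
  have hk0 : 0 ≤ k := by rw [hk]; simpa using hq.1
  have e1 : s * (1 + k : ℝ) = u * (rexp x + k : ℝ) := by
    have : s - u * rexp x = q * (s - u) := by rw [hqd]; field_simp
    rw [hqr] at this
    rw [hk]; push_cast
    push_cast at this
    linear_combination this
  have e2 : R * (1 + k) = rexp x + k := by
    have := congrArg norm e1
    rwa [norm_mul, norm_mul, hs, hu, one_mul, norm_real, norm_real,
      norm_of_nonneg (by positivity), norm_of_nonneg (by positivity)] at this
  have hkz : k = 0 := by
    rcases h with h | h <;> nlinarith
  apply hne
  simpa [hkz] using e1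

lemma rayLog_eq_integral {R x : ℝ} (hR : 0 < R) {u s : ℂ} (hu : ‖u‖ = 1) (hs : ‖s‖ = R)
    (h : ∀ τ ∈ uIcc 0 x, rexp τ ≠ R ∧ ((1 < R ∧ rexp τ ≤ R) ∨ (R < 1 ∧ R ≤ rexp τ))) :
    rayLog u x s = ∫ τ in (0 : ℝ)..x, -(u * rexp τ) / (s - u * rexp τ) := by
  have hne τ (hτ : τ ∈ uIcc 0 x) : s ≠ u * rexp τ := by
    rintro rfl
    rw [norm_mul, hu, one_mul, norm_real, norm_of_nonneg (exp_pos τ).le] at hs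
    exact (h τ hτ).1 hs
  have hq τ (hτ : τ ∈ uIcc 0 x) := rayLog_mem_slitPlane (h τ hτ).2 hu hs (hne τ hτ)
  have h0 := (hq 0 left_mem_uIcc).1
  have hd τ (hτ : τ ∈ uIcc 0 x) : HasDerivAt (fun τ : ℝ => rayLog u τ s)
      (-(u * rexp τ) / (s - u * rexp τ)) τ := by
    have h1 : HasDerivAt (fun τ : ℝ => (s - u * rexp τ) / (s - u)) (-(u * rexp τ) / (s - u)) τ :=
      (((Real.hasDerivAt_exp τ).ofReal_comp.const_mul u).const_sub s).div_const (s - u)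
    have h2 := h1.clog_real (hq τ hτ).2
    refine h2.congr_deriv ?_
    have := sub_ne_zero.2 (hne τ hτ)
    field_simp
  have h3 := integral_eq_sub_of_hasDerivAt hd (ContinuousOn.intervalIntegrable
    (ContinuousOn.div (by fun_prop) (by fun_prop) fun τ hτ => sub_ne_zero.2 (hne τ hτ)))
  rw [h3]
  simp [rayLog]

lemma abs_log_le {a t b : ℝ} (ha : 0 < a) (h1 : a ≤ t) (h2 : t ≤ b) :
    |log t| ≤ |log a| + |log b| := by
  have ht := ha.trans_le h1
  have l1 := Real.log_le_log ha h1
  have l2 := Real.log_le_log ht h2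
  grind

lemma exists_norm_rayLog_le {R b : ℝ} (h : (1 < R ∧ rexp b ≤ R) ∨ (R < 1 ∧ R ≤ rexp b)) :
    ∃ C : ℝ, ∀ κ ∈ Icc (0 : ℝ) 1, ∀ u s : ℂ, ‖u‖ = 1 → ‖s‖ = R → s ≠ u * rexp b →
      ‖rayLog u (κ * b) s‖ ≤ |log ‖s - u * rexp b‖| + C := by
  have hb := exp_pos b
  have hR1 : 0 < |R - 1| := by
    rw [abs_pos, sub_ne_zero]; rcases h with h | h <;> [exact h.1.ne'; exact h.1.ne]
  set D := max 2 ((R + rexp b) / |R - 1|) with hD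
  have hD2 : 2 ≤ D := le_max_left _ _
  set B := R + rexp b + 1 with hB
  refine ⟨|log D| + |log B| + (|log (|R - 1|)| + |log B|) + π, ?_⟩
  intro κ hκ u s hu hs hne
  set w := u * rexp (κ * b) with hw
  have hwn : ‖w‖ = rexp (κ * b) := by
    rw [norm_mul, hu, one_mul, norm_real, norm_of_nonneg (exp_pos _).le]
  have hd : ‖w - u * rexp b‖ = |rexp (κ * b) - rexp b| := by
    rw [← mul_sub, norm_mul, hu, one_mul, ← ofReal_sub, norm_real, norm_eq_abs]
  have hsw : |R - rexp (κ * b)| ≤ ‖s - w‖ := by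
    have := abs_norm_sub_norm_le s w
    rwa [hs, hwn] at this
  have hpos : 0 < ‖s - u * rexp b‖ := norm_pos_iff.2 (sub_ne_zero.2 hne)
  have hexp1 : rexp (κ * b) ≤ rexp b + 1 := by
    rcases le_total 0 b with hb0 | hb0
    · have : rexp (κ * b) ≤ rexp b := exp_le_exp.2 (by nlinarith [hκ.2])
      linarith
    · have : rexp (κ * b) ≤ 1 := exp_le_one_iff.2 (mul_nonpos_of_nonneg_of_nonpos hκ.1 hb0)
      linarith
  have key : ‖s - u * rexp b‖ ≤ D * ‖s - w‖ := by
    have hsb : ‖s - u * rexp b‖ ≤ R + rexp b := by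
      refine (norm_sub_le _ _).trans ?_
      rw [hs, norm_mul, hu, one_mul, norm_real, norm_of_nonneg hb.le]
    have case1 (h1 : |rexp (κ * b) - rexp b| ≤ |R - rexp (κ * b)|) :
        ‖s - u * rexp b‖ ≤ D * ‖s - w‖ := by
      have h2 := norm_sub_le_norm_sub_add_norm_sub s w (u * rexp b)
      rw [hd] at h2
      nlinarith [norm_nonneg (s - w)]
    have case2 (h1 : |R - 1| ≤ |R - rexp (κ * b)|) : ‖s - u * rexp b‖ ≤ D * ‖s - w‖ := by
      have h3 : (R + rexp b) / |R - 1| * |R - 1| ≤ D * ‖s - w‖ :=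
        mul_le_mul (le_max_right _ _) (h1.trans hsw) (abs_nonneg _) (by linarith)
      rw [div_mul_cancel₀ _ hR1.ne'] at h3
      exact hsb.trans h3
    rcases le_total 0 b with hb0 | hb0
    · have e1 : rexp (κ * b) ≤ rexp b := exp_le_exp.2 (by nlinarith [hκ.2])
      have e2 : 1 ≤ rexp (κ * b) := one_le_exp (mul_nonneg hκ.1 hb0)
      grind
    · have e1 : rexp b ≤ rexp (κ * b) := exp_le_exp.2 (by nlinarith [hκ.2])
      have e2 : rexp (κ * b) ≤ 1 :=
        exp_le_one_iff.2 (mul_nonpos_of_nonneg_of_nonpos hκ.1 hb0)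
      grind
  have hpw : ‖s - u * rexp b‖ / D ≤ ‖s - w‖ := by
    rw [div_le_iff₀ (by linarith)]; linarith
  have hpw0 : 0 < ‖s - u * rexp b‖ / D := div_pos hpos (by linarith)
  have hw1 : ‖s - w‖ ≤ B := by
    refine (norm_sub_le _ _).trans ?_
    rw [hs, hwn, hB]; linarith
  have hu1 : |R - 1| ≤ ‖s - u‖ := by
    have := abs_norm_sub_norm_le s u
    rwa [hs, hu] at this
  have hu2 : ‖s - u‖ ≤ B := by
    refine (norm_sub_le _ _).trans ?_
    rw [hs, hu, hB]; linarith
  have l1 := abs_log_le hpw0 hpw hw1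
  have l2 := abs_log_le hR1 hu1 hu2
  rw [Real.log_div hpos.ne' (by linarith)] at l1
  have l3 := abs_sub (log ‖s - u * rexp b‖) (log D)
  have l4 : ‖rayLog u (κ * b) s‖ ≤ |log ‖s - w‖ - log ‖s - u‖| + π := by
    refine (Complex.norm_le_abs_re_add_abs_im _).trans ?_
    rw [rayLog, log_re, Complex.log_im, norm_div,
      Real.log_div (hpw0.trans_le hpw).ne' (hR1.trans_le hu1).ne']
    gcongr
    exact Complex.abs_arg_le_pi _
  grind

lemma measurable_rayLog (u : ℂ) (x : ℝ) : Measurable (rayLog u x) := by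
  unfold rayLog
  fun_prop

lemma circleIntegrable_rayLog {R b : ℝ} (hR : 0 < R)
    (h : (1 < R ∧ rexp b ≤ R) ∨ (R < 1 ∧ R ≤ rexp b)) {u : ℂ} (hu : ‖u‖ = 1) :
    CircleIntegrable (rayLog u b) 0 R := by
  obtain ⟨C, hC⟩ := exists_norm_rayLog_le h
  have hi : CircleIntegrable (fun s => |log ‖s - u * rexp b‖| + C) 0 R :=
    ((circleIntegrable_log_norm_sub_const R).abs).add (circleIntegrable_const C 0 R)
  refine IntervalIntegrable.mono_fun' hi
    ((measurable_rayLog u b).comp (continuous_circleMap 0 R).measurable).aestronglyMeasurable ?_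
  refine ae_restrict_of_ae ?_
  filter_upwards [((countable_singleton (u * rexp b)).preimage_circleMap 0
    hR.ne').ae_notMem volume] with θ hθ
  have := hC 1 (by simp) u _ hu (mem_sphere_zero_iff_norm.1 (circleMap_mem_sphere 0 hR.le θ)) hθ
  rwa [one_mul] at this

lemma tendsto_circleIntegral_rayLog {R b : ℝ} (hR : 0 < R)
    (h : (1 < R ∧ rexp b ≤ R) ∨ (R < 1 ∧ R ≤ rexp b)) {u : ℂ} (hu : ‖u‖ = 1) {f : ℂ → ℂ}
    (hf : ContinuousOn f (sphere 0 R)) :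
    Tendsto (fun κ : ℝ => ∮ s in C(0, R), rayLog u (κ * b) s * f s) (𝓝[<] 1)
      (𝓝 (∮ s in C(0, R), rayLog u b s * f s)) := by
  obtain ⟨C, hC⟩ := exists_norm_rayLog_le h
  obtain ⟨M, hM⟩ := (isCompact_sphere 0 R).exists_bound_of_continuousOn hf
  have hi : CircleIntegrable (fun s => |log ‖s - u * rexp b‖| + C) 0 R :=
    ((circleIntegrable_log_norm_sub_const R).abs).add (circleIntegrable_const C 0 R)
  have hfc : Continuous fun θ => f (circleMap 0 R θ) :=
    hf.comp_continuous (continuous_circleMap _ _) fun θ => circleMap_mem_sphere _ hR.le _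
  have hsm θ := circleMap_mem_sphere 0 hR.le θ
  refine intervalIntegral.tendsto_integral_filter_of_dominated_convergence
    (fun θ => R * ((|log ‖circleMap 0 R θ - u * rexp b‖| + C) * M)) ?_ ?_ ?_ ?_
  · refine .of_forall fun κ => ?_
    have h1 : Continuous fun θ => deriv (circleMap 0 R) θ := by
      simp only [deriv_circleMap]; fun_prop
    exact h1.aestronglyMeasurable.mul (((measurable_rayLog u _).comp
        (continuous_circleMap 0 R).measurable).aestronglyMeasurable.mul hfc.aestronglyMeasurable)
  · filter_upwards [Ico_mem_nhdsLT (zero_lt_one' ℝ)] with κ hκ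
    filter_upwards [((countable_singleton (u * rexp b)).preimage_circleMap 0
      hR.ne').ae_notMem volume] with θ hθ _
    have h1 := hC κ ⟨hκ.1, hκ.2.le⟩ u _ hu (mem_sphere_zero_iff_norm.1 (hsm θ)) hθ
    rw [norm_smul, norm_mul]
    have h2 : ‖deriv (circleMap 0 R) θ‖ = R := by simp [abs_of_pos hR]
    rw [h2]
    have h3 := (norm_nonneg _).trans h1
    gcongr
    exact hM _ (hsm θ)
  · exact (IntervalIntegrable.mul_const hi M).const_mul R
  · filter_upwards [((countable_singleton (u * rexp b)).preimage_circleMap 0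
      hR.ne').ae_notMem volume] with θ hθ _
    refine Tendsto.smul tendsto_const_nhds (Tendsto.mul_const _ ?_)
    have hsl := (rayLog_mem_slitPlane h hu (mem_sphere_zero_iff_norm.1 (hsm θ)) hθ).2
    have h1 : ContinuousAt (fun κ : ℝ => rayLog u (κ * b) (circleMap 0 R θ)) 1 := by
      unfold rayLog
      refine ContinuousAt.clog (by fun_prop) ?_
      rwa [one_mul]
    have h2 := h1.tendsto
    rw [one_mul] at h2
    exact h2.mono_left nhdsWithin_le_nhds

lemma exp_mem_ring {A τ : ℝ} (hA : 1 < A) (h : |τ| < log A) {u : ℂ} (hu : ‖u‖ = 1) :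
    A⁻¹ < rexp τ ∧ rexp τ < A ∧ u * rexp τ ∈ ring A := by
  have hA0 : 0 < A := by linarith
  have h1 : rexp τ < A := (Real.lt_log_iff_exp_lt hA0).1 ((le_abs_self τ).trans_lt h)
  have h2 : A⁻¹ < rexp τ := by
    rw [← Real.exp_log hA0, ← Real.exp_neg, exp_lt_exp]
    linarith [neg_abs_le τ]
  refine ⟨h2, h1, ?_⟩
  change A⁻¹ < ‖_‖ ∧ ‖_‖ < A
  simp_all

lemma norm_exp_mul_I (α : ℝ) : ‖cexp (α * I)‖ = 1 :=
  norm_exp_ofReal_mul_I α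

lemma circleIntegral_combination {R : ℝ} {g f₁ f₂ f₃ f₄ : ℂ → ℂ} (p q : ℂ)
    (h₁ : CircleIntegrable f₁ 0 R) (h₂ : CircleIntegrable f₂ 0 R) (h₃ : CircleIntegrable f₃ 0 R)
    (h₄ : CircleIntegrable f₄ 0 R) (hg : ∀ᵐ θ : ℝ, g (circleMap 0 R θ) =
      p * (f₁ (circleMap 0 R θ) - q * f₂ (circleMap 0 R θ) - f₃ (circleMap 0 R θ)) +
        f₄ (circleMap 0 R θ)) :
    CircleIntegrable g 0 R ∧ (∮ s in C(0, R), g s) = p * ((∮ s in C(0, R), f₁ s) -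
      q * (∮ s in C(0, R), f₂ s) - ∮ s in C(0, R), f₃ s) + ∮ s in C(0, R), f₄ s := by
  have j1 : CircleIntegrable (fun s => q * f₂ s) 0 R := IntervalIntegrable.const_mul h₂ q
  have j2 : CircleIntegrable (fun s => f₁ s - q * f₂ s) 0 R := h₁.sub j1
  have j3 : CircleIntegrable (fun s => f₁ s - q * f₂ s - f₃ s) 0 R := j2.sub h₃
  have j4 : CircleIntegrable (fun s => p * (f₁ s - q * f₂ s - f₃ s)) 0 R :=
    IntervalIntegrable.const_mul j3 p
  have j5 : CircleIntegrable (fun s => p * (f₁ s - q * f₂ s - f₃ s) + f₄ s) 0 R := j4.add h₄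
  constructor
  · refine IntervalIntegrable.congr_ae j5 (ae_restrict_of_ae ?_)
    grind
  · rw [← circleIntegral.integral_const_mul, ← circleIntegral.integral_sub h₁ j1,
      ← circleIntegral.integral_sub j2 h₃, ← circleIntegral.integral_const_mul,
      ← circleIntegral.integral_add j4 h₄]
    refine intervalIntegral.integral_congr_ae ?_
    filter_upwards [hg] with θ hθ _
    rw [hθ]

section Primitive

variable {A : ℝ} {F P : ℂ → ℂ}

lemma separated {b R : ℝ} (hA : 1 < A) (hb : |b| = log A) (hR : R = A ∨ R = A⁻¹) :
    (1 < R ∧ rexp b ≤ R) ∨ (R < 1 ∧ R ≤ rexp b) := by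
  have hA0 : 0 < A := by linarith
  rcases hR with rfl | rfl
  · exact Or.inl ⟨hA, by rw [← Real.le_log_iff_exp_le hA0, ← hb]; exact le_abs_self b⟩
  · refine Or.inr ⟨(ring_lt hA).2.1, ?_⟩
    rw [← Real.exp_log hA0, ← Real.exp_neg, exp_le_exp, ← hb]
    exact neg_abs_le b

lemma hasDerivAt_comp_line (hP : ∀ w, HasDerivAt P (F (cexp w)) w) (w d : ℂ) (t : ℝ) :
    HasDerivAt (fun t : ℝ => P (t * d + w)) (d * F (cexp (t * d + w))) t := by
  have h1 : HasDerivAt (fun x : ℂ => x * d + w) d t := by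
    simpa using ((hasDerivAt_id (t : ℂ)).mul_const d).add_const w
  exact (hP _).scomp t h1.comp_ofReal

lemma continuous_comp_line (hF : DifferentiableOn ℂ F {0}ᶜ) (w d : ℂ) :
    Continuous fun t : ℝ => F (cexp (t * d + w)) :=
  hF.continuousOn.comp_continuous (by fun_prop) fun _ => exp_ne_zero _

lemma boundaryIntegral_rayLog (hA : 1 < A) {b : ℝ} (hb : |b| = log A) (α : ℝ)
    (hF : DifferentiableOn ℂ F {0}ᶜ) (hP : ∀ w, HasDerivAt P (F (cexp w)) w) :
    boundaryIntegral A (fun s => rayLog (cexp (α * I)) b s * (F s / s)) =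
      -(2 * π * I) * (P (b + α * I) - P (α * I)) := by
  have hA0 : 0 < A := by linarith
  obtain ⟨h0, hi1, -⟩ := ring_lt hA
  have hu := norm_exp_mul_I α
  set u := cexp (α * I) with hud
  have hFs : DifferentiableOn ℂ (fun s => F s / s) {0}ᶜ :=
    hF.div differentiableOn_id fun s hs => hs
  have hFc R (hR : 0 < R) : ContinuousOn (fun s => F s / s) (sphere 0 R) :=
    hFs.continuousOn.mono fun s hs => ne_zero_of_mem_sphere hR hs
  have hlim := (tendsto_circleIntegral_rayLog hA0 (separated hA hb (Or.inl rfl)) hu (hFc A hA0)).sub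
    (tendsto_circleIntegral_rayLog h0 (separated hA hb (Or.inr rfl)) hu (hFc _ h0))
  have hval κ (hκ : κ ∈ Ico 0 1) : ((∮ s in C(0, A), rayLog u (κ * b) s * (F s / s)) -
        ∮ s in C(0, A⁻¹), rayLog u (κ * b) s * (F s / s)) =
      -(2 * π * I) * (P ((κ * b : ℝ) + α * I) - P (α * I)) := by
    have hτ τ (h : τ ∈ uIcc 0 (κ * b)) : |τ| < log A := by
      have h1 : |τ| ≤ |κ * b| := by
        have := abs_sub_left_of_mem_uIcc h
        simpa using this
      rw [abs_mul, abs_of_nonneg hκ.1, hb] at h1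
      have := log_pos hA
      nlinarith [hκ.2]
    have hsup := boundaryIntegral_superposition hA
      (ρ := fun τ : ℝ => -(u * rexp τ)) (by fun_prop) (by fun_prop)
      (fun τ h => by
        rw [norm_neg, norm_mul, hu, one_mul, norm_real, norm_of_nonneg (exp_pos _).le]
        exact (exp_mem_ring hA (hτ τ h) hu).2.1.le)
      (fun τ h => (exp_mem_ring hA (hτ τ h) hu).2.2) hFs
    have hlog R (hR : 0 < R) (hRA : R = A ∨ R = A⁻¹) :
        (∮ s in C(0, R), rayLog u (κ * b) s * (F s / s)) = ∮ s in C(0, R),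
          (∫ τ in 0..κ * b, -(u * rexp τ) / (s - u * rexp τ)) * (F s / s) := by
      refine circleIntegral.integral_congr hR.le fun s hs => ?_
      rw [rayLog_eq_integral hR hu (mem_sphere_zero_iff_norm.1 hs) fun τ h => ?_]
      obtain ⟨h1, h2, -⟩ := exp_mem_ring hA (hτ τ h) hu
      rcases hRA with rfl | rfl
      · grind
      · grind
    rw [hlog A hA0 (Or.inl rfl), hlog _ h0 (Or.inr rfl)]
    rw [boundaryIntegral] at hsup
    rw [hsup]
    have h3 := integral_eq_sub_of_hasDerivAt (a := 0) (b := κ * b)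
      (fun τ _ => hasDerivAt_comp_line hP (α * I) 1 τ)
      ((continuous_const.mul (continuous_comp_line hF (α * I) 1)).intervalIntegrable _ _)
    simp only [mul_one, one_mul, ofReal_zero, zero_add] at h3
    rw [← h3, neg_mul, ← mul_neg, ← intervalIntegral.integral_neg]
    congr 2; funext τ
    have he : u * rexp τ = cexp (τ + α * I) := by
      rw [exp_add, hud]; push_cast; ring
    have hne := exp_ne_zero (τ + α * I)
    rw [he]; field_simp
  have hPc : Continuous P := continuous_iff_continuousAt.2 fun w => (hP w).continuousAt
  have hlim2 : Tendsto (fun κ : ℝ => -(2 * π * I) * (P ((κ * b : ℝ) + α * I) - P (α * I))) (𝓝[<] 1)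
      (𝓝 (-(2 * π * I) * (P (b + α * I) - P (α * I)))) := by
    have : Continuous fun κ : ℝ => -(2 * π * I) *
      (P ((κ * b : ℝ) + α * I) - P (α * I)) := by fun_prop
    have h := this.tendsto 1
    rw [one_mul] at h
    exact h.mono_left nhdsWithin_le_nhds
  refine tendsto_nhds_unique hlim (hlim2.congr' ?_)
  filter_upwards [Ico_mem_nhdsLT (zero_lt_one' ℝ)] with κ hκ
  exact (hval κ hκ).symm

/-- The Heaviside factor in the kernel `c`. -/
def halfCircle (σ α t : ℝ) : ℝ := heaviside (-(2 * σ * sin (t - α)))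

lemma measurable_halfCircle (σ α : ℝ) : Measurable (halfCircle σ α) := by
  have h : Measurable heaviside := Measurable.ite measurableSet_Ioi measurable_const measurable_const
  exact h.comp (by fun_prop)

lemma integral_halfCircle {σ : ℝ} (hσ : σ = 1 ∨ σ = -1) (α : ℝ) (hF : DifferentiableOn ℂ F {0}ᶜ)
    (hP : ∀ w, HasDerivAt P (F (cexp w)) w) :
    I * ∫ t in (0 : ℝ)..2 * π, halfCircle σ α t * F (cexp (t * I)) =
      σ * (P (α * I) - P (α * I - σ * π * I)) := by
  have hper : Function.Periodic (fun t : ℝ => (halfCircle σ α t) * F (cexp (t * I)))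
      (2 * π) := fun t => by
    simp only [halfCircle]
    rw [add_sub_right_comm, Real.sin_add_two_pi]
    push_cast
    rw [add_mul, exp_add, exp_two_pi_mul_I, mul_one]
  have hc := continuous_comp_line hF 0 I
  have h1 := hper.intervalIntegral_add_eq 0 (α - π)
  rw [zero_add, (by ring : α - π + 2 * π = α + π)] at h1
  have hFTC (a b) : I * ∫ t in a..b, F (cexp (t * I)) = P (b * I) - P (a * I) := by
    have h3 := integral_eq_sub_of_hasDerivAt (a := a) (b := b)
      (fun τ _ => hasDerivAt_comp_line hP 0 I τ)
      ((continuous_const.mul hc).intervalIntegrable _ _)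
    simp only [add_zero] at h3
    rw [← h3, intervalIntegral.integral_const_mul]
  simp only [add_zero] at hc
  have hL t (ht : t ∈ Ioo (α - π) α) : sin (t - α) < 0 :=
    Real.sin_neg_of_neg_of_neg_pi_lt (by linarith [ht.2]) (by linarith [ht.1])
  have hR t (ht : t ∈ Ioo α (α + π)) : 0 < sin (t - α) :=
    Real.sin_pos_of_pos_of_lt_pi (by linarith [ht.1]) (by linarith [ht.2])
  have hpi := pi_pos
  have key (a b c₀) (hab : a ≤ b) (h : ∀ t ∈ Ioo a b, halfCircle σ α t = c₀) :
      IntervalIntegrable (fun t : ℝ => (halfCircle σ α t) * F (cexp (t * I))) volume a b ∧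
      (∫ t in a..b, (halfCircle σ α t) * F (cexp (t * I))) =
        c₀ * ∫ t in a..b, F (cexp (t * I)) := by
    have hi := (hc.const_mul c₀).intervalIntegrable (μ := volume) a b
    have he : (fun t : ℝ => c₀ * F (cexp (t * I))) =ᵐ[volume.restrict (uIoc a b)]
        fun t : ℝ => (halfCircle σ α t) * F (cexp (t * I)) := by
      rw [uIoc_of_le hab, ← restrict_Ioo_eq_restrict_Ioc]
      filter_upwards [ae_restrict_mem measurableSet_Ioo] with t ht
      rw [h t ht]
    refine ⟨hi.congr_ae he, ?_⟩
    rw [← intervalIntegral.integral_const_mul]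
    exact (intervalIntegral.integral_congr_ae_restrict he).symm
  rw [h1]
  rcases hσ with rfl | rfl
  · obtain ⟨i1, e1⟩ := key (α - π) α 1 (by linarith) fun t ht => by
      rw [halfCircle, heaviside, if_pos]; linarith [hL t ht]
    obtain ⟨i2, e2⟩ := key α (α + π) 0 (by linarith) fun t ht => by
      rw [halfCircle, heaviside, if_neg]; linarith [hR t ht]
    rw [← integral_add_adjacent_intervals i1 i2, e1, e2]
    push_cast
    rw [one_mul, zero_mul, add_zero, hFTC]
    push_cast; ring_nf
  · obtain ⟨i1, e1⟩ := key (α - π) α 0 (by linarith) fun t ht => by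
      rw [halfCircle, heaviside, if_neg]; linarith [hL t ht]
    obtain ⟨i2, e2⟩ := key α (α + π) 1 (by linarith) fun t ht => by
      rw [halfCircle, heaviside, if_pos]; linarith [hR t ht]
    rw [← integral_add_adjacent_intervals i1 i2, e1, e2]
    push_cast
    rw [one_mul, zero_mul, zero_add, hFTC]
    push_cast; ring_nf

/-- The kernel `c` in logarithmic coordinates. -/
lemma c_eq {b α : ℝ} {s : ℂ} (hs0 : s ≠ 0) (hs1 : ‖s‖ ≠ 1)
    (hs : s ≠ -cexp (α * I) * rexp (-b)) :
    c (cexp (b + α * I)) s = I / 2 * sgn (cexp (b + α * I)) * (1 / s) *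
        (rayLog (cexp (α * I)) b s - b - rayLog (-cexp (α * I)) (-b) s) +
      ∫ t in (0 : ℝ)..2 * π, (halfCircle (sgn (cexp (b + α * I))) α t / 2 : ℂ) /
        (s - cexp (t * I)) := by
  set σ := sgn (cexp (b + α * I)) with hσ
  have hu := norm_exp_mul_I α
  set u := cexp (α * I) with hud
  have hu0 : u ≠ 0 := exp_ne_zero _
  have hl : cexp (b + α * I) = u * rexp b := by
    rw [exp_add, hud]; push_cast; ring
  have hn : ‖cexp (b + α * I)‖ = rexp b := by
    rw [hl, norm_mul, hu, one_mul, norm_real, norm_of_nonneg (exp_pos _).le]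
  have hcu : conj u ≠ 0 := by simpa using hu0
  have huc : u * conj u = 1 := by rw [mul_conj, normSq_eq_norm_sq, hu]; simp
  have hdu : cexp (b + α * I) / (rexp b) = u := by rw [hl]; field_simp
  have hdu' : conj (cexp (b + α * I)) / (rexp b) = conj u := by
    rw [hl, map_mul, conj_ofReal]; field_simp
  have hsu : s + u ≠ 0 := by
    intro h
    have h' : s = -u := eq_neg_of_add_eq_zero_left h
    rw [h', norm_neg, hu] at hs1
    exact hs1 rfl
  have hem : ((rexp (-b)) : ℂ) * (rexp b) = 1 := by
    rw [← ofReal_mul, ← Real.exp_add]; simp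
  have hσ' : Real.sign (rexp b ^ 2 - 1) = σ := by rw [hσ, sgn, hn]
  rw [c, hn, hdu, hdu', hσ']
  congr 1
  · congr 1
    rw [sub_sub]
    congr 1
    · rw [rayLog, ← hl]
    · have e1 : (-1 / s - conj (cexp (b + α * I))) / (-1 / s - conj u) =
          (rexp b) * ((s - -u * rexp (-b)) / (s - -u)) := by
        rw [hl, map_mul, conj_ofReal]
        have h1 : -1 / s - conj u = -(conj u / s) * (s - -u) := by
          field_simp; linear_combination huc
        have h2 : -1 / s - conj u * (rexp b) =
            -(conj u / s) * ((rexp b) * (s - -u * rexp (-b))) := by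
          field_simp; linear_combination huc + u * conj u * hem
        have h3 : -(conj u / s) ≠ 0 := neg_ne_zero.2 (div_ne_zero hcu hs0)
        rw [h1, h2, mul_div_mul_left _ _ h3, mul_div_assoc]
      rw [e1, Complex.log_ofReal_mul (exp_pos b), log_exp, rayLog]
      grind
  · congr 1; funext t
    have e2 : I * σ * ((rexp b) * cexp (I * t) / cexp (b + α * I) -
          cexp (b + α * I) / ((rexp b) * cexp (I * t))) =
        ((-(2 * σ * sin (t - α)) : ℝ)) := by
      have h1 : cexp (I * t) = u * cexp ((t - α) * I) := by
        rw [← exp_add]; congr 1; ring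
      have h2 := exp_ne_zero ((t - α) * I)
      have h3 := Complex.two_sin (t - α)
      have h4 : cexp (-(t - α) * I) = (cexp ((t - α) * I))⁻¹ := by rw [neg_mul, exp_neg]
      rw [h4] at h3
      rw [hl, h1]
      push_cast
      have heb' : cexp b ≠ 0 := exp_ne_zero _
      have h5 : -(2 * σ * Complex.sin (t - α)) = -(σ * (2 * Complex.sin (t - α))) := by ring
      rw [h5, h3]
      field_simp
      ring
    rw [e2, ofReal_re, halfCircle, mul_comm I]
    field_simp

lemma boundaryIntegral_c {l ω : ℂ} (hA : 1 < A) (hω : cexp ω = l) (hl : |ω.re| = log A)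
    (hF : DifferentiableOn ℂ F {0}ᶜ) (hP : ∀ w, HasDerivAt P (F (cexp w)) w) :
    BoundaryIntegrable A (fun s => c l s * F s) ∧
    boundaryIntegral A (fun s => c l s * F s) = π * sgn l * (P ω - P (antiLog (sgn l) ω)) := by
  have hA0 : 0 < A := by linarith
  obtain ⟨h0, hi1, -⟩ := ring_lt hA
  set b := ω.re with hb
  set α := ω.im with hα
  have hωe : ω = b + α * I := (re_add_im ω).symm
  have hb0 : b ≠ 0 := by
    have := log_pos hA
    rintro h; rw [h, abs_zero] at hl; linarith
  have hl1 : ‖l‖ ≠ 1 := by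
    rw [← hω, norm_exp]; simpa using hb0
  have hσ := sgn_eq hl1
  set σ := sgn l with hσd
  set u := cexp (α * I) with hud
  have hu := norm_exp_mul_I α
  have hun : -u = cexp ((α - σ * π : ℝ) * I) := by
    push_cast
    rw [sub_mul, Complex.exp_sub, ← hud]
    rcases hσ with h | h <;> rw [h] <;> push_cast
    · rw [one_mul, exp_pi_mul_I]; field_simp
    · rw [neg_one_mul, neg_mul, exp_neg, exp_pi_mul_I]; field_simp
  have hbn : |(-b)| = log A := by rw [abs_neg, hl]
  set third : ℂ → ℂ := fun s => ∫ t in 0..2 * π, (halfCircle σ α t / 2) /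
    (s - cexp (t * I)) with hthird
  have hFs : DifferentiableOn ℂ (fun s => F s / s) {0}ᶜ := hF.div differentiableOn_id fun s hs => hs
  set f₁ : ℂ → ℂ := fun s => rayLog u b s * (F s / s) with hf₁
  set f₂ : ℂ → ℂ := fun s => F s / s with hf₂
  set f₃ : ℂ → ℂ := fun s => rayLog (-u) (-b) s * (F s / s) with hf₃
  set f₄ : ℂ → ℂ := fun s => third s * F s with hf₄
  have hm : Measurable fun t : ℝ => (halfCircle σ α t / 2 : ℂ) :=
    (Complex.measurable_ofReal.comp (measurable_halfCircle σ α)).div_const 2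
  have hγ : Continuous fun t : ℝ => cexp (t * I) := by fun_prop
  have hM t (_ : t ∈ uIcc 0 (2 * π)) : ‖(halfCircle σ α t / 2 : ℂ)‖ ≤ 1 := by
    rw [halfCircle, heaviside]
    split_ifs <;> norm_num
  have hring t (_ : t ∈ uIcc 0 (2 * π)) : cexp (t * I) ∈ ring A := by
    change A⁻¹ < ‖_‖ ∧ ‖_‖ < A
    rw [norm_exp_mul_I]; exact ⟨hi1, hA⟩
  have hex R (hR : R = A ∨ R = A⁻¹) : 0 < R ∧ R ≠ 1 := by
    rcases hR with rfl | rfl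
    · exact ⟨hA0, hA.ne'⟩
    · exact ⟨h0, hi1.ne⟩
  have hint R (hR : R = A ∨ R = A⁻¹) : CircleIntegrable f₁ 0 R ∧ CircleIntegrable f₂ 0 R ∧
      CircleIntegrable f₃ 0 R ∧ CircleIntegrable f₄ 0 R := by
    have hR0 := (hex R hR).1
    have hc : ContinuousOn f₂ (sphere 0 |R|) := by
      rw [abs_of_pos hR0]
      exact hFs.continuousOn.mono fun s hs => ne_zero_of_mem_sphere hR0 hs
    refine ⟨(circleIntegrable_rayLog hR0 (separated hA hl hR) hu).mul_continuousOn hc,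
      hc.circleIntegrable', (circleIntegrable_rayLog hR0 (separated hA hbn hR)
        (by rwa [norm_neg])).mul_continuousOn hc, ?_⟩
    refine (circleIntegral_swap hR0 hγ hm hM (fun t _ => ?_)
      (hF.continuousOn.mono fun s hs => ne_zero_of_mem_sphere hR0 hs)).2.1
    rw [norm_exp_mul_I]; exact (hex R hR).2.symm
  have heq R (hR : R = A ∨ R = A⁻¹) : ∀ᵐ θ : ℝ, c l (circleMap 0 R θ) * F (circleMap 0 R θ) =
      I / 2 * σ * (f₁ (circleMap 0 R θ) - b * f₂ (circleMap 0 R θ) - f₃ (circleMap 0 R θ)) +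
        f₄ (circleMap 0 R θ) := by
    filter_upwards [((countable_singleton (-u * rexp (-b))).preimage_circleMap 0
      (hex R hR).1.ne').ae_notMem volume] with θ hθ
    have hs := circleMap_mem_sphere 0 (hex R hR).1.le θ
    have := c_eq (ne_zero_of_mem_sphere (hex R hR).1 hs)
      (by rw [mem_sphere_zero_iff_norm.1 hs]; exact (hex R hR).2) hθ
    rw [← hωe, hω] at this
    simp only [this, hf₁, hf₂, hf₃, hf₄, hthird]
    ring
  have hval R (hR : R = A ∨ R = A⁻¹) := by
    obtain ⟨i1, i2, i3, i4⟩ := hint R hR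
    exact circleIntegral_combination (g := fun s => c l s * F s) _ _ i1 i2 i3 i4 (heq R hR)
  refine ⟨⟨(hval A (Or.inl rfl)).1, (hval _ (Or.inr rfl)).1⟩, ?_⟩
  have b1 := boundaryIntegral_rayLog hA hl α hF hP
  have b3 := boundaryIntegral_rayLog hA hbn (α - σ * π) hF hP
  rw [← hun] at b3
  have b2 : boundaryIntegral A f₂ = 0 := boundaryIntegral_eq_zero hA fun s hs _ =>
    (hFs s (norm_pos_iff.1 (h0.trans_le hs))).differentiableAt
      (isOpen_compl_singleton.mem_nhds (norm_pos_iff.1 (h0.trans_le hs)))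
  have b4 : boundaryIntegral A f₄ = _ := boundaryIntegral_superposition hA hγ hm hM hring hF
  have b5 := integral_halfCircle hσ α hF hP
  have e5 : (∫ t in 0..2 * π, (halfCircle σ α t / 2) * F (cexp (t * I))) =
      1 / 2 * ∫ t in 0..2 * π, halfCircle σ α t * F (cexp (t * I)) := by
    rw [← intervalIntegral.integral_const_mul]
    congr 1; funext t; ring
  rw [e5] at b4
  rw [boundaryIntegral] at b1 b2 b3 b4
  rw [boundaryIntegral, (hval A (Or.inl rfl)).2, (hval _ (Or.inr rfl)).2]
  have ea : antiLog σ ω = ((-b : ℝ)) + ((α - σ * π : ℝ)) * I := by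
    rw [antiLog, hωe]
    simp only [map_add, map_mul, conj_ofReal, conj_I]
    push_cast; ring
  have e6 : ((α - σ * π : ℝ)) * I = α * I - σ * π * I := by
    push_cast; ring
  rw [e6] at b3 ea
  rw [ea, hωe]
  linear_combination (I / 2 * σ) * (b1 - b * b2 - b3) + b4 + π * b5 -
    π * σ * (P (b + α * I) - P (α * I) - (P ((-b : ℝ) + (α * I - σ * π * I)) -
      P (α * I - σ * π * I))) * I_sq

end Primitive

section Wirtinger

variable {X : Type*} [NormedAddCommGroup X] [NormedSpace ℂ X]

/-- The real-linear map with Wirtinger derivatives `α` and `β`. -/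
def wirt (α β : X) : ℂ →L[ℝ] X :=
  (ContinuousLinearMap.id ℝ ℂ).smulRight α + (conjCLE : ℂ →L[ℝ] ℂ).smulRight β

lemma wirt_apply (α β : X) (η : ℂ) : wirt α β η = η • α + conj η • β := rfl

lemma hasFDerivAt_wirt_left {P : ℂ → X} {p : X} {ω : ℂ} (h : HasDerivAt P p ω) :
    HasFDerivAt P (wirt p 0) ω := by
  refine (h.hasFDerivAt.restrictScalars ℝ).congr_fderiv ?_
  ext η
  simp [wirt_apply]

lemma hasFDerivAt_antiLog (σ : ℝ) (ω : ℂ) :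
    HasFDerivAt (antiLog σ) (-(conjCLE : ℂ →L[ℝ] ℂ)) ω :=
  ((conjCLE : ℂ →L[ℝ] ℂ).hasFDerivAt.neg).sub_const _

lemma hasFDerivAt_comp_antiLog {P : ℂ → X} {p : X} {σ : ℝ} {ω : ℂ}
    (h : HasDerivAt P p (antiLog σ ω)) : HasFDerivAt (fun ω => P (antiLog σ ω)) (wirt 0 (-p)) ω := by
  refine ((h.hasFDerivAt.restrictScalars ℝ).comp ω (hasFDerivAt_antiLog σ ω)).congr_fderiv ?_
  ext η
  simp [wirt_apply]

lemma HasFDerivAt.wirt_clm {Y : Type*} [NormedAddCommGroup Y] [NormedSpace ℂ Y] {P : ℂ → X}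
    {α β : X} {ω : ℂ} (h : HasFDerivAt P (wirt α β) ω) (L : X →L[ℂ] Y) :
    HasFDerivAt (fun ω => L (P ω)) (wirt (L α) (L β)) ω := by
  refine ((L.restrictScalars ℝ).hasFDerivAt.comp ω h).congr_fderiv ?_
  ext η
  simp [wirt_apply]

lemma HasFDerivAt.wirt_mul {P Q : ℂ → ℂ} {α β α' β' ω : ℂ} (h : HasFDerivAt P (wirt α β) ω)
    (h' : HasFDerivAt Q (wirt α' β') ω) :
    HasFDerivAt (fun ω => P ω * Q ω) (wirt (P ω * α' + Q ω * α) (P ω * β' + Q ω * β)) ω := by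
  refine (h.mul h').congr_fderiv ?_
  apply ContinuousLinearMap.ext; intro η
  simp only [ContinuousLinearMap.add_apply, ContinuousLinearMap.smul_apply, wirt_apply, smul_eq_mul]
  ring

/-- Wirtinger derivatives of the solution of a linear equation. -/
lemma hasFDerivAt_resolvent [CompleteSpace X] {T : ℂ → X →L[ℂ] X} {τ₁ τ₂ : X →L[ℂ] X} {Φ : ℂ → X}
    {φ : X} {ω : ℂ} (hT : HasFDerivAt T (wirt τ₁ τ₂) ω) (hΦ : HasFDerivAt Φ (wirt φ 0) ω)
    (hU : IsUnit (1 - T ω)) :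
    HasFDerivAt (fun ω => inverse (1 - T ω) (Φ ω))
      (wirt (inverse (1 - T ω) (φ + τ₁ (inverse (1 - T ω) (Φ ω))))
        (inverse (1 - T ω) (τ₂ (inverse (1 - T ω) (Φ ω))))) ω := by
  obtain ⟨u, hu⟩ := hU
  have h1 : HasFDerivAt (fun ω => 1 - T ω) (-wirt τ₁ τ₂) ω := hT.const_sub 1
  have h2 := hasFDerivAt_ringInverse (𝕜 := ℝ) u
  rw [hu] at h2
  have h3 := (ContinuousLinearMap.restrictScalarsL ℂ X X ℝ ℝ).hasFDerivAt.comp ω (h2.comp ω h1)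
  refine (h3.clm_apply hΦ).congr_fderiv ?_
  have hi : (↑u⁻¹ : X →L[ℂ] X) = inverse (1 - T ω) := by rw [← hu, Ring.inverse_unit]
  apply ContinuousLinearMap.ext; intro η
  simp [wirt_apply, hi]
  abel

lemma hasFDerivAt_add_smul_sub {P G : ℂ → X} (T₀ : X) (q : ℂ) (hP : ∀ w, HasDerivAt P (G w) w)
    {σ : ℝ} {ω : ℂ} : HasFDerivAt (fun ω => T₀ + q • (P ω - P (antiLog σ ω)))
      (wirt (q • G ω) (q • G (antiLog σ ω))) ω := by
  refine ((((hasFDerivAt_wirt_left (hP ω)).sub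
    (hasFDerivAt_comp_antiLog (hP (antiLog σ ω)))).const_smul q).const_add T₀).congr_fderiv ?_
  apply ContinuousLinearMap.ext; intro η
  simp [wirt_apply, smul_smul, mul_comm]

lemma eventually_isUnit_one_sub [CompleteSpace X] {T : ℂ → X →L[ℂ] X} {ω : ℂ}
    (hT : ContinuousAt T ω) (hU : IsUnit (1 - T ω)) : ∀ᶠ w in 𝓝 ω, IsUnit (1 - T w) := by
  have h' : ContinuousAt (fun w => 1 - T w) ω := continuousAt_const.sub hT
  exact h'.tendsto (Units.isOpen.mem_nhds hU)

lemma differentiable_clm_comp {Y : Type*} [NormedAddCommGroup Y] [NormedSpace ℂ Y] (L : X →L[ℂ] Y)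
    {P : ℂ → X} (h : Differentiable ℂ P) : Differentiable ℂ fun w => L (P w) :=
  L.differentiable.comp h

end Wirtinger

namespace Setup

variable (S : Setup)

lemma hasFDerivAt_TOp (σ : ℝ) (ω : ℂ) : HasFDerivAt (S.TOp σ)
    (wirt (X := S.X →L[ℂ] S.X) ((σ / (4 * π) : ℂ) • S.Theta (cexp ω))
      ((σ / (4 * π) : ℂ) • S.Theta (cexp (antiLog σ ω)))) ω := by
  exact hasFDerivAt_add_smul_sub S.Tplus _ S.hasDerivAt_Psi

/-- The `∂̄`-derivative of `ψ` in the logarithmic coordinate. -/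
def dbarPsi (σ : ℝ) (ω : ℂ) : S.X :=
  ((σ / (4 * π) : ℂ) * S.ell (S.Phi (-cexp (antiLog σ ω)) * S.psiX σ ω)) • S.psiX (-σ) (antiLog σ ω)

lemma hasFDerivAt_psiX {σ : ℝ} {ω : ℂ} (hU : IsUnit (1 - S.TOp σ ω)) :
    ∃ α, HasFDerivAt (S.psiX σ) (wirt α (S.dbarPsi σ ω)) ω := by
  have h := hasFDerivAt_resolvent (S.hasFDerivAt_TOp σ ω)
    (hasFDerivAt_wirt_left (S.differentiable_Phi_exp ω).hasDerivAt) hU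
  refine ⟨_, h.congr_fderiv (congrArg _ ?_)⟩
  change inverse (1 - S.TOp σ ω) ((σ / (4 * π) : ℂ) •
    (S.Theta (cexp (antiLog σ ω)) (S.psiX σ ω))) = _
  rw [Theta_apply, map_smul, map_smul, smul_smul, dbarPsi, psiX, psiX, TOp_antiLog]

lemma continuousAt_dbarPsi {σ : ℝ} {ω : ℂ} (hU : IsUnit (1 - S.TOp σ ω)) :
    ContinuousAt (S.dbarPsi σ) ω := by
  obtain ⟨_, h1⟩ := S.hasFDerivAt_psiX hU
  obtain ⟨_, h2⟩ := S.hasFDerivAt_psiX (by rwa [TOp_antiLog])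
  have h3 : ContinuousAt (antiLog σ) ω := (hasFDerivAt_antiLog σ ω).continuousAt
  have h4 : ContinuousAt (fun ω => S.Phi (-cexp (antiLog σ ω))) ω :=
    S.differentiable_Phi_neg_exp.continuous.continuousAt.comp h3
  have h5 : ContinuousAt (fun ω => S.psiX (-σ) (antiLog σ ω)) ω :=
    ContinuousAt.comp h2.continuousAt h3
  exact (continuousAt_const.mul (S.ell.continuous.continuousAt.comp
    (h4.mul h1.continuousAt))).smul h5

lemma eventually_isUnit {σ : ℝ} {ω : ℂ} (hU : IsUnit (1 - S.TOp σ ω)) :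
    ∀ᶠ w in 𝓝 ω, IsUnit (1 - S.TOp σ w) :=
  eventually_isUnit_one_sub (X := S.X) (S.hasFDerivAt_TOp σ ω).continuousAt hU

lemma h_eq {l ω : ℂ} (hω : cexp ω = l) (hl : ‖l‖ ≠ 1) (hU : IsUnit (1 - S.TOp (sgn l) ω)) (s : ℂ) :
    h S.E S.v s l = 1 / (2 * π : ℂ) ^ 2 * S.ell (S.Phi (-s) * S.psiX (sgn l) ω) := by
  rw [h, ell_apply]
  congr 2; funext z
  by_cases hz : z ∈ ball 0 S.R
  · have hz' := ball_subset_closedBall hz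
    rw [S.ext_of_mem _ hz', ContinuousMap.mul_apply, Phi_apply, ← S.psi_eq hω hl hU]
    ring
  · simp [S.v_eq_zero hz]

lemma r_eq {l ω : ℂ} (hω : cexp ω = l) (hl : ‖l‖ ≠ 1)
    (hU : IsUnit (1 - S.TOp (sgn l) ω)) : conj l * r S.E S.v l = (sgn l / (4 * π) : ℂ) *
      S.ell (S.Phi (-cexp (antiLog (sgn l) ω)) * S.psiX (sgn l) ω) := by
  have hl0 : conj l ≠ 0 := by simp [← hω]
  have e : Real.sign (‖l‖ ^ 2 - 1) = sgn l := rfl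
  rw [r, S.h_eq hω hl hU, exp_antiLog (sgn_eq hl), hω, e]
  field_simp
  ring

/-- The density `∂̄μ`. -/
lemma dbarPsi_eq {l ω : ℂ} (hω : cexp ω = l) (hl : ‖l‖ ≠ 1)
    (hU : IsUnit (1 - S.TOp (sgn l) ω)) (z : S.K) : phi0 S.E z (-l) * S.dbarPsi (sgn l) ω z =
      conj l * (r S.E S.v l * e0 S.E z l * mu S.E S.v z (-1 / conj l)) := by
  have hl0 : l ≠ 0 := by rw [← hω]; exact exp_ne_zero _
  have ha := exp_antiLog (sgn_eq hl) ω
  rw [hω] at ha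
  have h1 := S.psi_eq ha (norm_antipode_ne_one hl)
    (by rw [sgn_antipode hl0 hl, TOp_antiLog]; exact hU) z
  rw [sgn_antipode hl0 hl, psi] at h1
  change _ * (_ * S.psiX (-sgn l) (antiLog (sgn l) ω) z) = _
  rw [← S.r_eq hω hl hU, ← h1, e0]
  ring

end Setup

lemma differentiableOn_of_comp_exp {F : ℂ → ℂ} (h : Differentiable ℂ fun w => F (cexp w)) :
    DifferentiableOn ℂ F {0}ᶜ := by
  intro s hs
  have h1 : DifferentiableAt ℂ (fun w => Complex.log (w / s) + Complex.log s) s := by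
    refine DifferentiableAt.add_const _ (DifferentiableAt.clog (by fun_prop) ?_)
    rw [div_self hs]; simp
  have h2 := (h _).comp s h1
  refine (h2.congr_of_eventuallyEq ?_).differentiableWithinAt
  filter_upwards [isOpen_compl_singleton.mem_nhds hs] with w hw
  rw [Function.comp_apply, exp_add, exp_log (div_ne_zero hw hs), exp_log hs, div_mul_cancel₀ _ hs]

namespace Setup

variable (S : Setup)

lemma boundaryIntegral_clm {A : ℝ} {l ω : ℂ} (hA : 1 < A) (hω : cexp ω = l)
    (hl : |ω.re| = log A) (L : S.X →L[ℂ] S.X) (f : S.X) (z : S.K) :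
    BoundaryIntegrable A (fun s => c l s * L (S.Theta s f) z) ∧
    boundaryIntegral A (fun s => c l s * L (S.Theta s f) z) =
      4 * π ^ 2 * L ((S.TOp (sgn l) ω - S.Tplus) f) z := by
  let ev : (S.X →L[ℂ] S.X) →L[ℂ] ℂ :=
    ((ContinuousMap.evalCLM ℂ z).comp L).comp (ContinuousLinearMap.apply ℂ S.X f)
  have hP w : HasDerivAt (fun w => L (S.Psi w f) z) (L (S.Theta (cexp w) f) z) w :=
    hasDerivAt_clm_comp (X := S.X →L[ℂ] S.X) ev (S.hasDerivAt_Psi w)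
  have hF : DifferentiableOn ℂ (fun s => L (S.Theta s f) z) {0}ᶜ :=
    differentiableOn_of_comp_exp 
      (differentiable_clm_comp (X := S.X →L[ℂ] S.X) ev S.differentiable_Theta_exp)
  obtain ⟨h1, h2⟩ := boundaryIntegral_c hA hω hl hF hP
  refine ⟨h1, h2.trans ?_⟩
  have e : (S.TOp (sgn l) ω - S.Tplus) f =
      (sgn l / (4 * π) : ℂ) • (S.Psi ω f - S.Psi (antiLog (sgn l) ω) f) := by
    rw [TOp, add_sub_cancel_left]; rfl
  rw [e, map_smul, map_sub]
  change _ = 4 * π ^ 2 * ((sgn l / (4 * π)) * (L (S.Psi ω f) z - L (S.Psi _ f) z))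
  field_simp

end Setup

lemma integrableOn_reProdIm {f : ℂ → ℂ} {s t : Set ℝ} : IntegrableOn f (s ×ℂ t) ↔
    IntegrableOn (fun p : ℝ × ℝ => f (p.1 + p.2 * I)) (s ×ˢ t) := by
  have h := volume_preserving_equiv_real_prod.symm.integrableOn_comp_preimage
    measurableEquivRealProd.symm.measurableEmbedding (f := f) (s := s ×ℂ t)
  rw [← h]
  refine iff_of_eq (congrArg₂ (fun (g : ℝ × ℝ → ℂ) u => IntegrableOn g u) ?_ ?_)
  · funext p
    rw [← Complex.mk_eq_add_mul_I]; rfl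
  · rfl

lemma setIntegral_reProdIm {f : ℂ → ℂ} {s t : Set ℝ} (hf : IntegrableOn f (s ×ℂ t)) :
    ∫ w in s ×ℂ t, f w = ∫ x in s, ∫ y in t, f (x + y * I) := by
  have h := volume_preserving_equiv_real_prod.symm.setIntegral_preimage_emb
    measurableEquivRealProd.symm.measurableEmbedding f (s ×ℂ t)
  rw [← h, ← setIntegral_prod _ (integrableOn_reProdIm.1 hf)]
  refine congrArg₂ (fun (g : ℝ × ℝ → ℂ) u => ∫ p in u, g p) ?_ ?_
  · funext p
    rw [← Complex.mk_eq_add_mul_I]; rfl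
  · rfl

/-- The open annulus. -/
def annulus (a b : ℝ) : Set ℂ := {s | a < ‖s‖ ∧ ‖s‖ < b}

lemma measurableSet_annulus (a b : ℝ) : MeasurableSet (annulus a b) :=
  (measurableSet_lt measurable_const measurable_norm).inter
    (measurableSet_lt measurable_norm measurable_const)

lemma exp_image_rect (x₀ x₁ : ℝ) : cexp '' (Ioo x₀ x₁ ×ℂ Ioc (-π) π) =
    annulus (rexp x₀) (rexp x₁) := by
  ext s
  constructor
  · rintro ⟨w, ⟨h1, -⟩, rfl⟩
    change _ < ‖_‖ ∧ ‖_‖ < _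
    rw [norm_exp, exp_lt_exp, exp_lt_exp]; exact h1
  · rintro ⟨h1, h2⟩
    have h0 := (exp_pos x₀).trans h1
    refine ⟨Complex.log s, ⟨?_, ?_, ?_⟩, exp_log (norm_pos_iff.1 h0)⟩
    · rw [mem_preimage, log_re]
      exact ⟨(Real.lt_log_iff_exp_lt h0).2 h1, (Real.log_lt_iff_lt_exp h0).2 h2⟩
    · exact Complex.neg_pi_lt_log_im s
    · exact Complex.log_im_le_pi s

lemma det_smul_restrictScalars (c : ℂ) :
    ((c • (1 : ℂ →L[ℂ] ℂ)).restrictScalars ℝ).det = ‖c‖ ^ 2 := by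
  have : ((c • (1 : ℂ →L[ℂ] ℂ)).restrictScalars ℝ : ℂ →ₗ[ℝ] ℂ) = LinearMap.mulLeft ℝ c := by
    ext; simp
  rw [ContinuousLinearMap.det, this, ← normSq_eq_norm_sq, ← Algebra.norm_complex_apply]
  rfl

/-- Integration over annuli in logarithmic coordinates. -/
lemma setIntegral_annulus {f : ℂ → ℂ} {x₀ x₁ : ℝ}
    (hf : IntegrableOn f (annulus (rexp x₀) (rexp x₁))) :
    IntegrableOn (fun w => (‖cexp w‖ ^ 2 : ℝ) • f (cexp w)) (Ioo x₀ x₁ ×ℂ Ioc (-π) π) ∧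
    ∫ s in annulus (rexp x₀) (rexp x₁), f s = ∫ x in Ioo x₀ x₁, ∫ y in Ioc (-π) π,
      (‖cexp (x + y * I)‖ ^ 2 : ℝ) • f (cexp (x + y * I)) := by
  have hm : MeasurableSet (Ioo x₀ x₁ ×ℂ Ioc (-π) π) :=
    (Complex.measurable_re measurableSet_Ioo).inter (Complex.measurable_im measurableSet_Ioc)
  have hd w (_ : w ∈ Ioo x₀ x₁ ×ℂ Ioc (-π) π) : HasFDerivWithinAt cexp
      ((cexp w • (1 : ℂ →L[ℂ] ℂ)).restrictScalars ℝ) (Ioo x₀ x₁ ×ℂ Ioc (-π) π) w := by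
    have h1 : HasFDerivAt cexp (cexp w • (1 : ℂ →L[ℂ] ℂ)) w := by
      refine (hasDerivAt_exp w).hasFDerivAt.congr_fderiv ?_
      ext; simp
    exact (h1.restrictScalars ℝ).hasFDerivWithinAt
  have hinj : InjOn cexp (Ioo x₀ x₁ ×ℂ Ioc (-π) π) := fun w hw w' hw' h =>
    Complex.exp_inj_of_neg_pi_lt_of_le_pi hw.2.1 hw.2.2 hw'.2.1 hw'.2.2 h
  rw [← exp_image_rect] at hf ⊢
  have h1 := (integrableOn_image_iff_integrableOn_abs_det_fderiv_smul volume hm hd hinj f).1 hf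
  simp only [det_smul_restrictScalars, abs_sq] at h1
  refine ⟨h1, ?_⟩
  rw [integral_image_eq_integral_abs_det_fderiv_smul volume hm hd hinj f]
  simp only [det_smul_restrictScalars, abs_sq]
  rw [setIntegral_reProdIm h1]

lemma sq_norm_smul_eq (w a : ℂ) : (‖w‖ ^ 2 : ℝ) • a = conj w * w * a := by
  rw [real_smul, Complex.conj_mul']; push_cast; rfl

/-- The Cauchy kernel in logarithmic coordinates. -/
def expKer (l w : ℂ) : ℂ := cexp w / (cexp w - l)

lemma circleMap_exp (x θ : ℝ) : circleMap 0 (rexp x) θ = cexp (x + θ * I) := by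
  rw [circleMap, exp_add]; push_cast; ring

lemma circleIntegral_div_sub (m : ℂ → ℂ) (l : ℂ) (x : ℝ) :
    (∮ s in C(0, rexp x), m s / (s - l)) = I * ∫ y in (-π)..π,
      m (cexp (x + y * I)) * expKer l (x + y * I) := by
  have hper : Function.Periodic (fun y : ℝ => m (cexp (x + y * I)) *
      expKer l (x + y * I)) (2 * π) := fun y => by
    have : cexp (x + (y + 2 * π : ℝ) * I) = cexp (x + y * I) := by
      push_cast
      rw [add_mul, ← add_assoc, exp_add, exp_two_pi_mul_I, mul_one]
    simp only [expKer, this]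
  have h := hper.intervalIntegral_add_eq 0 (-π)
  rw [zero_add, (by ring : -π + 2 * π = π)] at h
  rw [← h, circleIntegral, ← intervalIntegral.integral_const_mul]
  congr 1; funext θ
  rw [deriv_circleMap, circleMap_exp, expKer, smul_eq_mul]; ring

lemma integral_expKer {l : ℂ} {x : ℝ} (hl : ‖l‖ ≠ rexp x) :
    (∫ y in (-π)..π, expKer l (x + y * I)) = if ‖l‖ < rexp x then 2 * π else 0 := by
  have h := circleIntegral_div_sub (fun _ => 1) l x
  simp only [one_mul, one_div] at h
  have : I * (∫ y in (-π)..π, expKer l (x + y * I)) = I * if ‖l‖ < rexp x then 2 * π else 0 := by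
    rw [← h]
    split_ifs with h1
    · rw [circleIntegral.integral_sub_inv_of_mem_ball (mem_ball_zero_iff.2 h1)]; push_cast; ring
    · rw [circleIntegral_inv_of_lt (exp_pos x) (lt_of_le_of_ne (not_lt.1 h1) hl.symm)]; simp
  simp_all

/-- Green's formula on an annulus, in logarithmic coordinates. -/
lemma green_annulus {N ρ : ℂ → ℂ} {l : ℂ} {x₀ x₁ : ℝ} (hx : x₀ ≤ x₁) (h₀ : ‖l‖ ≠ rexp x₀)
    (h₁ : ‖l‖ ≠ rexp x₁) (hper : ∀ w, N (w + 2 * π * I) = N w)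
    (hd : ∀ w : ℂ, w.re ∈ Icc x₀ x₁ → cexp w ≠ l →
      ∃ α, HasFDerivAt N (wirt α (conj (cexp w) * ρ (cexp w))) w)
    (hlim : ∃ L, ∀ w : ℂ, w.re ∈ Icc x₀ x₁ → cexp w = l →
      Tendsto (fun w => N w * expKer l w) (𝓝[≠] w) (𝓝 L))
    (hi : IntegrableOn (fun s => ρ s / (s - l)) (annulus (rexp x₀) (rexp x₁))) :
    (∫ y in (-π)..π, N (x₁ + y * I) * expKer l (x₁ + y * I)) -
      (∫ y in (-π)..π, N (x₀ + y * I) * expKer l (x₀ + y * I)) =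
      2 * ∫ s in annulus (rexp x₀) (rexp x₁), ρ s / (s - l) := by
  obtain ⟨L, hL⟩ := hlim
  set Z : Set ℂ := {w | cexp w = l} with hZ
  have hZc : Z.Countable := by
    by_cases hl : l = 0
    · simp_all
    · refine (countable_range fun n : ℤ => Complex.log l + n * (2 * π * I)).mono ?_
      intro w hw
      have : cexp w = cexp (Complex.log l) := by rw [exp_log hl]; exact hw
      obtain ⟨n, hn⟩ := Complex.exp_eq_exp_iff_exists_int.1 this
      exact ⟨n, hn.symm⟩
  have hZo : IsOpen Zᶜ := (isClosed_eq continuous_exp continuous_const).isOpen_compl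
  classical
  set G : ℂ → ℂ := fun w => if cexp w = l then L else N w * expKer l w with hG
  set b : ℂ → ℂ := fun w => (‖cexp w‖ ^ 2) • (ρ (cexp w) / (cexp w - l)) with hb
  have hGd w (hw : w.re ∈ Icc x₀ x₁) (hwZ : w ∉ Z) : ∃ α, HasFDerivAt G (wirt α (b w)) w := by
    obtain ⟨α, h1⟩ := hd w hw hwZ
    have hne : cexp w - l ≠ 0 := sub_ne_zero.2 hwZ
    have h2 := hasFDerivAt_wirt_left (((hasDerivAt_exp w).div
      ((hasDerivAt_exp w).sub_const l) hne))
    have h3 := HasFDerivAt.wirt_mul h1 h2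
    refine ⟨_, (h3.congr_of_eventuallyEq ?_).congr_fderiv (congrArg _ ?_)⟩
    · filter_upwards [hZo.mem_nhds hwZ] with w' hw'
      exact if_neg hw'
    · simp only [hb, mul_zero, zero_add, sq_norm_smul_eq, Pi.div_apply]; ring
  have hGc : ContinuousOn G (uIcc x₀ x₁ ×ℂ uIcc (-π) π) := by
    intro w hw
    rw [uIcc_of_le hx] at hw
    by_cases hwZ : w ∈ Z
    · refine ContinuousAt.continuousWithinAt ?_
      rw [continuousAt_iff_punctured_nhds]
      have e : G w = L := if_pos hwZ
      rw [e]
      refine (hL w hw.1 hwZ).congr' ?_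
      have h3 := (hasDerivAt_exp w).eventually_ne (exp_ne_zero w) (c := l)
      filter_upwards [h3] with w' hw'
      exact (if_neg hw').symm
    · obtain ⟨α, h⟩ := hGd w hw.1 hwZ
      exact h.continuousAt.continuousWithinAt
  choose! α hα using hGd
  have harea := setIntegral_annulus hi
  have hbi : IntegrableOn (fun w => 2 * I * b w) (uIcc x₀ x₁ ×ℂ uIcc (-π) π) := by
    have h1 := harea.1.const_mul (2 * I)
    rw [← IntegrableOn, integrableOn_reProdIm] at h1
    rw [integrableOn_reProdIm, uIcc_of_le hx, uIcc_of_le (by linarith [pi_pos])]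
    exact h1.congr_set_ae (Measure.set_prod_ae_eq Ioo_ae_eq_Icc Ioc_ae_eq_Icc).symm
  have hwirt w : I • wirt (α w) (b w) 1 - wirt (α w) (b w) I = 2 * I * b w := by
    simp only [wirt_apply, map_one, conj_I, smul_eq_mul]; ring
  have hgreen := Complex.integral_boundary_rect_of_hasFDerivAt_real_off_countable G
    (fun w => wirt (α w) (b w)) (⟨x₀, -π⟩) (⟨x₁, π⟩) Z hZc hGc
    (fun w hw => by
      refine hα w ?_ hw.2
      have := hw.1.1
      grind)
    (by grind)
  simp only [hwirt] at hgreen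
  have hGper w : G (w + 2 * π * I) = G w := by
    have : cexp (w + 2 * π * I) = cexp w := by
      rw [exp_add, exp_two_pi_mul_I, mul_one]
    simp only [hG, expKer, this, hper]
  have hhor : (∫ x in x₀..x₁, G (x + (-π : ℝ) * I)) = ∫ x in x₀..x₁, G (x + π * I) := by
    congr 1; funext x
    rw [← hGper]; congr 1; push_cast; ring
  have hedge x (h : ‖l‖ ≠ rexp x) (y : ℝ) : G (x + y * I) =
      N (x + y * I) * expKer l (x + y * I) := by
    refine if_neg fun h' => h ?_
    rw [← h', norm_exp]; simp
  rw [hhor, sub_self, zero_add] at hgreen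
  simp only [hedge _ h₀, hedge _ h₁, smul_eq_mul, intervalIntegral.integral_const_mul] at hgreen
  rw [harea.2, ← integral_Ioc_eq_integral_Ioo, ← integral_of_le hx]
  simp only [← integral_of_le (neg_le_self pi_pos.le)]
  refine mul_left_cancel₀ I_ne_zero ?_
  rw [mul_sub, hgreen]; ring

/-- `ρ` is the `∂̄`-derivative of `m` at `exp ω`, and is continuous there. -/
def DbarAt (m ρ : ℂ → ℂ) (ω : ℂ) : Prop :=
  (∃ α, HasFDerivAt (fun w => m (cexp w)) (wirt α (conj (cexp ω) * ρ (cexp ω))) ω) ∧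
  ContinuousAt (fun w => ρ (cexp w)) ω

/-- The **Cauchy–Pompeiu formula** on an annulus. -/
lemma cauchy_pompeiu {m ρ : ℂ → ℂ} {l : ℂ} {x₀ x₁ : ℝ} (hx : x₀ ≤ x₁) (h₀ : ‖l‖ ≠ rexp x₀)
    (h₁ : ‖l‖ ≠ rexp x₁) (hd : ∀ w : ℂ, w.re ∈ Icc x₀ x₁ → DbarAt m ρ w)
    (hk : IntegrableOn (fun s => (s - l)⁻¹) (annulus (rexp x₀) (rexp x₁)))
    (hi : IntegrableOn (fun s => ρ s / (s - l)) (annulus (rexp x₀) (rexp x₁))) :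
    (∮ s in C(0, rexp x₁), m s / (s - l)) - (∮ s in C(0, rexp x₀), m s / (s - l)) =
      2 * π * I * (annulus (rexp x₀) (rexp x₁)).indicator m l +
      2 * I * ∫ s in annulus (rexp x₀) (rexp x₁), ρ s / (s - l) := by
  have hexp w : cexp (w + 2 * π * I) = cexp w := by
    rw [exp_add, exp_two_pi_mul_I, mul_one]
  rw [circleIntegral_div_sub, circleIntegral_div_sub, ← mul_sub]
  by_cases hl : l ∈ annulus (rexp x₀) (rexp x₁)
  · rw [indicator_of_mem hl]
    have hl0 : 0 < ‖l‖ := (exp_pos x₀).trans hl.1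
    have hlne : l ≠ 0 := norm_pos_iff.1 hl0
    set t := log ‖l‖ with ht
    have het : rexp t = ‖l‖ := Real.exp_log hl0
    have ht0 : x₀ < t := by rw [← exp_lt_exp, het]; exact hl.1
    have ht1 : t < x₁ := by rw [← exp_lt_exp, het]; exact hl.2
    set β := conj l * ρ l with hβ
    set N : ℂ → ℂ := fun w => m (cexp w) - m l - 2 * β * ((w.re - t : ℝ)) with hN
    have hre w : HasFDerivAt (fun w : ℂ => 2 * β * ((w.re - t : ℝ))) (wirt β β) w := by
      have h1 := ((Complex.ofRealCLM.comp Complex.reCLM).hasFDerivAt (x := w)).const_mul (2 * β)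
      have h2 := h1.sub_const (2 * β * t)
      refine (h2.congr_of_eventuallyEq (.of_forall fun w => ?_)).congr_fderiv ?_
      · simp; ring
      · apply ContinuousLinearMap.ext; intro η
        simp only [ContinuousLinearMap.smul_apply, ContinuousLinearMap.comp_apply, wirt_apply,
          smul_eq_mul, Complex.reCLM_apply, Complex.ofRealCLM_apply, Complex.re_eq_add_conj]
        ring
    have hNd w (hw : w.re ∈ Icc x₀ x₁) : ∃ α, HasFDerivAt N (wirt (α - β)
        (conj (cexp w) * ρ (cexp w) - β)) w := by
      obtain ⟨⟨α, h⟩, -⟩ := hd w hw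
      refine ⟨α, ((h.sub_const (m l)).sub (hre w)).congr_fderiv ?_⟩
      apply ContinuousLinearMap.ext; intro η
      simp only [ContinuousLinearMap.sub_apply, wirt_apply, smul_eq_mul]; ring
    have hclose : IntegrableOn (fun s => β / conj s / (s - l)) (annulus (rexp x₀) (rexp x₁)) := by
      refine Integrable.mono' (hk.norm.const_mul (‖β‖ / rexp x₀))
        (Measurable.aestronglyMeasurable (by fun_prop)) ?_
      filter_upwards [ae_restrict_mem (measurableSet_annulus _ _)] with s hs
      rw [norm_div, norm_div, RCLike.norm_conj, div_eq_mul_inv _ ‖s - l‖, norm_inv]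
      gcongr
      exact hs.1.le
    have key := green_annulus (N := N) (ρ := fun s => ρ s - β / conj s) hx h₀ h₁
      (fun w => by simp [hN, hexp]) (fun w hw _ => by
        obtain ⟨α, h⟩ := hNd w hw
        have hc : conj (cexp w) ≠ 0 := by simp
        grind) ?_ (by
        simp only [sub_div]
        exact hi.sub hclose)
    · have e1 x (hxs : x = x₀ ∨ x = x₁) : (∫ y in (-π)..π, N (x + y * I) *
          expKer l (x + y * I)) = (∫ y in (-π)..π, m (cexp (x + y * I)) *
          expKer l (x + y * I)) - (m l + 2 * β * ((x - t : ℝ))) *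
          ∫ y in (-π)..π, expKer l (x + y * I) := by
        have hlx : ‖l‖ ≠ rexp x := by rcases hxs with rfl | rfl <;> assumption
        have hxI : x ∈ Icc x₀ x₁ := by
          rcases hxs with rfl | rfl <;> simp [hx]
        have hm : Continuous fun y : ℝ => m (cexp (x + y * I)) := by
          refine continuous_iff_continuousAt.2 fun y => ?_
          obtain ⟨⟨α, h⟩, -⟩ := hd (x + y * I) (by simpa using hxI)
          exact ContinuousAt.comp (f := fun y : ℝ => (x + y * I)) h.continuousAt (by fun_prop)
        have hk : Continuous fun y : ℝ => expKer l (x + y * I) := by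
          unfold expKer
          refine Continuous.div (by fun_prop) (by fun_prop) fun y h => hlx ?_
          rw [← sub_eq_zero.1 h, norm_exp]; simp
        have i1 := (hm.mul hk).intervalIntegrable (μ := volume) (-π) π
        have i2 := (hk.const_mul (m l + 2 * β * ((x - t : ℝ)))).intervalIntegrable
          (μ := volume) (-π) π
        have i3 := intervalIntegral.integral_sub i1 i2
        simp only [Pi.mul_apply] at i3
        rw [← intervalIntegral.integral_const_mul, ← i3]
        congr 1; funext y
        simp only [hN, Complex.add_re, ofReal_re, Complex.mul_re, Complex.I_re,
          ofReal_im, Complex.I_im]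
        push_cast; ring
      have e2 : ∫ s in annulus (rexp x₀) (rexp x₁), β / conj s / (s - l) =
          β * (2 * π * (x₁ - t)) := by
        rw [(setIntegral_annulus hclose).2, ← integral_Ioc_eq_integral_Ioo, ← integral_of_le hx]
        have e3 x (hxt : x ≠ t) : (∫ y in Ioc (-π) π,
            (‖cexp (x + y * I)‖ ^ 2) • (β / conj (cexp (x + y * I)) /
              (cexp (x + y * I) - l))) = if t < x then β * (2 * π) else 0 := by
          have e4 := integral_expKer (by
            rw [← het]; exact fun h => hxt (Real.exp_injective h).symm)
          simp only [← het, exp_lt_exp] at e4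
          have e6 : (if t < x then β * (2 * π) else 0) = β * ((if t < x then 2 * π else 0 : ℝ)) := by
            split_ifs <;> simp
          rw [← integral_of_le (neg_le_self pi_pos.le), e6, ← e4,
            ← intervalIntegral.integral_const_mul]
          congr 1; funext y
          have hc : conj (cexp (x + y * I)) ≠ 0 := by simp
          rw [sq_norm_smul_eq, expKer]; field_simp
        have hne : ∀ᵐ x : ℝ, x ≠ t := Measure.ae_ne volume t
        rw [intervalIntegral.integral_congr_ae
          (by filter_upwards [hne] with x h _ using e3 x h), integral_of_le hx,
          ← integral_indicator measurableSet_Ioc]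
        have e5 : (Ioc x₀ x₁).indicator (fun x => if t < x then β * (2 * π) else 0) =
            (Ioc t x₁).indicator fun _ => β * (2 * π) := by
          funext x
          by_cases hx1 : x ∈ Ioc t x₁
          · rw [indicator_of_mem hx1, indicator_of_mem
              (show x ∈ Ioc x₀ x₁ from ⟨ht0.trans hx1.1, hx1.2⟩), if_pos hx1.1]
          · rw [indicator_of_notMem hx1]
            by_cases hx2 : x ∈ Ioc x₀ x₁
            · rw [indicator_of_mem hx2, if_neg fun h => hx1 ⟨h, hx2.2⟩]
            simp_all
        rw [e5, integral_indicator measurableSet_Ioc, setIntegral_const]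
        simp only [Real.volume_real_Ioc_of_le ht1.le, real_smul]
        push_cast; ring
      rw [e1 x₁ (Or.inr rfl), e1 x₀ (Or.inl rfl), integral_expKer h₀, integral_expKer h₁, if_pos hl.2,
        if_neg (not_lt.2 hl.1.le)] at key
      simp only [sub_div _ _ (_ - l)] at key
      have hsub := integral_sub hi hclose
      rw [hsub, e2] at key
      push_cast at key
      linear_combination I * key
    · have hlr : (Complex.log l).re = t := log_re l
      obtain ⟨α, hα⟩ := hNd (Complex.log l) (by grind)
      rw [exp_log hlne, sub_self] at hα
      have hD : HasDerivAt N (α - β) (Complex.log l) := by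
        refine HasFDerivAt.hasDerivAt (f' := (α - β) • (1 : ℂ →L[ℂ] ℂ)) ?_ |>.congr_deriv (by simp)
        refine hasFDerivAt_of_restrictScalars ℝ hα ?_
        ext η; simp [wirt_apply, mul_comm]
      have hN0 : N (Complex.log l) = 0 := by simp [hN, exp_log hlne, hlr]
      have hlim : Tendsto (fun w => N w * expKer l w) (𝓝[≠] Complex.log l) (𝓝 (α - β)) := by
        have h1 := hasDerivAt_iff_tendsto_slope.1 hD
        have h2 := hasDerivAt_iff_tendsto_slope.1 (hasDerivAt_exp (Complex.log l))
        have h3 : Tendsto cexp (𝓝[≠] Complex.log l) (𝓝 (cexp (Complex.log l))) :=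
          (continuous_exp.tendsto _).mono_left nhdsWithin_le_nhds
        have h4 := (h1.mul h3).div h2 (exp_ne_zero _)
        rw [mul_div_assoc, div_self (exp_ne_zero _), mul_one] at h4
        refine h4.congr' ?_
        filter_upwards [self_mem_nhdsWithin] with w hw
        have hw' : w - Complex.log l ≠ 0 := sub_ne_zero.2 hw
        simp only [Pi.div_apply, slope, vsub_eq_sub, hN0, sub_zero, smul_eq_mul, exp_log hlne,
          expKer]
        rw [mul_assoc, mul_div_mul_left _ _ (inv_ne_zero hw'), mul_div_assoc]
      refine ⟨α - β, fun w _ hwl => ?_⟩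
      obtain ⟨n, hn⟩ := Complex.exp_eq_exp_iff_exists_int.1 (hwl.trans (exp_log hlne).symm)
      set c : ℂ := n * (2 * π * I) with hcd
      have hsh : Tendsto (fun u => u - c) (𝓝[≠] w) (𝓝[≠] Complex.log l) := by
        refine tendsto_nhdsWithin_iff.2 ⟨?_, ?_⟩
        · have : Tendsto (fun u => u - c) (𝓝 w) (𝓝 (w - c)) := tendsto_id.sub_const c
          rw [(by grind : w - c = Complex.log l)] at this
          exact this.mono_left nhdsWithin_le_nhds
        · filter_upwards [self_mem_nhdsWithin] with u hu h
          grind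
      refine (hlim.comp hsh).congr fun u => ?_
      have h5 : cexp (u - c) = cexp u := by
        rw [Complex.exp_sub, Complex.exp_int_mul_two_pi_mul_I, div_one]
      have h6 : (u - c).re = u.re := by simp [hcd]
      simp only [Function.comp_apply, hN, expKer, h5, h6]
  · rw [indicator_of_notMem hl, mul_zero, zero_add]
    have hne w (hw : w.re ∈ Icc x₀ x₁) : cexp w ≠ l := by
      intro h
      have e : ‖l‖ = rexp w.re := by rw [← h, norm_exp]
      refine hl ⟨lt_of_le_of_ne ?_ h₀.symm, lt_of_le_of_ne ?_ h₁⟩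
      · simp_all
      · simp_all
    rw [green_annulus hx h₀ h₁ (fun w => by simp only [hexp])
      (fun w hw _ => (hd w hw).1) ⟨0, fun w hw h => (hne w hw h).elim⟩ hi]
    ring

lemma integrableOn_inv_sub (l : ℂ) {t : Set ℂ} (ht : Bornology.IsBounded t) :
    IntegrableOn (fun s => (s - l)⁻¹) t := by
  have h : LocallyIntegrable (fun s : ℂ => s⁻¹) := by
    refine locallyIntegrable_of_norm_le_rpow (C := 1) (α := 1) (by simp) (by simp)
      (.of_forall fun s => ?_) (Measurable.aestronglyMeasurable (by fun_prop))
    rw [norm_inv, Real.rpow_neg_one, one_mul]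
  obtain ⟨R, hR⟩ := ht.subset_closedBall l
  have h1 := (h.integrableOn_isCompact (isCompact_closedBall 0 R))
  rw [← (measurePreserving_sub_right volume l).integrableOn_comp_preimage
    (measurableEmbedding_subRight l)] at h1
  refine h1.mono_set fun s hs => ?_
  simpa [dist_eq_norm] using hR hs

/-- Continuity of circle Cauchy integrals off the circle. -/
lemma continuousAt_circleIntegral {q : ℂ → ℂ} {R : ℝ} (hR : 0 < R)
    (hq : ContinuousOn q (sphere 0 R)) {l₀ : ℂ} (hl : ‖l₀‖ ≠ R) :
    ContinuousAt (fun l => ∮ s in C(0, R), q s / (s - l)) l₀ := by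
  have hqc : Continuous fun θ : ℝ => q (circleMap 0 R θ) :=
    hq.comp_continuous (continuous_circleMap 0 R) fun θ => circleMap_mem_sphere 0 hR.le θ
  obtain ⟨C, hC⟩ := (isCompact_sphere 0 R).exists_bound_of_continuousOn hq
  have hd : 0 < |R - ‖l₀‖| := abs_pos.2 (sub_ne_zero.2 hl.symm)
  have hdist : ∀ᶠ l in 𝓝 l₀, ∀ θ : ℝ, |R - ‖l₀‖| / 2 ≤ ‖circleMap 0 R θ - l‖ := by
    filter_upwards [Metric.ball_mem_nhds l₀ (half_pos hd)] with l h θ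
    have h1 := abs_norm_sub_norm_le (circleMap 0 R θ) l
    rw [norm_circleMap_zero, abs_of_pos hR] at h1
    have h2 := abs_norm_sub_norm_le l l₀
    rw [Metric.mem_ball, dist_eq_norm] at h
    have h3 := abs_sub_le R ‖l‖ ‖l₀‖
    linarith
  refine intervalIntegral.continuousAt_of_dominated_interval
    (bound := fun _ => R * (C / (|R - ‖l₀‖| / 2))) ?_ ?_ (by simp) ?_
  · filter_upwards [hdist] with l h
    refine (Continuous.aestronglyMeasurable ?_)
    simp only [deriv_circleMap, smul_eq_mul]
    exact Continuous.mul (by fun_prop) (hqc.div (by fun_prop) fun θ h0 => by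
      have := h θ
      rw [h0, norm_zero] at this
      linarith)
  · filter_upwards [hdist] with l h
    refine .of_forall fun θ _ => ?_
    have hc := hC _ (circleMap_mem_sphere 0 hR.le θ)
    rw [norm_smul, norm_div, deriv_circleMap, norm_mul, norm_I, norm_circleMap_zero,
      abs_of_pos hR, mul_one]
    gcongr
    exacts [(norm_nonneg _).trans hc, h θ]
  · refine .of_forall fun θ _ => ?_
    have h0 := hdist.self_of_nhds θ
    have hd : ContinuousAt (fun l => q (circleMap 0 R θ) / (circleMap 0 R θ - l)) l₀ :=
      continuousAt_const.div (continuousAt_const.sub continuousAt_id) fun h1 => by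
        rw [h1, norm_zero] at h0
        linarith
    fun_prop

lemma aestronglyMeasurable_of_div_one_add {ρ : ℂ → ℂ}
    (h : AEStronglyMeasurable (fun s => ρ s / (1 + ‖s‖)) volume) : AEStronglyMeasurable ρ volume := by
  refine (h.mul (g := fun s : ℂ => (1 + ‖s‖ : ℂ))
    (Continuous.aestronglyMeasurable (by fun_prop))).congr (.of_forall fun s => ?_)
  have : (1 + ‖s‖ : ℂ) ≠ 0 := by exact_mod_cast (by positivity : (1 + ‖s‖) ≠ 0)
  simp_all

lemma norm_div_one_add (a s : ℂ) : ‖a / (1 + ‖s‖)‖ = ‖a‖ / (1 + ‖s‖) := by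
  rw [norm_div]; congr 1
  exact_mod_cast norm_of_nonneg (by positivity : 0 ≤ 1 + ‖s‖)

lemma div_le_mul_div_one_add {a d η : ℝ} {l s : ℂ} (ha : 0 ≤ a) (hη : 0 < η) (h1 : η ≤ d)
    (h2 : ‖s - l‖ ≤ d) : a / d ≤ ((1 + ‖l‖) / η + 1) * (a / (1 + ‖s‖)) := by
  have hp : 0 < d := hη.trans_le h1
  rw [div_le_iff₀ hp, mul_assoc, div_mul_eq_mul_div, mul_div_assoc', le_div_iff₀ (by positivity),
    mul_left_comm]
  refine mul_le_mul_of_nonneg_left ?_ ha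
  have h2 : ‖s‖ ≤ ‖s - l‖ + ‖l‖ := by simpa using norm_add_le (s - l) l
  have h3 : 1 + ‖l‖ ≤ (1 + ‖l‖) / η * d := by
    rw [div_mul_eq_mul_div, le_div_iff₀ hη]; gcongr
  linarith

/-- Convergence of the solid Cauchy integral. -/
lemma integrable_div_sub {ρ : ℂ → ℂ} {l : ℂ} {C η : ℝ} (hη : 0 < η)
    (hb : ∀ s, ‖s - l‖ < η → ‖ρ s‖ ≤ C) (hi : Integrable fun s => ρ s / (1 + ‖s‖)) :
    Integrable fun s => ρ s / (s - l) := by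
  have hm := aestronglyMeasurable_of_div_one_add hi.1
  have h1 := (integrableOn_inv_sub l (isBounded_ball (x := l) (r := η))).norm.const_mul C
  rw [← IntegrableOn, ← integrable_indicator_iff isOpen_ball.measurableSet] at h1
  refine (h1.add (hi.norm.const_mul ((1 + ‖l‖) / η + 1))).mono'
    (hm.mul (Measurable.aestronglyMeasurable (by fun_prop))) (.of_forall fun s => ?_)
  rw [Pi.add_apply, norm_div_one_add]
  by_cases hs : ‖s - l‖ < η
  · rw [indicator_of_mem (by simpa [dist_eq_norm] using hs), norm_div, norm_inv, div_eq_mul_inv]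
    refine le_add_of_le_of_nonneg ?_ (by positivity)
    gcongr
    exact hb s hs
  · rw [indicator_of_notMem (by simpa [dist_eq_norm] using hs), zero_add, norm_div]
    exact div_le_mul_div_one_add (norm_nonneg _) hη (not_lt.1 hs) le_rfl

/-- Continuity of the solid Cauchy integral. -/
lemma continuousAt_cauchyTransform {ρ : ℂ → ℂ} {l₀ : ℂ} {C η : ℝ} (hη : 0 < η)
    (hb : ∀ s, ‖s - l₀‖ < η → ‖ρ s‖ ≤ C) (hi : Integrable fun s => ρ s / (1 + ‖s‖))
    (hc : ∀ᵐ s, ContinuousAt ρ s) : ContinuousAt (fun l => ∫ s, ρ s / (s - l)) l₀ := by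
  have hm := aestronglyMeasurable_of_div_one_add hi.1
  set r := η / 2 with hr
  have hr0 : 0 < r := half_pos hη
  set k : ℂ → ℂ := fun u => conj u / (max ‖u‖ r) ^ 2 with hk
  have hM (u : ℂ) : 0 < max ‖u‖ r := lt_max_of_lt_right hr0
  have hkc : Continuous k := by
    refine Continuous.div continuous_conj (by fun_prop) fun u => ?_
    exact_mod_cast (pow_pos (hM u) 2).ne'
  have hkn u : ‖k u‖ ≤ 1 / max ‖u‖ r := by
    rw [norm_div, RCLike.norm_conj, norm_pow, Complex.norm_of_nonneg (hM u).le,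
      div_le_div_iff₀ (pow_pos (hM u) 2) (hM u), one_mul, sq]
    exact mul_le_mul_of_nonneg_right (le_max_left _ _) (hM u).le
  have hku u (h : r ≤ ‖u‖) : u⁻¹ - k u = 0 := by
    change u⁻¹ - conj u / ((max ‖u‖ r : ℝ)) ^ 2 = 0
    rw [Complex.inv_def, normSq_eq_norm_sq, max_eq_left h, sub_eq_zero, div_eq_mul_inv]
    push_cast; rfl
  have hnear : ball l₀ r ∈ 𝓝 l₀ := Metric.ball_mem_nhds l₀ hr0
  have hfar l (hl : l ∈ ball l₀ r) s :
      ‖ρ s * k (s - l)‖ ≤ ((1 + (‖l₀‖ + r)) / r + 1) * ‖ρ s / (1 + ‖s‖)‖ := by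
    have h1 : ‖l‖ ≤ ‖l₀‖ + r := by
      have := norm_le_norm_add_norm_sub l₀ l
      rw [Metric.mem_ball, dist_eq_norm, norm_sub_rev] at hl
      linarith
    rw [norm_mul, norm_div_one_add]
    refine (mul_le_mul_of_nonneg_left (hkn _) (norm_nonneg _)).trans ?_
    rw [mul_one_div]
    refine (div_le_mul_div_one_add (norm_nonneg _) hr0 (le_max_right _ _) (le_max_left _ _)).trans ?_
    gcongr
  have hF l : AEStronglyMeasurable (fun s => ρ s * k (s - l)) volume :=
    hm.mul (Continuous.aestronglyMeasurable (by fun_prop))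
  have c1 : ContinuousAt (fun l => ∫ s, ρ s * k (s - l)) l₀ := by
    refine continuousAt_of_dominated (.of_forall hF) ?_
      (hi.norm.const_mul ((1 + (‖l₀‖ + r)) / r + 1)) ?_
    · filter_upwards [hnear] with l hl using .of_forall (hfar l hl)
    · exact .of_forall fun s => Continuous.continuousAt (by fun_prop)
  have c2 : ContinuousAt (fun l => ∫ u, ρ (u + l) * (u⁻¹ - k u)) l₀ := by
    have hB := (integrableOn_inv_sub 0 (isBounded_ball (x := 0) (r := r))).norm
    have hB := (hB.add (integrableOn_const (C := 1 / r) (by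
      exact isBounded_ball.measure_lt_top.ne))).const_mul C
    rw [← IntegrableOn, ← integrable_indicator_iff isOpen_ball.measurableSet] at hB
    refine continuousAt_of_dominated ?_ ?_ hB ?_
    · refine .of_forall fun l => AEStronglyMeasurable.mul
        (hm.comp_quasiMeasurePreserving (measurePreserving_add_right volume l).quasiMeasurePreserving)
        (Measurable.aestronglyMeasurable ?_)
      fun_prop
    · filter_upwards [hnear] with l hl
      refine .of_forall fun u => ?_
      by_cases hu : r ≤ ‖u‖
      · rw [hku u hu, mul_zero, norm_zero, indicator_of_notMem (by simpa using hu)]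
      · rw [indicator_of_mem (by simpa using hu), norm_mul]
        have h1 : ‖ρ (u + l)‖ ≤ C := hb _ (by
          rw [Metric.mem_ball, dist_eq_norm] at hl
          have := norm_add_le u (l - l₀)
          grind)
        refine mul_le_mul h1 ((norm_sub_le _ _).trans ?_) (norm_nonneg _) ((norm_nonneg _).trans h1)
        simp only [Pi.add_apply, sub_zero]
        grind
    · have := (measurePreserving_add_right (volume : Measure ℂ) l₀).quasiMeasurePreserving.ae hc
      filter_upwards [this] with u hu
      fun_prop
  refine (c1.add c2).congr ?_
  filter_upwards [hnear] with l hl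
  have i1 : Integrable fun s => ρ s * k (s - l) :=
    (hi.norm.const_mul _).mono' (hF l) (.of_forall (hfar l hl))
  have i2 : Integrable fun s => ρ s / (s - l) := by
    refine integrable_div_sub hr0 (fun s hs => hb s ?_) hi
    rw [Metric.mem_ball, dist_eq_norm] at hl
    have := norm_sub_le_norm_sub_add_norm_sub s l l₀
    linarith
  have h3 := integral_sub i2 i1
  rw [← integral_add_right_eq_self _ l] at h3
  rw [Pi.add_apply]
  rw [eq_sub_iff_add_eq] at h3
  rw [← h3, add_comm]
  congr 1
  refine integral_congr_ae (.of_forall fun u => ?_)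
  grind

lemma le_add_rpow_mul {q M t : ℝ} (hq : 1 < q) (hM : 0 < M) (ht : 0 ≤ t) :
    t ≤ M + M ^ (1 - q) * t ^ q := by
  rcases le_or_gt t M with h | h
  · have : 0 ≤ M ^ (1 - q) * t ^ q := by positivity
    linarith
  · have h1 := rpow_le_rpow_of_nonpos hM h.le (by linarith : 1 - q ≤ 0)
    have h2 : t = t ^ (1 - q) * t ^ q := by
      rw [← rpow_add (hM.trans h), sub_add_cancel, rpow_one]
    have h3 : t ^ (1 - q) * t ^ q ≤ M ^ (1 - q) * t ^ q := by gcongr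
    linarith

namespace Setup

variable (S : Setup)

/-- The Fourier transform of the potential. -/
def fourierV (l : ℂ) : ℂ :=
  ∫ z, cexp (I * √S.E * (inner ℝ z l : ℝ)) * (S.v z : ℂ)

lemma norm_exp_I_mul_sqrt (a t : ℝ) : ‖cexp (I * (√a : ℝ) * (t : ℂ))‖ = 1 := by
  rw [mul_assoc, mul_comm, ← ofReal_mul]; exact norm_exp_mul_I _

lemma continuous_fourierV : Continuous S.fourierV := by
  refine continuous_of_dominated (fun l => ?_) (fun l => .of_forall fun z => ?_)
    S.integrable_vC.norm (.of_forall fun z => by fun_prop)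
  · exact AEStronglyMeasurable.mul (Continuous.aestronglyMeasurable (by fun_prop)) S.integrable_vC.1
  · rw [norm_mul, norm_exp_I_mul_sqrt, one_mul]

/-- Gaussian means of the Fourier transform. -/
lemma lintegral_gauss_le : ∃ C : ℝ, 0 ≤ C ∧ ∀ s : ℝ, 0 < s →
    ∫⁻ l, ENNReal.ofReal (rexp (-s * ‖l‖ ^ 2) * ‖S.fourierV l‖ ^ 2) ≤
      ENNReal.ofReal (C * s ^ (-(1 / S.q))) := by
  have hE := S.hE
  have hq := S.hq1
  set B := ∫ z, |S.v z| ^ S.q with hB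
  set N := ∫ z, |S.v z| with hN
  refine ⟨N * (4 * π ^ 2 / S.E + π * B), by positivity, fun s hs => ?_⟩
  set c : ℂ := I * √S.E with hc
  let F : ℂ → ℂ × ℂ → ℂ := fun l p =>
    cexp (-s * ‖l‖ ^ 2 + c * (inner ℝ (p.1 - p.2) l)) * ((S.v p.1) * (S.v p.2))
  have hvv := S.integrable_vC.mul_prod S.integrable_vC
  have hsre : 0 < (s : ℂ).re := hs
  have hF : Integrable (Function.uncurry F) (volume.prod (volume.prod volume)) := by
    have h0 := GaussianFourier.integrable_cexp_neg_mul_sq_norm_add (V := ℂ) hsre 0 0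
    refine (h0.mul_prod hvv).mono (AEStronglyMeasurable.mul
      (Continuous.aestronglyMeasurable (by fun_prop)) hvv.1.comp_snd) (.of_forall fun p => ?_)
    simp only [Function.uncurry, F, norm_mul, exp_add, zero_mul, exp_zero,
      mul_one, hc, norm_exp_I_mul_sqrt]
    rfl
  have h1 l : ∫ p, F l p ∂(volume.prod volume) = ((rexp (-s * ‖l‖ ^ 2) * ‖S.fourierV l‖ ^ 2 : ℝ)) := by
    have e p : F l p = cexp (-s * ‖l‖ ^ 2) * ((cexp (c * (inner ℝ p.1 l)) * (S.v p.1)) *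
        conj (cexp (c * (inner ℝ p.2 l)) * (S.v p.2))) := by
      have hi : (inner ℝ (p.1 - p.2) l) = (inner ℝ p.1 l) - (inner ℝ p.2 l) :=
        inner_sub_left _ _ _
      simp only [F]
      rw [hi, ofReal_sub, mul_sub, exp_add, sub_eq_add_neg, exp_add]
      simp only [map_mul, conj_ofReal, ← exp_conj, hc, conj_I, neg_mul]
      ring
    have e2 := integral_prod_mul (μ := volume) (ν := volume)
      (fun x : ℂ => cexp (c * (inner ℝ x l)) * (S.v x))
      (fun y => conj (cexp (c * (inner ℝ y l)) * (S.v y)))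
    simp only [e]
    rw [integral_const_mul, e2, integral_conj]
    change _ * (S.fourierV l * conj (S.fourierV l)) = _
    rw [Complex.mul_conj']
    push_cast; rfl
  set K : ℂ → ℝ := fun u => π / s * rexp (-(S.E / (4 * s)) * ‖u‖ ^ 2) with hK
  have h2 p : ‖∫ l, F l p‖ = |S.v p.1| * (|S.v p.2| * K (p.1 - p.2)) := by
    simp only [F]
    rw [integral_mul_const, GaussianFourier.integral_cexp_neg_mul_sq_norm_add hsre,
      Complex.finrank_real_complex]
    have e : c ^ 2 * (‖p.1 - p.2‖) ^ 2 / (4 * s) = ((-(S.E / (4 * s)) * ‖p.1 - p.2‖ ^ 2 : ℝ)) := by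
      rw [mul_pow, I_sq, ← ofReal_pow √S.E, sq_sqrt hE.le]
      push_cast; ring
    have e2 : (π / s) ^ (((2 : ℕ) : ℂ) / 2) = ((π / s : ℝ) : ℂ) := by
      norm_num
    rw [e, e2, ← ofReal_exp]
    simp only [norm_mul, norm_real, norm_eq_abs, Real.abs_exp, K, abs_of_pos (div_pos pi_pos hs)]
    ring
  have hKi : (∫ u, K u) = 4 * π ^ 2 / S.E ∧ Integrable K := by
    have hb : 0 < S.E / (4 * s) := by positivity
    constructor
    · rw [integral_const_mul, GaussianFourier.integral_rexp_neg_mul_sq_norm hb,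
        Complex.finrank_real_complex]
      norm_num
      field_simp
    · have := (GaussianFourier.integrable_cexp_neg_mul_sq_norm_add (V := ℂ) (b := (S.E / (4 * s) : ℝ))
        hb 0 0).re
      refine (this.congr (.of_forall fun u => ?_)).const_mul (π / s)
      change (cexp _).re = _
      rw [zero_mul, add_zero, ← ofReal_neg, ← ofReal_pow, ← ofReal_mul,
        Complex.exp_ofReal_re]
  set M := s ^ (-(1 / S.q)) with hM
  have hM0 : 0 < M := by positivity
  have h3 x : ∫ y, |S.v x| * (|S.v y| * K (x - y)) ≤
      |S.v x| * ((4 * π ^ 2 / S.E + π * B) * M) := by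
    have i1 := (hKi.2.comp_sub_left x).const_mul M
    have i2 := S.integrable_abs_rpow_v.const_mul (M ^ (1 - S.q) * (π / s))
    have e1 : ∫ y, M * K (x - y) + M ^ (1 - S.q) * (π / s) * |S.v y| ^ S.q =
        (4 * π ^ 2 / S.E + π * B) * M := by
      rw [integral_add i1 i2, integral_const_mul, integral_sub_left_eq_self K, hKi.1,
        integral_const_mul, ← hB]
      have : M ^ (1 - S.q) * (π / s) = π * M := by
        have : -(1 / S.q) * (1 - S.q) = 1 + -(1 / S.q) := by field_simp; ring
        rw [hM, ← rpow_mul hs.le, this, rpow_add hs, rpow_one]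
        field_simp
      rw [this]; ring
    rw [integral_const_mul, ← e1]
    refine mul_le_mul_of_nonneg_left (integral_mono_of_nonneg (.of_forall fun y => ?_)
      (i1.add i2) (.of_forall fun y => ?_)) (abs_nonneg _)
    · positivity
    · have hk : K (x - y) ≤ π / s := mul_le_of_le_one_right (by positivity)
        (exp_le_one_iff.2 (by simp_all))
      have hk0 : 0 ≤ K (x - y) := by simp only [K]; positivity
      have := le_add_rpow_mul hq hM0 (abs_nonneg (S.v y))
      have h5 : 0 ≤ M ^ (1 - S.q) * |S.v y| ^ S.q := by positivity
      nlinarith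
  have hint := hF.integral_prod_right.norm
  have hl : Integrable fun l => ∫ p, F l p ∂(volume.prod volume) := hF.integral_prod_left
  have h4 : ∫ l, rexp (-s * ‖l‖ ^ 2) * ‖S.fourierV l‖ ^ 2 ≤ N * (4 * π ^ 2 / S.E + π * B) * M := by
    have e := integral_integral_swap hF
    simp only [h1] at e
    have e' : ((∫ l, rexp (-s * ‖l‖ ^ 2) * ‖S.fourierV l‖ ^ 2 : ℝ) : ℂ) = _ :=
      (integral_ofReal).symm.trans e
    refine (le_abs_self _).trans ?_
    rw [← norm_eq_abs, ← norm_real, e']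
    refine (norm_integral_le_integral_norm _).trans ?_
    refine (integral_prod _ hint).le.trans ?_
    rw [mul_assoc, ← integral_mul_const]
    have hi2 := hint.integral_prod_left
    simp only [Function.uncurry_apply_pair, h2] at hi2 ⊢
    exact integral_mono hi2 (S.integrable_v.abs.mul_const _) h3
  simp only [h1] at hl
  have hl' : Integrable fun l => rexp (-s * ‖l‖ ^ 2) * ‖S.fourierV l‖ ^ 2 := hl.re
  rw [← ofReal_integral_eq_lintegral_ofReal hl' (.of_forall fun l => ?_)]
  · exact ENNReal.ofReal_le_ofReal h4
  · positivity

end Setup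

lemma integrableOn_norm_rpow {a : ℝ} (ha : 2 < a) :
    IntegrableOn (fun l : ℂ => ‖l‖ ^ (-a)) {l | 1 ≤ ‖l‖} := by
  have h := integrable_one_add_norm (E := ℂ) (μ := volume) (r := a) (by simp_all)
  refine (h.integrableOn.const_mul (2 ^ a)).mono' (Measurable.aestronglyMeasurable (by fun_prop)) ?_
  filter_upwards [ae_restrict_mem (measurableSet_le measurable_const measurable_norm)] with l hl
  rw [norm_of_nonneg (by positivity)]
  have : (2 * ‖l‖) ^ (-a) ≤ (1 + ‖l‖) ^ (-a) :=
    rpow_le_rpow_of_nonpos (by positivity) (by linarith) (by linarith)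
  rw [mul_rpow (by norm_num) (norm_nonneg _), rpow_neg (by norm_num)] at this
  rwa [← inv_mul_le_iff₀ (by positivity)]

namespace Setup

variable (S : Setup)

lemma integrableOn_fourierV : IntegrableOn (fun l => ‖S.fourierV l‖ / ‖l‖ ^ 2) {l | 1 ≤ ‖l‖} := by
  obtain ⟨C, hC, hG⟩ := S.lintegral_gauss_le
  have hδ := S.δ_pos
  have hV := S.continuous_fourierV
  have hm : MeasurableSet {l : ℂ | 1 ≤ ‖l‖} := measurableSet_le measurable_const measurable_norm
  have hI := integrableOn_norm_rpow (a := 2 + 2 * S.δ) (by linarith)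
  let W : ℂ → ℝ → ENNReal := fun l s =>
    ENNReal.ofReal (s ^ (-S.δ)) * ENNReal.ofReal (rexp (-s * ‖l‖ ^ 2) * ‖S.fourierV l‖ ^ 2)
  have hW : ∫⁻ l, ∫⁻ s in Ioo 0 1, W l s < ⊤ := by
    rw [lintegral_lintegral_swap (Measurable.aemeasurable (by
      fun_prop))]
    have h1 : IntegrableOn (fun s : ℝ => C * s ^ (-1 + S.δ)) (Ioo 0 1) :=
      ((intervalIntegral.integrableOn_Ioo_rpow_iff one_pos).2 (by linarith)).const_mul C
    refine lt_of_le_of_lt (setLIntegral_mono' measurableSet_Ioo fun s hs => ?_) h1.lintegral_lt_top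
    rw [lintegral_const_mul' _ _ ENNReal.ofReal_ne_top]
    refine (mul_le_mul_right (hG s hs.1) _).trans_eq ?_
    rw [← ENNReal.ofReal_mul (by have := hs.1; positivity), mul_left_comm, ← rpow_add hs.1]
    congr 3
    rw [δ]; ring
  refine ⟨(hV.norm.measurable.div (by fun_prop)).aestronglyMeasurable, ?_⟩
  rw [hasFiniteIntegral_iff_ofReal (.of_forall fun l => by positivity)]
  have hb l (hl : 1 ≤ ‖l‖) : ENNReal.ofReal (‖S.fourierV l‖ / ‖l‖ ^ 2) ≤
      ENNReal.ofReal (‖l‖ ^ (-(2 + 2 * S.δ))) +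
        ENNReal.ofReal (rexp 1) * ∫⁻ s in Ioo 0 1, W l s := by
    set n := ‖l‖ with hn
    set a := ‖S.fourierV l‖ with ha
    have hn0 : 0 < n := by linarith
    have ha0 : 0 ≤ a := norm_nonneg _
    have h1 : ENNReal.ofReal (n ^ (2 * S.δ) * (rexp (-1) * a ^ 2) * n ^ (-2 : ℝ)) ≤
        ∫⁻ s in Ioo 0 1, W l s := by
      calc _ = ∫⁻ s in Ioo 0 (n ^ (-2 : ℝ)),
            ENNReal.ofReal (n ^ (2 * S.δ) * (rexp (-1) * a ^ 2)) := by
            rw [setLIntegral_const, Real.volume_Ioo, sub_zero, ENNReal.ofReal_mul (by positivity)]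
        _ ≤ ∫⁻ s in Ioo 0 (n ^ (-2 : ℝ)), W l s := by
            refine setLIntegral_mono' measurableSet_Ioo fun s hs => ?_
            simp only [W]
            rw [← ENNReal.ofReal_mul (by have := hs.1; positivity)]
            refine ENNReal.ofReal_le_ofReal (mul_le_mul ?_ ?_ (by positivity)
              (by have := hs.1; positivity))
            · have := rpow_le_rpow_of_nonpos hs.1 hs.2.le (by linarith : -S.δ ≤ 0)
              rwa [← rpow_mul hn0.le, neg_mul_neg] at this
            · gcongr
              rw [neg_mul, neg_le_neg_iff]
              have := hs.2.le
              rw [rpow_neg hn0.le, Real.rpow_two, le_inv_comm₀ hs.1 (by positivity)] at this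
              calc s * n ^ 2 ≤ s * s⁻¹ := mul_le_mul_of_nonneg_left this hs.1.le
                _ = 1 := mul_inv_cancel₀ hs.1.ne'
        _ ≤ _ := lintegral_mono_set (Ioo_subset_Ioo_right
            (Real.rpow_le_one_of_one_le_of_nonpos hl (by norm_num)))
    refine le_trans ?_ (add_le_add_right (mul_le_mul_right h1 _) _)
    rw [← ENNReal.ofReal_mul (by positivity), ← ENNReal.ofReal_add (by positivity) (by positivity)]
    refine ENNReal.ofReal_le_ofReal ?_
    have e0 : (n ^ S.δ) ^ 2 = n ^ (2 * S.δ) := by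
      rw [← Real.rpow_natCast, ← rpow_mul hn0.le, mul_comm]; norm_num
    rw [neg_add, rpow_add hn0, rpow_neg hn0.le 2, Real.rpow_two, rpow_neg hn0.le,
      ← e0, Real.exp_neg]
    set y := n ^ S.δ with hy
    have hy0 : 0 < y := by positivity
    have e1 : rexp 1 * (y ^ 2 * ((rexp 1)⁻¹ * a ^ 2) * (n ^ 2)⁻¹) = (a * y) ^ 2 * (n ^ 2)⁻¹ := by
      field_simp
    rw [e1, mul_comm (n ^ 2)⁻¹, ← add_mul, div_eq_mul_inv]
    refine mul_le_mul_of_nonneg_right ?_ (by positivity)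
    have e2 : a = y⁻¹ * (a * y) := by field_simp
    rw [← inv_pow]
    nlinarith [sq_nonneg (y⁻¹ - a * y), sq_nonneg (y⁻¹)]
  refine lt_of_le_of_lt (setLIntegral_mono' hm hb) ?_
  rw [lintegral_add_left (by fun_prop)]
  refine ENNReal.add_lt_top.2 ⟨hI.lintegral_lt_top, ?_⟩
  rw [lintegral_const_mul' _ _ ENNReal.ofReal_ne_top]
  exact ENNReal.mul_lt_top ENNReal.ofReal_lt_top ((setLIntegral_le_lintegral _ _).trans_lt hW)

end Setup

lemma phi0_inv_conj_mul_phi0 (E : ℝ) (z l : ℂ) : phi0 E z (1 / conj l) * phi0 E z l =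
    cexp (I * √E * (inner ℝ z l : ℝ)) * cexp (I * √E * ((z / l).re : ℝ)) := by
  rw [phi0, phi0, ← exp_add, ← exp_add, Complex.inner, Complex.re_eq_add_conj,
    Complex.re_eq_add_conj]
  congr 1
  simp only [map_mul, map_div₀, conj_conj, one_div, div_inv_eq_mul]
  ring

namespace Setup

variable (S : Setup)

/-- Decay of the scattering data `r`. -/
lemma exists_r_decay : ∃ (B C : ℝ) (G : ℂ → ℝ), 1 < B ∧ 0 ≤ C ∧
    IntegrableOn G {l | 1 ≤ ‖l‖} ∧ ∀ l : ℂ, l ≠ 0 → B ≤ specSize l → ‖l‖ ≠ 1 →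
      ‖r S.E S.v l‖ * ‖l‖ ≤ C ∧ (1 ≤ ‖l‖ → ‖r S.E S.v l‖ / ‖l‖ ≤ G l) := by
  obtain ⟨B, C₀, hB, hC₀, hmu⟩ := S.exists_mu_sub_one_le
  have hδ := S.δ_pos
  have hR := S.hR
  set N := ∫ z, |S.v z| with hN
  refine ⟨B, (1 + C₀) * N, fun l => ‖S.fourierV l‖ / ‖l‖ ^ 2 +
    (√S.E * S.R + C₀) * N * ‖l‖ ^ (-(2 + S.δ / 2)), hB, by positivity,
    S.integrableOn_fourierV.add ((integrableOn_norm_rpow (by linarith)).const_mul _), ?_⟩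
  intro l hl hs hl1
  have hlp := norm_pos_iff.2 hl
  obtain ⟨hU, hm⟩ := hmu l hl hs hl1
  have hω := exp_log hl
  rw [S.existsUnique_isFaddeevMu_iff hω hl1] at hU
  set f : S.X := S.Phi (-(-1 / conj l)) * S.psiX (sgn l) (Complex.log l) with hf
  set κ := √(specSize l) ^ (-S.δ) with hκ
  have hκ1 : κ ≤ 1 := Real.rpow_le_one_of_one_le_of_nonpos
    (Real.one_le_sqrt.2 (one_le_specSize hl)) (by linarith)
  have hr : ‖r S.E S.v l‖ * ‖l‖ ≤ ‖S.ell f‖ := by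
    have h1 := congrArg norm (S.r_eq hω hl1 hU)
    rw [exp_antiLog (sgn_eq hl1), hω, norm_mul, RCLike.norm_conj, norm_mul] at h1
    rw [mul_comm, h1]
    refine mul_le_of_le_one_left (norm_nonneg _) ?_
    have h2 : ‖(sgn l : ℂ)‖ = 1 := by rcases sgn_eq hl1 with h | h <;> simp [h]
    have h3 : ‖(4 * π : ℂ)‖ = 4 * π := by
      rw [norm_mul, Complex.norm_of_nonneg pi_pos.le]; norm_num
    rw [norm_div, h2, h3, div_le_one (by positivity)]
    linarith [Real.pi_gt_three]
  have hfz z (hz : z ∈ S.K) : S.ext f z = cexp (I * √S.E * (inner ℝ z l)) *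
      cexp (I * √S.E * ((z / l).re)) * mu S.E S.v z l := by
    rw [← phi0_inv_conj_mul_phi0, S.ext_of_mem f hz, ContinuousMap.mul_apply, Phi_apply,
      ← S.psi_eq hω hl1 hU, psi, neg_div, neg_neg, mul_assoc]
  have hmn z (hz : z ∈ S.K) : ‖mu S.E S.v z l - 1‖ ≤ C₀ * κ := hm z hz
  have hvi := S.integrable_v.abs
  have hbound {F : ℂ → ℂ} {c : ℝ} (h : ∀ z ∈ S.K, ‖F z‖ ≤ c) : ‖∫ z, F z * (S.v z)‖ ≤ c * N := by
    rw [← integral_const_mul]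
    refine norm_integral_le_of_norm_le (hvi.const_mul c) (.of_forall fun z => ?_)
    by_cases hz : z ∈ ball 0 S.R
    · rw [norm_mul, norm_real, norm_eq_abs]
      exact mul_le_mul_of_nonneg_right (h z (ball_subset_closedBall hz)) (abs_nonneg _)
    · simp [S.v_eq_zero hz]
  constructor
  · refine hr.trans (hbound fun z hz => ?_)
    rw [hfz z hz, norm_mul, norm_mul, norm_exp_I_mul_sqrt, norm_exp_I_mul_sqrt, one_mul, one_mul]
    have := norm_le_norm_add_norm_sub' (mu S.E S.v z l) 1
    rw [norm_one] at this
    nlinarith [hmn z hz]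
  · intro hl2
    have hspec : specSize l = ‖l‖ := max_eq_left ((inv_le_one_of_one_le₀ hl2).trans hl2)
    have hκ' : κ = ‖l‖ ^ (-(S.δ / 2)) := by
      rw [hκ, hspec, Real.sqrt_eq_rpow, ← rpow_mul hlp.le]; congr 1; ring
    have hinv : ‖l‖⁻¹ ≤ κ := by
      rw [hκ', ← Real.rpow_neg_one]
      exact Real.rpow_le_rpow_of_exponent_le hl2 (by linarith [S.δ_lt])
    have i1 := S.integrable_mul_v (S.continuous_ext f)
    have i2 := S.integrable_mul_v (F := fun z => cexp (I * √S.E * (inner ℝ z l))) (by fun_prop)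
    have h1 : ‖S.ell f - S.fourierV l‖ ≤ (√S.E * S.R + C₀) * κ * N := by
      rw [ell_apply, fourierV, ← integral_sub i1 i2]
      simp only [← sub_mul]
      refine hbound fun z hz => ?_
      set e₂ := cexp (I * √S.E * ((z / l).re)) with he₂
      rw [hfz z hz, mul_assoc, ← mul_sub_one, norm_mul, norm_exp_I_mul_sqrt, one_mul]
      have h2 : e₂ * mu S.E S.v z l - 1 = e₂ * (mu S.E S.v z l - 1) + (e₂ - 1) := by ring
      have h3 : ‖e₂ - 1‖ ≤ √S.E * S.R * κ := by
        rw [he₂, mul_assoc, ← ofReal_mul]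
        refine Real.norm_exp_I_mul_ofReal_sub_one_le.trans ?_
        rw [norm_mul, norm_of_nonneg (Real.sqrt_nonneg _), mul_assoc]
        gcongr
        refine (abs_re_le_norm _).trans ?_
        rw [norm_div, div_eq_mul_inv]
        exact mul_le_mul (by simpa using hz) hinv (by positivity) hR.le
      have h4 : ‖e₂ * (mu S.E S.v z l - 1)‖ ≤ C₀ * κ := by
        rw [norm_mul, norm_exp_I_mul_sqrt, one_mul]; exact hmn z hz
      rw [h2]
      linarith [norm_add_le (e₂ * (mu S.E S.v z l - 1)) (e₂ - 1)]
    have h5 := norm_le_norm_add_norm_sub' (S.ell f) (S.fourierV l)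
    have e : ‖l‖ ^ (-(2 + S.δ / 2)) = κ / ‖l‖ ^ 2 := by
      rw [neg_add, rpow_add hlp, hκ', rpow_neg hlp.le 2, Real.rpow_two]; ring
    beta_reduce
    rw [e, ← mul_div_assoc, ← add_div, le_div_iff₀ (by positivity), sq, ← mul_assoc,
      div_mul_cancel₀ _ hlp.ne']
    linarith

end Setup

lemma continuousAt_of_comp_exp {f : ℂ → ℂ} {s : ℂ} (hs : s ≠ 0)
    (h : ContinuousAt (fun w => f (cexp w)) (Complex.log s)) : ContinuousAt f s := by
  rw [ContinuousAt, exp_log hs] at h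
  rwa [ContinuousAt, ← exp_log hs, ← (Complex.hasStrictDerivAt_exp _).map_nhds_eq
    (exp_ne_zero _), exp_log hs, tendsto_map'_iff]

lemma DbarAt.continuousAt {m ρ : ℂ → ℂ} {s : ℂ} (h : DbarAt m ρ (Complex.log s)) (hs : s ≠ 0) :
    ContinuousAt m s ∧ ContinuousAt ρ s := by
  obtain ⟨⟨α, h1⟩, h2⟩ := h
  exact ⟨continuousAt_of_comp_exp hs h1.continuousAt, continuousAt_of_comp_exp hs h2⟩

/-- The part of the shell `B⁻¹ < |s| < B` off the closed ring. -/
def shell (A B : ℝ) : Set ℂ := annulus B⁻¹ A⁻¹ ∪ annulus A B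

/-- The punctured complement of the closed ring. -/
def offRing (A : ℝ) : Set ℂ := norm ⁻¹' (Ioo 0 A⁻¹ ∪ Ioi A)

lemma isOpen_annulus (a b : ℝ) : IsOpen (annulus a b) :=
  (isOpen_lt continuous_const continuous_norm).inter (isOpen_lt continuous_norm continuous_const)

lemma isOpen_offRing (A : ℝ) : IsOpen (offRing A) :=
  (isOpen_Ioo.union isOpen_Ioi).preimage continuous_norm

lemma ae_norm_ne (c : ℝ) : ∀ᵐ s : ℂ, ‖s‖ ≠ c := by
  refine measure_mono_null (fun s hs => ?_) (Measure.addHaar_sphere volume 0 c)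
  simpa using hs

lemma ae_continuousAt_indicator {t : Set ℝ} (ht : IsOpen t) (hc : (frontier t).Countable)
    {ρ : ℂ → ℂ} (hρ : ∀ s, ‖s‖ ∈ t → ContinuousAt ρ s) :
    ∀ᵐ s, ContinuousAt ((norm ⁻¹' t).indicator ρ) s := by
  have := (ae_ball_iff hc).2 fun c _ => ae_norm_ne c
  filter_upwards [this] with s hs
  by_cases h : ‖s‖ ∈ t
  · refine (hρ s h).congr ?_
    filter_upwards [(ht.preimage continuous_norm).mem_nhds h] with w hw
    simp_all
  · have h1 : ‖s‖ ∉ closure t := fun h' => hs _ (by rw [ht.frontier_eq]; exact ⟨h', h⟩) rfl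
    refine ContinuousAt.congr (f := fun _ => 0) continuousAt_const ?_
    filter_upwards [(isClosed_closure.isOpen_compl.preimage continuous_norm).mem_nhds h1] with w hw
    exact (indicator_of_notMem (s := norm ⁻¹' t) (fun h' => hw (subset_closure h')) _).symm

lemma indicator_div_sub (U : Set ℂ) (ρ : ℂ → ℂ) (l : ℂ) :
    (U.indicator fun s => ρ s / (s - l)) = fun s => U.indicator ρ s / (s - l) := by
  funext s
  simp only [indicator]
  split_ifs <;> simp

lemma log_le_abs_re {A : ℝ} (hA : 1 < A) {s : ℂ} (h0 : s ≠ 0) :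
    log A ≤ |(Complex.log s).re| ↔ s ∉ ring A := by
  have hA0 : 0 < A := by linarith
  have hs := norm_pos_iff.2 h0
  rw [log_re, le_abs, Real.log_le_log_iff hA0 hs, ← Real.log_inv,
    Real.log_le_log_iff hA0 (inv_pos.2 hs), le_inv_comm₀ hA0 hs]
  change _ ↔ ¬ (_ ∧ _)
  grind

lemma boundaryIntegral_shell {A B : ℝ} {m ρ : ℂ → ℂ} {l : ℂ} (hA : 1 < A)
    (hd : ∀ w : ℂ, log A ≤ |w.re| → DbarAt m ρ w) (hB : A < B) (h1 : ‖l‖ ≠ A) (h2 : ‖l‖ ≠ A⁻¹)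
    (h3 : ‖l‖ ≠ B) (h4 : ‖l‖ ≠ B⁻¹) (hi : IntegrableOn (fun s => ρ s / (s - l)) (shell A B)) :
    boundaryIntegral A (fun s => m s / (s - l)) = boundaryIntegral B (fun s => m s / (s - l)) -
      2 * π * I * (shell A B).indicator m l -
      2 * I * ∫ s in shell A B, ρ s / (s - l) := by
  have hA0 : 0 < A := by linarith
  have hAB := Real.log_lt_log hA0 hB
  have e1 : rexp (log A) = A := Real.exp_log hA0
  have e2 : rexp (log B) = B := Real.exp_log (hA0.trans hB)
  have e3 : rexp (-log A) = A⁻¹ := by rw [Real.exp_neg, e1]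
  have e4 : rexp (-log B) = B⁻¹ := by rw [Real.exp_neg, e2]
  obtain ⟨-, hA1, hA2⟩ := ring_lt hA
  have hdisj : Disjoint (annulus B⁻¹ A⁻¹) (annulus A B) :=
    disjoint_left.2 fun s h h' => by have := h.2; have := h'.1; linarith
  have hk (a b) : IntegrableOn (fun s => (s - l)⁻¹) (annulus a b) :=
    integrableOn_inv_sub l (isBounded_ball.subset fun s hs => mem_ball_zero_iff.2 hs.2)
  have p1 := cauchy_pompeiu hAB.le (by rwa [e1]) (by rwa [e2])
    (fun w hw => hd w (hw.1.trans (le_abs_self _))) (hk _ _)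
    (by rw [e1, e2]; exact hi.mono_set subset_union_right)
  have p2 := cauchy_pompeiu (neg_le_neg hAB.le) (by rwa [e4])
    (by rwa [e3]) (fun w hw => hd w ((le_neg.1 hw.2).trans (neg_le_abs _))) (hk _ _)
    (by rw [e3, e4]; exact hi.mono_set subset_union_left)
  rw [e1, e2] at p1
  rw [e3, e4] at p2
  rw [boundaryIntegral, boundaryIntegral, shell, setIntegral_union hdisj (measurableSet_annulus _ _)
    (hi.mono_set subset_union_left) (hi.mono_set subset_union_right),
    indicator_union_of_disjoint hdisj]
  linear_combination -p1 - p2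

lemma isCompact_norm_preimage {t : Set ℝ} (h : IsCompact t) : IsCompact ((norm : ℂ → ℝ) ⁻¹' t) := by
  obtain ⟨R, hR⟩ := h.isBounded.subset_closedBall 0
  refine (isCompact_closedBall 0 R).of_isClosed_subset (h.isClosed.preimage continuous_norm)
    fun s hs => ?_
  simpa using hR hs

lemma eventually_norm_ne {A : ℝ} (hA : 1 < A) {f : Filter ℂ}
    (hs : (∀ᶠ l in f, l ∈ ring A) ∨ ∀ᶠ l in f, l ∈ offRing A) :
    ∀ᶠ l in f, l ≠ 0 ∧ ‖l‖ ≠ A ∧ ‖l‖ ≠ A⁻¹ := by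
  obtain ⟨hA0, -, hA2⟩ := ring_lt hA
  rcases hs with h | h <;> filter_upwards [h] with s hs
  · exact ⟨norm_pos_iff.1 (hA0.trans hs.1), hs.2.ne, hs.1.ne'⟩
  · refine ⟨norm_pos_iff.1 ?_, ?_⟩ <;> rcases hs with h | h
    exacts [h.1, hA0.trans (hA2.trans h), ⟨(h.2.trans hA2).ne, h.2.ne⟩,
      ⟨ne_of_gt h, (hA2.trans h).ne'⟩]

/-- Boundary values of Cauchy integrals over the boundary of the ring. -/
lemma exists_tendsto_boundaryIntegral {A : ℝ} {m ρ : ℂ → ℂ} {l₀ : ℂ} {f : Filter ℂ} (hA : 1 < A)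
    (hd : ∀ w : ℂ, log A ≤ |w.re| → DbarAt m ρ w) (hl₀ : ‖l₀‖ = A ∨ ‖l₀‖ = A⁻¹) (hf : f ≤ 𝓝 l₀)
    (hs : (∀ᶠ l in f, l ∈ ring A) ∨ ∀ᶠ l in f, l ∈ offRing A) :
    ∃ b, Tendsto (fun l => boundaryIntegral A fun s => m s / (s - l)) f (𝓝 b) := by
  obtain ⟨hA0, hA1, hA2⟩ := ring_lt hA
  have hm {s : ℂ} (h : s ∉ ring A) (h0 : s ≠ 0) : ContinuousAt m s ∧ ContinuousAt ρ s :=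
    (hd _ ((log_le_abs_re hA h0).2 h)).continuousAt h0
  set B := 2 * A with hBd
  have hB : A < B := by linarith
  have hB0 : 0 < B⁻¹ := by positivity
  have hBA : B⁻¹ < A⁻¹ := inv_strictAnti₀ (by linarith) hB
  have hsh : shell A B = norm ⁻¹' (Ioo B⁻¹ A⁻¹ ∪ Ioo A B) := rfl
  have hcl {s : ℂ} (h : ‖s‖ ∈ Icc B⁻¹ A⁻¹ ∪ Icc A B) : s ∉ ring A ∧ s ≠ 0 := by
    refine ⟨fun h' => ?_, fun h' => ?_⟩
    · rcases h with h | h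
      · exact absurd h'.1 (not_lt.2 h.2)
      · exact absurd h'.2 (not_lt.2 h.1)
    · rw [h', norm_zero] at h
      grind
  have hK := isCompact_norm_preimage ((isCompact_Icc (a := B⁻¹) (b := A⁻¹)).union
    (isCompact_Icc (a := A) (b := B)))
  have hρK : ContinuousOn ρ (norm ⁻¹' (Icc B⁻¹ A⁻¹ ∪ Icc A B)) := fun s hs =>
    (hm (hcl hs).1 (hcl hs).2).2.continuousWithinAt
  have hsub : shell A B ⊆ norm ⁻¹' (Icc B⁻¹ A⁻¹ ∪ Icc A B) :=
    preimage_mono (union_subset_union Ioo_subset_Icc_self Ioo_subset_Icc_self)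
  have hsm : MeasurableSet (shell A B) := (measurableSet_annulus _ _).union (measurableSet_annulus _ _)
  obtain ⟨C, hC⟩ := hK.exists_bound_of_continuousOn hρK
  set ρ' := (shell A B).indicator ρ with hρ'
  have hb s : ‖ρ' s‖ ≤ max C 0 := by
    rw [norm_indicator_eq_indicator_norm]
    exact indicator_le' (fun s hs => (hC s (hsub hs)).trans (le_max_left _ _))
      (fun s _ => le_max_right _ _) s
  have hi : Integrable fun s => ρ' s / (1 + ‖s‖) := by
    have h1 : IntegrableOn ρ (shell A B) := (hρK.integrableOn_compact hK).mono_set hsub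
    rw [← integrable_indicator_iff hsm] at h1
    refine h1.norm.mono' (h1.1.mul
      (Measurable.aestronglyMeasurable (by fun_prop))) (.of_forall fun s => ?_)
    rw [norm_div_one_add]
    exact div_le_self (norm_nonneg _) (by linarith [norm_nonneg s])
  have hcont : ContinuousAt (fun l => ∫ s, ρ' s / (s - l)) l₀ := by
    refine continuousAt_cauchyTransform one_pos (fun s _ => hb s) hi ?_
    rw [hρ', hsh]
    refine ae_continuousAt_indicator (isOpen_Ioo.union isOpen_Ioo) ?_ fun s hs =>
      (hm (hcl (hsub hs)).1 (hcl (hsub hs)).2).2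
    refine Countable.mono ((frontier_union_subset _ _).trans
      (union_subset_union inter_subset_left inter_subset_right)) ?_
    rw [frontier_Ioo hBA, frontier_Ioo hB]
    exact ((finite_singleton _).insert _).union ((finite_singleton _).insert _) |>.countable
  have hint l : (∫ s in shell A B, ρ s / (s - l)) = ∫ s, ρ' s / (s - l) := by
    rw [← integral_indicator hsm, indicator_div_sub]
  have hout : ContinuousAt (fun l => boundaryIntegral B fun s => m s / (s - l)) l₀ := by
    have hc R (hR : R = B ∨ R = B⁻¹) : ContinuousOn m (sphere 0 R) := fun s hs => by
      have hs : ‖s‖ = R := by simpa using hs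
      have h := hcl (s := s) (by
        grind)
      exact (hm h.1 h.2).1.continuousWithinAt
    exact (continuousAt_circleIntegral (by linarith) (hc B (Or.inl rfl))
      (by grind)).sub (continuousAt_circleIntegral hB0
      (hc _ (Or.inr rfl)) (by grind))
  have hl₀' : l₀ ∉ ring A ∧ l₀ ≠ 0 := hcl (by
    grind)
  have hnear : ∀ᶠ l in f, ‖l‖ ∈ Ioo B⁻¹ B := by
    refine hf (continuous_norm.continuousAt.eventually (Ioo_mem_nhds ?_ ?_)) <;> beta_reduce <;>
    rcases hl₀ with h | h <;> rw [h] <;> linarith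
  have hind : ∃ β, Tendsto ((shell A B).indicator m) f (𝓝 β) := by
    rcases hs with hs | hs
    · refine ⟨0, tendsto_const_nhds.congr' ?_⟩
      filter_upwards [hs] with l hl
      exact (indicator_of_notMem (fun h => (hcl (hsub h)).1 hl) _).symm
    · refine ⟨m l₀, ((hm hl₀'.1 hl₀'.2).1.tendsto.mono_left hf).congr' ?_⟩
      filter_upwards [hs, hnear] with l hl hl'
      refine (indicator_of_mem ?_ _).symm
      rcases hl with h | h
      exacts [Or.inl ⟨hl'.1, h.2⟩, Or.inr ⟨h, hl'.2⟩]
  obtain ⟨β, hβ⟩ := hind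
  refine ⟨_, ((((hout.tendsto.mono_left hf).sub (hβ.const_mul (2 * π * I))).sub
    ((hcont.tendsto.mono_left hf).const_mul (2 * I)))).congr' ?_⟩
  filter_upwards [eventually_norm_ne hA hs, hnear] with l h1 h2
  rw [boundaryIntegral_shell hA hd hB h1.2.1 h1.2.2 h2.2.ne h2.1.ne', hint]
  rw [← integrable_indicator_iff hsm, indicator_div_sub]
  exact integrable_div_sub one_pos (fun s _ => hb s) hi

lemma norm_circleIntegral_div_sub_le {m : ℂ → ℂ} {l : ℂ} {R ε : ℝ} (hR : 0 < R)
    (h : R ≤ 2 * |R - ‖l‖|) (hm : ∀ s, ‖s‖ = R → ‖m s‖ ≤ ε) :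
    ‖∮ s in C(0, R), m s / (s - l)‖ ≤ 4 * π * ε := by
  have hd : 0 < |R - ‖l‖| := by linarith
  have hε : 0 ≤ ε := (norm_nonneg _).trans (hm R (by simp [abs_of_pos hR]))
  refine (circleIntegral.norm_integral_le_of_norm_le_const hR.le (C := ε / |R - ‖l‖|)
    fun s hs => ?_).trans ?_
  · have hs : ‖s‖ = R := by simpa using hs
    have h1 := abs_norm_sub_norm_le s l
    rw [hs] at h1
    rw [norm_div]
    gcongr
    exact hm s hs
  · rw [mul_div_assoc', div_le_iff₀ hd]
    nlinarith [mul_le_mul_of_nonneg_left h (by positivity : 0 ≤ 2 * π * ε)]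

/-- The Cauchy–Pompeiu formula on the complement of the ring, for functions that vanish at `0` and
at infinity. -/
lemma boundaryIntegral_offRing {A : ℝ} {m ρ : ℂ → ℂ} {l : ℂ} (hA : 1 < A)
    (hd : ∀ w : ℂ, log A ≤ |w.re| → DbarAt m ρ w) (h1 : ‖l‖ ≠ A) (h2 : ‖l‖ ≠ A⁻¹) (h0 : l ≠ 0)
    (hm : ∀ ε > 0, ∃ B, ∀ s, B ≤ specSize s → ‖m s‖ ≤ ε)
    (hi : IntegrableOn (fun s => ρ s / (s - l)) (offRing A)) :
    boundaryIntegral A (fun s => m s / (s - l)) = -(2 * π * I * (offRing A).indicator m l) -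
      2 * I * ∫ s in offRing A, ρ s / (s - l) := by
  have hl := norm_pos_iff.2 h0
  set u : ℕ → ℝ := fun n => n + (A + 2 * ‖l‖ + 2 * ‖l‖⁻¹) with hu
  have hlu n : A < u n ∧ 2 * ‖l‖ < u n ∧ 2 * ‖l‖⁻¹ < u n := by
    have : (0 : ℝ) ≤ n := n.cast_nonneg
    have := inv_pos.2 hl
    refine ⟨?_, ?_, ?_⟩ <;> simp only [hu] <;> linarith
  have hu0 n : 0 < u n := by linarith [(hlu n).1]
  have hinv n : (u n)⁻¹ < ‖l‖ / 2 := by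
    rw [inv_lt_comm₀ (hu0 n) (by positivity), inv_div, div_eq_mul_inv]; exact (hlu n).2.2
  have humono : Monotone u := fun a b h => by simp only [hu]; gcongr
  have hutop : Tendsto u atTop atTop :=
    tendsto_atTop_add_const_right _ _ tendsto_natCast_atTop_atTop
  have hmono : Monotone fun n => shell A (u n) := fun a b h => union_subset_union
    (fun s hs => ⟨(inv_anti₀ (hu0 a) (humono h)).trans_lt hs.1, hs.2⟩)
    (fun s hs => ⟨hs.1, hs.2.trans_le (humono h)⟩)
  have hmem {s : ℂ} (hs : s ∈ offRing A) : ∃ n, s ∈ shell A (u n) := by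
    obtain ⟨n, h, h'⟩ := ((hutop.eventually_gt_atTop ‖s‖).and (hutop.eventually_gt_atTop ‖s‖⁻¹)).exists
    refine ⟨n, ?_⟩
    rcases hs with hs | hs
    exacts [Or.inl ⟨inv_lt_of_inv_lt₀ hs.1 h', hs.2⟩, Or.inr ⟨hs, h⟩]
  have hsub n : shell A (u n) ⊆ offRing A := union_subset_union
    (fun s hs => ⟨(inv_pos.2 (hu0 n)).trans hs.1, hs.2⟩) fun s hs => hs.1
  have hU : ⋃ n, shell A (u n) = offRing A :=
    (iUnion_subset hsub).antisymm fun s hs => mem_iUnion.2 (hmem hs)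
  have hlim := tendsto_setIntegral_of_monotone (s := fun n => shell A (u n))
    (fun n => (measurableSet_annulus _ _).union (measurableSet_annulus _ _)) hmono (by rwa [hU])
  rw [hU] at hlim
  have hind n : (shell A (u n)).indicator m l = (offRing A).indicator m l := by
    by_cases h : l ∈ offRing A
    · rw [indicator_of_mem h, indicator_of_mem]
      rcases h with h | h
      · exact Or.inl ⟨(hinv n).trans (half_lt_self hl), h.2⟩
      · exact Or.inr ⟨h, by linarith [(hlu n).2.1]⟩
    · rw [indicator_of_notMem h, indicator_of_notMem fun h' => h (hsub n h')]
  have hcirc : Tendsto (fun n => boundaryIntegral (u n) fun s => m s / (s - l)) atTop (𝓝 0) := by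
    refine Metric.tendsto_nhds.2 fun ε hε => ?_
    obtain ⟨B, hB⟩ := hm (ε / (16 * π)) (by positivity)
    filter_upwards [hutop.eventually_ge_atTop B] with n hn
    have b1 := norm_circleIntegral_div_sub_le (l := l) (hu0 n) (by grind) fun s hs =>
        hB s (by rw [specSize, hs]; grind)
    have b2 := norm_circleIntegral_div_sub_le (l := l) (inv_pos.2 (hu0 n)) (by grind) fun s hs =>
        hB s (by rw [specSize, hs, inv_inv]; grind)
    have e : 4 * π * (ε / (16 * π)) = ε / 4 := by field_simp; norm_num
    rw [e] at b1 b2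
    rw [dist_zero_right]
    refine (norm_sub_le _ _).trans_lt ?_
    linarith
  have hconst := ((hcirc.sub (tendsto_const_nhds (x := 2 * π * I *
    (offRing A).indicator m l))).sub (hlim.const_mul (2 * I)))
  rw [zero_sub] at hconst
  refine tendsto_nhds_unique (tendsto_const_nhds.congr fun n => ?_) hconst
  rw [boundaryIntegral_shell hA hd (hlu n).1 h1 h2 (by linarith [(hlu n).2.1])
    (by linarith [hinv n]) (hi.mono_set (hsub n)), hind]

lemma eventually_sgn {l : ℂ} (hl : ‖l‖ ≠ 1) : ∀ᶠ w in 𝓝 l, sgn w = sgn l := by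
  rcases sgn_ne hl with ⟨h, h1⟩ | ⟨h, h1⟩
  · filter_upwards [continuous_norm.continuousAt.eventually (lt_mem_nhds h1)] with w hw
    rw [h, sgn_of_one_lt hw]
  · filter_upwards [continuous_norm.continuousAt.eventually (gt_mem_nhds h1)] with w hw
    rw [h, sgn_of_lt_one hw]

lemma norm_ne_one_of_notMem {A : ℝ} (hA : 1 < A) {s : ℂ} (hs : s ∉ ring A) : ‖s‖ ≠ 1 :=
  fun h => hs ⟨by rw [h]; exact inv_lt_one_of_one_lt₀ hA, by rwa [h]⟩

namespace Setup

variable (S : Setup)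

lemma psiX_congr (σ : ℝ) {ω ω' : ℂ} (h : cexp ω = cexp ω') : S.psiX σ ω = S.psiX σ ω' := by
  rw [psiX, psiX, S.TOp_congr σ h, h]

lemma dbarPsi_congr {σ : ℝ} (hσ : σ = 1 ∨ σ = -1) {ω ω' : ℂ}
    (h : cexp ω = cexp ω') : S.dbarPsi σ ω = S.dbarPsi σ ω' := by
  have e : cexp (antiLog σ ω) = cexp (antiLog σ ω') := by
    rw [exp_antiLog hσ, exp_antiLog hσ, h]
  rw [dbarPsi, dbarPsi, S.psiX_congr _ h, S.psiX_congr _ e, e]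

lemma isUnit_of_notMem {A : ℝ} (hA : 1 < A) (had : IsAdmissible S.E S.v A) {ω : ℂ}
    (h : cexp ω ∉ ring A) : IsUnit (1 - S.TOp (sgn (cexp ω)) ω) := by
  have h1 := norm_ne_one_of_notMem hA h
  rw [← S.existsUnique_isFaddeevMu_iff rfl h1]
  by_contra h2
  exact h (had _ ⟨exp_ne_zero _, h1, h2⟩)

/-- Images of the Faddeev solution under an operator, with the plane wave removed. -/
def modWave (K : S.X →L[ℂ] S.X) (z : S.K) (s : ℂ) : ℂ :=
  phi0 S.E z (-s) * K (S.psiX (sgn s) (Complex.log s)) z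

/-- The `∂̄`-derivative of `modWave`. -/
def dbarWave (K : S.X →L[ℂ] S.X) (z : S.K) (s : ℂ) : ℂ :=
  (conj s)⁻¹ * (phi0 S.E z (-s) * K (S.dbarPsi (sgn s) (Complex.log s)) z)

lemma differentiable_phi0_neg_exp (z : S.K) : Differentiable ℂ fun w => phi0 S.E z (-cexp w) :=
  differentiable_clm_comp (X := S.X) (ContinuousMap.evalCLM ℂ z) S.differentiable_Phi_neg_exp

lemma eventually_sgn_exp {ω : ℂ} (h : ‖cexp ω‖ ≠ 1) : ∀ᶠ w in 𝓝 ω, sgn (cexp w) = sgn (cexp ω) :=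
  continuous_exp.continuousAt.eventually (eventually_sgn h)

lemma dbarAt_modWave {A : ℝ} (hA : 1 < A) (had : IsAdmissible S.E S.v A)
    (K : S.X →L[ℂ] S.X) (z : S.K) {ω : ℂ} (h : cexp ω ∉ ring A) :
    DbarAt (S.modWave K z) (S.dbarWave K z) ω := by
  have h1 := norm_ne_one_of_notMem hA h
  have hU := S.isUnit_of_notMem hA had h
  have hs := eventually_sgn_exp h1
  have hlog w : cexp (Complex.log (cexp w)) = cexp w :=
    exp_log (exp_ne_zero w)
  have hφ := (S.differentiable_phi0_neg_exp z ω)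
  have hσ := sgn_eq h1
  set σ := sgn (cexp ω) with hσd
  constructor
  · obtain ⟨α, hα⟩ := S.hasFDerivAt_psiX hU
    have h2 := HasFDerivAt.wirt_mul (hasFDerivAt_wirt_left hφ.hasDerivAt)
      (HasFDerivAt.wirt_clm hα ((ContinuousMap.evalCLM ℂ z).comp K))
    refine ⟨_, (h2.congr_of_eventuallyEq ?_).congr_fderiv (congrArg _ ?_)⟩
    · filter_upwards [hs] with w hw
      rw [modWave, hw, S.psiX_congr σ (hlog w)]; rfl
    · have : conj (cexp ω) ≠ 0 := by simp
      rw [dbarWave, mul_inv_cancel_left₀ this, S.dbarPsi_congr hσ (hlog ω), mul_zero, add_zero]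
      rfl
  · have h3 : ContinuousAt (fun w => K (S.dbarPsi σ w) z) ω :=
      ((ContinuousMap.evalCLM ℂ z).comp K).continuous.continuousAt.comp (S.continuousAt_dbarPsi hU)
    have h4 : ContinuousAt (fun w => (conj (cexp w))⁻¹) ω :=
      ContinuousAt.inv₀ (Continuous.continuousAt (by fun_prop)) (by simp)
    refine (h4.mul (hφ.continuousAt.mul h3)).congr ?_
    filter_upwards [hs] with w hw
    rw [dbarWave, hw, S.dbarPsi_congr hσ (hlog w)]; rfl

lemma modWave_one {A : ℝ} (hA : 1 < A) (had : IsAdmissible S.E S.v A) (z : S.K) {s : ℂ}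
    (h0 : s ≠ 0) (hs : s ∉ ring A) : S.modWave 1 z s = mu S.E S.v z s := by
  have hω := exp_log h0
  have := S.psi_eq hω (norm_ne_one_of_notMem hA hs)
    (by have := S.isUnit_of_notMem hA had (ω := Complex.log s); grind) z
  rw [modWave, ContinuousLinearMap.one_apply, ← this, psi, ← mul_assoc, mul_comm (phi0 _ _ _),
    phi0_mul_neg, one_mul]

lemma dbarWave_one {A : ℝ} (hA : 1 < A) (had : IsAdmissible S.E S.v A) (z : S.K) {s : ℂ}
    (h0 : s ≠ 0) (hs : s ∉ ring A) :
    S.dbarWave 1 z s = r S.E S.v s * e0 S.E z s * mu S.E S.v z (-1 / conj s) := by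
  have hω := exp_log h0
  have := S.dbarPsi_eq hω (norm_ne_one_of_notMem hA hs)
    (by have := S.isUnit_of_notMem hA had (ω := Complex.log s); grind) z
  rw [dbarWave, ContinuousLinearMap.one_apply, this, inv_mul_cancel_left₀ (by simpa using h0)]

lemma continuousAt_r {A : ℝ} (hA : 1 < A) (had : IsAdmissible S.E S.v A) {s : ℂ}
    (h0 : s ≠ 0) (hs : s ∉ ring A) : ContinuousAt (r S.E S.v) s := by
  refine continuousAt_of_comp_exp h0 ?_
  have h : cexp (Complex.log s) ∉ ring A := by rwa [exp_log h0]
  set ω := Complex.log s with hω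
  have h1 := norm_ne_one_of_notMem hA h
  have hU := S.isUnit_of_notMem hA had h
  have hn : ∀ᶠ w in 𝓝 ω, ‖cexp w‖ ≠ 1 :=
    (continuous_exp.norm.continuousAt).eventually_ne h1
  set σ := sgn (cexp ω) with hσ
  obtain ⟨α, hα⟩ := S.hasFDerivAt_psiX hU
  have h2 : ContinuousAt (fun ω => S.Phi (-cexp (antiLog σ ω))) ω :=
    S.differentiable_Phi_neg_exp.continuous.continuousAt.comp (hasFDerivAt_antiLog σ ω).continuousAt
  have h3 := S.ell.continuous.continuousAt.comp
    (f := fun ω => S.Phi (-cexp (antiLog σ ω)) * S.psiX σ ω) (h2.mul hα.continuousAt)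
  have h4 : ContinuousAt (fun w => (conj (cexp w))⁻¹) ω :=
    ContinuousAt.inv₀ (Continuous.continuousAt (by fun_prop)) (by simp)
  refine (h4.mul (continuousAt_const (y := (σ / (4 * π) : ℂ)).mul h3)).congr ?_
  filter_upwards [eventually_sgn_exp h1, S.eventually_isUnit hU, hn] with w h5 h6 h7
  have h8 := S.r_eq rfl h7 (by rw [h5]; exact h6)
  rw [h5] at h8
  change (conj (cexp w))⁻¹ * ((σ / (4 * π)) * S.ell _) = _
  rw [← h8, inv_mul_cancel_left₀ (by simp)]

end Setup

lemma isOpen_ring (A : ℝ) : IsOpen (ring A) := isOpen_annulus _ _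

lemma notMem_ring_of_mem_offRing {A : ℝ} (hA : 1 < A) {s : ℂ} (hs : s ∈ offRing A) :
    s ∉ ring A ∧ s ≠ 0 := by
  rcases hs with h | h
  · exact ⟨fun h' => lt_asymm h.2 h'.1, norm_pos_iff.1 h.1⟩
  · exact ⟨fun h' => lt_asymm (show A < ‖s‖ from h) h'.2, norm_pos_iff.1 (by grind)⟩

lemma mem_offRing_iff {A : ℝ} {s : ℂ} (h0 : s ≠ 0) (h1 : ‖s‖ ≠ A) (h2 : ‖s‖ ≠ A⁻¹) :
    s ∈ offRing A ↔ s ∉ ring A := by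
  have := norm_pos_iff.2 h0
  change (_ ∧ _ ∨ _) ↔ ¬ (_ ∧ _)
  grind

lemma neBot_nhdsWithin_ring {A : ℝ} (hA : 1 < A) {l : ℂ} (hl : ‖l‖ = A ∨ ‖l‖ = A⁻¹) :
    (𝓝[ring A] l).NeBot := by
  obtain ⟨hA0, hA1, hA2⟩ := ring_lt hA
  rw [← mem_closure_iff_nhdsWithin_neBot]
  have hc (f : Filter ℝ) (hf : f ≤ 𝓝 1) : Tendsto (fun t : ℝ => t • l) f (𝓝 l) := by
    have : Tendsto (fun t : ℝ => t • l) (𝓝 1) (𝓝 ((1 : ℝ) • l)) := Continuous.tendsto (by fun_prop) 1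
    rw [one_smul] at this
    exact this.mono_left hf
  have hn (f : Filter ℝ) (hf : f ≤ 𝓝 1) : ∀ᶠ t in f, ‖t • l‖ = t * ‖l‖ :=
    hf ((lt_mem_nhds one_pos).mono fun t ht => by rw [norm_smul, norm_of_nonneg ht.le])
  rcases hl with hl | hl
  · have h1 := (hc _ (nhdsWithin_le_nhds (s := Iio 1)))
    refine mem_closure_of_tendsto h1 ?_
    filter_upwards [hn _ nhdsWithin_le_nhds, self_mem_nhdsWithin,
      (h1.norm.eventually (lt_mem_nhds (show A⁻¹ < ‖l‖ by rwa [hl])))] with t h2 h3 h4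
    refine ⟨h4, ?_⟩
    rw [h2, hl]
    simp_all
  · have h1 := (hc _ (nhdsWithin_le_nhds (s := Ioi 1)))
    refine mem_closure_of_tendsto h1 ?_
    filter_upwards [hn _ nhdsWithin_le_nhds, self_mem_nhdsWithin,
      (h1.norm.eventually (gt_mem_nhds (show ‖l‖ < A by rwa [hl])))] with t h2 h3 h4
    refine ⟨?_, h4⟩
    rw [h2, hl]
    simp_all

lemma closure_ring_subset (A : ℝ) : closure (ring A) ⊆ norm ⁻¹' Icc A⁻¹ A :=
  closure_minimal (fun _ h => ⟨h.1.le, h.2.le⟩) (isClosed_Icc.preimage continuous_norm)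

lemma mem_frontier_ring {A : ℝ} (hA : 1 < A) {l : ℂ} :
    l ∈ frontier (ring A) ↔ ‖l‖ = A ∨ ‖l‖ = A⁻¹ := by
  rw [(isOpen_ring A).frontier_eq]
  constructor
  · intro ⟨h1, h2⟩
    have h := closure_ring_subset A h1
    by_contra! h3
    exact h2 ⟨lt_of_le_of_ne h.1 h3.2.symm, lt_of_le_of_ne h.2 h3.1⟩
  · intro h
    refine ⟨mem_closure_iff_nhdsWithin_neBot.2 (neBot_nhdsWithin_ring hA h), fun h' => ?_⟩
    rcases h with h | h
    exacts [h'.2.ne h, h'.1.ne' h]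

lemma nhdsWithin_compl_closure {A : ℝ} (hA : 1 < A) {l : ℂ} (hl : ‖l‖ = A ∨ ‖l‖ = A⁻¹) :
    ∀ᶠ s in 𝓝[(closure (ring A))ᶜ] l, s ∈ offRing A := by
  have h0 : l ≠ 0 := by
    rw [← norm_pos_iff]
    rcases hl with h | h <;> rw [h] <;> linarith [(ring_lt hA).1]
  filter_upwards [self_mem_nhdsWithin, nhdsWithin_le_nhds (isOpen_compl_singleton.mem_nhds h0)]
    with s hs h
  have h1 (h' : ‖s‖ = A ∨ ‖s‖ = A⁻¹) : False :=
    hs (frontier_subset_closure ((mem_frontier_ring hA).2 h'))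
  exact (mem_offRing_iff h (fun h => h1 (Or.inl h)) fun h => h1 (Or.inr h)).2
    fun h => hs (subset_closure h)

lemma exists_bound_offRing {A B C : ℝ} (hA : 1 < A) {F : ℂ → ℂ}
    (hc : ∀ s, s ≠ 0 → s ∉ ring A → ContinuousAt F s)
    (hB : ∀ s, s ≠ 0 → s ∉ ring A → B ≤ specSize s → ‖F s‖ ≤ C) :
    ∃ C', ∀ s, s ≠ 0 → s ∉ ring A → ‖F s‖ ≤ C' := by
  set t : Set ℝ := Icc (max B A)⁻¹ A⁻¹ ∪ Icc A (max B A) with ht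
  have hcl {s : ℂ} (hs : ‖s‖ ∈ t) : s ≠ 0 ∧ s ∉ ring A := by
    refine ⟨norm_pos_iff.1 ?_, fun h' => ?_⟩
    · rcases hs with h | h
      · exact (inv_pos.2 (by linarith [le_max_right B A])).trans_le h.1
      · linarith [h.1]
    · rcases hs with h | h
      exacts [absurd h'.1 (not_lt.2 h.2), absurd h'.2 (not_lt.2 h.1)]
  obtain ⟨C₂, h⟩ := (isCompact_norm_preimage (isCompact_Icc.union
    isCompact_Icc : IsCompact t)).exists_bound_of_continuousOn
    fun s hs => (hc s (hcl hs).1 (hcl hs).2).continuousWithinAt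
  refine ⟨max C C₂, fun s h0 h1 => ?_⟩
  by_cases hsp : B ≤ specSize s
  · grind
  · refine (h s ?_).trans (le_max_right _ _)
    have hn := norm_pos_iff.2 h0
    rw [specSize, le_max_iff, not_or, not_le, not_le] at hsp
    by_cases hs : A⁻¹ < ‖s‖
    · exact Or.inr ⟨not_lt.1 fun h' => h1 ⟨hs, h'⟩, hsp.1.le.trans (le_max_left _ _)⟩
    · exact Or.inl ⟨inv_le_of_inv_le₀ hn (hsp.2.le.trans (le_max_left _ _)), not_lt.1 hs⟩

namespace Setup

variable (S : Setup)

lemma norm_e0 (E : ℝ) (z l : ℂ) : ‖e0 E z l‖ = 1 := by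
  rw [e0, phi0_antipode, norm_mul, RCLike.norm_conj, ← norm_mul, mul_comm, phi0_mul_neg, norm_one]

lemma continuousAt_e0 (E : ℝ) (z : ℂ) {l : ℂ} (hl : l ≠ 0) : ContinuousAt (e0 E z) l := by
  unfold e0 phi0
  refine ContinuousAt.mul ?_ ?_ <;> fun_prop (disch := simp [hl])

/-- The solid Cauchy integrals of the density `r e₀ f`. -/
lemma density {A : ℝ} (hA : 1 < A) (had : IsAdmissible S.E S.v A) (z : ℂ)
    {f : ℂ → ℂ} {C : ℝ} (hf : ∀ s, s ≠ 0 → s ∉ ring A → ContinuousAt f s)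
    (hC : ∀ s, s ≠ 0 → s ∉ ring A → ‖f s‖ ≤ C) {l : ℂ} (hl : l ≠ 0) :
    Integrable (fun s => (offRing A).indicator (fun s => r S.E S.v s * e0 S.E z s * f s) s / (s - l)) ∧
    ContinuousAt (fun l => ∫ s, (offRing A).indicator (fun s => r S.E S.v s * e0 S.E z s * f s) s /
      (s - l)) l := by
  obtain ⟨B, C₁, G, hB, hC₁, hG, hr⟩ := S.exists_r_decay
  obtain ⟨hA0, hA1, hA2⟩ := ring_lt hA
  have hext {s : ℂ} (hs : s ∈ offRing A) := notMem_ring_of_mem_offRing hA hs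
  set ρ : ℂ → ℂ := fun s => r S.E S.v s * e0 S.E z s * f s with hρ
  have hρc s (hs : s ∈ offRing A) : ContinuousAt ρ s := by
    obtain ⟨h1, h0⟩ := hext hs
    exact ((S.continuousAt_r hA had h0 h1).mul (continuousAt_e0 _ _ h0)).mul (hf s h0 h1)
  have hC0 : 0 ≤ C := (norm_nonneg _).trans (hC A (by exact_mod_cast (by linarith : A ≠ 0))
    fun h => by have := h.2; rw [Complex.norm_of_nonneg (by linarith)] at this; exact lt_irrefl _ this)
  obtain ⟨C₂, hC₂⟩ : ∃ C₂, ∀ s, s ≠ 0 → s ∉ ring A → ‖r S.E S.v s * s‖ ≤ C₂ :=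
    exists_bound_offRing hA (fun s h0 h1 => (S.continuousAt_r hA had h0 h1).mul continuousAt_id)
      fun s h0 h1 h => (norm_mul _ _).trans_le (hr s h0 h (norm_ne_one_of_notMem hA h1)).1
  have hnρ s (hs : s ∈ offRing A) : ‖ρ s‖ ≤ ‖r S.E S.v s‖ * C := by
    obtain ⟨h1, h0⟩ := hext hs
    rw [norm_mul, norm_mul, norm_e0, mul_one]
    exact mul_le_mul_of_nonneg_left (hC s h0 h1) (norm_nonneg _)
  have hinv s (hs : s ∈ offRing A) : ‖ρ s‖ ≤ |C₂ * C| * ‖s‖⁻¹ := by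
    have h0 := norm_pos_iff.2 (hext hs).2
    have := mul_le_mul_of_nonneg_right (hC₂ s (hext hs).2 (hext hs).1) hC0
    rw [norm_mul] at this
    rw [← div_eq_mul_inv, le_div_iff₀ h0]
    nlinarith [hnρ s hs, le_abs_self (C₂ * C)]
  have hm := (isOpen_offRing A).measurableSet
  set ρ' := (offRing A).indicator ρ with hρ'
  have hm' : AEStronglyMeasurable ρ' volume :=
    (aestronglyMeasurable_indicator_iff hm).2 (ContinuousOn.aestronglyMeasurable
      (fun s hs => (hρc s hs).continuousWithinAt) hm)
  have hi : Integrable fun s => ρ' s / (1 + ‖s‖) := by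
    have i1 := ((integrableOn_inv_sub 0 (isBounded_ball (x := 0) (r := B))).norm.const_mul
      |C₂ * C|)
    rw [← IntegrableOn, ← integrable_indicator_iff isOpen_ball.measurableSet] at i1
    have i2 := hG.norm.mul_const C
    rw [← IntegrableOn, ← integrable_indicator_iff (measurableSet_le measurable_const measurable_norm)]
      at i2
    refine (i1.add i2).mono' (hm'.mul
      (Measurable.aestronglyMeasurable (by fun_prop))) (.of_forall fun s => ?_)
    rw [norm_div_one_add, Pi.add_apply]
    have n1 : 0 ≤ (ball 0 B).indicator (fun s => |C₂ * C| * ‖(s - 0)⁻¹‖) s :=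
      indicator_nonneg (fun _ _ => by positivity) _
    have n2 : 0 ≤ {l : ℂ | 1 ≤ ‖l‖}.indicator (fun s => ‖G s‖ * C) s :=
      indicator_nonneg (fun _ _ => by positivity) _
    by_cases hs : s ∈ offRing A
    · rw [hρ', indicator_of_mem hs]
      by_cases hb : ‖s‖ < B
      · refine le_add_of_le_of_nonneg ?_ n2
        rw [indicator_of_mem (by simpa using hb), sub_zero, norm_inv]
        exact (div_le_self (norm_nonneg _) (by linarith [norm_nonneg s])).trans (hinv s hs)
      · rw [not_lt] at hb
        refine le_add_of_nonneg_of_le n1 ?_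
        rw [indicator_of_mem (by exact hB.le.trans hb)]
        obtain ⟨h1, h0⟩ := hext hs
        have h2 := (hr s h0 (hb.trans (le_max_left _ _)) (norm_ne_one_of_notMem hA h1)).2
          (hB.le.trans hb)
        calc ‖ρ s‖ / (1 + ‖s‖) ≤ ‖r S.E S.v s‖ * C / ‖s‖ := by
              gcongr
              exacts [hnρ s hs, by linarith]
          _ = ‖r S.E S.v s‖ / ‖s‖ * C := by ring
          _ ≤ _ := by gcongr; exact h2.trans (le_abs_self _)
    · rw [hρ', indicator_of_notMem hs, norm_zero, zero_div]
      exact add_nonneg n1 n2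
  have hlp := norm_pos_iff.2 hl
  have hb s (hs : ‖s - l‖ < ‖l‖ / 2) : ‖ρ' s‖ ≤ |C₂ * C| * (‖l‖ / 2)⁻¹ := by
    by_cases h : s ∈ offRing A
    · rw [hρ', indicator_of_mem h]
      refine (hinv s h).trans ?_
      gcongr
      have := norm_le_norm_add_norm_sub s l
      linarith
    · rw [hρ', indicator_of_notMem h, norm_zero]; positivity
  refine ⟨integrable_div_sub (half_pos hlp) hb hi, continuousAt_cauchyTransform (half_pos hlp) hb hi
    (ae_continuousAt_indicator (isOpen_Ioo.union isOpen_Ioi) ?_ hρc)⟩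
  refine Countable.mono ((frontier_union_subset _ _).trans
    (union_subset_union inter_subset_left inter_subset_right)) ?_
  simp_all

end Setup

lemma boundaryIntegral_congr {A : ℝ} (hA : 1 < A) {f g : ℂ → ℂ}
    (h : ∀ s, ‖s‖ = A ∨ ‖s‖ = A⁻¹ → f s = g s) :
    boundaryIntegral A f = boundaryIntegral A g ∧ (BoundaryIntegrable A g → BoundaryIntegrable A f) := by
  have hA0 := (ring_lt hA).1.le
  have hA1 : 0 ≤ A := by linarith
  refine ⟨congrArg₂ (fun x y : ℂ => x - y)
    (circleIntegral.integral_congr hA1 fun s hs => h s (Or.inl (by simpa using hs)))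
    (circleIntegral.integral_congr hA0 fun s hs => h s (Or.inr (by simpa using hs))), fun hg => ?_⟩
  have e R (hR : R = A ∨ R = A⁻¹) (hg : CircleIntegrable g 0 R) : CircleIntegrable f 0 R := by
    have : (fun θ => f (circleMap 0 R θ)) = fun θ => g (circleMap 0 R θ) := by
      funext θ
      have h0 : ‖circleMap 0 R θ‖ = R := by
        rw [norm_circleMap_zero, abs_of_nonneg]; rcases hR with rfl | rfl <;> assumption
      exact h _ (hR.imp (h0.trans ·) (h0.trans ·))
    rw [CircleIntegrable, this]; exact hg
  exact ⟨e A (Or.inl rfl) hg.1, e _ (Or.inr rfl) hg.2⟩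

lemma boundaryIntegrable_of_continuousAt {A : ℝ} (hA : 1 < A) {f : ℂ → ℂ}
    (h : ∀ s, ‖s‖ = A ∨ ‖s‖ = A⁻¹ → ContinuousAt f s) : BoundaryIntegrable A f :=
  ⟨ContinuousOn.circleIntegrable (by linarith) fun s hs =>
    (h s (Or.inl (by simpa using hs))).continuousWithinAt,
  ContinuousOn.circleIntegrable (ring_lt hA).1.le fun s hs =>
    (h s (Or.inr (by simpa using hs))).continuousWithinAt⟩

lemma boundaryIntegral_add {A : ℝ} {f g : ℂ → ℂ} (hf : BoundaryIntegrable A f)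
    (hg : BoundaryIntegrable A g) :
    boundaryIntegral A (fun s => f s + g s) = boundaryIntegral A f + boundaryIntegral A g := by
  rw [boundaryIntegral, circleIntegral.integral_add hf.1 hg.1, circleIntegral.integral_add hf.2 hg.2,
    boundaryIntegral, boundaryIntegral]
  ring

lemma notMem_ring_of_norm_eq {A : ℝ} (hA : 1 < A) {s : ℂ} (hs : ‖s‖ = A ∨ ‖s‖ = A⁻¹) :
    s ∉ ring A ∧ s ≠ 0 := by
  refine ⟨fun h => ?_, norm_pos_iff.1 ?_⟩ <;> rcases hs with h' | h'
  · exact h.2.ne h'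
  · exact h.1.ne' h'
  all_goals rw [h']; linarith [(ring_lt hA).1]

lemma boundaryIntegral_const_mul (A : ℝ) (q : ℂ) (f : ℂ → ℂ) :
    boundaryIntegral A (fun s => q * f s) = q * boundaryIntegral A f := by
  rw [boundaryIntegral, boundaryIntegral, circleIntegral.integral_const_mul,
    circleIntegral.integral_const_mul, mul_sub]

namespace Setup

variable (S : Setup)

/-- Images of the plane wave under an operator, with the plane wave removed. -/
def planeWave (L : S.X →L[ℂ] S.X) (z : S.K) (s : ℂ) : ℂ :=
  phi0 S.E z (-s) * L (S.Phi s) z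

lemma differentiableOn_planeWave (L : S.X →L[ℂ] S.X) (z : S.K) :
    DifferentiableOn ℂ (S.planeWave L z) {0}ᶜ :=
  differentiableOn_of_comp_exp ((S.differentiable_phi0_neg_exp z).mul
    (differentiable_clm_comp (X := S.X) ((ContinuousMap.evalCLM ℂ z).comp L) S.differentiable_Phi_exp))

lemma continuousAt_planeWave (L : S.X →L[ℂ] S.X) (z : S.K) {s : ℂ} (h : s ≠ 0) :
    ContinuousAt (S.planeWave L z) s :=
  ((S.differentiableOn_planeWave L z).differentiableAt (isOpen_compl_singleton.mem_nhds h)).continuousAt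

/-- The inner boundary integral. -/
lemma inner_eq {A : ℝ} (hA : 1 < A) (had : IsAdmissible S.E S.v A) (z : S.K) {φ : ℂ → ℂ}
    {L : S.X →L[ℂ] S.X}
    (hL : ∀ s, ‖s‖ = A ∨ ‖s‖ = A⁻¹ → phi0 S.E z s * trace A φ s = L (S.Phi s) z) {s : ℂ}
    (hs : ‖s‖ = A ∨ ‖s‖ = A⁻¹) : BoundaryIntegrable A (innerIntegrand S.E S.v A z φ s) ∧
    boundaryIntegral A (innerIntegrand S.E S.v A z φ s) =
      S.modWave (L * (1 - S.Tplus)) z s - S.planeWave L z s := by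
  obtain ⟨h1, h0⟩ := notMem_ring_of_norm_eq hA hs
  have hω := exp_log h0
  have hn := norm_ne_one_of_notMem hA h1
  have hU := S.isUnit_of_notMem hA had (by rwa [hω])
  rw [hω] at hU
  have hre : |(Complex.log s).re| = log A := by
    have := log_pos hA
    rw [log_re]
    rcases hs with h | h
    · rw [h, abs_of_pos this]
    · rw [h, Real.log_inv, abs_neg, abs_of_pos this]
  set ψ := S.psiX (sgn s) (Complex.log s) with hψ
  obtain ⟨i1, i2⟩ := S.boundaryIntegral_clm hA hω hre L ψ z
  set q : ℂ := phi0 S.E z (-s) / (4 * π ^ 2) with hq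
  have e := boundaryIntegral_congr hA (f := innerIntegrand S.E S.v A z φ s)
    (g := fun s' => q * (c s s' * L (S.Theta s' ψ) z)) fun s' hs' => by
      have e1 : L (S.Theta s' ψ) z = S.ell (S.Phi (-s') * ψ) * L (S.Phi s') z := by
        rw [Theta_apply, map_smul]; rfl
      rw [e1, ← hL s' hs', innerIntegrand, S.h_eq hω hn hU, hq]
      ring
  have hψ' : ψ = S.Phi s + S.TOp (sgn s) (Complex.log s) ψ := by
    have := (inverse_one_sub_apply hU).1 (rfl : _ = ψ)
    rwa [hω] at this
  have e2 : (S.TOp (sgn s) (Complex.log s) - S.Tplus) ψ = (1 - S.Tplus) ψ - S.Phi s := by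
    have h := sub_eq_of_eq_add' hψ'
    change S.TOp (sgn s) (Complex.log s) ψ - S.Tplus ψ = ψ - S.Tplus ψ - S.Phi s
    rw [← h]; abel
  refine ⟨e.2 ⟨IntervalIntegrable.const_mul i1.1 q, IntervalIntegrable.const_mul i1.2 q⟩, ?_⟩
  rw [e.1, boundaryIntegral_const_mul, i2, e2, map_sub, hq]
  change _ * (_ * (L ((1 - S.Tplus) ψ) z - L (S.Phi s) z)) = phi0 S.E z (-s) * L ((1 - S.Tplus) ψ) z -
    phi0 S.E z (-s) * L (S.Phi s) z
  field_simp

/-- Convergence of the integrals in `T φ`, and their values. -/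
lemma converge {A : ℝ} (hA : 1 < A) (had : IsAdmissible S.E S.v A) (z : S.K)
    {φ t f : ℂ → ℂ} {L : S.X →L[ℂ] S.X} {C : ℝ}
    (ht : ∀ s, ‖s‖ = A ∨ ‖s‖ = A⁻¹ → Tendsto φ (𝓝[ring A] s) (𝓝 (t s)))
    (hL : ∀ s, ‖s‖ = A ∨ ‖s‖ = A⁻¹ → phi0 S.E z s * t s = L (S.Phi s) z)
    (hf : ∀ s, s ≠ 0 → s ∉ ring A → ContinuousAt f s) (hC : ∀ s, s ≠ 0 → s ∉ ring A → ‖f s‖ ≤ C)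
    (hφ : ∀ s ∈ offRing A, φ (-1 / conj s) = f s ∧ conj (φ s) = f s) {l : ℂ} (hl : l ≠ 0)
    (h1 : ‖l‖ ≠ A) (h2 : ‖l‖ ≠ A⁻¹) :
    IntegralsConverge S.E S.v A z φ l ∧ T S.E S.v A z φ l = 1 / π *
      (∫ s, (offRing A).indicator (fun s => r S.E S.v s * e0 S.E z s * f s) s / (s - l)) +
      1 / (2 * π * I) * boundaryIntegral A (fun s =>
        (S.modWave (L * (1 - S.Tplus)) z s - S.planeWave L z s) / (s - l)) ∧
    BoundaryIntegrable A (fun s => (S.modWave (L * (1 - S.Tplus)) z s - S.planeWave L z s) / (s - l)) ∧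
    TReal S.E S.v A z φ l = T S.E S.v A z φ l := by
  have htr s (hs : ‖s‖ = A ∨ ‖s‖ = A⁻¹) : trace A φ s = t s :=
    haveI := neBot_nhdsWithin_ring hA hs
    (ht s hs).limUnder_eq
  have hin (s : ℂ) (hs : ‖s‖ = A ∨ ‖s‖ = A⁻¹) := S.inner_eq hA had z
    (fun s hs => by rw [htr s hs]; exact hL s hs) hs
  have hbi := boundaryIntegrable_of_continuousAt hA (f := fun s =>
      (S.modWave (L * (1 - S.Tplus)) z s - S.planeWave L z s) / (s - l)) fun s hs => by
    obtain ⟨h3, h0⟩ := notMem_ring_of_norm_eq hA hs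
    refine ContinuousAt.div (((S.dbarAt_modWave hA had _ z (by rwa [exp_log h0])).continuousAt
      h0).1.sub (S.continuousAt_planeWave L z h0)) (by fun_prop) (sub_ne_zero.2 fun h => ?_)
    grind
  have hout := boundaryIntegral_congr hA (f := outerIntegrand S.E S.v A z φ l) fun s hs => by
    rw [outerIntegrand, (hin s hs).2]
  have hae : ∀ᵐ s, areaIntegrand S.E S.v A z φ l s =
      (offRing A).indicator (fun s => r S.E S.v s * e0 S.E z s * f s) s / (s - l) ∧
      areaIntegrandReal S.E S.v A z φ l s = areaIntegrand S.E S.v A z φ l s := by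
    filter_upwards [ae_norm_ne A, ae_norm_ne A⁻¹] with s h3 h4
    rw [areaIntegrand, areaIntegrandReal, rPrime]
    by_cases hs : s ∈ offRing A
    · rw [indicator_of_mem hs, if_neg (not_or.2 (notMem_ring_of_mem_offRing hA hs)), (hφ s hs).1,
        (hφ s hs).2]
      exact ⟨rfl, rfl⟩
    · have : s ∈ ring A ∨ s = 0 := by
        by_contra! h
        exact hs ((mem_offRing_iff h.2 h3 h4).2 h.1)
      simp_all
  have i1 := (S.density hA had z hf hC hl).1.congr (hae.mono fun s h => h.1.symm)
  have e2 : TReal S.E S.v A z φ l = T S.E S.v A z φ l := by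
    rw [TReal, T, integral_congr_ae (hae.mono fun s h => h.2)]
  refine ⟨⟨fun s hs => ?_, i1, i1.congr (hae.mono fun s h => h.2.symm), fun s hs =>
    (hin s ((mem_frontier_ring hA).1 hs)).1, hout.2 hbi⟩, ?_, hbi, e2⟩
  · have hs := (mem_frontier_ring hA).1 hs
    grind
  · rw [T, T2, integral_congr_ae (hae.mono fun s h => h.1), hout.1]

end Setup

/-- The relation on the boundary follows from the relation off the boundary. -/
lemma satisfiesRelation {A : ℝ} (hA : 1 < A) {T : (ℂ → ℂ) → ℂ → ℂ} {M : ℂ → ℂ}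
    (h : ∀ l, l ≠ 0 → ‖l‖ ≠ A → ‖l‖ ≠ A⁻¹ → T (fun w => M w - 1) l + T (fun _ => 1) l = -(M l - 1))
    (hM : ∀ l, ‖l‖ = A ∨ ‖l‖ = A⁻¹ → ∃ m₀, Tendsto M (𝓝[ring A] l) (𝓝 m₀))
    (hM' : ∀ l, ‖l‖ = A ∨ ‖l‖ = A⁻¹ → Tendsto M (𝓝[(closure (ring A))ᶜ] l) (𝓝 (M l)))
    (hT : ∀ l, ‖l‖ = A ∨ ‖l‖ = A⁻¹ → ∀ f ≤ 𝓝 l, ((∀ᶠ s in f, s ∈ ring A) ∨ ∀ᶠ s in f, s ∈ offRing A) →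
      ∃ b, Tendsto (T fun _ => 1) f (𝓝 b)) : SatisfiesRelation A T M := by
  have key l (hl : ‖l‖ = A ∨ ‖l‖ = A⁻¹) (f : Filter ℂ) (hf : f ≤ 𝓝 l)
      (hs : (∀ᶠ s in f, s ∈ ring A) ∨ ∀ᶠ s in f, s ∈ offRing A) {m₀ : ℂ} (hm : Tendsto M f (𝓝 m₀)) :
      ∃ a b, Tendsto (T fun w => M w - 1) f (𝓝 a) ∧ Tendsto (T fun _ => 1) f (𝓝 b) ∧
        m₀ - 1 + a = -b := by
    obtain ⟨b, hb⟩ := hT l hl f hf hs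
    refine ⟨-(m₀ - 1) - b, b, (((hm.sub_const 1).neg).sub hb).congr' ?_, hb, by ring⟩
    filter_upwards [eventually_norm_ne hA hs] with s ⟨h0, h1, h2⟩
    rw [← h s h0 h1 h2, add_sub_cancel_right]
  simp only [SatisfiesRelation, mem_frontier_ring hA]
  refine ⟨fun l h0 hl => ?_, fun l hl => ?_, fun l hl => ?_⟩
  · grind
  · obtain ⟨m₀, hm⟩ := hM l hl
    obtain ⟨a, b, h1, h2, h3⟩ := key l hl _ nhdsWithin_le_nhds (Or.inl self_mem_nhdsWithin) hm
    exact ⟨m₀, a, b, hm, h1, h2, h3⟩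
  · obtain ⟨a, b, h1, h2, h3⟩ := key l hl _ nhdsWithin_le_nhds
      (Or.inr (nhdsWithin_compl_closure hA hl)) (hM' l hl)
    grind

lemma Setup.exists_isAdmissible (S : Setup) : ∃ A : ℝ, 1 < A ∧ IsAdmissible S.E S.v A := by
  obtain ⟨A, C, hA, -, h⟩ := S.exists_mu_sub_one_le
  refine ⟨A, hA, fun l ⟨h0, h1, h2⟩ => ?_⟩
  have : ¬A ≤ specSize l := fun hs => h2 (h l h0 hs h1).1
  rw [specSize, not_le, max_lt_iff] at this
  exact ⟨inv_lt_of_inv_lt₀ (norm_pos_iff.2 h0) this.2, this.1⟩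

lemma Setup.modWave_add (S : Setup) (K K' : S.X →L[ℂ] S.X) (z : S.K) (s : ℂ) :
    S.modWave (K + K') z s = S.modWave K z s + S.modWave K' z s :=
  mul_add (phi0 S.E z (-s)) (K _ z) (K' _ z)

lemma Setup.planeWave_add (S : Setup) (K K' : S.X →L[ℂ] S.X) (z : S.K) (s : ℂ) :
    S.planeWave (K + K') z s = S.planeWave K z s + S.planeWave K' z s :=
  mul_add (phi0 S.E z (-s)) (K _ z) (K' _ z)

lemma Setup.relation (S : Setup) {A : ℝ} (hA : 1 < A) (had : IsAdmissible S.E S.v A) (z : S.K) :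
    (∀ l : ℂ, l ≠ 0 → l ∉ frontier (ring A) → IntegralsConverge S.E S.v A z (fun _ => 1) l ∧
      IntegralsConverge S.E S.v A z (fun w => muPrime S.E S.v A z w - 1) l) ∧
    SatisfiesRelation A (T S.E S.v A z) (muPrime S.E S.v A z) ∧
    SatisfiesRelation A (TReal S.E S.v A z) (muPrime S.E S.v A z) := by
  set L := inverse (1 - S.Tplus) with hLd
  set M := muPrime S.E S.v A z with hMd
  have hL : L * (1 - S.Tplus) = 1 := Ring.inverse_mul_cancel _ S.isUnit_one_sub_Tplus
  have hin {s : ℂ} (hs : s ∈ ring A) : M s = S.planeWave L z s := by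
    rw [hMd, muPrime, psiPrime, if_pos hs, psiPlus_eq, mul_comm]; rfl
  have hmu {s : ℂ} (h0 : s ≠ 0) (h : s ∉ ring A) : M s = mu S.E S.v z s := by
    rw [hMd, muPrime, psiPrime, if_neg h, psi, mul_right_comm, phi0_mul_neg, one_mul]
  have hout {s : ℂ} (h0 : s ≠ 0) (h : s ∉ ring A) : M s = S.modWave 1 z s :=
    (hmu h0 h).trans (S.modWave_one hA had z h0 h).symm
  have hdb (K : S.X →L[ℂ] S.X) {w : ℂ} (h : log A ≤ |w.re|) :
      DbarAt (fun s => S.modWave K z s - 1) (S.dbarWave K z) w := by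
    have hw : cexp w ∉ ring A := by
      rw [← log_le_abs_re hA (exp_ne_zero w), log_re, norm_exp, log_exp]
      exact h
    obtain ⟨⟨α, h1⟩, h2⟩ := S.dbarAt_modWave hA had K z hw
    exact ⟨⟨α, h1.sub_const 1⟩, h2⟩
  have hcont {s : ℂ} (h0 : s ≠ 0) (h : s ∉ ring A) : ContinuousAt (S.modWave 1 z) s :=
    ((S.dbarAt_modWave hA had 1 z (by rwa [exp_log h0])).continuousAt h0).1
  have hsmall : ∀ ε > 0, ∃ B, ∀ s, s ≠ 0 → s ∉ ring A → B ≤ specSize s → ‖S.modWave 1 z s - 1‖ ≤ ε := by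
    intro ε hε
    obtain ⟨B, C, -, -, h⟩ := S.exists_mu_sub_one_le
    have hlim : Tendsto (fun s : ℝ => C * √s ^ (-S.δ)) atTop (𝓝 0) := by
      simpa using ((tendsto_rpow_neg_atTop S.δ_pos).comp Real.tendsto_sqrt_atTop).const_mul C
    obtain ⟨B', hB'⟩ := ((tendsto_order.1 hlim).2 ε hε).exists_forall_of_atTop
    refine ⟨max B B', fun s h0 h1 hs => ?_⟩
    rw [← hout h0 h1, hmu h0 h1]
    exact ((h s h0 ((le_max_left _ _).trans hs) (norm_ne_one_of_notMem hA h1)).2 z z.2).trans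
      (hB' _ ((le_max_right _ _).trans hs)).le
  obtain ⟨C, hC⟩ : ∃ C, ∀ s, s ≠ 0 → s ∉ ring A → ‖conj (S.modWave 1 z s) - 1‖ ≤ C := by
    obtain ⟨B, hB⟩ := hsmall 1 one_pos
    obtain ⟨C, hC⟩ := exists_bound_offRing (F := fun s => S.modWave 1 z s - 1) hA
      (fun s h0 h => (hcont h0 h).sub continuousAt_const) hB
    refine ⟨C, fun s h0 h => ?_⟩
    rw [← RCLike.norm_conj, map_sub, conj_conj, map_one]
    exact hC s h0 h
  have hfc s (h0 : s ≠ 0) (h : s ∉ ring A) : ContinuousAt (fun s => conj (S.modWave 1 z s) - 1) s :=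
    (continuous_conj.continuousAt.comp (hcont h0 h)).sub continuousAt_const
  have hanti {s : ℂ} (hs : s ∈ offRing A) : mu S.E S.v z (-1 / conj s) = conj (S.modWave 1 z s) := by
    obtain ⟨h1, h0⟩ := notMem_ring_of_mem_offRing hA hs
    have hn := norm_ne_one_of_notMem hA h1
    rw [← hout h0 h1, hmu h0 h1, mu_antipode h0 hn]
    by_contra h2
    exact h1 (had _ ⟨h0, hn, h2⟩)
  have hMin l (hl : ‖l‖ = A ∨ ‖l‖ = A⁻¹) : Tendsto M (𝓝[ring A] l) (𝓝 (S.planeWave L z l)) := by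
    refine ((S.continuousAt_planeWave L z (notMem_ring_of_norm_eq hA hl).2).tendsto.mono_left
      nhdsWithin_le_nhds).congr' ?_
    filter_upwards [self_mem_nhdsWithin] with s hs using (hin hs).symm
  have hMout l (hl : ‖l‖ = A ∨ ‖l‖ = A⁻¹) : Tendsto M (𝓝[(closure (ring A))ᶜ] l) (𝓝 (M l)) := by
    obtain ⟨h1, h0⟩ := notMem_ring_of_norm_eq hA hl
    rw [hout h0 h1]
    refine ((hcont h0 h1).tendsto.mono_left nhdsWithin_le_nhds).congr' ?_
    filter_upwards [nhdsWithin_compl_closure hA hl] with s hs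
    obtain ⟨h2, h3⟩ := notMem_ring_of_mem_offRing hA hs
    exact (hout h3 h2).symm
  have hplane s : S.planeWave 1 z s = 1 := by
    change phi0 _ _ _ * phi0 _ _ _ = 1
    rw [mul_comm, phi0_mul_neg]
  have c₁ {l : ℂ} (h0 : l ≠ 0) (h1 : ‖l‖ ≠ A) (h2 : ‖l‖ ≠ A⁻¹) := S.converge hA had z
    (f := fun _ => 1) (L := 1) (C := 1) (fun _ _ => tendsto_const_nhds)
    (fun s _ => mul_one _) (fun _ _ _ => continuousAt_const) (fun _ _ _ => by simp) (by simp) h0 h1 h2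
  have c₂ {l : ℂ} (h0 : l ≠ 0) (h1 : ‖l‖ ≠ A) (h2 : ‖l‖ ≠ A⁻¹) := S.converge hA had z
    (φ := fun w => M w - 1)
    (L := L - 1)
    (fun s hs => (hMin s hs).sub_const 1) (fun s _ => by
      change _ * (_ * _ - 1) = L (S.Phi s) z - phi0 S.E z s
      rw [mul_sub, ← mul_assoc, phi0_mul_neg]; ring) hfc hC (fun s hs => by
      obtain ⟨h1, h0⟩ := notMem_ring_of_mem_offRing hA hs
      have h3 : -1 / conj s ∉ ring A := fun h => h1 (by
        change _ < ‖_‖ ∧ ‖_‖ < _ at h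
        rw [norm_antipode] at h
        have hp := norm_pos_iff.2 h0
        exact ⟨inv_lt_of_inv_lt₀ hp h.2, (inv_lt_inv₀ (by linarith) hp).1 h.1⟩)
      rw [hmu (antipode_ne_zero h0) h3, hanti hs, map_sub, map_one, hout h0 h1]
      exact ⟨rfl, rfl⟩) h0 h1 h2
  have hrel l (h0 : l ≠ 0) (h1 : ‖l‖ ≠ A) (h2 : ‖l‖ ≠ A⁻¹) :
      T S.E S.v A z (fun w => M w - 1) l + T S.E S.v A z (fun _ => 1) l = -(M l - 1) := by
    obtain ⟨-, e₁, b₁, -⟩ := c₁ h0 h1 h2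
    obtain ⟨-, e₂, b₂, -⟩ := c₂ h0 h1 h2
    have i₁ := (S.density hA had z (fun _ _ _ => continuousAt_const) (f := fun _ => 1) (C := 1)
      (fun _ _ _ => by simp) h0).1
    have i₂ := (S.density hA had z hfc hC h0).1
    have hdens s : (offRing A).indicator (fun s => r S.E S.v s * e0 S.E z s *
        (conj (S.modWave 1 z s) - 1)) s / (s - l) + (offRing A).indicator (fun s => r S.E S.v s *
        e0 S.E z s * 1) s / (s - l) = (offRing A).indicator (fun s => S.dbarWave 1 z s / (s - l)) s := by
      rw [indicator_div_sub]
      by_cases hs : s ∈ offRing A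
      · obtain ⟨h3, h4⟩ := notMem_ring_of_mem_offRing hA hs
        simp only [indicator_of_mem hs]
        rw [S.dbarWave_one hA had z h4 h3, hanti hs]; ring
      · simp only [indicator_of_notMem hs]; simp
    have hm := (isOpen_offRing A).measurableSet
    have hi : IntegrableOn (fun s => S.dbarWave 1 z s / (s - l)) (offRing A) := by
      rw [← integrable_indicator_iff hm]
      exact (i₂.add i₁).congr (.of_forall hdens)
    have hI := integral_add i₂ i₁
    simp only [hdens] at hI
    rw [integral_indicator hm] at hI
    set P : ℂ → ℂ := fun s => S.planeWave L z s - 1 with hP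
    have hPd : DifferentiableOn ℂ P {0}ᶜ := (S.differentiableOn_planeWave L z).sub_const 1
    have hPb := boundaryIntegrable_of_continuousAt hA (f := fun s => P s / (s - l)) fun s hs => by
      refine ContinuousAt.div ((S.continuousAt_planeWave L z (notMem_ring_of_norm_eq hA hs).2).sub
        continuousAt_const) (by fun_prop) (sub_ne_zero.2 fun h => ?_)
      rw [h] at hs
      exact hs.elim h1 h2
    have hB := boundaryIntegral_add b₂ b₁
    have hB' := boundaryIntegral_add ⟨b₂.1.add b₁.1, b₂.2.add b₁.2⟩ hPb
    have hcomb s : (S.modWave ((L - 1) * (1 - S.Tplus)) z s - S.planeWave (L - 1) z s) / (s - l) +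
        (S.modWave (1 * (1 - S.Tplus)) z s - S.planeWave 1 z s) / (s - l) + P s / (s - l) =
        (S.modWave 1 z s - 1) / (s - l) := by
      have hp : L - 1 + 1 = L := sub_add_cancel L 1
      have hm : (L - 1) * (1 - S.Tplus) + 1 * (1 - S.Tplus) = 1 := by rw [← add_mul, hp, hL]
      have e1 := modWave_add S ((L - 1) * (1 - S.Tplus)) (1 * (1 - S.Tplus)) z s
      have e2 := planeWave_add S (L - 1) 1 z s
      rw [hm] at e1
      rw [hp] at e2
      rw [e1]
      simp only [hP, e2]
      ring
    replace hB' := hB'.trans (congrArg (· + boundaryIntegral A fun s => P s / (s - l)) hB)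
    simp only [Pi.add_apply, hcomb] at hB'
    have hpomp := boundaryIntegral_offRing hA (fun w hw => hdb 1 hw) h1 h2 h0 (fun ε hε => by
      obtain ⟨B, hB⟩ := hsmall ε hε
      refine ⟨max B A, fun s hs => ?_⟩
      have hs' := (le_max_right _ _).trans hs
      refine hB s (fun h => ?_) (fun h => ?_) ((le_max_left _ _).trans hs)
      · rw [h, specSize, norm_zero, inv_zero, max_self] at hs'
        linarith
      · exact not_lt.2 hs' (max_lt h.2 (inv_lt_of_inv_lt₀ (by linarith) h.1))) hi
    have hval : boundaryIntegral A (fun s => P s / (s - l)) =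
        2 * π * I * (M l - 1 - (offRing A).indicator (fun s => S.modWave 1 z s - 1) l) := by
      by_cases hl : l ∈ ring A
      · have h3 : l ∉ offRing A := fun h => (notMem_ring_of_mem_offRing hA h).1 hl
        rw [boundaryIntegral_cauchy hA hPd hl, indicator_of_notMem h3, sub_zero, hin hl]
      · rw [indicator_of_mem ((mem_offRing_iff h0 h1 h2).2 hl), hout h0 hl, sub_self, mul_zero]
        refine boundaryIntegral_eq_zero hA fun s h3 h4 => ?_
        have hs0 := norm_pos_iff.1 ((ring_lt hA).1.trans_le h3)
        refine ((hPd s hs0).differentiableAt (isOpen_compl_singleton.mem_nhds hs0)).div (by fun_prop)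
          (sub_ne_zero.2 fun h => hl ?_)
        rw [h] at h3 h4
        exact ⟨h3.lt_of_ne' h2, h4.lt_of_ne h1⟩
    rw [e₁, e₂]
    have hπ : (π : ℂ) ≠ 0 := by exact_mod_cast pi_ne_zero
    rw [hpomp, hval] at hB'
    simp only [hplane] at hB' ⊢
    have w := mul_inv_cancel₀ I_ne_zero
    linear_combination (-1 / π) * hI - (1 / (2 * π * I)) * hB' + (1 - M l) *
      mul_inv_cancel₀ hπ + ((1 - M l) * (π * π⁻¹) -
        π⁻¹ * ∫ s in offRing A, S.dbarWave 1 z s / (s - l)) * w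
  have hlim l (hl : ‖l‖ = A ∨ ‖l‖ = A⁻¹) (f : Filter ℂ) (hf : f ≤ 𝓝 l)
      (hs : (∀ᶠ s in f, s ∈ ring A) ∨ ∀ᶠ s in f, s ∈ offRing A) :
      ∃ b, Tendsto (T S.E S.v A z fun _ => 1) f (𝓝 b) := by
    have h0 := (notMem_ring_of_norm_eq hA hl).2
    obtain ⟨b, hb⟩ := exists_tendsto_boundaryIntegral hA (fun w hw => hdb (1 * (1 - S.Tplus)) hw) hl hf hs
    have hd := (S.density hA had z (fun _ _ _ => continuousAt_const) (f := fun _ => 1) (C := 1)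
      (fun _ _ _ => by simp) h0).2
    refine ⟨_, (((hd.tendsto.mono_left hf).const_mul (1 / (π : ℂ))).add
      (hb.const_mul (1 / (2 * π * I)))).congr' ?_⟩
    filter_upwards [eventually_norm_ne hA hs] with s ⟨h0, h1, h2⟩
    rw [(c₁ h0 h1 h2).2.1]
    simp only [hplane]
  refine ⟨fun l h0 hl => ?_, satisfiesRelation hA hrel (fun l hl => ⟨_, hMin l hl⟩) hMout hlim, ?_⟩
  · rw [mem_frontier_ring hA, not_or] at hl
    exact ⟨(c₁ h0 hl.1 hl.2).1, (c₂ h0 hl.1 hl.2).1⟩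
  · refine satisfiesRelation hA (fun l h0 h1 h2 => ?_) (fun l hl => ⟨_, hMin l hl⟩) hMout
      fun l hl f hf hs => ?_
    · rw [(c₂ h0 h1 h2).2.2.2, (c₁ h0 h1 h2).2.2.2]; exact hrel l h0 h1 h2
    · obtain ⟨b, hb⟩ := hlim l hl f hf hs
      refine ⟨b, hb.congr' ?_⟩
      filter_upwards [eventually_norm_ne hA hs] with s ⟨h0, h1, h2⟩
      exact (c₁ h0 h1 h2).2.2.2.symm

end

end Faddeev

theorem theorem2p2 (E : ℝ) (hE : 0 < E) (p : ENNReal) (hp : 1 < p) (v : ℂ → ℝ)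
    (hv : MeasureTheory.MemLp v p MeasureTheory.volume) (hcomp : HasCompactSupport v) :
    (∃ A : ℝ, 1 < A ∧ Faddeev.IsAdmissible E v A) ∧
    (∀ l : ℂ, l ≠ 0 → ∃! f : ℂ → ℂ, Faddeev.IsScatteringSolution E v l f) ∧
    ∀ A : ℝ, 1 < A → Faddeev.IsAdmissible E v A → ∀ z : ℂ,
      (∀ l : ℂ, l ≠ 0 → l ∉ frontier (Faddeev.ring A) →
        Faddeev.IntegralsConverge E v A z (fun _ => 1) l ∧
        Faddeev.IntegralsConverge E v A z (fun w => Faddeev.muPrime E v A z w - 1) l) ∧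
      Faddeev.SatisfiesRelation A (Faddeev.T E v A z) (Faddeev.muPrime E v A z) ∧
      Faddeev.SatisfiesRelation A (Faddeev.TReal E v A z) (Faddeev.muPrime E v A z) := by
  obtain ⟨S, rfl, rfl, -⟩ := Faddeev.exists_setup hE hp hv hcomp 0
  refine ⟨S.exists_isAdmissible, fun l _ => S.existsUnique_isScatteringSolution l, fun A hA had z => ?_⟩
  obtain ⟨S', h1, h2, h3⟩ := Faddeev.exists_setup hE hp hv hcomp ‖z‖
  rw [← h1, ← h2] at had ⊢
  exact S'.relation hA had ⟨z, mem_closedBall_zero_iff.2 h3⟩
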